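/- All graded rings are commutative and $\mathbb Z$-graded. For a graded ring $A=\bigoplus_{d\in\mathbb Z}A_d$ let $\mathrm{gspec}\,A$ be the space of homogeneous prime ideals (with closed sets $V(\mathfrak a)=\{\mathfrak p\supseteq\mathfrak a\}$, $\mathfrak a$ a homogeneous ideal), and for $\mathfrak p\in\mathrm{gspec}\,A$ let $A_{\mathfrak p}$, $M_{\mathfrak p}$ be the graded localizations at the homogeneous elements outside $\mathfrak p$. $A$ is called \emph{standard} if it contains an invertible homogeneous element of degree $1$, and \emph{good} if $\mathfrak p\mapsto\mathfrak p\cap A_0$ is injective on $\mathrm{gspec}\,A$. \textbf{(1) Modules.} Let $A$ be a graded ring and let $u_A\colon M\mapsto M_0$ be the functor from graded $A$-modules (with morphisms of degree $0$) to $A_0$-modules. Then $u_A$ is an equivalence of categories if and only if $A_{\mathfrak p}$ is standard for every $\mathfrak p\in\mathrm{gspec}\,A$. If this is the case, the functors $o_A=A\otimes_{A_0}-$ and $h_A$, where $h_A(N)=\bigoplus_{d}\mathrm{Hom}_{A_0}(A_{-d},N)$ with the action $(af)(b)=f(ab)$, are isomorphic, exact, and quasi-inverse to $u_A$; and if moreover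 $A$ is noetherian, the restrictions of $u_A$, $o_A$, $h_A$ give equivalences between finitely generated graded $A$-modules and finitely generated $A_0$-modules. \textbf{(2) Sheaves.} For a noetherian graded ring $A$ and a graded $A$-module $M$, let $M^{\sim}$ be the sheaf on $\mathrm{gspec}\,A$ whose sections of degree $d$ are the functions $\mathfrak p\mapsto s(\mathfrak p)\in M_{\mathfrak p}$ that are locally of the form $m/a$ with $a$ homogeneous and $m\in M_{d+\deg a}$; with structure sheaf $A^{\sim}$, $\mathrm{gspec}\,A$ is a graded ringed space. A \emph{graded scheme} is a graded ringed space $X$ whose underlying space is noetherian, whose stalks have a unique maximal homogeneous ideal, and in which every point has an open neighbourhood isomorphic to $\mathrm{gspec}\,A$ for some noetherian graded ring $A$. A sheaf of graded $\mathcal O_X$-modules is \emph{quasi-coherent} (\emph{coherent}) if $X$ is covered by open subsets $U_i\cong\mathrm{gspec}\,A^i$, with $A^i$ noetherian graded rings, on which it is isomorphic to $(M^i)^{\sim}$ for a graded (finitely generated graded) $A^i$-module $M^i$. A point of $X$ is \emph{standard} (\emph{good}) if the graded local ring at it is, and $X$ is standard (good) if all its points are. Let $X$ be a good graded scheme, $X_0=(X,(\mathcal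 O_X)_0)$ (a noetherian scheme), and let $u_X\colon\mathcal F\mapsto\mathcal F_0$ be the functor from sheaves of graded $\mathcal O_X$-modules (with morphisms of degree $0$) to sheaves of $\mathcal O_{X_0}$-modules. Then $u_X$ is an equivalence of categories if and only if $X$ is standard. If this is the case, $u_X$ restricts to an equivalence between quasi-coherent graded $\mathcal O_X$-modules and quasi-coherent $\mathcal O_{X_0}$-modules, and between coherent graded $\mathcal O_X$-modules and coherent $\mathcal O_{X_0}$-modules. Moreover, in this case the functors $o_X=\mathcal O_X\otimes_{\mathcal O_{X_0}}-$ and $h_X$, where $h_X(\mathcal G)_d=\mathcal Hom_{\mathcal O_{X_0}}((\mathcal O_X)_{-d},\mathcal G)$ with the action $(af)(b)=f(ab)$, are isomorphic, exact, and quasi-inverse to $u_X$. \textbf{(3) Weighted projective spaces.} Let $A$ be a noetherian ring, $n\ge 0$, $w=(w_0,\dots,w_n)$ a tuple of positive integers, $R=A[x_0,\dots,x_n]$ graded by $\deg x_i=w_i$ (and $\deg a=0$ for $a\in A$), and let $\bar{\mathbb P}_A(w)$ be the open graded subspace $\mathrm{gspec}\,R\setminus V(R_+)$ of $\mathrm{gspec}\,R$,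 where $R_+=\bigoplus_{d>0}R_d$. Then a point $\mathfrak p\in\bar{\mathbb P}_A(w)$ is standard if and only if $\gcd(w_i : x_i\notin\mathfrak p)=1$. In particular, if $A\neq0$, then $\bar{\mathbb P}_A(w)$ is standard if and only if $w=(1,\dots,1)$. -/

import Mathlib

open CategoryTheory TopologicalSpace Opposite DirectSum TensorProduct

universe u

noncomputable section

namespace GrSch

section Aux

/-- A family of subgroups is a direct sum decomposition as soon as every element is a sum of
homogeneous elements, and finite sums of homogeneous elements of distinct degrees vanish only
trivially. -/
theorem isInternal_of {M : Type*} [AddCommGroup M] (ℳ : ℤ → AddSubgroup M)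
    (hspan : ∀ x : M, x ∈ ⨆ d, ℳ d)
    (hind : ∀ (s : Finset ℤ) (f : ℤ → M), (∀ d, f d ∈ ℳ d) → ∑ d ∈ s, f d = 0 →
      ∀ d ∈ s, f d = 0) :
    DirectSum.IsInternal ℳ := by
  constructor
  · rw [injective_iff_map_eq_zero]
    intro x hx
    classical
    have h1 : ∑ d ∈ x.support, (x d : M) = 0 := by
      rw [← hx, DirectSum.coeAddMonoidHom_eq_dfinsuppSum, DFinsupp.sum]
    have h2 := hind x.support (fun d => (x d : M)) (fun d => (x d).2) h1
    ext d
    by_cases hd : d ∈ x.support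
    · exact h2 d hd
    · simpa using hd
  · intro x
    have h : ⨆ d, ℳ d ≤ (DirectSum.coeAddMonoidHom ℳ).range :=
      iSup_le fun d y hy => ⟨DirectSum.of (fun i => ℳ i) d ⟨y, hy⟩, by simp⟩
    exact h (hspan x)

end Aux

section Ring

variable {A : Type u} [CommRing A] (𝒜 : ℤ → AddSubgroup A)

/-- A graded ring is standard if it contains an invertible homogeneous element of degree `1`. -/
def IsStandardRing : Prop := ∃ a ∈ 𝒜 1, IsUnit a

variable [GradedRing 𝒜]

/-- The set of homogeneous prime ideals of a graded ring. -/
@[ext]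
structure GSpec where
  /-- the underlying homogeneous ideal -/
  ideal : HomogeneousIdeal 𝒜
  isPrime : ideal.toIdeal.IsPrime

variable {𝒜}

/-- A homogeneous prime ideal as a point of the ordinary prime spectrum. -/
def GSpec.toPrime (p : GSpec 𝒜) : PrimeSpectrum A := ⟨p.ideal.toIdeal, p.isPrime⟩

instance : TopologicalSpace (GSpec 𝒜) := TopologicalSpace.induced GSpec.toPrime inferInstance

/-- The closed subsets of `GSpec 𝒜` are the sets `V(𝔞)` with `𝔞` a homogeneous ideal. -/
theorem GSpec.isClosed_iff (Z : Set (GSpec 𝒜)) :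
    IsClosed Z ↔ ∃ I : HomogeneousIdeal 𝒜, Z = {p | I ≤ p.ideal} := by
  rw [isClosed_induced_iff]
  constructor
  · rintro ⟨t, ht, rfl⟩
    obtain ⟨s, rfl⟩ := (PrimeSpectrum.isClosed_iff_zeroLocus_ideal t).1 ht
    refine ⟨s.homogeneousHull 𝒜, ?_⟩
    ext p
    change (s : Set A) ⊆ _ ↔ _
    exact ⟨fun h => (Ideal.homogeneousHull.gc 𝒜 s p.ideal).2 h,
      fun h => (Ideal.homogeneousHull.gc 𝒜 s p.ideal).1 h⟩
  · rintro ⟨I, rfl⟩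
    exact ⟨PrimeSpectrum.zeroLocus I.toIdeal, PrimeSpectrum.isClosed_zeroLocus _, rfl⟩

instance [IsNoetherianRing A] : NoetherianSpace (GSpec 𝒜) :=
  Topology.IsInducing.noetherianSpace (i := GSpec.toPrime) ⟨rfl⟩

variable (𝒜) in
/-- The map `𝔭 ↦ 𝔭₀ = 𝔭 ∩ A₀`. -/
def GSpec.degZero (p : GSpec 𝒜) : PrimeSpectrum (𝒜 0) :=
  PrimeSpectrum.comap (algebraMap (𝒜 0) A) p.toPrime

variable (𝒜) in
/-- A graded ring is good if `𝔭 ↦ 𝔭₀` is injective on homogeneous primes. -/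
def IsGoodRing : Prop := Function.Injective (GSpec.degZero 𝒜)

variable (𝒜) in
/-- A local graded ring: there is a unique maximal (proper) homogeneous ideal. -/
def IsLocalGraded : Prop := ∃! m : HomogeneousIdeal 𝒜, IsCoatom m

/-- The multiplicative system of homogeneous elements outside `𝔭`. -/
def GSpec.homCompl (p : GSpec 𝒜) : Submonoid A where
  carrier := {a | SetLike.IsHomogeneousElem 𝒜 a ∧ a ∉ p.ideal}
  one_mem' := ⟨⟨0, SetLike.one_mem_graded 𝒜⟩, fun h => p.isPrime.ne_top
    ((Ideal.eq_top_iff_one _).2 h)⟩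
  mul_mem' := by
    rintro a b ⟨ha, ha'⟩ ⟨hb, hb'⟩
    exact ⟨ha.mul hb, fun h => (p.isPrime.mem_or_mem h).elim ha' hb'⟩

/-- `A_𝔭`: the localization at the homogeneous elements outside `𝔭`. -/
abbrev GSpec.Loc (p : GSpec 𝒜) : Type u := Localization p.homCompl

/-- The grading of `A_𝔭`: `(A_𝔭)_d` consists of the `m / a` with `a` homogeneous of some degree `e`
and `m` homogeneous of degree `d + e`. -/
def GSpec.locGr (p : GSpec 𝒜) (d : ℤ) : AddSubgroup p.Loc where
  carrier := {x | ∃ (e : ℤ) (m : A) (a : p.homCompl), m ∈ 𝒜 (d + e) ∧ (a : A) ∈ 𝒜 e ∧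
    x = Localization.mk m a}
  zero_mem' := ⟨0, 0, 1, zero_mem _, SetLike.one_mem_graded 𝒜, (Localization.mk_zero _).symm⟩
  add_mem' := by
    rintro _ _ ⟨e, m, a, hm, ha, rfl⟩ ⟨e', m', a', hm', ha', rfl⟩
    refine ⟨e + e', a * m' + a' * m, a * a', add_mem ?_ ?_, SetLike.mul_mem_graded ha ha', ?_⟩
    · have := SetLike.mul_mem_graded ha hm'
      rwa [show e + (d + e') = d + (e + e') by ring] at this
    · have := SetLike.mul_mem_graded ha' hm
      rwa [show e' + (d + e) = d + (e + e') by ring] at this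
    · rw [Localization.add_mk]
  neg_mem' := by
    rintro _ ⟨e, m, a, hm, ha, rfl⟩
    exact ⟨e, -m, a, neg_mem hm, ha, by rw [Localization.neg_mk]⟩

theorem GSpec.mk_mem_locGr (p : GSpec 𝒜) {d e : ℤ} {m : A} (hm : m ∈ 𝒜 (d + e)) (a : p.homCompl)
    (ha : (a : A) ∈ 𝒜 e) : Localization.mk m a ∈ p.locGr d := ⟨e, m, a, hm, ha, rfl⟩

theorem GSpec.mk_eq_zero (p : GSpec 𝒜) (m : A) (a : p.homCompl)
    (h : (Localization.mk m a : p.Loc) = 0) : ∃ c : p.homCompl, (c : A) * m = 0 := by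
  rw [Localization.mk_eq_mk'] at h
  exact (IsLocalization.mk'_eq_zero_iff m a).1 h

theorem GSpec.common_denom (p : GSpec 𝒜) (s : Finset ℤ) (f : ℤ → p.Loc)
    (hf : ∀ d, f d ∈ p.locGr d) :
    ∃ (E : ℤ) (b : p.homCompl) (n : ℤ → A), (b : A) ∈ 𝒜 E ∧ (∀ d, n d ∈ 𝒜 (d + E)) ∧
      ∀ d ∈ s, f d = Localization.mk (n d) b := by
  classical
  induction s using Finset.induction_on with
  | empty => exact ⟨0, 1, 0, SetLike.one_mem_graded 𝒜, fun d => zero_mem _, by simp⟩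
  | insert i s hi ih =>
    obtain ⟨E, b, n, hb, hn, h⟩ := ih
    obtain ⟨e, m, a, hm, ha, hx⟩ := hf i
    refine ⟨e + E, a * b, fun d => if d = i then b * m else a * n d,
      SetLike.mul_mem_graded ha hb, ?_, ?_⟩
    · intro d
      dsimp only
      split_ifs with hd
      · subst hd
        have := SetLike.mul_mem_graded hb hm
        rwa [show E + (d + e) = d + (e + E) by ring] at this
      · have := SetLike.mul_mem_graded ha (hn d)
        rwa [show e + (d + E) = d + (e + E) by ring] at this
    · intro d hd
      dsimp only
      split_ifs with hdi
      · subst hdi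
        rw [hx, Localization.mk_eq_mk_iff, Localization.r_iff_exists]
        exact ⟨1, by push_cast; ring⟩
      · rw [h d (Finset.mem_of_mem_insert_of_ne hd hdi), Localization.mk_eq_mk_iff,
          Localization.r_iff_exists]
        exact ⟨1, by push_cast; ring⟩

theorem eq_zero_of_sum_eq_zero (E : ℤ) (s : Finset ℤ) (n : ℤ → A) (hn : ∀ d, n d ∈ 𝒜 (d + E))
    (h : ∑ d ∈ s, n d = 0) : ∀ d ∈ s, n d = 0 := by
  intro d hd
  have h1 := congrArg (fun x => ((DirectSum.decompose 𝒜 x (d + E) : 𝒜 (d + E)) : A)) h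
  simp only [DirectSum.decompose_sum, DirectSum.decompose_zero] at h1
  rw [DirectSum.sum_apply, AddSubgroup.val_finsetSum] at h1
  rw [Finset.sum_eq_single d] at h1
  · rw [DirectSum.decompose_of_mem_same 𝒜 (hn d)] at h1
    simpa using h1
  · intro j _ hj
    exact DirectSum.decompose_of_mem_ne 𝒜 (hn j) (fun h => hj (by linarith))
  · intro h; exact absurd hd h

theorem GSpec.locGr_isInternal (p : GSpec 𝒜) : DirectSum.IsInternal p.locGr := by
  apply isInternal_of
  · intro x
    induction x using Localization.induction_on with
    | H y =>
      obtain ⟨m, a⟩ := y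
      obtain ⟨e, he⟩ := a.2.1
      classical
      have : (Localization.mk m a : p.Loc) =
          ∑ i ∈ (DirectSum.decompose 𝒜 m).support,
            Localization.mk ((DirectSum.decompose 𝒜 m i : 𝒜 i) : A) a := by
        rw [← Localization.mk_sum, DirectSum.sum_support_decompose]
      rw [this]
      refine sum_mem fun i _ => ?_
      refine AddSubgroup.mem_iSup_of_mem (i - e) (p.mk_mem_locGr (e := e) ?_ a he)
      rw [sub_add_cancel]
      exact SetLike.coe_mem _
  · intro s f hf h0 d hd
    obtain ⟨E, b, n, hb, hn, h⟩ := p.common_denom s f hf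
    rw [Finset.sum_congr rfl h, ← Localization.mk_sum] at h0
    obtain ⟨c, hc⟩ := p.mk_eq_zero _ _ h0
    obtain ⟨e, he⟩ := c.2.1
    rw [Finset.mul_sum] at hc
    have := eq_zero_of_sum_eq_zero (𝒜 := 𝒜) (e + E) s (fun d => c * n d) (fun d => by
      have := SetLike.mul_mem_graded he (hn d)
      rwa [show e + (d + E) = d + (e + E) by ring] at this) hc d hd
    rw [h d hd, Localization.mk_eq_mk', IsLocalization.mk'_eq_zero_iff]
    exact ⟨c, this⟩

instance (p : GSpec 𝒜) : SetLike.GradedMonoid p.locGr where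
  one_mem := ⟨0, 1, 1, SetLike.one_mem_graded 𝒜, SetLike.one_mem_graded 𝒜,
    Localization.mk_one.symm⟩
  mul_mem := by
    rintro i j _ _ ⟨e, m, a, hm, ha, rfl⟩ ⟨e', m', a', hm', ha', rfl⟩
    refine ⟨e + e', m * m', a * a', ?_, SetLike.mul_mem_graded ha ha', Localization.mk_mul _ _ _ _⟩
    have := SetLike.mul_mem_graded hm hm'
    rwa [show (i + e) + (j + e') = i + j + (e + e') by ring] at this

instance (p : GSpec 𝒜) : GradedRing p.locGr where
  toDecomposition := p.locGr_isInternal.chooseDecomposition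

end Ring

section LocalSections

variable {X : TopCat.{u}} {T : X → Type u}

/-- The prelocal predicate of belonging to a restriction-stable family of sets of dependent
functions. -/
@[reducible]
def prelocalOf (B : ∀ V : Opens X, Set (∀ x : V, T x))
    (hB : ∀ {V W : Opens X} (i : W ⟶ V) (s : ∀ x : V, T x), s ∈ B V → (fun x : W => s (i x)) ∈ B W) :
    TopCat.PrelocalPredicate T where
  pred {V} s := s ∈ B V
  res i s h := hB i s h

/-- A restriction-stable family of groups of dependent functions. -/
structure LocalGroups (T : X → Type u) [∀ x, AddCommGroup (T x)] where
  /-- the functions on an open set -/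
  fn : ∀ V : Opens X, AddSubgroup (∀ x : V, T x)
  res : ∀ {V W : Opens X} (i : W ⟶ V) (s : ∀ x : V, T x), s ∈ fn V → (fun x : W => s (i x)) ∈ fn W

namespace LocalGroups

variable [∀ x, AddCommGroup (T x)] (B : LocalGroups T)

/-- The functions that lie locally in `B`. -/
@[reducible]
def pred : TopCat.LocalPredicate T :=
  (prelocalOf (fun V => (B.fn V : Set (∀ x : V, T x))) B.res).sheafify

/-- The group of functions on `U` that lie locally in `B`. -/
def sections (U : Opens X) : AddSubgroup (∀ x : U, T x) where
  carrier := {s | B.pred.pred s}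
  zero_mem' := fun x => ⟨U, x.2, 𝟙 _, (B.fn U).zero_mem⟩
  add_mem' := by
    intro s t hs ht x
    obtain ⟨V, hV, i, h⟩ := hs x
    obtain ⟨W, hW, j, h'⟩ := ht x
    exact ⟨V ⊓ W, ⟨hV, hW⟩, Opens.infLELeft _ _ ≫ i,
      (B.fn _).add_mem (B.res (Opens.infLELeft V W) _ h) (B.res (Opens.infLERight V W) _ h')⟩
  neg_mem' := by
    intro s hs x
    obtain ⟨V, hV, i, h⟩ := hs x
    exact ⟨V, hV, i, (B.fn _).neg_mem h⟩

theorem mem_sections {U : Opens X} {s : ∀ x : U, T x} :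
    s ∈ B.sections U ↔ ∀ x : U, ∃ (V : Opens X) (_ : x.1 ∈ V) (i : V ⟶ U),
      (fun y : V => s (i y)) ∈ B.fn V := Iff.rfl

theorem mem_sections_res {U V : Opens X} (i : V ⟶ U) {s : ∀ x : U, T x} (hs : s ∈ B.sections U) :
    (fun x : V => s (i x)) ∈ B.sections V := B.pred.res i s hs

/-- The presheaf of functions that lie locally in `B`. -/
def presheaf : TopCat.Presheaf AddCommGrpCat.{u} X where
  obj U := AddCommGrpCat.of (B.sections U.unop)
  map i := AddCommGrpCat.ofHom
    { toFun := fun s => ⟨fun x => s.1 (i.unop x), B.mem_sections_res i.unop s.2⟩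
      map_zero' := rfl
      map_add' := fun _ _ => rfl }

/-- The sheaf of functions that lie locally in `B`. -/
def sheaf : TopCat.Sheaf AddCommGrpCat.{u} X :=
  ⟨B.presheaf, (TopCat.Presheaf.isSheaf_iff_isSheaf_comp (CategoryTheory.forget AddCommGrpCat) _).mpr
    (TopCat.Presheaf.isSheaf_of_iso
      (NatIso.ofComponents (fun _ => Iso.refl _) (by intros; rfl)) (TopCat.subsheafToTypes B.pred).property)⟩

end LocalGroups

/-- A restriction-stable family of rings of dependent functions. -/
structure LocalRings (T : X → Type u) [∀ x, CommRing (T x)] where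
  /-- the functions on an open set -/
  fn : ∀ V : Opens X, Subring (∀ x : V, T x)
  res : ∀ {V W : Opens X} (i : W ⟶ V) (s : ∀ x : V, T x), s ∈ fn V → (fun x : W => s (i x)) ∈ fn W

namespace LocalRings

variable [∀ x, CommRing (T x)] (B : LocalRings T)

/-- The functions that lie locally in `B`. -/
@[reducible]
def pred : TopCat.LocalPredicate T :=
  (prelocalOf (fun V => (B.fn V : Set (∀ x : V, T x))) B.res).sheafify

/-- The ring of functions on `U` that lie locally in `B`. -/
def sections (U : Opens X) : Subring (∀ x : U, T x) where
  carrier := {s | B.pred.pred s}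
  zero_mem' := fun x => ⟨U, x.2, 𝟙 _, (B.fn U).zero_mem⟩
  one_mem' := fun x => ⟨U, x.2, 𝟙 _, (B.fn U).one_mem⟩
  add_mem' := by
    intro s t hs ht x
    obtain ⟨V, hV, i, h⟩ := hs x
    obtain ⟨W, hW, j, h'⟩ := ht x
    exact ⟨V ⊓ W, ⟨hV, hW⟩, Opens.infLELeft _ _ ≫ i,
      (B.fn _).add_mem (B.res (Opens.infLELeft V W) _ h) (B.res (Opens.infLERight V W) _ h')⟩
  mul_mem' := by
    intro s t hs ht x
    obtain ⟨V, hV, i, h⟩ := hs x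
    obtain ⟨W, hW, j, h'⟩ := ht x
    exact ⟨V ⊓ W, ⟨hV, hW⟩, Opens.infLELeft _ _ ≫ i,
      (B.fn _).mul_mem (B.res (Opens.infLELeft V W) _ h) (B.res (Opens.infLERight V W) _ h')⟩
  neg_mem' := by
    intro s hs x
    obtain ⟨V, hV, i, h⟩ := hs x
    exact ⟨V, hV, i, (B.fn _).neg_mem h⟩

theorem mem_sections {U : Opens X} {s : ∀ x : U, T x} :
    s ∈ B.sections U ↔ ∀ x : U, ∃ (V : Opens X) (_ : x.1 ∈ V) (i : V ⟶ U),
      (fun y : V => s (i y)) ∈ B.fn V := Iff.rfl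

theorem mem_sections_res {U V : Opens X} (i : V ⟶ U) {s : ∀ x : U, T x} (hs : s ∈ B.sections U) :
    (fun x : V => s (i x)) ∈ B.sections V := B.pred.res i s hs

/-- The presheaf of functions that lie locally in `B`. -/
def presheaf : TopCat.Presheaf CommRingCat.{u} X where
  obj U := CommRingCat.of (B.sections U.unop)
  map i := CommRingCat.ofHom
    { toFun := fun s => ⟨fun x => s.1 (i.unop x), B.mem_sections_res i.unop s.2⟩
      map_zero' := rfl
      map_one' := rfl
      map_mul' := fun _ _ => rfl
      map_add' := fun _ _ => rfl }

/-- The sheaf of functions that lie locally in `B`. -/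
def sheaf : TopCat.Sheaf CommRingCat.{u} X :=
  ⟨B.presheaf, (TopCat.Presheaf.isSheaf_iff_isSheaf_comp (CategoryTheory.forget CommRingCat) _).mpr
    (TopCat.Presheaf.isSheaf_of_iso
      (NatIso.ofComponents (fun _ => Iso.refl _) (by intros; rfl)) (TopCat.subsheafToTypes B.pred).property)⟩

end LocalRings

end LocalSections

theorem mem_inf' {X : TopCat.{u}} {U V : Opens X} {x : X} (h : x ∈ U) (h' : x ∈ V) : x ∈ U ⊓ V :=
  ⟨h, h'⟩

/-- A graded ringed space: a topological space with a sheaf of (commutative) `ℤ`-graded rings. -/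
structure GradedRingedSpace where
  /-- the underlying topological space -/
  carrier : TopCat.{u}
  /-- the structure sheaf -/
  sheaf : TopCat.Sheaf CommRingCat.{u} carrier
  /-- the homogeneous sections of given degree -/
  gr : ∀ U : Opens carrier, ℤ → AddSubgroup (sheaf.presheaf.obj (op U))
  [gradedRing : ∀ U, GradedRing (gr U)]
  map_mem : ∀ {U V : Opens carrier} (i : V ⟶ U) {d : ℤ} {a : sheaf.presheaf.obj (op U)},
    a ∈ gr U d → sheaf.presheaf.map i.op a ∈ gr V d

namespace GradedRingedSpace

attribute [instance] gradedRing

variable (X : GradedRingedSpace.{u})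

/-- Sections of the structure sheaf. -/
abbrev Sec (U : Opens X.carrier) : CommRingCat.{u} := X.sheaf.presheaf.obj (op U)

/-- Restriction of sections. -/
abbrev res {U V : Opens X.carrier} (i : V ⟶ U) : X.Sec U →+* X.Sec V :=
  (X.sheaf.presheaf.map i.op).hom

theorem res_res {U V W : Opens X.carrier} (i : V ⟶ U) (j : W ⟶ V) (a : X.Sec U) :
    X.res j (X.res i a) = X.res (j ≫ i) a := by
  simp [res]

theorem res_id {U : Opens X.carrier} (a : X.Sec U) : X.res (𝟙 U) a = a := by
  simp [res]

/-- Restriction of homogeneous sections. -/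
def resGr {U V : Opens X.carrier} (i : V ⟶ U) (d : ℤ) : X.gr U d →+ X.gr V d :=
  ((X.res i : X.Sec U →+ X.Sec V).comp (X.gr U d).subtype).codRestrict _
    (fun a => X.map_mem i a.2)

@[simp] theorem resGr_coe {U V : Opens X.carrier} (i : V ⟶ U) (d : ℤ) (a : X.gr U d) :
    (X.resGr i d a : X.Sec V) = X.res i a := rfl

theorem decompose_res {U V : Opens X.carrier} (i : V ⟶ U) (a : X.Sec U) (d : ℤ) :
    ((DirectSum.decompose (X.gr V) (X.res i a) d : X.gr V d) : X.Sec V) =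
      X.res i (DirectSum.decompose (X.gr U) a d : X.gr U d) := by
  induction a using DirectSum.Decomposition.inductionOn (X.gr U) with
  | zero => simp
  | @homogeneous e m =>
    by_cases h : e = d
    · subst h
      rw [DirectSum.decompose_of_mem_same _ (X.map_mem i m.2),
        DirectSum.decompose_of_mem_same _ m.2]
    · rw [DirectSum.decompose_of_mem_ne _ (X.map_mem i m.2) h,
        DirectSum.decompose_of_mem_ne _ m.2 h, map_zero]
  | add m m' h h' =>
    simp only [map_add, DirectSum.decompose_add, DirectSum.add_apply, AddSubgroup.coe_add, h, h']

/-- Being homogeneous of degree `d` is a local property. -/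
theorem mem_gr_of_local {U : Opens X.carrier} {d : ℤ} (a : X.Sec U)
    (h : ∀ x : U, ∃ (V : Opens X.carrier) (_ : x.1 ∈ V) (i : V ⟶ U), X.res i a ∈ X.gr V d) :
    a ∈ X.gr U d := by
  have key : ((DirectSum.decompose (X.gr U) a d : X.gr U d) : X.Sec U) = a := by
    choose V hV i hi using h
    refine X.sheaf.eq_of_locally_eq' V U i (fun x hx => ?_) _ _ (fun x => ?_)
    · exact Opens.mem_iSup.2 ⟨⟨x, hx⟩, hV _⟩
    · have := X.decompose_res (i x) a d
      rw [DirectSum.decompose_of_mem_same _ (hi x)] at this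
      exact this.symm
  rw [← key]
  exact SetLike.coe_mem _

/-- The stalk of the structure sheaf. -/
abbrev stalk (x : X.carrier) : CommRingCat.{u} := X.sheaf.presheaf.stalk x

/-- The germ of a section. -/
abbrev germ {U : Opens X.carrier} (x : X.carrier) (hx : x ∈ U) : X.Sec U →+* X.stalk x :=
  (X.sheaf.presheaf.germ U x hx).hom

theorem germ_res {U V : Opens X.carrier} (i : V ⟶ U) (x : X.carrier) (hx : x ∈ V) (a : X.Sec U) :
    X.germ x hx (X.res i a) = X.germ x (i.le hx) a :=
  X.sheaf.presheaf.germ_res_apply i x hx a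

/-- The grading of the stalk: germs of homogeneous sections. -/
def stalkGr (x : X.carrier) (d : ℤ) : AddSubgroup (X.stalk x) where
  carrier := {z | ∃ (U : Opens X.carrier) (hx : x ∈ U) (a : X.Sec U),
    a ∈ X.gr U d ∧ X.germ x hx a = z}
  zero_mem' := ⟨⊤, trivial, 0, zero_mem _, map_zero _⟩
  add_mem' := by
    rintro _ _ ⟨U, hx, a, ha, rfl⟩ ⟨V, hx', b, hb, rfl⟩
    refine ⟨U ⊓ V, mem_inf' hx hx', X.res (Opens.infLELeft U V) a + X.res (Opens.infLERight U V) b,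
      add_mem (X.map_mem _ ha) (X.map_mem _ hb), ?_⟩
    rw [map_add, X.germ_res, X.germ_res]
  neg_mem' := by
    rintro _ ⟨U, hx, a, ha, rfl⟩
    exact ⟨U, hx, -a, neg_mem ha, map_neg _ _⟩

theorem germ_mem_stalkGr {U : Opens X.carrier} (x : X.carrier) (hx : x ∈ U) {d : ℤ} {a : X.Sec U}
    (ha : a ∈ X.gr U d) : X.germ x hx a ∈ X.stalkGr x d := ⟨U, hx, a, ha, rfl⟩

theorem common_nhd (x : X.carrier) (s : Finset ℤ) (f : ℤ → X.stalk x)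
    (hf : ∀ d, f d ∈ X.stalkGr x d) :
    ∃ (U : Opens X.carrier) (hx : x ∈ U) (n : ℤ → X.Sec U), (∀ d, n d ∈ X.gr U d) ∧
      ∀ d ∈ s, f d = X.germ x hx (n d) := by
  classical
  induction s using Finset.induction_on with
  | empty => exact ⟨⊤, trivial, 0, fun d => zero_mem _, by simp⟩
  | insert i s hi ih =>
    obtain ⟨U, hx, n, hn, h⟩ := ih
    obtain ⟨V, hx', a, ha, hfa⟩ := hf i
    refine ⟨U ⊓ V, mem_inf' hx hx', fun d => if d = i then X.res (Opens.infLERight U V) a else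
      X.res (Opens.infLELeft U V) (n d), ?_, ?_⟩
    · intro d
      dsimp only
      split_ifs with hd
      · subst hd; exact X.map_mem _ ha
      · exact X.map_mem _ (hn d)
    · intro d hd
      dsimp only
      split_ifs with hdi
      · subst hdi; rw [X.germ_res, hfa]
      · rw [X.germ_res, h d (Finset.mem_of_mem_insert_of_ne hd hdi)]

theorem stalkGr_isInternal (x : X.carrier) : DirectSum.IsInternal (X.stalkGr x) := by
  apply isInternal_of
  · intro z
    obtain ⟨U, hx, a, rfl⟩ := X.sheaf.presheaf.exists_germ_eq z
    classical
    rw [← DirectSum.sum_support_decompose (X.gr U) a]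
    change X.germ x hx _ ∈ _
    rw [map_sum]
    exact sum_mem fun i _ => AddSubgroup.mem_iSup_of_mem i
      (X.germ_mem_stalkGr x hx (SetLike.coe_mem _))
  · intro s f hf h0 d hd
    obtain ⟨U, hx, n, hn, h⟩ := X.common_nhd x s f hf
    rw [Finset.sum_congr rfl h, ← map_sum] at h0
    obtain ⟨V, hxV, i, j, hij⟩ := X.sheaf.presheaf.germ_eq x hx hx (∑ d ∈ s, n d) 0
      (h0.trans (map_zero _).symm)
    have h1 : ∑ d ∈ s, X.res i (n d) = 0 := by
      rw [← map_sum]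
      exact hij.trans (map_zero (X.res j))
    have h2 := eq_zero_of_sum_eq_zero (𝒜 := X.gr V) 0 s (fun d => X.res i (n d))
      (fun d => by rw [add_zero]; exact X.map_mem i (hn d)) h1 d hd
    rw [h d hd, ← X.germ_res i x hxV, h2, map_zero]

instance (x : X.carrier) : SetLike.GradedMonoid (X.stalkGr x) where
  one_mem := ⟨⊤, trivial, 1, SetLike.one_mem_graded _, map_one _⟩
  mul_mem := by
    rintro i j _ _ ⟨U, hx, a, ha, rfl⟩ ⟨V, hx', b, hb, rfl⟩
    refine ⟨U ⊓ V, mem_inf' hx hx', X.res (Opens.infLELeft U V) a * X.res (Opens.infLERight U V) b,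
      SetLike.mul_mem_graded (X.map_mem _ ha) (X.map_mem _ hb), ?_⟩
    rw [map_mul, X.germ_res, X.germ_res]

instance (x : X.carrier) : GradedRing (X.stalkGr x) where
  toDecomposition := (X.stalkGr_isInternal x).chooseDecomposition

/-- A point is standard if the graded local ring at it is standard. -/
def IsStandardPoint (x : X.carrier) : Prop := IsStandardRing (X.stalkGr x)

/-- `X` is standard if all its points are standard. -/
def IsStandard : Prop := ∀ x, X.IsStandardPoint x

/-- `X` is good if all its local rings are good. -/
def IsGood : Prop := ∀ x, IsGoodRing (X.stalkGr x)

/-- The presheaf of rings of degree zero sections. -/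
def zeroPresheaf : TopCat.Presheaf CommRingCat.{u} X.carrier where
  obj U := CommRingCat.of (X.gr U.unop 0)
  map {U V} i := CommRingCat.ofHom
    { toFun := X.resGr i.unop 0
      map_zero' := map_zero _
      map_one' := Subtype.ext (map_one (X.res i.unop))
      map_mul' := fun a b => Subtype.ext (map_mul (X.res i.unop) a.1 b.1)
      map_add' := map_add _ }
  map_id U := by
    refine CommRingCat.hom_ext (RingHom.ext fun a => ?_)
    exact Subtype.ext (X.res_id (U := U.unop) a.1)
  map_comp {U V W} i j := by
    refine CommRingCat.hom_ext (RingHom.ext fun a => ?_)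
    exact Subtype.ext (X.res_res i.unop j.unop a.1).symm

/-- The inclusion of the degree zero part in the structure sheaf. -/
def zeroInclusion : X.zeroPresheaf ⟶ X.sheaf.presheaf where
  app U := CommRingCat.ofHom (algebraMap (X.gr U.unop 0) (X.Sec U.unop))
  naturality _ _ _ := rfl

theorem zeroPresheaf_isSheaf : X.zeroPresheaf.IsSheaf := by
  rw [TopCat.Presheaf.isSheaf_iff_isSheaf_comp (CategoryTheory.forget CommRingCat)]
  apply TopCat.Presheaf.isSheaf_of_isSheafUniqueGluing_types
  intro ι U sf hsf
  have hsf' : TopCat.Presheaf.IsCompatible X.sheaf.presheaf U (fun i => (sf i).1) := fun i j =>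
    congrArg Subtype.val (hsf i j)
  obtain ⟨s, hs, hu⟩ := X.sheaf.existsUnique_gluing U _ hsf'
  have hmem : s ∈ X.gr (iSup U) 0 := by
    refine X.mem_gr_of_local s fun x => ?_
    obtain ⟨i, hi⟩ := Opens.mem_iSup.1 x.2
    refine ⟨U i, hi, Opens.leSupr U i, ?_⟩
    have := hs i
    change X.res _ s = _ at this
    rw [this]
    exact (sf i).2
  refine ⟨⟨s, hmem⟩, fun i => Subtype.ext (hs i), fun t ht => Subtype.ext (hu t.1 fun i => ?_)⟩
  exact congrArg Subtype.val (ht i)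

/-- The structure sheaf of `X₀ = (X, (𝒪_X)₀)`. -/
def zeroSheaf : TopCat.Sheaf CommRingCat.{u} X.carrier := ⟨X.zeroPresheaf, X.zeroPresheaf_isSheaf⟩

/-- The structure sheaf of `X₀` as a sheaf of (not necessarily commutative) rings. -/
abbrev zeroRing : TopCat.Sheaf RingCat.{u} X.carrier :=
  (sheafCompose _ (forget₂ CommRingCat.{u} RingCat.{u})).obj X.zeroSheaf

/-- The category `Mod(X₀)` of sheaves of `𝒪_{X₀}`-modules. -/
abbrev ZeroMod := SheafOfModules.{u} X.zeroRing

end GradedRingedSpace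

/-- A sheaf of graded `𝒪_X`-modules `ℱ = ⨁ ℱ_d`, given by the sheaves of abelian groups `ℱ_d` and
the multiplications `(𝒪_X)_i × ℱ_j → ℱ_{i+j}`. (On a noetherian topological space the direct sum
of the `ℱ_d` is again a sheaf, so that this is the same as a graded sheaf of modules.) -/
structure GMod (X : GradedRingedSpace.{u}) where
  /-- the homogeneous parts -/
  sec : ℤ → TopCat.Sheaf AddCommGrpCat.{u} X.carrier
  /-- multiplication by homogeneous sections of `𝒪_X` -/
  smul : ∀ {i j k : ℤ} (_ : i + j = k) (U : Opens X.carrier),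
    X.gr U i →+ (sec j).presheaf.obj (op U) →+ (sec k).presheaf.obj (op U)
  one_smul : ∀ {j : ℤ} (U : Opens X.carrier) (s : (sec j).presheaf.obj (op U)),
    smul (zero_add j) U ⟨1, SetLike.one_mem_graded _⟩ s = s
  mul_smul : ∀ {i j k l m : ℤ} (h : j + k = l) (h' : i + l = m) (U : Opens X.carrier)
    (a : X.gr U i) (b : X.gr U j) (s : (sec k).presheaf.obj (op U)),
    smul (show (i + j) + k = m by omega) U ⟨a * b, SetLike.mul_mem_graded a.2 b.2⟩ s =
      smul h' U a (smul h U b s)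
  smul_res : ∀ {i j k : ℤ} (h : i + j = k) {U V : Opens X.carrier} (f : V ⟶ U) (a : X.gr U i)
    (s : (sec j).presheaf.obj (op U)),
    (sec k).presheaf.map f.op (smul h U a s) =
      smul h V (X.resGr f i a) ((sec j).presheaf.map f.op s)

namespace GMod

variable {X : GradedRingedSpace.{u}}

/-- Sections of degree `d`. -/
abbrev Sec (F : GMod X) (d : ℤ) (U : Opens X.carrier) : AddCommGrpCat.{u} :=
  (F.sec d).presheaf.obj (op U)

/-- Restriction of sections of degree `d`. -/
abbrev res (F : GMod X) (d : ℤ) {U V : Opens X.carrier} (i : V ⟶ U) : F.Sec d U →+ F.Sec d V :=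
  ((F.sec d).presheaf.map i.op).hom

/-- Morphisms of sheaves of graded modules (of degree `0`). -/
@[ext]
structure Hom (F G : GMod X) where
  /-- the homogeneous parts of the morphism -/
  app : ∀ d : ℤ, F.sec d ⟶ G.sec d
  map_smul : ∀ {i j k : ℤ} (h : i + j = k) (U : Opens X.carrier) (a : X.gr U i) (s : F.Sec j U),
    (app k).hom.app (op U) (F.smul h U a s) = G.smul h U a ((app j).hom.app (op U) s)

instance : Category (GMod X) where
  Hom := Hom
  id F := ⟨fun d => 𝟙 _, fun _ _ _ _ => rfl⟩
  comp f g := ⟨fun d => f.app d ≫ g.app d, fun h U a s => by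
    change (g.app _).hom.app (op U) ((f.app _).hom.app (op U) _) = _
    rw [f.map_smul, g.map_smul]
    rfl⟩

@[simp] theorem id_app (F : GMod X) (d : ℤ) : Hom.app (𝟙 F) d = 𝟙 _ := rfl

@[simp] theorem comp_app {F G H : GMod X} (f : F ⟶ G) (g : G ⟶ H) (d : ℤ) :
    (f ≫ g).app d = f.app d ≫ g.app d := rfl

@[ext] theorem hom_ext {F G : GMod X} {f g : F ⟶ G} (h : ∀ d, f.app d = g.app d) : f = g :=
  Hom.ext (funext h)

instance zeroModule (F : GMod X) (U : (Opens X.carrier)ᵒᵖ) :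
    Module (X.zeroRing.obj.obj U) ((F.sec 0).presheaf.obj U) where
  smul (a : X.gr U.unop 0) s := F.smul (zero_add 0) U.unop a s
  one_smul s := F.one_smul U.unop s
  mul_smul (a b : X.gr U.unop 0) s := F.mul_smul (zero_add 0) (zero_add 0) U.unop a b s
  smul_zero (a : X.gr U.unop 0) := map_zero (F.smul (zero_add 0) U.unop a)
  smul_add (a : X.gr U.unop 0) := map_add (F.smul (zero_add 0) U.unop a)
  add_smul (a b : X.gr U.unop 0) s :=
    DFunLike.congr_fun (map_add (F.smul (zero_add 0) U.unop) a b) s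
  zero_smul s := DFunLike.congr_fun (map_zero (F.smul (zero_add 0) U.unop)) s

/-- The degree zero part `ℱ₀`, a sheaf of `𝒪_{X₀}`-modules. -/
def zero (F : GMod X) : X.ZeroMod where
  val := PresheafOfModules.ofPresheaf (R := X.zeroRing.obj) (F.sec 0).presheaf
    (fun _ _ f r m => F.smul_res (zero_add 0) f.unop r m)
  isSheaf := (F.sec 0).property

variable (X) in
/-- The functor `ℱ ↦ ℱ₀`. -/
def zeroFunctor : GMod X ⥤ X.ZeroMod where
  obj F := F.zero
  map {F G} f := ⟨PresheafOfModules.homMk (M₁ := F.zero.val) (M₂ := G.zero.val)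
    (by exact (f.app 0).hom) (by exact fun U r m => f.map_smul (zero_add 0) U.unop r m)⟩
  map_id _ := rfl
  map_comp _ _ := rfl

end GMod

theorem isHom {A : Type u} [CommRing A] {𝒜 : ℤ → AddSubgroup A} {a : A} {e : ℤ} (ha : a ∈ 𝒜 e) :
    SetLike.IsHomogeneousElem 𝒜 a := ⟨e, ha⟩

section AffineGraded

variable {A : Type u} [CommRing A] {𝒜 : ℤ → AddSubgroup A} [GradedRing 𝒜]

/-- The class of `m / a`, for `a` homogeneous with `a ∉ 𝔭`. -/
def GSpec.frac (p : GSpec 𝒜) (m a : A) (ha : SetLike.IsHomogeneousElem 𝒜 a) (hp : a ∉ p.ideal) :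
    p.Loc := Localization.mk m ⟨a, ha, hp⟩

theorem GSpec.frac_add (p : GSpec 𝒜) {m a m' a' : A} (ha : SetLike.IsHomogeneousElem 𝒜 a)
    (hp : a ∉ p.ideal) (ha' : SetLike.IsHomogeneousElem 𝒜 a') (hp' : a' ∉ p.ideal) :
    p.frac m a ha hp + p.frac m' a' ha' hp' =
      p.frac (a * m' + a' * m) (a * a') (ha.mul ha')
        (p.homCompl.mul_mem (x := a) (y := a') ⟨ha, hp⟩ ⟨ha', hp'⟩).2 :=
  Localization.add_mk _ _ _ _

theorem GSpec.frac_mul (p : GSpec 𝒜) {m a m' a' : A} (ha : SetLike.IsHomogeneousElem 𝒜 a)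
    (hp : a ∉ p.ideal) (ha' : SetLike.IsHomogeneousElem 𝒜 a') (hp' : a' ∉ p.ideal) :
    p.frac m a ha hp * p.frac m' a' ha' hp' = p.frac (m * m') (a * a') (ha.mul ha')
        (p.homCompl.mul_mem (x := a) (y := a') ⟨ha, hp⟩ ⟨ha', hp'⟩).2 :=
  Localization.mk_mul _ _ _ _

theorem GSpec.one_not_mem (p : GSpec 𝒜) : (1 : A) ∉ p.ideal := p.homCompl.one_mem.2

theorem isHom_one : SetLike.IsHomogeneousElem 𝒜 (1 : A) := ⟨0, SetLike.one_mem_graded 𝒜⟩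

theorem GSpec.mul_not_mem (p : GSpec 𝒜) {a b : A} (ha : a ∉ p.ideal) (hb : b ∉ p.ideal) :
    a * b ∉ p.ideal := fun h => (p.isPrime.mem_or_mem h).elim ha hb

variable (𝒜)

/-- The space of homogeneous primes as a bundled topological space. -/
abbrev gspecTop : TopCat.{u} := TopCat.of (GSpec 𝒜)

/-- Functions of the form `𝔮 ↦ m / a`, with `a` homogeneous. -/
def fracRings : LocalRings (X := gspecTop 𝒜) (fun p => GSpec.Loc p) where
  fn V :=
    { carrier := {s | ∃ (m a : A) (ha : SetLike.IsHomogeneousElem 𝒜 a) (hV : ∀ q : V, a ∉ q.1.ideal),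
        ∀ q : V, s q = q.1.frac m a ha (hV q)}
      zero_mem' := ⟨0, 1, isHom_one, fun q => q.1.one_not_mem, fun q => (Localization.mk_zero _).symm⟩
      one_mem' := ⟨1, 1, isHom_one, fun q => q.1.one_not_mem, fun q => Localization.mk_one.symm⟩
      add_mem' := by
        rintro s t ⟨m, a, ha, hV, h⟩ ⟨m', a', ha', hV', h'⟩
        refine ⟨a * m' + a' * m, a * a', ha.mul ha', fun q => q.1.mul_not_mem (hV q) (hV' q),
          fun q => ?_⟩
        rw [Pi.add_apply, h, h', GSpec.frac_add]
      mul_mem' := by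
        rintro s t ⟨m, a, ha, hV, h⟩ ⟨m', a', ha', hV', h'⟩
        refine ⟨m * m', a * a', ha.mul ha', fun q => q.1.mul_not_mem (hV q) (hV' q),
          fun q => ?_⟩
        rw [Pi.mul_apply, h, h', GSpec.frac_mul]
      neg_mem' := by
        rintro s ⟨m, a, ha, hV, h⟩
        refine ⟨-m, a, ha, hV, fun q => ?_⟩
        rw [Pi.neg_apply, h]
        exact Localization.neg_mk _ _ }
  res := by
    rintro V W i s ⟨m, a, ha, hV, h⟩
    exact ⟨m, a, ha, fun q => hV ⟨q.1, i.le q.2⟩, fun q => h ⟨q.1, i.le q.2⟩⟩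

/-- Functions of the form `𝔮 ↦ m / a`, with `a` homogeneous of some degree `e` and `m` homogeneous
of degree `d + e`. -/
def fracGroups (d : ℤ) : LocalGroups (X := gspecTop 𝒜) (fun p => GSpec.Loc p) where
  fn V :=
    { carrier := {s | ∃ (e : ℤ) (m a : A) (_ : m ∈ 𝒜 (d + e)) (ha : a ∈ 𝒜 e)
        (hV : ∀ q : V, a ∉ q.1.ideal), ∀ q : V, s q = q.1.frac m a (isHom ha) (hV q)}
      zero_mem' := ⟨0, 0, 1, zero_mem _, SetLike.one_mem_graded 𝒜, fun q => q.1.one_not_mem,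
        fun q => (Localization.mk_zero _).symm⟩
      add_mem' := by
        rintro s t ⟨e, m, a, hm, ha, hV, h⟩ ⟨e', m', a', hm', ha', hV', h'⟩
        refine ⟨e + e', a * m' + a' * m, a * a', add_mem ?_ ?_, SetLike.mul_mem_graded ha ha',
          fun q => q.1.mul_not_mem (hV q) (hV' q), fun q => ?_⟩
        · have := SetLike.mul_mem_graded ha hm'
          rwa [show e + (d + e') = d + (e + e') by ring] at this
        · have := SetLike.mul_mem_graded ha' hm
          rwa [show e' + (d + e) = d + (e + e') by ring] at this
        · rw [Pi.add_apply, h, h', GSpec.frac_add]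
      neg_mem' := by
        rintro s ⟨e, m, a, hm, ha, hV, h⟩
        refine ⟨e, -m, a, neg_mem hm, ha, hV, fun q => ?_⟩
        rw [Pi.neg_apply, h]
        exact Localization.neg_mk _ _ }
  res := by
    rintro V W i s ⟨e, m, a, hm, ha, hV, h⟩
    exact ⟨e, m, a, hm, ha, fun q => hV ⟨q.1, i.le q.2⟩, fun q => h ⟨q.1, i.le q.2⟩⟩

/-- Sections of degree `d` of the structure sheaf: functions that are locally of the form `m / a`
with `m` homogeneous of degree `d + deg a`. -/
def gspecGr (U : Opens (gspecTop 𝒜)) (d : ℤ) : AddSubgroup ((fracRings 𝒜).sections U) :=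
  ((fracGroups 𝒜 d).sections U).comap ((fracRings 𝒜).sections U).subtype.toAddMonoidHom

variable {𝒜}

theorem mem_gspecGr {U : Opens (gspecTop 𝒜)} {d : ℤ} {s : (fracRings 𝒜).sections U} :
    s ∈ gspecGr 𝒜 U d ↔ ∀ x : U, ∃ (V : Opens (gspecTop 𝒜)) (_ : x.1 ∈ V) (i : V ⟶ U)
      (e : ℤ) (m a : A) (_ : m ∈ 𝒜 (d + e)) (ha : a ∈ 𝒜 e) (hV : ∀ q : V, a ∉ q.1.ideal),
        ∀ q : V, s.1 ⟨q.1, i.le q.2⟩ = q.1.frac m a (isHom ha) (hV q) := Iff.rfl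

theorem gspecGr_val {U : Opens (gspecTop 𝒜)} {d : ℤ} {s : (fracRings 𝒜).sections U}
    (hs : s ∈ gspecGr 𝒜 U d) (p : U) : s.1 p ∈ GSpec.locGr p.1 d := by
  obtain ⟨V, hV, i, e, m, a, hm, ha, hne, h⟩ := mem_gspecGr.1 hs p
  have := h ⟨p.1, hV⟩
  rw [show s.1 p = _ from this]
  exact GSpec.mk_mem_locGr _ hm _ ha

/-- The homogeneous components of an element of `A_𝔭`. -/
def GSpec.comp (p : GSpec 𝒜) (d : ℤ) (x : p.Loc) : p.Loc := (DirectSum.decompose p.locGr x d : p.locGr d)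

theorem GSpec.comp_frac (p : GSpec 𝒜) (d : ℤ) {e : ℤ} (m a : A) (ha : a ∈ 𝒜 e) (hp : a ∉ p.ideal) :
    p.comp d (p.frac m a (isHom ha) hp) =
      p.frac (DirectSum.decompose 𝒜 m (d + e) : 𝒜 (d + e)) a (isHom ha) hp := by
  induction m using DirectSum.Decomposition.inductionOn 𝒜 with
  | zero => simp [frac, comp, Localization.mk_zero]
  | @homogeneous i m =>
    by_cases h : i = d + e
    · subst h
      rw [DirectSum.decompose_of_mem_same _ m.2, comp, DirectSum.decompose_of_mem_same]
      exact p.mk_mem_locGr m.2 _ ha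
    · have hx : p.frac (m : A) a (isHom ha) hp ∈ p.locGr (i - e) :=
        p.mk_mem_locGr (e := e) (by simp) _ ha
      rw [DirectSum.decompose_of_mem_ne _ m.2 h, comp,
        DirectSum.decompose_of_mem_ne p.locGr hx (fun h' => h (by linarith))]
      exact (Localization.mk_zero _).symm
  | add m m' h h' =>
    have key : ∀ x y : A, p.frac (x + y) a (isHom ha) hp =
        p.frac x a (isHom ha) hp + p.frac y a (isHom ha) hp := fun x y =>
      (Localization.add_mk_self _ _ _).symm
    rw [key, DirectSum.decompose_add, DirectSum.add_apply, AddSubgroup.coe_add, key, ← h, ← h']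
    simp [comp]

/-- The homogeneous component of a section. -/
def gspecComp {U : Opens (gspecTop 𝒜)} (s : (fracRings 𝒜).sections U) (d : ℤ) :
    (fracRings 𝒜).sections U :=
  ⟨fun p => GSpec.comp p.1 d (s.1 p), fun x => by
    obtain ⟨V, hV, i, m, a, ⟨e, ha⟩, hne, h⟩ := s.2 x
    refine ⟨V, hV, i, (DirectSum.decompose 𝒜 m (d + e) : 𝒜 (d + e)), a, isHom ha, hne, fun q => ?_⟩
    exact (congrArg (GSpec.comp q.1 d) (h q)).trans (GSpec.comp_frac _ _ _ _ ha _)⟩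

theorem gspecComp_mem {U : Opens (gspecTop 𝒜)} (s : (fracRings 𝒜).sections U) (d : ℤ) :
    gspecComp s d ∈ gspecGr 𝒜 U d := mem_gspecGr.2 fun x => by
  obtain ⟨V, hV, i, m, a, ⟨e, ha⟩, hne, h⟩ := s.2 x
  refine ⟨V, hV, i, e, (DirectSum.decompose 𝒜 m (d + e) : 𝒜 (d + e)), a, SetLike.coe_mem _, ha, hne, fun q => ?_⟩
  exact (congrArg (GSpec.comp q.1 d) (h q)).trans (GSpec.comp_frac _ _ _ _ ha _)

variable [IsNoetherianRing A]

theorem gspec_bounded {U : Opens (gspecTop 𝒜)} (s : (fracRings 𝒜).sections U) :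
    ∃ N : Finset ℤ, ∀ p : U, ∀ d ∉ N, GSpec.comp p.1 d (s.1 p) = 0 := by
  classical
  have hU : IsCompact (U : Set (gspecTop 𝒜)) := NoetherianSpace.isCompact _
  suffices h : ∃ N : Finset ℤ, ∀ p : U, p.1 ∈ (U : Set (gspecTop 𝒜)) →
      ∀ d ∉ N, GSpec.comp p.1 d (s.1 p) = 0 from
    h.imp fun N hN p => hN p p.2
  refine hU.induction_on (p := fun S => ∃ N : Finset ℤ, ∀ p : U, p.1 ∈ S →
      ∀ d ∉ N, GSpec.comp p.1 d (s.1 p) = 0) ?_ ?_ ?_ ?_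
  · exact ⟨∅, fun p hp => hp.elim⟩
  · rintro S S' hS ⟨N, hN⟩
    exact ⟨N, fun p hp => hN p (hS hp)⟩
  · rintro S S' ⟨N, hN⟩ ⟨N', hN'⟩
    refine ⟨N ∪ N', fun p hp d hd => ?_⟩
    rw [Finset.mem_union, not_or] at hd
    exact hp.elim (fun h => hN p h d hd.1) (fun h => hN' p h d hd.2)
  · intro x hx
    obtain ⟨V, hV, i, m, a, ⟨e, ha⟩, hne, h⟩ := s.2 ⟨x, hx⟩
    refine ⟨V, mem_nhdsWithin_of_mem_nhds (V.isOpen.mem_nhds hV),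
      (DirectSum.decompose 𝒜 m).support.image (fun j => j - e), fun p hp d hd => ?_⟩
    have h1 := h ⟨p.1, hp⟩
    rw [show s.1 p = _ from h1, GSpec.comp_frac p.1 d m a ha]
    have h2 : DirectSum.decompose 𝒜 m (d + e) = 0 := by
      by_contra hne
      exact hd (Finset.mem_image.2 ⟨d + e, DFinsupp.mem_support_iff.2 hne, by ring⟩)
    rw [h2]
    exact Localization.mk_zero _

theorem gspecGr_isInternal (U : Opens (gspecTop 𝒜)) : DirectSum.IsInternal (gspecGr 𝒜 U) := by
  apply isInternal_of
  · intro s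
    obtain ⟨N, hN⟩ := gspec_bounded s
    have : s = ∑ d ∈ N, gspecComp s d := by
      refine Subtype.ext (funext fun p => ?_)
      rw [AddSubmonoidClass.coe_finsetSum, Finset.sum_apply]
      change s.1 p = ∑ d ∈ N, GSpec.comp p.1 d (s.1 p)
      classical
      have h1 := DirectSum.sum_support_decompose (GSpec.locGr p.1) (s.1 p)
      rw [← Finset.sum_subset (s₁ := (DirectSum.decompose (GSpec.locGr p.1) (s.1 p)).support)]
      · exact h1.symm
      · intro d hd
        by_contra hdN
        have := hN p d hdN
        rw [DFinsupp.mem_support_iff] at hd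
        exact hd (Subtype.ext this)
      · intro d _ hd
        rw [DFinsupp.notMem_support_iff] at hd
        rw [GSpec.comp, hd]
        rfl
    rw [this]
    exact sum_mem fun d _ => AddSubgroup.mem_iSup_of_mem d (gspecComp_mem s d)
  · intro N f hf h0 d hd
    refine Subtype.ext (funext fun p => ?_)
    refine eq_zero_of_sum_eq_zero (𝒜 := GSpec.locGr p.1) 0 N (fun d => (f d).1 p)
      (fun d => by rw [add_zero]; exact gspecGr_val (hf d) p) ?_ d hd
    have := congrFun (congrArg Subtype.val h0) p
    rw [AddSubmonoidClass.coe_finsetSum, Finset.sum_apply] at this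
    exact this

instance (U : Opens (gspecTop 𝒜)) : SetLike.GradedMonoid (gspecGr 𝒜 U) where
  one_mem := mem_gspecGr.2 fun x => ⟨U, x.2, 𝟙 _, 0, 1, 1, SetLike.one_mem_graded 𝒜, SetLike.one_mem_graded 𝒜,
    fun q => q.1.one_not_mem, fun q => Localization.mk_one.symm⟩
  mul_mem := by
    intro i j s t hs ht
    refine mem_gspecGr.2 fun x => ?_
    obtain ⟨V, hV, f, e, m, a, hm, ha, hne, h⟩ := mem_gspecGr.1 hs x
    obtain ⟨W, hW, g, e', m', a', hm', ha', hne', h'⟩ := mem_gspecGr.1 ht x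
    refine ⟨V ⊓ W, mem_inf' hV hW, Opens.infLELeft V W ≫ f, e + e', m * m', a * a', ?_,
      SetLike.mul_mem_graded ha ha', fun q => q.1.mul_not_mem (hne ⟨q.1, q.2.1⟩) (hne' ⟨q.1, q.2.2⟩),
      fun q => ?_⟩
    · have := SetLike.mul_mem_graded hm hm'
      rwa [show (i + e) + (j + e') = i + j + (e + e') by ring] at this
    · refine Eq.trans (congrArg₂ (· * ·) (h ⟨q.1, q.2.1⟩) (h' ⟨q.1, q.2.2⟩)) ?_
      exact GSpec.frac_mul _ _ _ _ _

instance gspecGradedRing (U : Opens (gspecTop 𝒜)) : GradedRing (gspecGr 𝒜 U) where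
  toDecomposition := (gspecGr_isInternal U).chooseDecomposition

variable (𝒜) in
/-- The affine graded scheme attached to a noetherian graded ring. -/
def gspec : GradedRingedSpace.{u} where
  carrier := gspecTop 𝒜
  sheaf := (fracRings 𝒜).sheaf
  gr U := gspecGr 𝒜 U
  gradedRing U := gspecGradedRing U
  map_mem i d _ ha := (fracGroups 𝒜 d).mem_sections_res i ha

end AffineGraded

section GradedModules

variable {A : Type u} [CommRing A] (𝒜 : ℤ → AddSubgroup A) [GradedRing 𝒜]

/-- A graded module over the graded ring `A`. -/
structure GrMod where
  /-- the underlying module -/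
  carrier : ModuleCat.{u} A
  /-- the homogeneous parts -/
  gr : ℤ → AddSubgroup carrier
  isInternal : DirectSum.IsInternal gr
  smul_mem : ∀ {i j : ℤ} {a : A} {m : carrier}, a ∈ 𝒜 i → m ∈ gr j → a • m ∈ gr (i + j)

variable {𝒜}

namespace GrMod

/-- Morphisms of graded modules: linear maps that preserve degrees. -/
@[ext]
structure Hom (M N : GrMod 𝒜) where
  /-- the underlying linear map -/
  toLin : M.carrier →ₗ[A] N.carrier
  map_mem : ∀ {d : ℤ} {m : M.carrier}, m ∈ M.gr d → toLin m ∈ N.gr d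

instance : Category (GrMod 𝒜) where
  Hom := Hom
  id M := ⟨LinearMap.id, fun h => h⟩
  comp f g := ⟨g.toLin ∘ₗ f.toLin, fun h => g.map_mem (f.map_mem h)⟩

instance (M : GrMod 𝒜) : Module (𝒜 0) (M.gr 0) where
  smul a m := ⟨(a : A) • (m : M.carrier), by simpa using M.smul_mem a.2 m.2⟩
  one_smul m := Subtype.ext (one_smul A (m : M.carrier))
  mul_smul a b m := Subtype.ext (mul_smul (a : A) (b : A) (m : M.carrier))
  smul_zero a := Subtype.ext (smul_zero (a : A))
  smul_add a m n := Subtype.ext (smul_add (a : A) (m : M.carrier) (n : M.carrier))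
  add_smul a b m := Subtype.ext (add_smul (a : A) (b : A) (m : M.carrier))
  zero_smul m := Subtype.ext (zero_smul A (m : M.carrier))

variable (𝒜) in
/-- The functor `u_A : M ↦ M₀`. -/
def zeroFunctor : GrMod 𝒜 ⥤ ModuleCat.{u} (𝒜 0) where
  obj M := ModuleCat.of (𝒜 0) (M.gr 0)
  map f := ModuleCat.ofHom
    { toFun := fun m => ⟨f.toLin m.1, f.map_mem m.2⟩
      map_add' := fun m n => Subtype.ext (map_add f.toLin m.1 n.1)
      map_smul' := fun a m => Subtype.ext (map_smul f.toLin a.1 m.1) }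
  map_id _ := rfl
  map_comp _ _ := rfl

variable (𝒜) in
/-- The finitely generated graded modules. -/
def isFG : ObjectProperty (GrMod 𝒜) := fun M => Module.Finite A M.carrier

variable (𝒜) in
/-- The homogeneous part `A_d` as a module over `A₀`. -/
def part (d : ℤ) : Submodule (𝒜 0) A where
  carrier := 𝒜 d
  add_mem' := add_mem
  zero_mem' := zero_mem _
  smul_mem' a m hm := by
    have := SetLike.mul_mem_graded a.2 hm
    rwa [zero_add] at this

variable (𝒜) in
/-- The projection of `A` to its part of degree `d`. -/
def proj (d : ℤ) : A →ₗ[𝒜 0] A where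
  toFun a := (DirectSum.decompose 𝒜 a d : 𝒜 d)
  map_add' a b := by simp
  map_smul' c a := by
    have := DirectSum.coe_decompose_mul_add_of_left_mem 𝒜 (i := 0) (j := d) (b := a) c.2
    rw [zero_add] at this
    exact this

theorem proj_same {d : ℤ} {a : A} (ha : a ∈ 𝒜 d) : proj 𝒜 d a = a :=
  DirectSum.decompose_of_mem_same 𝒜 ha

theorem proj_ne {d e : ℤ} {a : A} (ha : a ∈ 𝒜 e) (h : e ≠ d) : proj 𝒜 d a = 0 :=
  DirectSum.decompose_of_mem_ne 𝒜 ha h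

section Tensor

variable (N : Type u) [AddCommGroup N] [Module (𝒜 0) N]

variable (𝒜) in
/-- The image of `A_d ⊗ N` in `A ⊗ N`. -/
def tensorGr (d : ℤ) : AddSubgroup (A ⊗[𝒜 0] N) :=
  (LinearMap.range ((part 𝒜 d).subtype.rTensor N)).toAddSubgroup

variable {N}

theorem tmul_mem_tensorGr {d : ℤ} {a : A} (ha : a ∈ 𝒜 d) (n : N) :
    a ⊗ₜ[𝒜 0] n ∈ tensorGr 𝒜 N d :=
  ⟨(⟨a, ha⟩ : part 𝒜 d) ⊗ₜ n, rfl⟩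

theorem tensorGr_induction {d : ℤ} {p : A ⊗[𝒜 0] N → Prop} (hz : p 0)
    (ht : ∀ a ∈ 𝒜 d, ∀ n : N, p (a ⊗ₜ n)) (hadd : ∀ x y, p x → p y → p (x + y))
    {x : A ⊗[𝒜 0] N} (hx : x ∈ tensorGr 𝒜 N d) : p x := by
  obtain ⟨y, rfl⟩ := hx
  induction y using TensorProduct.induction_on with
  | zero => simpa using hz
  | tmul a n => exact ht a.1 a.2 n
  | add y z hy hz' => rw [map_add]; exact hadd _ _ hy hz'

theorem proj_tensor {d e : ℤ} {x : A ⊗[𝒜 0] N} (hx : x ∈ tensorGr 𝒜 N e) :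
    (proj 𝒜 d).rTensor N x = if e = d then x else 0 := by
  refine tensorGr_induction (p := fun x => (proj 𝒜 d).rTensor N x = if e = d then x else 0)
    ?_ ?_ ?_ hx
  · simp
  · intro a ha n
    split_ifs with h
    · subst h; rw [LinearMap.rTensor_tmul, proj_same ha]
    · rw [LinearMap.rTensor_tmul, proj_ne ha h, TensorProduct.zero_tmul]
  · intro x y hx hy
    rw [map_add, hx, hy]
    split_ifs <;> simp

theorem tensorGr_isInternal : DirectSum.IsInternal (tensorGr 𝒜 N) := by
  apply isInternal_of
  · intro x
    induction x using TensorProduct.induction_on with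
    | zero => exact zero_mem _
    | tmul a n =>
      classical
      rw [← DirectSum.sum_support_decompose 𝒜 a, TensorProduct.sum_tmul]
      exact sum_mem fun i _ => AddSubgroup.mem_iSup_of_mem i (tmul_mem_tensorGr (SetLike.coe_mem _) n)
    | add x y hx hy => exact add_mem hx hy
  · intro s f hf h0 d hd
    have h1 := congrArg ((proj 𝒜 d).rTensor N) h0
    rw [map_sum, Finset.sum_congr rfl (fun e _ => proj_tensor (hf e)), map_zero,
      Finset.sum_eq_single d] at h1
    · simpa using h1
    · intro e _ h; rw [if_neg h]
    · intro h; exact absurd hd h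

theorem tensorGr_smul_mem {i j : ℤ} {a : A} {m : A ⊗[𝒜 0] N} (ha : a ∈ 𝒜 i)
    (hm : m ∈ tensorGr 𝒜 N j) : a • m ∈ tensorGr 𝒜 N (i + j) := by
  refine tensorGr_induction (p := fun m => a • m ∈ tensorGr 𝒜 N (i + j)) ?_ ?_ ?_ hm
  · rw [smul_zero]; exact zero_mem _
  · intro b hb n
    rw [TensorProduct.smul_tmul', smul_eq_mul]
    exact tmul_mem_tensorGr (SetLike.mul_mem_graded ha hb) n
  · intro x y hx hy
    rw [smul_add]; exact add_mem hx hy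

end Tensor

variable (𝒜) in
/-- The functor `o_A = A ⊗_{A₀} -`. -/
def tensorFunctor : ModuleCat.{u} (𝒜 0) ⥤ GrMod 𝒜 where
  obj N :=
    { carrier := ModuleCat.of A (A ⊗[𝒜 0] N)
      gr := tensorGr 𝒜 N
      isInternal := tensorGr_isInternal
      smul_mem := tensorGr_smul_mem }
  map {N N'} f :=
    { toLin := TensorProduct.AlgebraTensorModule.map (LinearMap.id : A →ₗ[A] A) f.hom
      map_mem := fun {d m} hm => by
        refine tensorGr_induction (p := fun m => TensorProduct.AlgebraTensorModule.map
          (LinearMap.id : A →ₗ[A] A) f.hom m ∈ tensorGr 𝒜 N' d) ?_ ?_ ?_ hm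
        · rw [map_zero]; exact zero_mem _
        · intro a ha n
          rw [TensorProduct.AlgebraTensorModule.map_tmul]
          exact tmul_mem_tensorGr ha _
        · intro x y hx hy
          rw [map_add]; exact add_mem hx hy }
  map_id N := Hom.ext (TensorProduct.AlgebraTensorModule.ext fun _ _ => rfl)
  map_comp f g := Hom.ext (TensorProduct.AlgebraTensorModule.ext fun _ _ => rfl)

section InternalHom

variable (N : Type u) [AddCommGroup N] [Module (𝒜 0) N]

variable (𝒜) in
/-- The `A₀`-linear maps `A → N` that vanish on all but finitely many homogeneous parts of `A`. -/
def coindCarrier : AddSubgroup (A →ₗ[𝒜 0] N) where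
  carrier := {f | ∃ s : Finset ℤ, ∀ d ∉ s, ∀ a ∈ 𝒜 d, f a = 0}
  zero_mem' := ⟨∅, fun _ _ _ _ => rfl⟩
  add_mem' := by
    rintro f g ⟨s, hs⟩ ⟨t, ht⟩
    classical
    refine ⟨s ∪ t, fun d hd a ha => ?_⟩
    rw [Finset.mem_union, not_or] at hd
    rw [LinearMap.add_apply, hs d hd.1 a ha, ht d hd.2 a ha, add_zero]
  neg_mem' := by
    rintro f ⟨s, hs⟩
    exact ⟨s, fun d hd a ha => by rw [LinearMap.neg_apply, hs d hd a ha, neg_zero]⟩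

variable {N}

/-- The action of `A` by `(a f)(b) = f(ab)`. -/
instance : Module A (coindCarrier 𝒜 N) where
  smul a f := ⟨f.1 ∘ₗ LinearMap.mulLeft (𝒜 0) a, by
    obtain ⟨s, hs⟩ := f.2
    classical
    refine ⟨Finset.image₂ (fun i j => i - j) s (DirectSum.decompose 𝒜 a).support,
      fun d hd b hb => ?_⟩
    rw [LinearMap.comp_apply, LinearMap.mulLeft_apply,
      ← DirectSum.sum_support_decompose 𝒜 a, Finset.sum_mul, map_sum]
    refine Finset.sum_eq_zero fun j hj => hs (j + d) (fun h => hd ?_) _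
      (SetLike.mul_mem_graded (SetLike.coe_mem _) hb)
    exact Finset.mem_image₂.2 ⟨j + d, h, j, hj, by ring⟩⟩
  one_smul f := Subtype.ext (LinearMap.ext fun b => congrArg f.1 (one_mul b))
  mul_smul a b f := Subtype.ext (LinearMap.ext fun c => congrArg f.1 (by
    change a * b * c = b * (a * c); ring))
  smul_zero a := rfl
  smul_add a f g := rfl
  add_smul a b f := Subtype.ext (LinearMap.ext fun c => by
    change f.1 ((a + b) * c) = f.1 (a * c) + f.1 (b * c)
    rw [add_mul, map_add])
  zero_smul f := Subtype.ext (LinearMap.ext fun c => by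
    change f.1 (0 * c) = 0
    rw [zero_mul, map_zero])

theorem coind_smul_apply (a b : A) (f : coindCarrier 𝒜 N) : (a • f).1 b = f.1 (a * b) := rfl

variable (𝒜 N) in
/-- The maps of degree `d`: those that vanish on `A_e` for `e ≠ -d`. -/
def coindGr (d : ℤ) : AddSubgroup (coindCarrier 𝒜 N) where
  carrier := {f | ∀ e, e ≠ -d → ∀ a ∈ 𝒜 e, f.1 a = 0}
  zero_mem' := fun _ _ _ _ => rfl
  add_mem' := by
    intro f g hf hg e he a ha
    change f.1 a + g.1 a = 0
    rw [hf e he a ha, hg e he a ha, add_zero]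
  neg_mem' := by
    intro f hf e he a ha
    change - f.1 a = 0
    rw [hf e he a ha, neg_zero]

theorem coindGr_smul_mem {i j : ℤ} {a : A} {f : coindCarrier 𝒜 N} (ha : a ∈ 𝒜 i)
    (hf : f ∈ coindGr 𝒜 N j) : a • f ∈ coindGr 𝒜 N (i + j) := fun e he b hb =>
  hf (i + e) (fun h => he (by linarith)) _ (SetLike.mul_mem_graded ha hb)

/-- The component of degree `d` of a linear map. -/
def coindComp (f : coindCarrier 𝒜 N) (d : ℤ) : coindCarrier 𝒜 N :=
  ⟨f.1 ∘ₗ proj 𝒜 (-d), {-d}, fun e he a ha => by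
    rw [Finset.mem_singleton] at he
    rw [LinearMap.comp_apply, proj_ne ha he, map_zero]⟩

theorem coindComp_mem (f : coindCarrier 𝒜 N) (d : ℤ) : coindComp f d ∈ coindGr 𝒜 N d :=
  fun e he a ha => by
    change f.1 (proj 𝒜 (-d) a) = 0
    rw [proj_ne ha he, map_zero]

theorem linearMap_ext_homogeneous {f g : A →ₗ[𝒜 0] N} (h : ∀ d, ∀ a ∈ 𝒜 d, f a = g a) : f = g := by
  ext a
  classical
  rw [← DirectSum.sum_support_decompose 𝒜 a, map_sum, map_sum]
  exact Finset.sum_congr rfl fun d _ => h d _ (SetLike.coe_mem _)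

theorem coindGr_isInternal : DirectSum.IsInternal (coindGr 𝒜 N) := by
  apply isInternal_of
  · intro f
    obtain ⟨s, hs⟩ := f.2
    have : f = ∑ e ∈ s, coindComp f (-e) := by
      refine Subtype.ext (linearMap_ext_homogeneous (𝒜 := 𝒜) fun d a ha => ?_)
      rw [AddSubmonoidClass.coe_finsetSum, LinearMap.sum_apply]
      by_cases hd : d ∈ s
      · rw [Finset.sum_eq_single d]
        · change _ = f.1 (proj 𝒜 (- -d) a)
          rw [neg_neg, proj_same ha]
        · intro e _ he
          change f.1 (proj 𝒜 (- -e) a) = 0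
          rw [neg_neg, proj_ne ha he.symm, map_zero]
        · intro h; exact absurd hd h
      · rw [hs d hd a ha]
        refine (Finset.sum_eq_zero fun e he => ?_).symm
        change f.1 (proj 𝒜 (- -e) a) = 0
        rw [neg_neg, proj_ne ha (fun h => hd (h ▸ he)), map_zero]
    rw [this]
    exact sum_mem fun e _ => AddSubgroup.mem_iSup_of_mem (-e) (coindComp_mem f (-e))
  · intro s f hf h0 d hd
    refine Subtype.ext (linearMap_ext_homogeneous (𝒜 := 𝒜) fun e a ha => ?_)
    by_cases he : e = -d
    · have h1 := congrArg (fun g : coindCarrier 𝒜 N => g.1 a) h0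
      simp only [AddSubmonoidClass.coe_finsetSum, LinearMap.sum_apply] at h1
      rw [Finset.sum_eq_single d] at h1
      · exact h1
      · intro d' _ hd'
        exact hf d' e (fun h => hd' (by linarith)) a ha
      · intro h; exact absurd hd h
    · exact hf d e he a ha

end InternalHom

variable (𝒜) in
/-- The functor `h_A` sending `N` to the graded module of `A₀`-linear maps `A → N`. -/
def coindFunctor : ModuleCat.{u} (𝒜 0) ⥤ GrMod 𝒜 where
  obj N :=
    { carrier := ModuleCat.of A (coindCarrier 𝒜 N)
      gr := coindGr 𝒜 N
      isInternal := coindGr_isInternal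
      smul_mem := coindGr_smul_mem }
  map {N N'} g :=
    { toLin :=
        { toFun := fun f => (⟨g.hom ∘ₗ f.1, by
            obtain ⟨s, hs⟩ := f.2
            exact ⟨s, fun d hd a ha => by rw [LinearMap.comp_apply, hs d hd a ha, map_zero]⟩⟩ :
              coindCarrier 𝒜 N')
          map_add' := fun f f' => Subtype.ext (LinearMap.ext fun a => map_add g.hom (f.1 a) (f'.1 a))
          map_smul' := fun _ _ => rfl }
      map_mem := fun {d f} hf e he a ha => by
        change g.hom (f.1 a) = 0
        rw [hf e he a ha, map_zero] }
  map_id _ := rfl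
  map_comp _ _ := rfl

end GrMod

end GradedModules

section Tilde

variable {A : Type u} [CommRing A] {𝒜 : ℤ → AddSubgroup A} [GradedRing 𝒜] (M : GrMod 𝒜)

/-- The localization `M_𝔭` at the homogeneous elements outside `𝔭`. -/
abbrev GrMod.Loc (p : GSpec 𝒜) : Type u := LocalizedModule p.homCompl M.carrier

variable {M}

/-- The class of `m / a` in `M_𝔭`, for `a` homogeneous with `a ∉ 𝔭`. -/
def GSpec.modFrac (p : GSpec 𝒜) (m : M.carrier) (a : A) (ha : SetLike.IsHomogeneousElem 𝒜 a)
    (hp : a ∉ p.ideal) : M.Loc p := LocalizedModule.mk m ⟨a, ha, hp⟩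

theorem GSpec.modFrac_add (p : GSpec 𝒜) {m m' : M.carrier} {a a' : A}
    (ha : SetLike.IsHomogeneousElem 𝒜 a)
    (hp : a ∉ p.ideal) (ha' : SetLike.IsHomogeneousElem 𝒜 a') (hp' : a' ∉ p.ideal) :
    p.modFrac m a ha hp + p.modFrac m' a' ha' hp' =
      p.modFrac (a' • m + a • m') (a * a') (ha.mul ha') (p.mul_not_mem hp hp') :=
  LocalizedModule.mk_add_mk

theorem GSpec.frac_smul_modFrac (p : GSpec 𝒜) {b : A} {m : M.carrier} {a a' : A}
    (ha : SetLike.IsHomogeneousElem 𝒜 a)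
    (hp : a ∉ p.ideal) (ha' : SetLike.IsHomogeneousElem 𝒜 a') (hp' : a' ∉ p.ideal) :
    p.frac b a ha hp • p.modFrac m a' ha' hp' =
      p.modFrac (b • m) (a * a') (ha.mul ha') (p.mul_not_mem hp hp') :=
  LocalizedModule.mk_smul_mk _ _ _ _

variable (M)

/-- Functions of the form `𝔮 ↦ m / a`, with `a` homogeneous of some degree `e` and `m` homogeneous
of degree `d + e`. -/
def tildeGroups (d : ℤ) : LocalGroups (X := gspecTop 𝒜) (fun p => GrMod.Loc M p) where
  fn V :=
    { carrier := {s | ∃ (e : ℤ) (m : M.carrier) (a : A) (_ : m ∈ M.gr (d + e)) (ha : a ∈ 𝒜 e)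
        (hV : ∀ q : V, a ∉ q.1.ideal), ∀ q : V, s q = q.1.modFrac m a (isHom ha) (hV q)}
      zero_mem' := ⟨0, 0, 1, zero_mem _, SetLike.one_mem_graded 𝒜, fun q => q.1.one_not_mem,
        fun q => (LocalizedModule.zero_mk _).symm⟩
      add_mem' := by
        rintro s t ⟨e, m, a, hm, ha, hV, h⟩ ⟨e', m', a', hm', ha', hV', h'⟩
        refine ⟨e + e', a' • m + a • m', a * a', add_mem ?_ ?_, SetLike.mul_mem_graded ha ha',
          fun q => q.1.mul_not_mem (hV q) (hV' q), fun q => ?_⟩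
        · have := M.smul_mem ha' hm
          rwa [show e' + (d + e) = d + (e + e') by ring] at this
        · have := M.smul_mem ha hm'
          rwa [show e + (d + e') = d + (e + e') by ring] at this
        · rw [Pi.add_apply, h, h', GSpec.modFrac_add]
      neg_mem' := by
        rintro s ⟨e, m, a, hm, ha, hV, h⟩
        refine ⟨e, -m, a, neg_mem hm, ha, hV, fun q => ?_⟩
        rw [Pi.neg_apply, h]
        exact LocalizedModule.mk_neg.symm }
  res := by
    rintro V W i s ⟨e, m, a, hm, ha, hV, h⟩
    exact ⟨e, m, a, hm, ha, fun q => hV ⟨q.1, i.le q.2⟩, fun q => h ⟨q.1, i.le q.2⟩⟩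

variable {M} in
theorem tilde_smul_mem {i j k : ℤ} (h : i + j = k) {U : Opens (gspecTop 𝒜)}
    {a : ∀ p : U, GSpec.Loc p.1} {s : ∀ p : U, GrMod.Loc M p.1}
    (ha : a ∈ (fracGroups 𝒜 i).sections U) (hs : s ∈ (tildeGroups M j).sections U) :
    (fun p => a p • s p) ∈ (tildeGroups M k).sections U := by
  intro x
  obtain ⟨V, hV, f, e, m, b, hm, hb, hne, h1⟩ := ha x
  obtain ⟨W, hW, g, e', m', b', hm', hb', hne', h2⟩ := hs x
  refine ⟨V ⊓ W, mem_inf' hV hW, Opens.infLELeft V W ≫ f, e + e', m • m', b * b', ?_,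
    SetLike.mul_mem_graded hb hb', fun q => q.1.mul_not_mem (hne ⟨q.1, q.2.1⟩) (hne' ⟨q.1, q.2.2⟩),
    fun q => ?_⟩
  · have := M.smul_mem hm hm'
    rwa [show (i + e) + (j + e') = k + (e + e') by rw [← h]; ring] at this
  · refine Eq.trans (congrArg₂ (· • ·) (h1 ⟨q.1, q.2.1⟩) (h2 ⟨q.1, q.2.2⟩)) ?_
    exact GSpec.frac_smul_modFrac _ _ _ _ _

variable [IsNoetherianRing A]

/-- The sheaf of graded modules `M~` on `gspec 𝒜`. -/
def tilde : GMod (gspec 𝒜) where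
  sec d := (tildeGroups M d).sheaf
  smul {_ _ k} h U := AddMonoidHom.mk'
    (fun a => AddMonoidHom.mk'
      (fun s => (⟨fun p => a.1.1 p • s.1 p, tilde_smul_mem h a.2 s.2⟩ : (tildeGroups M k).sections U))
      (fun s t => Subtype.ext (funext fun p => smul_add (a.1.1 p) (s.1 p) (t.1 p))))
    (fun a b => AddMonoidHom.ext fun s =>
      Subtype.ext (funext fun p => add_smul (a.1.1 p) (b.1.1 p) (s.1 p)))
  one_smul _ s := Subtype.ext (funext fun p => one_smul (GSpec.Loc p.1) (s.1 p))
  mul_smul _ _ _ a b s := Subtype.ext (funext fun p => mul_smul (a.1.1 p) (b.1.1 p) (s.1 p))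
  smul_res _ _ _ _ _ _ := rfl

end Tilde

section GradedSchemes

/-- An isomorphism of the graded ringed space `Y` with an open subspace of `X`. -/
structure OpenImmersion (Y X : GradedRingedSpace.{u}) where
  /-- the underlying continuous map -/
  base : Y.carrier ⟶ X.carrier
  isOpenEmbedding : Topology.IsOpenEmbedding base
  /-- the isomorphism of `𝒪_X|_U` with `𝒪_Y` -/
  iso : ∀ V : Opens Y.carrier, X.Sec (isOpenEmbedding.isOpenMap.functor.obj V) ≃+* Y.Sec V
  iso_res : ∀ {V W : Opens Y.carrier} (i : W ⟶ V)
    (a : X.Sec (isOpenEmbedding.isOpenMap.functor.obj V)),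
    iso W (X.res (isOpenEmbedding.isOpenMap.functor.map i) a) = Y.res i (iso V a)
  iso_mem : ∀ (V : Opens Y.carrier) (d : ℤ) (a : X.Sec (isOpenEmbedding.isOpenMap.functor.obj V)),
    iso V a ∈ Y.gr V d ↔ a ∈ X.gr (isOpenEmbedding.isOpenMap.functor.obj V) d

namespace OpenImmersion

variable {Y X : GradedRingedSpace.{u}} (j : OpenImmersion Y X)

/-- The image of an open subset of `Y`. -/
abbrev image : Opens Y.carrier ⥤ Opens X.carrier := j.isOpenEmbedding.isOpenMap.functor

/-- The inverse of the isomorphism of structure sheaves on homogeneous sections. -/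
def symmGr (V : Opens Y.carrier) (d : ℤ) : Y.gr V d →+ X.gr (j.image.obj V) d where
  toFun a := ⟨(j.iso V).symm a.1, (j.iso_mem V d _).1 (by rw [RingEquiv.apply_symm_apply]; exact a.2)⟩
  map_zero' := Subtype.ext (map_zero (j.iso V).symm)
  map_add' a b := Subtype.ext (map_add (j.iso V).symm a.1 b.1)

theorem symmGr_res {V W : Opens Y.carrier} (i : W ⟶ V) (d : ℤ) (a : Y.gr V d) :
    X.resGr (j.image.map i) d (j.symmGr V d a) = j.symmGr W d (Y.resGr i d a) := by
  refine Subtype.ext ((j.iso W).injective ?_)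
  change j.iso W (X.res _ ((j.iso V).symm a.1)) = j.iso W ((j.iso W).symm _)
  rw [j.iso_res, RingEquiv.apply_symm_apply, RingEquiv.apply_symm_apply]
  rfl

/-- The restriction of a sheaf of graded modules to an open subspace. -/
def restrict (F : GMod X) : GMod Y where
  sec d := ⟨j.image.op ⋙ (F.sec d).presheaf,
    TopCat.Presheaf.isSheaf_of_isOpenEmbedding j.isOpenEmbedding (F.sec d).property⟩
  smul {i k l} h U := (F.smul h (j.image.obj U)).comp (j.symmGr U i)
  one_smul {k} U s := by
    have h : j.symmGr U 0 ⟨1, SetLike.one_mem_graded _⟩ = ⟨1, SetLike.one_mem_graded _⟩ :=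
      Subtype.ext (map_one (j.iso U).symm)
    change F.smul _ _ (j.symmGr U 0 _) s = s
    rw [h]
    exact F.one_smul _ _
  mul_smul {i k l m n} h h' U a b s := by
    have e : j.symmGr U (i + k) ⟨a.1 * b.1, SetLike.mul_mem_graded a.2 b.2⟩ =
        ⟨(j.symmGr U i a).1 * (j.symmGr U k b).1, SetLike.mul_mem_graded (Subtype.prop _) (Subtype.prop _)⟩ :=
      Subtype.ext (map_mul (j.iso U).symm a.1 b.1)
    change F.smul _ _ (j.symmGr U _ _) s = _
    rw [e]
    exact F.mul_smul h h' _ _ _ _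
  smul_res {i k l} h U V f a s := by
    refine (F.smul_res h (j.image.map f) (j.symmGr U i a) s).trans ?_
    rw [j.symmGr_res]
    rfl

end OpenImmersion

namespace GradedRingedSpace

variable (X : GradedRingedSpace.{u})

/-- A graded scheme: a locally graded ringed space with noetherian underlying space, in which
every point has an open neighbourhood isomorphic to `gspec A` for a noetherian graded ring `A`. -/
structure IsGradedScheme : Prop where
  noetherianSpace : NoetherianSpace X.carrier
  isLocal : ∀ x, IsLocalGraded (X.stalkGr x)
  isLocallyAffine : ∀ x : X.carrier, ∃ (A : Type u) (_ : CommRing A) (_ : IsNoetherianRing A)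
    (𝒜 : ℤ → AddSubgroup A) (_ : GradedRing 𝒜) (j : OpenImmersion (gspec 𝒜) X),
    x ∈ Set.range j.base

end GradedRingedSpace

namespace GMod

variable (X : GradedRingedSpace.{u})

/-- Quasi-coherent graded sheaves: `X` is covered by affine graded schemes on which the sheaf is
isomorphic to `M~` for a graded module `M`. -/
def isQCoh : ObjectProperty (GMod X) := fun F => ∀ x : X.carrier,
  ∃ (A : Type u) (_ : CommRing A) (_ : IsNoetherianRing A)
    (𝒜 : ℤ → AddSubgroup A) (_ : GradedRing 𝒜) (j : OpenImmersion (gspec 𝒜) X) (M : GrMod 𝒜),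
    x ∈ Set.range j.base ∧ Nonempty (j.restrict F ≅ tilde M)

/-- Coherent graded sheaves: `X` is covered by affine graded schemes on which the sheaf is
isomorphic to `M~` for a finitely generated graded module `M`. -/
def isCoh : ObjectProperty (GMod X) := fun F => ∀ x : X.carrier,
  ∃ (A : Type u) (_ : CommRing A) (_ : IsNoetherianRing A)
    (𝒜 : ℤ → AddSubgroup A) (_ : GradedRing 𝒜) (j : OpenImmersion (gspec 𝒜) X) (M : GrMod 𝒜),
    x ∈ Set.range j.base ∧ Module.Finite A M.carrier ∧ Nonempty (j.restrict F ≅ tilde M)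

end GMod

end GradedSchemes

namespace GradedRingedSpace

variable {X : GradedRingedSpace.{u}}

namespace ZeroMod

/-- Sections of a sheaf of `𝒪_{X₀}`-modules. -/
abbrev Sec (G : X.ZeroMod) (U : Opens X.carrier) : ModuleCat.{u} (X.zeroRing.obj.obj (op U)) :=
  G.val.obj (op U)

/-- The underlying sheaf of abelian groups. -/
def ab (G : X.ZeroMod) : TopCat.Sheaf AddCommGrpCat.{u} X.carrier := ⟨G.val.presheaf, G.isSheaf⟩

/-- Restriction of sections. -/
def res (G : X.ZeroMod) {U V : Opens X.carrier} (i : V ⟶ U) : Sec G U →+ Sec G V :=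
  (G.val.presheaf.map i.op).hom

/-- Multiplication by a section of degree zero. -/
def act (G : X.ZeroMod) {U : Opens X.carrier} (c : X.gr U 0) (g : Sec G U) : Sec G U :=
  (show X.zeroRing.obj.obj (op U) from c) • g

theorem res_act (G : X.ZeroMod) {U V : Opens X.carrier} (i : V ⟶ U) (c : X.gr U 0) (g : Sec G U) :
    res G i (act G c g) = act G (X.resGr i 0 c) (res G i g) :=
  PresheafOfModules.map_smul G.val i.op c g

theorem res_res (G : X.ZeroMod) {U V W : Opens X.carrier} (i : V ⟶ U) (j : W ⟶ V) (g : Sec G U) :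
    res G j (res G i g) = res G (j ≫ i) g := by
  have := ConcreteCategory.congr_hom (G.val.presheaf.map_comp i.op j.op) g
  exact this.symm

theorem res_id (G : X.ZeroMod) {U : Opens X.carrier} (g : Sec G U) : res G (𝟙 U) g = g :=
  ConcreteCategory.congr_hom (G.val.presheaf.map_id (op U)) g

/-- Evaluation of a morphism on sections. -/
def mapSec {G H : X.ZeroMod} (f : G ⟶ H) (U : Opens X.carrier) : Sec G U →+ Sec H U :=
  (f.val.app (op U)).hom.toAddMonoidHom

theorem mapSec_act {G H : X.ZeroMod} (f : G ⟶ H) {U : Opens X.carrier} (c : X.gr U 0) (g : Sec G U) :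
    mapSec f U (act G c g) = act H c (mapSec f U g) :=
  map_smul (f.val.app (op U)).hom (show X.zeroRing.obj.obj (op U) from c) g

theorem mapSec_res {G H : X.ZeroMod} (f : G ⟶ H) {U V : Opens X.carrier} (i : V ⟶ U) (g : Sec G U) :
    mapSec f V (res G i g) = res H i (mapSec f U g) :=
  PresheafOfModules.naturality_apply f.val i.op g

section Tensor

/-- A sheaf of `𝒪_{X₀}`-modules as a presheaf of modules over a presheaf of commutative rings. -/
abbrev pre (G : X.ZeroMod) : PresheafOfModules.{u} (X.zeroPresheaf ⋙ forget₂ CommRingCat.{u} RingCat.{u}) :=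
  G.val

/-- The stalk of a sheaf of `𝒪_{X₀}`-modules. -/
abbrev stalk (G : X.ZeroMod) (x : X.carrier) : AddCommGrpCat.{u} :=
  TopCat.Presheaf.stalk (pre G).presheaf x

instance (x : X.carrier) : Algebra (X.zeroPresheaf.stalk x) (X.stalk x) :=
  ((TopCat.Presheaf.stalkFunctor CommRingCat.{u} x).map X.zeroInclusion).hom.toAlgebra

theorem algebraMap_germ (x : X.carrier) (U : Opens X.carrier) (hx : x ∈ U) (a : X.gr U 0) :
    algebraMap (X.zeroPresheaf.stalk x) (X.stalk x) (X.zeroPresheaf.germ U x hx a) =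
      X.germ x hx a.1 :=
  TopCat.Presheaf.stalkFunctor_map_germ_apply U x hx X.zeroInclusion a

/-- The germ of a section of a sheaf of `𝒪_{X₀}`-modules. -/
def germ (G : X.ZeroMod) {U : Opens X.carrier} (x : X.carrier) (hx : x ∈ U) : Sec G U →+ stalk G x :=
  (TopCat.Presheaf.germ (pre G).presheaf U x hx).hom

theorem germ_res (G : X.ZeroMod) {U V : Opens X.carrier} (i : V ⟶ U) (x : X.carrier) (hx : x ∈ V)
    (g : Sec G U) : germ G x hx (res G i g) = germ G x (i.le hx) g :=
  TopCat.Presheaf.germ_res_apply (pre G).presheaf i x hx g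

/-- The stalk of `𝒪_X ⊗ G`. -/
abbrev TStalk (G : X.ZeroMod) (x : X.carrier) : Type u :=
  X.stalk x ⊗[X.zeroPresheaf.stalk x] stalk G x

/-- Finite sums of the functions `x ↦ a_x ⊗ g_x` with `a` homogeneous of degree `d`. -/
def tensorGroups (G : X.ZeroMod) (d : ℤ) : LocalGroups (X := X.carrier) (TStalk G) where
  fn V := AddSubgroup.closure {s | ∃ a ∈ X.gr V d, ∃ g : Sec G V,
    ∀ x : V, s x = X.germ x.1 x.2 a ⊗ₜ germ G x.1 x.2 g}
  res {V W} i s hs := by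
    induction hs using AddSubgroup.closure_induction with
    | mem s hs =>
      obtain ⟨a, ha, g, h⟩ := hs
      refine AddSubgroup.subset_closure ⟨X.res i a, X.map_mem i ha, res G i g, fun x => ?_⟩
      rw [X.germ_res, germ_res]
      exact h _
    | zero => exact zero_mem _
    | add s t _ _ hs ht => exact add_mem hs ht
    | neg s _ hs => exact neg_mem hs

theorem tensorGroups_smul {i j k : ℤ} (h : i + j = k) (G : X.ZeroMod) {V : Opens X.carrier}
    {a : X.Sec V} (ha : a ∈ X.gr V i) {s : ∀ x : V, TStalk G x.1} (hs : s ∈ (tensorGroups G j).fn V) :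
    (fun x : V => X.germ x.1 x.2 a • s x) ∈ (tensorGroups G k).fn V := by
  induction hs using AddSubgroup.closure_induction with
  | mem s hs =>
    obtain ⟨b, hb, g, h'⟩ := hs
    refine AddSubgroup.subset_closure ⟨a * b, h ▸ SetLike.mul_mem_graded ha hb, g, fun x => ?_⟩
    dsimp only
    rw [h', TensorProduct.smul_tmul', smul_eq_mul, map_mul]
  | zero =>
    have : (fun x : V => X.germ x.1 x.2 a • (0 : ∀ x : V, TStalk G x.1) x) = 0 :=
      funext fun x => smul_zero _
    rw [this]
    exact zero_mem _
  | add s t _ _ hs ht =>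
    convert! add_mem hs ht using 1
    exact funext fun x => smul_add _ _ _
  | neg s _ hs =>
    convert! neg_mem hs using 1
    exact funext fun x => smul_neg _ _

theorem tensor_smul_mem {i j k : ℤ} (h : i + j = k) (G : X.ZeroMod) {U : Opens X.carrier}
    {a : X.Sec U} (ha : a ∈ X.gr U i) {s : ∀ x : U, TStalk G x.1}
    (hs : s ∈ (tensorGroups G j).sections U) :
    (fun x : U => X.germ x.1 x.2 a • s x) ∈ (tensorGroups G k).sections U := by
  intro x
  obtain ⟨V, hV, f, h1⟩ := hs x
  refine ⟨V, hV, f, ?_⟩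
  have := tensorGroups_smul h G (X.map_mem f ha) h1
  convert! this using 1
  funext y
  dsimp only
  rw [X.germ_res]
  rfl

/-- The sheaf of graded modules `𝒪_X ⊗_{𝒪_{X₀}} G`. -/
def tensor (G : X.ZeroMod) : GMod X where
  sec d := (tensorGroups G d).sheaf
  smul {i j k} h U := AddMonoidHom.mk'
    (fun a => AddMonoidHom.mk'
      (fun s => (⟨fun x => X.germ x.1 x.2 a.1 • s.1 x, tensor_smul_mem h G a.2 s.2⟩ :
        (tensorGroups G k).sections U))
      (fun s t => Subtype.ext (funext fun x => smul_add (X.germ x.1 x.2 a.1) (s.1 x) (t.1 x))))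
    (fun a b => AddMonoidHom.ext fun s =>
      Subtype.ext (funext fun x => by
        change X.germ x.1 x.2 (a.1 + b.1) • s.1 x = _
        rw [map_add, add_smul]
        rfl))
  one_smul U s := Subtype.ext (funext fun x => by
    change X.germ x.1 x.2 1 • s.1 x = _
    rw [map_one, one_smul])
  mul_smul h h' U a b s := Subtype.ext (funext fun x => by
    change X.germ x.1 x.2 (a.1 * b.1) • s.1 x = X.germ x.1 x.2 a.1 • X.germ x.1 x.2 b.1 • s.1 x
    rw [map_mul, mul_smul])
  smul_res h U V f a s := Subtype.ext (funext fun x => by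
    change X.germ x.1 (f.le x.2) a.1 • s.1 ⟨x.1, f.le x.2⟩ =
      X.germ x.1 x.2 (X.res f a.1) • s.1 ⟨x.1, f.le x.2⟩
    rw [X.germ_res])

/-- The additive map on stalks induced by a morphism. -/
def stalkMapAdd {G H : X.ZeroMod} (f : G ⟶ H) (x : X.carrier) : stalk G x →+ stalk H x :=
  ((TopCat.Presheaf.stalkFunctor AddCommGrpCat.{u} x).map
    ((PresheafOfModules.toPresheaf _).map f.val)).hom

theorem stalkMapAdd_germ {G H : X.ZeroMod} (f : G ⟶ H) {U : Opens X.carrier} (x : X.carrier)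
    (hx : x ∈ U) (g : Sec G U) : stalkMapAdd f x (germ G x hx g) = germ H x hx (mapSec f U g) :=
  TopCat.Presheaf.stalkFunctor_map_germ_apply U x hx ((PresheafOfModules.toPresheaf _).map f.val) g

theorem germ_act (G : X.ZeroMod) {U : Opens X.carrier} (x : X.carrier) (hx : x ∈ U) (c : X.gr U 0)
    (g : Sec G U) : germ G x hx (act G c g) = X.zeroPresheaf.germ U x hx c • germ G x hx g :=
  PresheafOfModules.germ_smul (pre G) x U hx c g

theorem exists_germ (G : X.ZeroMod) (x : X.carrier) (m : stalk G x) :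
    ∃ (U : Opens X.carrier) (hx : x ∈ U) (g : Sec G U), germ G x hx g = m := by
  obtain ⟨U, hx, g, h⟩ := TopCat.Presheaf.exists_germ_eq (pre G).presheaf m
  exact ⟨U, hx, g, h⟩

/-- The linear map on stalks induced by a morphism. -/
def stalkMap {G H : X.ZeroMod} (f : G ⟶ H) (x : X.carrier) :
    stalk G x →ₗ[X.zeroPresheaf.stalk x] stalk H x where
  toFun := stalkMapAdd f x
  map_add' := map_add _
  map_smul' r m := by
    obtain ⟨U, hx, c, rfl⟩ := X.zeroPresheaf.exists_germ_eq r
    obtain ⟨V, hx', g, rfl⟩ := exists_germ G x m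
    have e : X.zeroPresheaf.germ U x hx c = X.zeroPresheaf.germ (U ⊓ V) x (mem_inf' hx hx')
        (X.resGr (Opens.infLELeft U V) 0 c) :=
      (X.zeroPresheaf.germ_res_apply (Opens.infLELeft U V) x (mem_inf' hx hx') c).symm
    rw [RingHom.id_apply, e, ← germ_res G (Opens.infLERight U V) x (mem_inf' hx hx'), ← germ_act,
      stalkMapAdd_germ, stalkMapAdd_germ, ← germ_act, mapSec_act]

theorem stalkMap_germ {G H : X.ZeroMod} (f : G ⟶ H) {U : Opens X.carrier} (x : X.carrier)
    (hx : x ∈ U) (g : Sec G U) : stalkMap f x (germ G x hx g) = germ H x hx (mapSec f U g) :=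
  stalkMapAdd_germ f x hx g

theorem stalkMap_id (G : X.ZeroMod) (x : X.carrier) : stalkMap (𝟙 G) x = LinearMap.id := by
  refine LinearMap.ext fun m => ?_
  obtain ⟨V, hx, g, rfl⟩ := exists_germ G x m
  rw [stalkMap_germ]
  rfl

theorem stalkMap_comp {G H K : X.ZeroMod} (f : G ⟶ H) (g : H ⟶ K) (x : X.carrier) :
    stalkMap (f ≫ g) x = stalkMap g x ∘ₗ stalkMap f x := by
  refine LinearMap.ext fun m => ?_
  obtain ⟨V, hx, g, rfl⟩ := exists_germ G x m
  rw [LinearMap.comp_apply, stalkMap_germ, stalkMap_germ, stalkMap_germ]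
  rfl

/-- The map `𝒪_{X,x} ⊗ G_x → 𝒪_{X,x} ⊗ H_x` induced by a morphism. -/
def tensorStalkMap {G H : X.ZeroMod} (f : G ⟶ H) (x : X.carrier) :
    TStalk G x →ₗ[X.stalk x] TStalk H x :=
  TensorProduct.AlgebraTensorModule.map LinearMap.id (stalkMap f x)

theorem tensorStalkMap_mem {G H : X.ZeroMod} (f : G ⟶ H) (d : ℤ) {U : Opens X.carrier}
    {s : ∀ x : U, TStalk G x.1} (hs : s ∈ (tensorGroups G d).sections U) :
    (fun x : U => tensorStalkMap f x.1 (s x)) ∈ (tensorGroups H d).sections U := by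
  intro x
  obtain ⟨V, hV, i, h⟩ := hs x
  refine ⟨V, hV, i, ?_⟩
  have key : ∀ t ∈ (tensorGroups G d).fn V,
      (fun x : V => tensorStalkMap f x.1 (t x)) ∈ (tensorGroups H d).fn V := by
    intro t ht
    induction ht using AddSubgroup.closure_induction with
    | mem t ht =>
      obtain ⟨a, ha, g, h'⟩ := ht
      refine AddSubgroup.subset_closure ⟨a, ha, mapSec f V g, fun x => ?_⟩
      dsimp only
      rw [h', ← stalkMap_germ]
      rfl
    | zero =>
      have : (fun x : V => tensorStalkMap f x.1 ((0 : ∀ x : V, TStalk G x.1) x)) = 0 :=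
        funext fun x => map_zero _
      rw [this]
      exact zero_mem _
    | add s t _ _ hs ht =>
      convert! add_mem hs ht using 1
      exact funext fun x => map_add _ _ _
    | neg s _ hs =>
      convert! neg_mem hs using 1
      exact funext fun x => map_neg _ _
  exact key _ h

variable (X) in
/-- The functor `o_X : G ↦ 𝒪_X ⊗_{𝒪_{X₀}} G`. -/
def tensorFunctor : X.ZeroMod ⥤ GMod X where
  obj G := tensor G
  map {G H} f :=
    { app := fun d => ⟨
        { app := fun U => AddCommGrpCat.ofHom (AddMonoidHom.mk'
            (fun s => (⟨fun x => tensorStalkMap f x.1 (s.1 x), tensorStalkMap_mem f d s.2⟩ :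
              (tensorGroups H d).sections U.unop))
            (fun s t => Subtype.ext (funext fun x => map_add (tensorStalkMap f x.1) _ _)))
          naturality := fun _ _ _ => rfl }⟩
      map_smul := fun _ _ a s => Subtype.ext (funext fun x =>
        map_smul (tensorStalkMap f x.1) (X.germ x.1 x.2 a.1) (s.1 x)) }
  map_id G := GMod.hom_ext fun d => by
    refine Sheaf.hom_ext (NatTrans.ext (funext fun U => ?_))
    refine AddCommGrpCat.hom_ext (AddMonoidHom.ext fun s => Subtype.ext (funext fun x => ?_))
    change TensorProduct.AlgebraTensorModule.map LinearMap.id (stalkMap (𝟙 G) x.1) (s.1 x) = s.1 x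
    rw [stalkMap_id, TensorProduct.AlgebraTensorModule.map_id]
    rfl
  map_comp f g := GMod.hom_ext fun d => by
    refine Sheaf.hom_ext (NatTrans.ext (funext fun U => ?_))
    refine AddCommGrpCat.hom_ext (AddMonoidHom.ext fun s => Subtype.ext (funext fun x => ?_))
    change TensorProduct.AlgebraTensorModule.map LinearMap.id (stalkMap (f ≫ g) x.1) (s.1 x) =
      tensorStalkMap g x.1 (tensorStalkMap f x.1 (s.1 x))
    rw [stalkMap_comp]
    induction s.1 x using TensorProduct.induction_on with
    | zero => simp
    | tmul a m => rfl
    | add y z hy hz => rw [map_add, map_add, map_add, hy, hz]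

end Tensor

end ZeroMod

end GradedRingedSpace

namespace GradedRingedSpace

variable {X : GradedRingedSpace.{u}}

namespace ZeroMod

section InternalHom

/-- Families of `(𝒪_{X₀})(V)`-linear maps `(𝒪_X)_{-d}(V) → G(V)`, for `V ⊆ U` open, that are compatible with
restriction: the morphisms of `𝒪_{X₀}|_U`-modules from `(𝒪_X)_{-d}|_U` to `G|_U`. -/
def coindSec (G : X.ZeroMod) (d : ℤ) (U : Opens X.carrier) :
    AddSubgroup (∀ V : {V : Opens X.carrier // V ≤ U}, X.gr V.1 (-d) →+ Sec G V.1) where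
  carrier := {f | (∀ V (c : X.gr V.1 0) (b : X.gr V.1 (-d)),
      f V ⟨c.1 * b.1, by simpa using SetLike.mul_mem_graded c.2 b.2⟩ = act G c (f V b)) ∧
    ∀ (V W : {V : Opens X.carrier // V ≤ U}) (i : W.1 ⟶ V.1) (b : X.gr V.1 (-d)),
      res G i (f V b) = f W (X.resGr i (-d) b)}
  zero_mem' := ⟨fun V c b => (smul_zero (A := Sec G V.1)
    (show X.zeroRing.obj.obj (op V.1) from c)).symm, fun V W i b => map_zero _⟩
  add_mem' := by
    rintro f g ⟨hf, hf'⟩ ⟨hg, hg'⟩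
    refine ⟨fun V c b => ?_, fun V W i b => ?_⟩
    · change f V _ + g V _ = _
      rw [hf, hg]
      exact (smul_add (show X.zeroRing.obj.obj (op V.1) from c) _ _).symm
    · change res G i (f V b + g V b) = f W _ + g W _
      rw [map_add, hf' V W i, hg' V W i]
  neg_mem' := by
    rintro f ⟨hf, hf'⟩
    refine ⟨fun V c b => ?_, fun V W i b => ?_⟩
    · change - f V _ = _
      rw [hf]
      exact (smul_neg (show X.zeroRing.obj.obj (op V.1) from c) _).symm
    · change res G i (- f V b) = - f W _
      rw [map_neg, hf' V W i]

/-- The presheaf of morphisms from `(𝒪_X)_{-d}` to `G`. -/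
def coindPresheaf (G : X.ZeroMod) (d : ℤ) : TopCat.Presheaf AddCommGrpCat.{u} X.carrier where
  obj U := AddCommGrpCat.of (coindSec G d U.unop)
  map {U V} i := AddCommGrpCat.ofHom
    { toFun := fun f => (⟨fun W => f.1 ⟨W.1, W.2.trans i.unop.le⟩,
        fun W c b => f.2.1 ⟨W.1, W.2.trans i.unop.le⟩ c b,
        fun W W' j b => f.2.2 ⟨W.1, W.2.trans i.unop.le⟩ ⟨W'.1, W'.2.trans i.unop.le⟩ j b⟩ :
          coindSec G d V.unop)
      map_zero' := rfl
      map_add' := fun _ _ => rfl }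

theorem coind_glue (G : X.ZeroMod) (d : ℤ) {ι : Type u} (U : ι → Opens X.carrier)
    (sf : ∀ i, coindSec G d (U i))
    (hsf : ∀ i j (V : Opens X.carrier) (hi : V ≤ U i) (hj : V ≤ U j),
      (sf i).1 ⟨V, hi⟩ = (sf j).1 ⟨V, hj⟩) :
    ∃! s : coindSec G d (iSup U), ∀ i (V : Opens X.carrier) (hi : V ≤ U i),
      s.1 ⟨V, hi.trans (le_iSup U i)⟩ = (sf i).1 ⟨V, hi⟩ := by
  have cover : ∀ V : Opens X.carrier, V ≤ iSup U → V ≤ ⨆ i, V ⊓ U i := by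
    intro V hV x hx
    obtain ⟨i, hi⟩ := Opens.mem_iSup.1 (hV hx)
    exact Opens.mem_iSup.2 ⟨i, mem_inf' hx hi⟩
  have hext : ∀ V : Opens X.carrier, V ≤ iSup U → ∀ g g' : Sec G V,
      (∀ i, res G (Opens.infLELeft V (U i)) g = res G (Opens.infLELeft V (U i)) g') → g = g' := by
    intro V hV g g' h
    exact (ab G).eq_of_locally_eq' (fun i => V ⊓ U i) V (fun i => Opens.infLELeft V (U i))
      (cover V hV) g g' h
  have hex : ∀ (V : {V : Opens X.carrier // V ≤ iSup U}) (b : X.gr V.1 (-d)), ∃ g : Sec G V.1, ∀ i,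
      res G (Opens.infLELeft V.1 (U i)) g =
        (sf i).1 ⟨V.1 ⊓ U i, inf_le_right⟩ (X.resGr (Opens.infLELeft V.1 (U i)) (-d) b) := by
    intro V b
    obtain ⟨g, hg, -⟩ := (ab G).existsUnique_gluing' (fun i => V.1 ⊓ U i) V.1
      (fun i => Opens.infLELeft V.1 (U i)) (cover V.1 V.2)
      (fun i => (sf i).1 ⟨V.1 ⊓ U i, inf_le_right⟩ (X.resGr (Opens.infLELeft V.1 (U i)) (-d) b)) (by
        intro i j
        have h1 := (sf i).2.2 ⟨V.1 ⊓ U i, inf_le_right⟩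
          ⟨(V.1 ⊓ U i) ⊓ (V.1 ⊓ U j), inf_le_left.trans inf_le_right⟩
          (Opens.infLELeft _ _) (X.resGr (Opens.infLELeft V.1 (U i)) (-d) b)
        have h2 := (sf j).2.2 ⟨V.1 ⊓ U j, inf_le_right⟩
          ⟨(V.1 ⊓ U i) ⊓ (V.1 ⊓ U j), inf_le_right.trans inf_le_right⟩
          (Opens.infLERight _ _) (X.resGr (Opens.infLELeft V.1 (U j)) (-d) b)
        refine h1.trans (Eq.trans ?_ h2.symm)
        rw [hsf i j _ _ (inf_le_right.trans inf_le_right)]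
        refine congrArg _ (Subtype.ext ?_)
        exact (X.res_res _ _ b.1).trans
          (X.res_res (Opens.infLELeft V.1 (U j)) (Opens.infLERight (V.1 ⊓ U i) (V.1 ⊓ U j)) b.1).symm)
    exact ⟨g, hg⟩
  choose F hF using hex
  have hFadd : ∀ V b b', F V (b + b') = F V b + F V b' := by
    intro V b b'
    refine hext V.1 V.2 _ _ fun i => ?_
    rw [map_add, hF, hF, hF, map_add, map_add]
  let f : ∀ V : {V : Opens X.carrier // V ≤ iSup U}, X.gr V.1 (-d) →+ Sec G V.1 :=
    fun V => AddMonoidHom.mk' (F V) (hFadd V)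
  have hf : ∀ V b i, res G (Opens.infLELeft V.1 (U i)) (f V b) =
    (sf i).1 ⟨V.1 ⊓ U i, inf_le_right⟩ (X.resGr (Opens.infLELeft V.1 (U i)) (-d) b) :=
    fun V b i => hF V b i
  have hmem : f ∈ coindSec G d (iSup U) := by
    refine ⟨fun V c b => hext V.1 V.2 _ _ fun i => ?_, fun V W j b => hext W.1 W.2 _ _ fun i => ?_⟩
    · rw [hf, res_act, hf]
      refine Eq.trans (congrArg _ (Subtype.ext ?_)) ((sf i).2.1 ⟨V.1 ⊓ U i, inf_le_right⟩ _ _)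
      exact map_mul (X.res _) c.1 b.1
    · rw [hf, res_res]
      let k : W.1 ⊓ U i ⟶ V.1 ⊓ U i := homOfLE (inf_le_inf_right _ j.le)
      have e : Opens.infLELeft W.1 (U i) ≫ j = k ≫ Opens.infLELeft V.1 (U i) := Subsingleton.elim _ _
      rw [e, ← res_res, hf, (sf i).2.2 ⟨V.1 ⊓ U i, inf_le_right⟩ ⟨W.1 ⊓ U i, inf_le_right⟩ k]
      refine congrArg _ (Subtype.ext ?_)
      change X.res k (X.res _ b.1) = X.res _ (X.res j b.1)
      rw [X.res_res, X.res_res, e]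
  have hres : ∀ i (V : Opens X.carrier) (hi : V ≤ U i),
      f ⟨V, hi.trans (le_iSup U i)⟩ = (sf i).1 ⟨V, hi⟩ := by
    intro i V hi
    refine AddMonoidHom.ext fun b => hext V (hi.trans (le_iSup U i)) _ _ fun j => ?_
    refine (hf ⟨V, hi.trans (le_iSup U i)⟩ b j).trans ?_
    refine Eq.trans ?_ ((sf i).2.2 ⟨V, hi⟩ ⟨V ⊓ U j, inf_le_left.trans hi⟩ (Opens.infLELeft V (U j)) b).symm
    rw [hsf i j _ (inf_le_left.trans hi) inf_le_right]
  refine ⟨⟨f, hmem⟩, hres, ?_⟩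
  intro t ht
  refine Subtype.ext (funext fun V => AddMonoidHom.ext fun b => hext V.1 V.2 _ _ fun i => ?_)
  rw [hf, t.2.2 V ⟨V.1 ⊓ U i, inf_le_left.trans V.2⟩ (Opens.infLELeft V.1 (U i)), ht i _ inf_le_right]

theorem coindPresheaf_isSheaf (G : X.ZeroMod) (d : ℤ) : (coindPresheaf G d).IsSheaf := by
  rw [TopCat.Presheaf.isSheaf_iff_isSheaf_comp (CategoryTheory.forget AddCommGrpCat)]
  apply TopCat.Presheaf.isSheaf_of_isSheafUniqueGluing_types
  intro ι U sf hsf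
  have h1 : ∀ i j (V : Opens X.carrier) (hi : V ≤ U i) (hj : V ≤ U j),
      (show coindSec G d (U i) from sf i).1 ⟨V, hi⟩ =
        (show coindSec G d (U j) from sf j).1 ⟨V, hj⟩ := by
    intro i j V hi hj
    exact congrFun (congrArg Subtype.val (hsf i j)) ⟨V, le_inf hi hj⟩
  obtain ⟨s, hs, hu⟩ := coind_glue G d U (fun i => sf i) h1
  refine ⟨s, fun i => Subtype.ext (funext fun V => hs i V.1 V.2), fun t ht => hu t fun i V hi => ?_⟩
  exact congrFun (congrArg Subtype.val (ht i)) ⟨V, hi⟩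

/-- Multiplication by a homogeneous section of `𝒪_X`. -/
def mulGr {U : Opens X.carrier} {i j k : ℤ} (h : i + j = k) (a : X.gr U i) : X.gr U j →+ X.gr U k where
  toFun b := ⟨a.1 * b.1, h ▸ SetLike.mul_mem_graded a.2 b.2⟩
  map_zero' := Subtype.ext (mul_zero _)
  map_add' _ _ := Subtype.ext (mul_add _ _ _)

/-- The action `(a f)(b) = f(ab)`. -/
def coindSmul (G : X.ZeroMod) {i j k : ℤ} (h : i + j = k) (U : Opens X.carrier) (a : X.gr U i)
    (f : coindSec G j U) : coindSec G k U :=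
  ⟨fun V => (f.1 V).comp (mulGr (show i + -k = -j by omega) (X.resGr (homOfLE V.2) i a)), by
    refine ⟨fun V c b => ?_, fun V W l b => ?_⟩
    · refine Eq.trans (congrArg (f.1 V) (Subtype.ext ?_)) (f.2.1 V c _)
      exact mul_left_comm _ _ _
    · refine (f.2.2 V W l _).trans (congrArg (f.1 W) (Subtype.ext ?_))
      change X.res l (X.res _ a.1 * b.1) = X.res _ a.1 * X.res l b.1
      rw [map_mul, X.res_res]
      rfl⟩

/-- The sheaf of graded modules with homogeneous parts `ℋom((𝒪_X)_{-d}, G)`. -/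
def coind (G : X.ZeroMod) : GMod X where
  sec d := ⟨coindPresheaf G d, coindPresheaf_isSheaf G d⟩
  smul {i j k} h U := AddMonoidHom.mk'
    (fun a => AddMonoidHom.mk' (fun f => coindSmul G h U a f) (fun f g => rfl))
    (fun a a' => AddMonoidHom.ext fun f => Subtype.ext (funext fun V => AddMonoidHom.ext fun b => by
      refine Eq.trans (congrArg ((show coindSec G j U from f).1 V) (Subtype.ext ?_))
        (map_add ((show coindSec G j U from f).1 V) _ _)
      change X.res _ (a.1 + a'.1) * b.1 = X.res _ a.1 * b.1 + X.res _ a'.1 * b.1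
      rw [map_add, add_mul]))
  one_smul {j} U f := Subtype.ext (funext fun V => AddMonoidHom.ext fun b => by
    refine congrArg ((show coindSec G j U from f).1 V) (Subtype.ext ?_)
    change X.res _ 1 * b.1 = b.1
    rw [map_one, one_mul])
  mul_smul {i j k l m} h h' U a b f := Subtype.ext (funext fun V => AddMonoidHom.ext fun c => by
    refine congrArg ((show coindSec G k U from f).1 V) (Subtype.ext ?_)
    change X.res _ (a.1 * b.1) * c.1 = X.res _ b.1 * (X.res _ a.1 * c.1)
    rw [map_mul]
    ring)
  smul_res {i j k} h U V l a f := Subtype.ext (funext fun W => AddMonoidHom.ext fun b => by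
    refine congrArg ((show coindSec G j U from f).1 ⟨W.1, W.2.trans l.le⟩) (Subtype.ext ?_)
    change X.res _ a.1 * b.1 = X.res _ (X.res l a.1) * b.1
    rw [X.res_res]
    rfl)

variable (X) in
/-- The functor `h_X : G ↦ ℋom_{X₀}(𝒪_X, G)`. -/
def coindFunctor : X.ZeroMod ⥤ GMod X where
  obj G := coind G
  map {G H} f :=
    { app := fun d => ⟨
        { app := fun U => AddCommGrpCat.ofHom (AddMonoidHom.mk'
            (fun s => (⟨fun V => (mapSec f V.1).comp (s.1 V),
              fun V c b => by
                change mapSec f V.1 (s.1 V _) = act H c (mapSec f V.1 (s.1 V b))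
                rw [s.2.1, mapSec_act],
              fun V W i b => by
                change res H i (mapSec f V.1 (s.1 V b)) = mapSec f W.1 (s.1 W _)
                rw [← mapSec_res, s.2.2 V W i]⟩ : coindSec H d U.unop))
            (fun s t => Subtype.ext (funext fun V => AddMonoidHom.ext fun b =>
              map_add (mapSec f V.1) _ _)))
          naturality := fun _ _ _ => rfl }⟩
      map_smul := fun _ _ a s => rfl }
  map_id G := rfl
  map_comp f g := rfl

end InternalHom

end ZeroMod

end GradedRingedSpace

section Proj

/-- The open graded subspace of `X` on the open subset `U`. -/
def GradedRingedSpace.restrict (X : GradedRingedSpace.{u}) (U : Opens X.carrier) :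
    GradedRingedSpace.{u} where
  carrier := TopCat.of U
  sheaf := ⟨U.isOpenEmbedding.isOpenMap.functor.op ⋙ X.sheaf.presheaf,
    TopCat.Presheaf.isSheaf_of_isOpenEmbedding U.isOpenEmbedding X.sheaf.property⟩
  gr V := X.gr (U.isOpenEmbedding.isOpenMap.functor.obj V)
  gradedRing V := X.gradedRing (U.isOpenEmbedding.isOpenMap.functor.obj V)
  map_mem i _ _ ha := X.map_mem (U.isOpenEmbedding.isOpenMap.functor.map i) ha

section

variable {A : Type u} [CommRing A] (𝒜 : ℤ → AddSubgroup A) [GradedRing 𝒜]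

/-- The complement of `V(A₊)`: the homogeneous primes that do not contain all homogeneous elements of
positive degree. -/
def projOpen : Opens (gspecTop 𝒜) where
  carrier := {p | ¬ ∀ d : ℤ, 0 < d → ∀ a ∈ 𝒜 d, a ∈ GSpec.ideal p}
  is_open' := by
    have : {p : GSpec 𝒜 | ¬ ∀ d : ℤ, 0 < d → ∀ a ∈ 𝒜 d, a ∈ p.ideal} =
        ⋃ (d : ℤ) (_ : 0 < d) (a : A) (_ : a ∈ 𝒜 d),
          GSpec.toPrime ⁻¹' (PrimeSpectrum.basicOpen a : Set (PrimeSpectrum A)) := by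
      ext p
      simp only [Set.mem_iUnion, not_forall, exists_prop]
      rfl
    change IsOpen {p : GSpec 𝒜 | _}
    rw [this]
    exact isOpen_iUnion fun d => isOpen_iUnion fun _ => isOpen_iUnion fun a => isOpen_iUnion fun _ =>
      ⟨_, (PrimeSpectrum.basicOpen a).isOpen, rfl⟩

/-- `gproj` of a noetherian (positively) graded ring: the open graded subscheme
`gspec 𝒜 ∖ V(A₊)` of `gspec 𝒜`. -/
def gproj [IsNoetherianRing A] : GradedRingedSpace.{u} := (gspec 𝒜).restrict (projOpen 𝒜)

end

variable (A : Type u) [CommRing A] {n : ℕ} (w : Fin (n + 1) → ℕ)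

/-- The grading of `A[x_0, …, x_n]` with `deg x_i = w_i`. -/
def weightedGr (d : ℤ) : AddSubgroup (MvPolynomial (Fin (n + 1)) A) :=
  (MvPolynomial.weightedHomogeneousSubmodule A (fun i => (w i : ℤ)) d).toAddSubgroup

instance : GradedRing (weightedGr A w) :=
  letI := MvPolynomial.weightedGradedAlgebra A (fun i => (w i : ℤ))
  { one_mem := SetLike.one_mem_graded (MvPolynomial.weightedHomogeneousSubmodule A (fun i => (w i : ℤ)))
    mul_mem := fun {_ _ _ _} ha hb => SetLike.mul_mem_graded
      (A := MvPolynomial.weightedHomogeneousSubmodule A (fun i => (w i : ℤ))) ha hb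
    decompose' := DirectSum.Decomposition.decompose'
      (ℳ := MvPolynomial.weightedHomogeneousSubmodule A (fun i => (w i : ℤ)))
    left_inv := DirectSum.Decomposition.left_inv
      (ℳ := MvPolynomial.weightedHomogeneousSubmodule A (fun i => (w i : ℤ)))
    right_inv := DirectSum.Decomposition.right_inv
      (ℳ := MvPolynomial.weightedHomogeneousSubmodule A (fun i => (w i : ℤ))) }

/-- The graded weighted projective space over `A` with weights `w_0, …, w_n`. -/
def wproj [IsNoetherianRing A] : GradedRingedSpace.{u} := gproj (weightedGr A w)

variable {A w} in
/-- The homogeneous prime ideal of a point of weighted projective space. -/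
def wprojIdeal [IsNoetherianRing A] (p : (wproj A w).carrier) :
    Ideal (MvPolynomial (Fin (n + 1)) A) :=
  (show GSpec (weightedGr A w) from (show projOpen (weightedGr A w) from p).1).ideal.toIdeal

open Classical in
variable {A w} in
/-- The greatest common divisor of the weights `w_i` with `x_i ∉ 𝔭`. -/
def weightGcd [IsNoetherianRing A] (p : (wproj A w).carrier) : ℕ :=
  (Finset.univ.filter fun i => MvPolynomial.X i ∉ wprojIdeal p).gcd w

end Proj

section Functors

variable {C D : Type*} [Category C] [Category D]

/-- Exactness of an (additive) functor between abelian categories: it preserves finite limits and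
finite colimits. -/
def IsExact (F : C ⥤ D) : Prop :=
  Limits.PreservesFiniteLimits F ∧ Limits.PreservesFiniteColimits F

/-- `G` is a quasi-inverse of `F`. -/
def IsQuasiInverse (F : C ⥤ D) (G : D ⥤ C) : Prop :=
  Nonempty (F ⋙ G ≅ 𝟭 C) ∧ Nonempty (G ⋙ F ≅ 𝟭 D)

/-- `F` maps the full subcategory `P` to the full subcategory `Q`, and the restricted functor
is an equivalence. -/
def RestrictsToEquivalence (F : C ⥤ D) (P : ObjectProperty C) (Q : ObjectProperty D) : Prop :=
  ∃ h : ∀ X, P X → Q (F.obj X),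
    (Q.lift (P.ι ⋙ F) (fun X => h X.obj X.property)).IsEquivalence

end Functors

section Properties

/-- The finitely generated modules over a ring. -/
def fgModules (R : Type u) [CommRing R] : ObjectProperty (ModuleCat.{u} R) := fun N =>
  Module.Finite R N

namespace GradedRingedSpace

variable (X : GradedRingedSpace.{u})

/-- The quasi-coherent sheaves of `𝒪_{X₀}`-modules. -/
def ZeroMod.isQCoh : ObjectProperty X.ZeroMod := fun G => G.IsQuasicoherent

/-- The coherent sheaves of `𝒪_{X₀}`-modules. (`X₀` is a noetherian scheme if `X` is a good graded
scheme, so that these are the sheaves of modules of finite presentation.) -/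
def ZeroMod.isCoh : ObjectProperty X.ZeroMod := fun G => G.IsFinitePresentation

end GradedRingedSpace

end Properties

end GrSch

end

open GrSch

/-! Modules. The condition that links both sides is that `A` is strongly graded: `1` is a sum of
products `a_i b_i` with `a_i ∈ A_d`, `b_i ∈ A_{-d}`, for every `d`. If this holds, some `a_i` of
degree `1` avoids a given prime `𝔭` and is a unit of `A_𝔭`. If it fails for `d = 1`, the ideal `A
A_1` is proper; for a maximal ideal `𝔪` of `A_0` containing its degree zero part, the largest
homogeneous ideal with degree zero part inside `𝔪` is a prime at which `A` is not standard
(`isStronglyGraded_of_isStandardRing_loc`). Over a strongly graded ring the map `M_d → Hom(A_{-d},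
M_0)`, `m ↦ (b ↦ b m)`, has inverse `f ↦ ∑ a_i f(b_i)` (`GrMod.isIso_toCoind`). Since `h_A(N)_0 ≅ N`
and `(A ⊗ N)_0 ≅ N` hold over any graded ring, `h_A` is a quasi-inverse of `u_A`, and `o_A ≅ h_A`
follows formally. Conversely the graded module `A(d) / A A_d` has zero degree zero part, so a
faithful `u_A` forces it to vanish (`GrMod.isStronglyGraded_of_faithful`).

Sheaves. On a standard `X` every point has a neighbourhood with mutually inverse sections of degrees
`d` and `-d`, and the same two formulas work locally, each with a single summand. For the converse,
`A(d) / A A_d` over the stalk is placed in a skyscraper sheaf, and a graded local ring with `1 ∈ A_1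
A_{-1}` has a unit of degree `1` (`isStandardRing_of_isLocalGraded`). Quasi-coherence and coherence
on `X_0` are both translated into local generators and relations for `F_0`, in the elementary form
`ZeroMod.IsPresentedBy`. A homogeneous presentation of `M` becomes such a presentation of `(M~)_0`
after multiplication by local units of the right degrees (`tilde_isPresentedBy`). In the other
direction the open set is shrunk to some `gspec A`; its sections of degree zero are the elements of
`A_0` (`exists_eq_toSections`), so the relations define an `A_0`-module `N`. The sheaves `F_0` and
`((A ⊗ N)~)_0` have the same presentation, hence are isomorphic
(`ZeroMod.IsPresentedBy.nonempty_iso`), and the equivalence lifts this to `F ≅ (A ⊗ N)~`.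

Weighted projective spaces. A polynomial outside `𝔭` has a monomial outside `𝔭`, all of whose
variables are outside `𝔭`. So the degrees of homogeneous units of `A_𝔭` are exactly the multiples of
the greatest common divisor of the `w_i` with `x_i ∉ 𝔭` (`isStandardRing_weighted_iff`). The primes
above `(x_j : j ≠ i)` that miss `x_i` detect each single weight. -/

noncomputable section

namespace GrSch

/-! ### Strongly graded rings and standard localizations. -/

section StronglyGraded

variable {A : Type u} [CommRing A] (𝒜 : ℤ → AddSubgroup A)

/-- The sums of products `a * b` with `a` of degree `d` and `b` of degree `-d`. -/
def pairing (d : ℤ) : AddSubgroup A :=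
  AddSubgroup.closure {x | ∃ a ∈ 𝒜 d, ∃ b ∈ 𝒜 (-d), x = a * b}

/-- `A_d A_{-d} = A_0` for all `d`. -/
def IsStronglyGraded : Prop := ∀ d, (1 : A) ∈ pairing 𝒜 d

variable {𝒜}

theorem mul_mem_pairing {d : ℤ} {a b : A} (ha : a ∈ 𝒜 d) (hb : b ∈ 𝒜 (-d)) :
    a * b ∈ pairing 𝒜 d := AddSubgroup.subset_closure ⟨a, ha, b, hb, rfl⟩

theorem pairing_neg_le (d : ℤ) : pairing 𝒜 d ≤ pairing 𝒜 (-d) := by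
  refine (AddSubgroup.closure_le _).2 ?_
  rintro _ ⟨a, ha, b, hb, rfl⟩
  rw [mul_comm]
  exact mul_mem_pairing hb (by rwa [neg_neg])

variable [GradedRing 𝒜]

theorem mul_mem_pairing_add {d e : ℤ} {x y : A} (hx : x ∈ pairing 𝒜 d) (hy : y ∈ pairing 𝒜 e) :
    x * y ∈ pairing 𝒜 (d + e) := by
  induction hx using AddSubgroup.closure_induction with
  | mem x hx =>
    obtain ⟨a, ha, b, hb, rfl⟩ := hx
    induction hy using AddSubgroup.closure_induction with
    | mem y hy =>
      obtain ⟨a', ha', b', hb', rfl⟩ := hy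
      rw [mul_mul_mul_comm]
      refine mul_mem_pairing (SetLike.mul_mem_graded ha ha') ?_
      rw [neg_add]
      exact SetLike.mul_mem_graded hb hb'
    | zero => rw [mul_zero]; exact zero_mem _
    | add y z _ _ hy hz => rw [mul_add]; exact add_mem hy hz
    | neg y _ hy => rw [mul_neg]; exact neg_mem hy
  | zero => rw [zero_mul]; exact zero_mem _
  | add y z _ _ hy hz => rw [add_mul]; exact add_mem hy hz
  | neg y _ hy => rw [neg_mul]; exact neg_mem hy

/-- Powers of a relation `1 = ∑ a_i b_i` in degree `1` give one in every degree `n ≥ 0`, and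
exchanging the two factors gives degree `-n`. -/
theorem isStronglyGraded_of_one (h : (1 : A) ∈ pairing 𝒜 1) : IsStronglyGraded 𝒜 := by
  have key : ∀ n : ℕ, (1 : A) ∈ pairing 𝒜 n := by
    intro n
    induction n with
    | zero =>
      have := mul_mem_pairing (𝒜 := 𝒜) (d := 0) (SetLike.one_mem_graded 𝒜)
        (by rw [neg_zero]; exact SetLike.one_mem_graded 𝒜)
      rwa [one_mul] at this
    | succ n ih =>
      have := mul_mem_pairing_add ih h
      rw [one_mul] at this
      exact_mod_cast this
  intro d
  obtain ⟨n, rfl | rfl⟩ := d.eq_nat_or_neg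
  · exact key n
  · exact pairing_neg_le _ (key n)

/-- The homogeneous components of the elements of the ideal generated by `A_d`. -/
theorem decompose_mem_pairing {d : ℤ} {x : A} (hx : x ∈ Ideal.span (𝒜 d : Set A)) :
    ((DirectSum.decompose 𝒜 x 0 : 𝒜 0) : A) ∈ pairing 𝒜 d := by
  induction hx using Submodule.span_induction with
  | mem x hx =>
    by_cases h : d = 0
    · subst h
      rw [DirectSum.decompose_of_mem_same 𝒜 hx, ← mul_one x]
      exact mul_mem_pairing hx (by rw [neg_zero]; exact SetLike.one_mem_graded 𝒜)
    · rw [DirectSum.decompose_of_mem_ne 𝒜 hx h]; exact zero_mem _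
  | zero => simp
  | add x y _ _ hx hy => simpa using add_mem hx hy
  | smul a x hx h =>
    rw [smul_eq_mul]
    -- The induction hypothesis concerns the degree zero part of `x` and says nothing about that of
    -- `a * x`. A second induction on `x`, with `a` arbitrary, replaces it.
    clear h
    induction hx using Submodule.span_induction generalizing a with
    | mem x hx =>
      have h1 : ((DirectSum.decompose 𝒜 (a * x) 0 : 𝒜 0) : A) =
          (DirectSum.decompose 𝒜 a (-d) : 𝒜 (-d)) * x := by
        have := DirectSum.coe_decompose_mul_add_of_right_mem 𝒜 (i := -d) (j := d) (a := a) hx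
        rwa [neg_add_cancel] at this
      rw [h1, mul_comm]
      exact mul_mem_pairing hx (SetLike.coe_mem _)
    | zero => simp
    | add x y _ _ hx hy => rw [mul_add]; simpa using add_mem (hx a) (hy a)
    | smul b x _ hx => rw [smul_eq_mul, ← mul_assoc]; exact hx (a * b)

/-- As `1` is homogeneous of degree zero, in `1 = ∑ c_i a_i` with `a_i` of degree `d` each `c_i` may
be replaced by its component of degree `-d`. -/
theorem one_mem_pairing {d : ℤ} (h : (1 : A) ∈ Ideal.span (𝒜 d : Set A)) :
    (1 : A) ∈ pairing 𝒜 d := by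
  have := decompose_mem_pairing h
  rwa [DirectSum.decompose_of_mem_same 𝒜 (SetLike.one_mem_graded 𝒜)] at this

theorem GSpec.isUnit_mk {p : GSpec 𝒜} {a : A} (ha : SetLike.IsHomogeneousElem 𝒜 a)
    (hp : a ∉ p.ideal) : IsUnit (algebraMap A p.Loc a) :=
  IsLocalization.map_units p.Loc (⟨a, ha, hp⟩ : p.homCompl)

/-- If all of `A_1` were contained in `p`, then so would be all products `a * b` in `pairing 𝒜 1`,
and with them `1`. An element of degree `1` outside `p` becomes a unit. -/
theorem IsStronglyGraded.isStandardRing_loc (h : IsStronglyGraded 𝒜) (p : GSpec 𝒜) :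
    IsStandardRing p.locGr := by
  have key : ∃ a ∈ 𝒜 1, a ∉ p.ideal := by
    by_contra! hc
    refine p.one_not_mem ?_
    have : pairing 𝒜 1 ≤ p.ideal.toIdeal.toAddSubgroup := by
      refine (AddSubgroup.closure_le _).2 ?_
      rintro _ ⟨a, ha, b, hb, rfl⟩
      exact p.ideal.toIdeal.mul_mem_right _ (hc a ha)
    exact this (h 1)
  obtain ⟨a, ha, hp⟩ := key
  refine ⟨algebraMap A p.Loc a, ?_, GSpec.isUnit_mk ⟨1, ha⟩ hp⟩
  have := p.mk_mem_locGr (d := 1) (e := 0) (m := a) (by simpa using ha) 1 (SetLike.one_mem_graded 𝒜)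
  rwa [Localization.mk_one_eq_algebraMap] at this

/-- The numerator of a unit of `A_𝔭` lies outside `𝔭`. -/
theorem GSpec.num_not_mem {p : GSpec 𝒜} {m : A} {a : p.homCompl}
    (h : IsUnit (Localization.mk m a : p.Loc)) : m ∉ p.ideal := by
  intro hm
  obtain ⟨y, hy⟩ := h.exists_right_inv
  induction y using Localization.induction_on with
  | H y =>
    obtain ⟨n, b⟩ := y
    rw [Localization.mk_mul, ← Localization.mk_one, Localization.mk_eq_mk_iff,
      Localization.r_iff_exists] at hy
    obtain ⟨c, hc⟩ := hy
    have h1 : (c : A) * ((a * b : p.homCompl) : A) ∉ p.ideal :=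
      p.mul_not_mem c.2.2 (a * b).2.2
    refine h1 ?_
    have h2 : (c : A) * (m * n) ∈ p.ideal.toIdeal :=
      p.ideal.toIdeal.mul_mem_left _ (p.ideal.toIdeal.mul_mem_right _ hm)
    simp only [OneMemClass.coe_one, one_mul, mul_one] at hc
    rw [hc] at h2
    exact h2

/-- The largest homogeneous ideal whose degree zero part is contained in a given ideal. -/
def largestIdeal (m : Ideal (𝒜 0)) : Ideal A where
  carrier := {a | ∀ c : A, DirectSum.decompose 𝒜 (c * a) 0 ∈ m}
  zero_mem' c := by simp
  add_mem' ha hb c := by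
    rw [mul_add, DirectSum.decompose_add]
    exact add_mem (ha c) (hb c)
  smul_mem' b a ha c := by
    rw [smul_eq_mul, ← mul_assoc]
    exact ha _

theorem decompose_mul_zero {d : ℤ} (c : A) {a : A} (ha : a ∈ 𝒜 d) :
    ((DirectSum.decompose 𝒜 (c * a) 0 : 𝒜 0) : A) =
      (DirectSum.decompose 𝒜 c (-d) : 𝒜 (-d)) * a := by
  have := DirectSum.coe_decompose_mul_add_of_right_mem 𝒜 (i := -d) (j := d) (a := c) ha
  rwa [neg_add_cancel] at this

/-- The degree zero part of `c * a_d` equals that of `c_{-d} * a`. Testing the component `a_d`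
against `c` therefore amounts to testing `a` against `c_{-d}`. -/
theorem largestIdeal_isHomogeneous (m : Ideal (𝒜 0)) : (largestIdeal m).IsHomogeneous 𝒜 := by
  intro d a ha c
  have h1 := ha (DirectSum.decompose 𝒜 c (-d) : 𝒜 (-d))
  have h2 : DirectSum.decompose 𝒜 (c * (DirectSum.decompose 𝒜 a d : 𝒜 d)) 0 =
      DirectSum.decompose 𝒜 (((DirectSum.decompose 𝒜 c (-d) : 𝒜 (-d)) : A) * a) 0 := by
    refine Subtype.ext ?_
    rw [decompose_mul_zero c (SetLike.coe_mem _)]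
    have := DirectSum.coe_decompose_mul_add_of_left_mem 𝒜 (i := -d) (j := d) (b := a)
      (SetLike.coe_mem (DirectSum.decompose 𝒜 c (-d)))
    rw [neg_add_cancel] at this
    exact this.symm
  rw [h2]
  exact h1

/-- A homogeneous element outside the ideal can be moved into degree zero while staying outside `m`.
This reduces primality and maximality to the corresponding property of `m`. -/
theorem not_mem_largestIdeal {m : Ideal (𝒜 0)} {d : ℤ} {a : A} (ha : a ∈ 𝒜 d)
    (h : a ∉ largestIdeal m) : ∃ c ∈ 𝒜 (-d), ∃ z : 𝒜 0, (z : A) = c * a ∧ z ∉ m := by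
  have h' : ¬ ∀ c : A, DirectSum.decompose 𝒜 (c * a) 0 ∈ m := h
  push Not at h'
  obtain ⟨c, hc⟩ := h'
  exact ⟨_, SetLike.coe_mem (DirectSum.decompose 𝒜 c (-d)), _, decompose_mul_zero c ha, hc⟩

theorem mem_largestIdeal_zero {m : Ideal (𝒜 0)} {z : 𝒜 0} (h : (z : A) ∈ largestIdeal m) : z ∈ m := by
  have := h 1
  rw [one_mul] at this
  convert this using 1
  exact Subtype.ext (DirectSum.decompose_of_mem_same 𝒜 z.2).symm

/-- The homogeneous prime ideal above a prime ideal of `A_0`, the largest one. -/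
def GSpec.ofMax (m : Ideal (𝒜 0)) [hm : m.IsPrime] : GSpec 𝒜 where
  ideal := ⟨largestIdeal m, largestIdeal_isHomogeneous m⟩
  isPrime := by
    refine Ideal.IsHomogeneous.isPrime_of_homogeneous_mem_or_mem (largestIdeal_isHomogeneous m) ?_ ?_
    · intro h
      refine hm.ne_top ((Ideal.eq_top_iff_one _).2 (mem_largestIdeal_zero ?_))
      exact (Ideal.eq_top_iff_one _).1 h
    · rintro x y ⟨d, hx⟩ ⟨e, hy⟩ hxy
      by_contra! hc
      obtain ⟨c, hc1, z, hz, hzm⟩ := not_mem_largestIdeal hx hc.1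
      obtain ⟨c', hc1', z', hz', hzm'⟩ := not_mem_largestIdeal hy hc.2
      refine (hm.mem_or_mem (x := z) (y := z') (mem_largestIdeal_zero ?_)).elim hzm hzm'
      change (z : A) * z' ∈ _
      rw [hz, hz', show c * x * (c' * y) = (c * c') * (x * y) by ring]
      exact Ideal.mul_mem_left _ _ hxy

/-- Suppose `A A_1` is proper and let `m` be maximal in `A_0` over its degree zero part. A unit `n /
a` of degree `1` at the prime over `m` has `n` and `a` outside that prime, so there are `c n` and
`c' a` in `A_0` outside `m`. Their product is a multiple of `c' n`, which has degree `1`, and so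
lies in `A A_1` and in `m`: a contradiction. -/
theorem isStronglyGraded_of_isStandardRing_loc (h : ∀ p : GSpec 𝒜, IsStandardRing p.locGr) :
    IsStronglyGraded 𝒜 := by
  refine isStronglyGraded_of_one (one_mem_pairing ?_)
  by_contra hc
  have hne : (Ideal.span (𝒜 1 : Set A)).comap (algebraMap (𝒜 0) A) ≠ ⊤ := by
    intro h
    rw [Ideal.eq_top_iff_one, Ideal.mem_comap, map_one] at h
    exact hc h
  obtain ⟨m, hm, hle⟩ := Ideal.exists_le_maximal _ hne
  have := hm.isPrime
  let p : GSpec 𝒜 := GSpec.ofMax m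
  obtain ⟨_, ⟨e, n, a, hn, ha, rfl⟩, hu⟩ := h p
  have hnp := GSpec.num_not_mem hu
  obtain ⟨c, hc, z, hz, hzm⟩ := not_mem_largestIdeal hn (m := m) hnp
  obtain ⟨c', hc', z', hz', hzm'⟩ := not_mem_largestIdeal ha (m := m) a.2.2
  refine (hm.isPrime.mem_or_mem (x := z) (y := z') (hle ?_)).elim hzm hzm'
  rw [Ideal.mem_comap]
  change (z : A) * z' ∈ _
  rw [hz, hz', show c * n * (c' * a) = (c * a) * (c' * n) by ring]
  refine Ideal.mul_mem_left _ _ (Ideal.subset_span ?_)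
  have := SetLike.mul_mem_graded hc' hn
  rwa [show -e + (1 + e) = 1 by ring] at this

end StronglyGraded

/-! ### Graded modules: the functors `M ↦ M_0`, `A ⊗ N` and `Hom(A, N)`. -/

namespace GrMod

variable {A : Type u} [CommRing A] {𝒜 : ℤ → AddSubgroup A} [GradedRing 𝒜]

section Iso

variable {M N : GrMod 𝒜}

instance decomposition (M : GrMod 𝒜) : DirectSum.Decomposition M.gr :=
  M.isInternal.chooseDecomposition

omit [GradedRing 𝒜] in
theorem decompose_map (f : M ⟶ N) (m : M.carrier) (d : ℤ) :
    ((DirectSum.decompose N.gr (Hom.toLin f m) d : N.gr d) : N.carrier) =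
      Hom.toLin f (DirectSum.decompose M.gr m d : M.gr d) := by
  induction m using DirectSum.Decomposition.inductionOn M.gr with
  | zero => simp
  | @homogeneous e m =>
    by_cases h : e = d
    · subst h
      rw [DirectSum.decompose_of_mem_same _ (f.map_mem m.2),
        DirectSum.decompose_of_mem_same _ m.2]
    · rw [DirectSum.decompose_of_mem_ne _ (f.map_mem m.2) h,
        DirectSum.decompose_of_mem_ne _ m.2 h, map_zero]
  | add m m' h h' =>
    simp only [map_add, DirectSum.decompose_add, DirectSum.add_apply, AddSubgroup.coe_add, h, h']

-- A graded map commutes with taking components, so bijectivity may be tested degree by degree.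
-- Preimages of the same degree make the inverse map graded.
omit [GradedRing 𝒜] in
theorem isIso_of_bijective (f : M ⟶ N) (hi : ∀ d, ∀ m ∈ M.gr d, Hom.toLin f m = 0 → m = 0)
    (hs : ∀ d, ∀ n ∈ N.gr d, ∃ m ∈ M.gr d, Hom.toLin f m = n) : IsIso f := by
  have hinj : Function.Injective (Hom.toLin f) := by
    rw [injective_iff_map_eq_zero]
    intro m hm
    classical
    rw [← DirectSum.sum_support_decompose M.gr m]
    refine Finset.sum_eq_zero fun d _ => hi d _ (SetLike.coe_mem _) ?_
    rw [← decompose_map, hm]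
    simp
  have hsurj : Function.Surjective (Hom.toLin f) := by
    intro n
    classical
    rw [← DirectSum.sum_support_decompose N.gr n]
    refine (LinearMap.range (Hom.toLin f)).sum_mem fun d _ => ?_
    obtain ⟨m, -, hm⟩ := hs d _ (SetLike.coe_mem (DirectSum.decompose N.gr n d))
    exact ⟨m, hm⟩
  let e := LinearEquiv.ofBijective (Hom.toLin f) ⟨hinj, hsurj⟩
  refine ⟨⟨e.symm.toLinearMap, ?_⟩, Hom.ext ?_, Hom.ext ?_⟩
  · intro d n hn
    obtain ⟨m, hm, rfl⟩ := hs d n hn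
    have : e.symm (Hom.toLin f m) = m := e.symm_apply_apply m
    exact this.symm ▸ hm
  · exact LinearMap.ext fun m => e.symm_apply_apply m
  · exact LinearMap.ext fun m => e.apply_symm_apply m

end Iso

variable (𝒜) in
/-- The isomorphism `(A ⊗ N)_0 ≅ N`. -/
def tensorZeroIso : tensorFunctor 𝒜 ⋙ zeroFunctor 𝒜 ≅ 𝟭 (ModuleCat.{u} (𝒜 0)) :=
  Iso.symm <| NatIso.ofComponents (fun N => LinearEquiv.toModuleIso <| LinearEquiv.ofBijective
    (show N →ₗ[𝒜 0] ((tensorFunctor 𝒜).obj N).gr 0 from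
    { toFun := fun n : N => (⟨1 ⊗ₜ n, tmul_mem_tensorGr (SetLike.one_mem_graded 𝒜) n⟩ : tensorGr 𝒜 N 0)
      map_add' := fun m n => Subtype.ext (TensorProduct.tmul_add _ _ _)
      map_smul' := fun c n => Subtype.ext (by
        rw [RingHom.id_apply]
        change (1 : A) ⊗ₜ[𝒜 0] (c • n) = (c : A) • ((1 : A) ⊗ₜ[𝒜 0] n)
        rw [TensorProduct.smul_tmul', ← TensorProduct.smul_tmul]
        rfl) }) (by
    constructor
    · let r : A ⊗[𝒜 0] N →ₗ[𝒜 0] N := TensorProduct.lift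
        { toFun := fun a => LinearMap.lsmul (𝒜 0) N (DirectSum.decompose 𝒜 a 0)
          map_add' := fun a b => by simp
          map_smul' := fun c a => by
            have : DirectSum.decompose 𝒜 (c • a) 0 = c * DirectSum.decompose 𝒜 a 0 :=
              Subtype.ext ((proj 𝒜 0).map_smul c a)
            rw [this, ← smul_eq_mul, map_smul]
            rfl }
      refine Function.LeftInverse.injective (g := fun x => r x.1) fun n => ?_
      change DirectSum.decompose 𝒜 (1 : A) 0 • n = n
      rw [DirectSum.decompose_one, DirectSum.one_def, DirectSum.of_eq_same]
      exact one_smul _ n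
    · rintro ⟨x, hx⟩
      have : ∃ n : N, (1 : A) ⊗ₜ[𝒜 0] n = x := by
        refine tensorGr_induction (p := fun x => ∃ n : N, (1 : A) ⊗ₜ[𝒜 0] n = x) ?_ ?_ ?_ hx
        · exact ⟨0, TensorProduct.tmul_zero _ _⟩
        · intro a ha n
          refine ⟨(⟨a, ha⟩ : 𝒜 0) • n, ?_⟩
          rw [← TensorProduct.smul_tmul]
          exact congrArg (· ⊗ₜ n) (mul_one a)
        · rintro _ _ ⟨m, rfl⟩ ⟨n, rfl⟩
          exact ⟨m + n, TensorProduct.tmul_add _ _ _⟩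
      obtain ⟨n, hn⟩ := this
      exact ⟨n, Subtype.ext hn⟩)) (by
    intro N N' f
    rfl)

/-- The linear map `a ↦ a_0 n`. -/
def coindOf {N : Type u} [AddCommGroup N] [Module (𝒜 0) N] (n : N) : A →ₗ[𝒜 0] N where
  toFun a := (DirectSum.decompose 𝒜 a 0) • n
  map_add' a b := by simp [add_smul]
  map_smul' c a := by
    have : DirectSum.decompose 𝒜 (c • a) 0 = c * DirectSum.decompose 𝒜 a 0 :=
      Subtype.ext ((proj 𝒜 0).map_smul c a)
    rw [this, mul_smul]
    rfl

variable (𝒜) in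
/-- The isomorphism `Hom(A, N)_0 ≅ N`. -/
def coindZeroIso : coindFunctor 𝒜 ⋙ zeroFunctor 𝒜 ≅ 𝟭 (ModuleCat.{u} (𝒜 0)) :=
  NatIso.ofComponents (fun N => LinearEquiv.toModuleIso <| LinearEquiv.ofBijective
    (show ((coindFunctor 𝒜).obj N).gr 0 →ₗ[𝒜 0] N from
    { toFun := fun f : coindGr 𝒜 N 0 => f.1.1 1
      map_add' := fun m n => rfl
      map_smul' := fun c f => by
        change f.1.1 (c.1 * 1) = c • f.1.1 1
        rw [← map_smul]
        rfl }) (by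
    have hone : ∀ a : 𝒜 0, ∀ f : A →ₗ[𝒜 0] N, f a.1 = a • f 1 := by
      intro a f
      rw [← map_smul]
      exact congrArg f (mul_one a.1).symm
    constructor
    · intro f g h
      refine Subtype.ext (Subtype.ext (linearMap_ext_homogeneous (𝒜 := 𝒜) fun d a ha => ?_))
      by_cases hd : d = 0
      · subst hd
        rw [hone ⟨a, ha⟩, hone ⟨a, ha⟩]
        exact congrArg _ h
      · rw [f.2 d (by simpa using hd) a ha, g.2 d (by simpa using hd) a ha]
    · intro n
      have hz : ∀ d : ℤ, d ≠ 0 → ∀ a ∈ 𝒜 d, coindOf (𝒜 := 𝒜) n a = 0 := by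
        intro d hd a ha
        change (DirectSum.decompose 𝒜 a 0) • n = 0
        rw [show DirectSum.decompose 𝒜 a 0 = 0 from
          Subtype.ext (DirectSum.decompose_of_mem_ne 𝒜 ha hd)]
        exact zero_smul (𝒜 0) n
      refine ⟨⟨⟨coindOf n, {0}, fun d hd => hz d (by simpa using hd)⟩,
        fun d hd => hz d (by simpa using hd)⟩, ?_⟩
      change DirectSum.decompose 𝒜 (1 : A) 0 • n = n
      rw [DirectSum.decompose_one, DirectSum.one_def, DirectSum.of_eq_same]
      exact one_smul _ n)) (by
    intro N N' f
    rfl)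

omit [GradedRing 𝒜] in
theorem decompose_smul_left (M : GrMod 𝒜) {i j : ℤ} {a : A} (ha : a ∈ 𝒜 i) (m : M.carrier) :
    ((DirectSum.decompose M.gr (a • m) (i + j) : M.gr (i + j)) : M.carrier) =
      a • (DirectSum.decompose M.gr m j : M.gr j).1 := by
  induction m using DirectSum.Decomposition.inductionOn M.gr with
  | zero => simp
  | @homogeneous e m =>
    by_cases h : e = j
    · subst h
      rw [DirectSum.decompose_of_mem_same _ (M.smul_mem ha m.2),
        DirectSum.decompose_of_mem_same _ m.2]
    · rw [DirectSum.decompose_of_mem_ne _ (M.smul_mem ha m.2) (by omega),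
        DirectSum.decompose_of_mem_ne _ m.2 h, smul_zero]
  | add m m' h h' =>
    simp only [smul_add, DirectSum.decompose_add, DirectSum.add_apply, AddSubgroup.coe_add, h, h']

/-- The map `b ↦ (b m)_0`. -/
def toCoindLin (M : GrMod 𝒜) (m : M.carrier) : A →ₗ[𝒜 0] M.gr 0 where
  toFun b := DirectSum.decompose M.gr (b • m) 0
  map_add' b c := by simp [add_smul]
  map_smul' c b := Subtype.ext (by
    rw [RingHom.id_apply, show c • b = (c : A) * b from rfl, mul_smul]
    exact decompose_smul_left M (i := 0) (j := 0) c.2 (b • m))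

theorem toCoindLin_of_mem (M : GrMod 𝒜) {d : ℤ} {m : M.carrier} (hm : m ∈ M.gr d) {b : A}
    (hb : b ∈ 𝒜 (-d)) : (toCoindLin M m b : M.carrier) = b • m := by
  have := M.smul_mem hb hm
  rw [neg_add_cancel] at this
  exact DirectSum.decompose_of_mem_same _ this

theorem toCoindLin_of_mem_ne (M : GrMod 𝒜) {d e : ℤ} {m : M.carrier} (hm : m ∈ M.gr d) {b : A}
    (hb : b ∈ 𝒜 e) (h : e ≠ -d) : toCoindLin M m b = 0 :=
  Subtype.ext (DirectSum.decompose_of_mem_ne _ (M.smul_mem hb hm) (by omega))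

/-- A homogeneous `m` of degree `e` pairs nontrivially only with `A_{-e}`, and every element is a
finite sum of homogeneous ones; hence the finiteness condition in `coindCarrier`. -/
theorem toCoindLin_mem (M : GrMod 𝒜) (m : M.carrier) :
    toCoindLin M m ∈ coindCarrier 𝒜 (M.gr 0) := by
  have hadd : ∀ m m', toCoindLin M (m + m') = toCoindLin M m + toCoindLin M m' := fun m m' =>
    LinearMap.ext fun b => by simp [toCoindLin]
  induction m using DirectSum.Decomposition.inductionOn M.gr with
  | zero => exact ⟨∅, fun d _ a _ => by simp [toCoindLin]⟩
  | @homogeneous e m =>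
    exact ⟨{-e}, fun d hd a ha => toCoindLin_of_mem_ne M m.2 ha (by simpa using hd)⟩
  | add m m' h h' => rw [hadd]; exact add_mem h h'

/-- The map `M → Hom(A, M_0)`. -/
def toCoind (M : GrMod 𝒜) : M ⟶ (zeroFunctor 𝒜 ⋙ coindFunctor 𝒜).obj M where
  toLin :=
    { toFun := fun m => (⟨toCoindLin M m, toCoindLin_mem M m⟩ : coindCarrier 𝒜 (M.gr 0))
      map_add' := fun m m' => Subtype.ext (LinearMap.ext fun b => by
        change DirectSum.decompose M.gr (b • (m + m')) 0 =
          DirectSum.decompose M.gr (b • m) 0 + DirectSum.decompose M.gr (b • m') 0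
        rw [smul_add, DirectSum.decompose_add, DirectSum.add_apply])
      map_smul' := fun a m => Subtype.ext (LinearMap.ext fun b => by
        change DirectSum.decompose M.gr (b • a • m) 0 =
          DirectSum.decompose M.gr ((a * b) • m) 0
        rw [← mul_smul, mul_comm]) }
  map_mem {d m} hm e he a ha := toCoindLin_of_mem_ne M hm ha he

variable (𝒜) in
/-- The natural transformation `M → Hom(A, M_0)`. -/
def toCoindTrans : 𝟭 (GrMod 𝒜) ⟶ zeroFunctor 𝒜 ⋙ coindFunctor 𝒜 where
  app M := toCoind M
  naturality M N f := Hom.ext (LinearMap.ext fun m => Subtype.ext (LinearMap.ext fun b => by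
    refine Subtype.ext ?_
    change ((DirectSum.decompose N.gr (b • Hom.toLin f m) 0 : N.gr 0) : N.carrier) =
      Hom.toLin f (DirectSum.decompose M.gr (b • m) 0 : M.gr 0)
    rw [← map_smul, decompose_map]))

/-- Let `1 = ∑ a_i b_i` with `a_i` of degree `d` and `b_i` of degree `-d`. If all `b_i m` vanish
then `m = ∑ a_i b_i m` is zero, and a map `f` of degree `d` is the image of `∑ a_i f(b_i)`. -/
theorem isIso_toCoind (h : IsStronglyGraded 𝒜) (M : GrMod 𝒜) : IsIso (toCoind M) := by
  refine isIso_of_bijective _ ?_ ?_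
  · intro d m hm h0
    have h1 : ∀ b ∈ 𝒜 (-d), b • m = 0 := fun b hb => by
      have h2 := congrArg (fun f : coindCarrier 𝒜 (M.gr 0) => (f.1 b).1) h0
      exact (toCoindLin_of_mem M hm hb).symm.trans h2
    have h3 : ∀ x ∈ pairing 𝒜 d, x • m = 0 := by
      intro x hx
      induction hx using AddSubgroup.closure_induction with
      | mem x hx =>
        obtain ⟨a, ha, b, hb, rfl⟩ := hx
        rw [mul_smul, h1 b hb, smul_zero]
      | zero => exact zero_smul _ _
      | add x y _ _ hx hy => rw [add_smul, hx, hy, add_zero]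
      | neg x _ hx => rw [neg_smul, hx, neg_zero]
    simpa using h3 1 (h d)
  · intro d f hf
    replace hf : (f : coindCarrier 𝒜 (M.gr 0)) ∈ coindGr 𝒜 (M.gr 0) d := hf
    -- Generalizing from `1` to an arbitrary sum `x` of products allows the element `∑ a_i f(b_i)`
    -- to be built by induction; it multiplies `b` to `f(b x)`, and `x = 1` gives the preimage.
    have key : ∀ x ∈ pairing 𝒜 d, ∃ m ∈ M.gr d, ∀ b ∈ 𝒜 (-d),
        b • m = ((f : coindCarrier 𝒜 (M.gr 0)).1 (b * x)).1 := by
      intro x hx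
      induction hx using AddSubgroup.closure_induction with
      | mem x hx =>
        obtain ⟨a, ha, b, hb, rfl⟩ := hx
        refine ⟨a • ((f : coindCarrier 𝒜 (M.gr 0)).1 b).1, ?_, fun c hc => ?_⟩
        · simpa using M.smul_mem ha ((f : coindCarrier 𝒜 (M.gr 0)).1 b).2
        · have hca : c * a ∈ 𝒜 0 := by simpa using SetLike.mul_mem_graded hc ha
          rw [← mul_smul, ← mul_assoc]
          have := (f : coindCarrier 𝒜 (M.gr 0)).1.map_smul (⟨c * a, hca⟩ : 𝒜 0) b
          exact (congrArg Subtype.val this).symm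
      | zero => exact ⟨0, zero_mem _, fun b _ => by rw [smul_zero, mul_zero, map_zero]; rfl⟩
      | add x y _ _ hx hy =>
        obtain ⟨m, hm, h1⟩ := hx
        obtain ⟨n, hn, h2⟩ := hy
        refine ⟨m + n, add_mem hm hn, fun b hb => ?_⟩
        rw [smul_add, h1 b hb, h2 b hb, mul_add, map_add]
        rfl
      | neg x _ hx =>
        obtain ⟨m, hm, h1⟩ := hx
        refine ⟨-m, neg_mem hm, fun b hb => ?_⟩
        rw [smul_neg, h1 b hb, mul_neg, map_neg]
        rfl
    obtain ⟨m, hm, h1⟩ := key 1 (h d)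
    refine ⟨m, hm, Subtype.ext (linearMap_ext_homogeneous (𝒜 := 𝒜) fun e a ha => ?_)⟩
    by_cases he : e = -d
    · subst he
      refine Subtype.ext ((toCoindLin_of_mem M hm ha).trans ?_)
      rw [h1 a ha, mul_one]
    · exact (toCoindLin_of_mem_ne M hm ha he).trans (hf e he a ha).symm

/-- The isomorphism `M ≅ Hom(A, M_0)` for a strongly graded ring. -/
def toCoindIso (h : IsStronglyGraded 𝒜) : 𝟭 (GrMod 𝒜) ≅ zeroFunctor 𝒜 ⋙ coindFunctor 𝒜 :=
  have : ∀ M, IsIso ((toCoindTrans 𝒜).app M) := isIso_toCoind h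
  have := NatIso.isIso_of_isIso_app (toCoindTrans 𝒜)
  asIso (toCoindTrans 𝒜)

/-- The graded module `A(d) / A A_d`. -/
def shiftQuotient (𝒜 : ℤ → AddSubgroup A) [GradedRing 𝒜] (d : ℤ) : GrMod 𝒜 where
  carrier := ModuleCat.of A (A ⧸ Ideal.span (𝒜 d : Set A))
  gr n := (𝒜 (n + d)).map (Submodule.mkQ (Ideal.span (𝒜 d : Set A))).toAddMonoidHom
  isInternal := by
    have hI : (Ideal.span (𝒜 d : Set A)).IsHomogeneous 𝒜 :=
      Ideal.homogeneous_span 𝒜 _ fun x hx => ⟨d, hx⟩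
    apply isInternal_of
    · intro x
      obtain ⟨a, rfl⟩ := Submodule.mkQ_surjective _ x
      classical
      rw [← DirectSum.sum_support_decompose 𝒜 a, map_sum]
      refine sum_mem fun i _ => AddSubgroup.mem_iSup_of_mem (i - d) ?_
      exact ⟨_, by rw [sub_add_cancel]; exact SetLike.coe_mem _, rfl⟩
    · intro s f hf h0 e he
      choose g hg hgf using hf
      have h1 : ∑ i ∈ s, g i ∈ Ideal.span (𝒜 d : Set A) := by
        rw [← Submodule.Quotient.mk_eq_zero, ← h0]
        change Submodule.mkQ _ _ = _
        rw [map_sum]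
        exact Finset.sum_congr rfl fun i _ => hgf i
      have h2 := hI (e + d) h1
      rw [DirectSum.decompose_sum, DirectSum.sum_apply, AddSubgroup.val_finsetSum,
        Finset.sum_eq_single e] at h2
      · rw [DirectSum.decompose_of_mem_same 𝒜 (hg e)] at h2
        rw [← hgf e]
        exact (Submodule.Quotient.mk_eq_zero _).2 h2
      · intro j _ hj
        exact DirectSum.decompose_of_mem_ne 𝒜 (hg j) (fun h => hj (by linarith))
      · intro h; exact absurd he h
  smul_mem := by
    rintro i j a _ ha ⟨m, hm, rfl⟩
    refine ⟨a • m, ?_, map_smul (Submodule.mkQ (Ideal.span (𝒜 d : Set A))) a m⟩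
    rw [add_assoc]
    exact SetLike.mul_mem_graded ha hm

theorem shiftQuotient_zero (d : ℤ) : ∀ m ∈ (shiftQuotient 𝒜 d).gr 0, m = 0 := by
  rintro _ ⟨a, ha, rfl⟩
  refine (Submodule.Quotient.mk_eq_zero _).2 (Ideal.subset_span ?_)
  rwa [zero_add] at ha

theorem one_mem_pairing_of_shiftQuotient {d : ℤ}
    (h : ∀ m ∈ (shiftQuotient 𝒜 d).gr (-d), m = 0) : (1 : A) ∈ pairing 𝒜 d := by
  refine one_mem_pairing ((Submodule.Quotient.mk_eq_zero _).1 (h _ ⟨1, ?_, rfl⟩))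
  rw [neg_add_cancel]
  exact SetLike.one_mem_graded 𝒜

/-- In degree zero, `A(d) / A A_d` is `A_d` modulo itself. Its identity and its zero endomorphism
therefore agree after `u_A`, so by faithfulness the module is zero; the vanishing of the class of
`1`, which sits in degree `-d`, says that `1 ∈ A A_d`. -/
theorem isStronglyGraded_of_faithful [(zeroFunctor 𝒜).Faithful] : IsStronglyGraded 𝒜 := by
  intro d
  refine one_mem_pairing_of_shiftQuotient fun m _ => ?_
  have : (𝟙 (shiftQuotient 𝒜 d) : shiftQuotient 𝒜 d ⟶ _) = ⟨0, fun _ => zero_mem _⟩ := by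
    apply (zeroFunctor 𝒜).map_injective
    refine ModuleCat.hom_ext (LinearMap.ext fun x => Subtype.ext ?_)
    exact shiftQuotient_zero d x.1 x.2
  exact LinearMap.congr_fun (congrArg Hom.toLin this) m

end GrMod

/-! ### Quasi-inverses and restriction of equivalences to full subcategories. -/

section Functors

variable {C D : Type*} [Category C] [Category D]

theorem isExact_of_isEquivalence (F : C ⥤ D) [F.IsEquivalence] : IsExact F :=
  ⟨inferInstance, inferInstance⟩

theorem IsQuasiInverse.isEquivalence_right {F : C ⥤ D} {G : D ⥤ C} (h : IsQuasiInverse F G) :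
    G.IsEquivalence :=
  (CategoryTheory.Equivalence.mk F G h.1.some.symm h.2.some).isEquivalence_inverse

theorem IsQuasiInverse.isEquivalence_left {F : C ⥤ D} {G : D ⥤ C} (h : IsQuasiInverse F G) :
    F.IsEquivalence :=
  (CategoryTheory.Equivalence.mk F G h.1.some.symm h.2.some).isEquivalence_functor

theorem IsQuasiInverse.of_iso {F : C ⥤ D} {G H : D ⥤ C} (h : IsQuasiInverse F G) (e : G ≅ H) :
    IsQuasiInverse F H :=
  ⟨⟨Functor.isoWhiskerLeft F e.symm ≪≫ h.1.some⟩, ⟨Functor.isoWhiskerRight e.symm F ≪≫ h.2.some⟩⟩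

/-- A one-sided inverse of an equivalence is isomorphic to any quasi-inverse. -/
def isoOfCompIso {F : C ⥤ D} {G H : D ⥤ C} (e : 𝟭 C ≅ F ⋙ G) (e' : H ⋙ F ≅ 𝟭 D) : H ≅ G :=
  H.rightUnitor.symm ≪≫ Functor.isoWhiskerLeft H e ≪≫ (Functor.associator _ _ _).symm ≪≫
    Functor.isoWhiskerRight e' G ≪≫ G.leftUnitor

/-- Fullness and faithfulness are inherited by the restriction. Because `P` is exactly the preimage
of `Q`, a preimage under `F` of an object of `Q` lies in `P`, which gives essential surjectivity. -/
theorem restrictsToEquivalence (F : C ⥤ D) [F.IsEquivalence] (P : ObjectProperty C)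
    (Q : ObjectProperty D) [Q.IsClosedUnderIsomorphisms] (h : ∀ X, P X ↔ Q (F.obj X)) :
    RestrictsToEquivalence F P Q := by
  refine ⟨fun X => (h X).1, ?_⟩
  have : (Q.lift (P.ι ⋙ F) fun X => (h X.obj).1 X.property).EssSurj := by
    refine ⟨fun Y => ?_⟩
    have e := F.objObjPreimageIso Y.obj
    exact ⟨⟨F.objPreimage Y.obj, (h _).2 (Q.prop_of_iso e.symm Y.property)⟩,
      ⟨Q.isoMk e⟩⟩
  exact { }

/-- The membership criterion for `F` yields one for `G`, because `F (G Y) ≅ Y`. -/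
theorem IsQuasiInverse.restrictsToEquivalence {F : C ⥤ D} {G : D ⥤ C} (h : IsQuasiInverse F G)
    (P : ObjectProperty C) (Q : ObjectProperty D) [P.IsClosedUnderIsomorphisms]
    [Q.IsClosedUnderIsomorphisms] (hP : ∀ X, P X ↔ Q (F.obj X)) :
    RestrictsToEquivalence G Q P := by
  have := h.isEquivalence_right
  refine GrSch.restrictsToEquivalence G Q P fun Y => ?_
  rw [hP]
  exact (Q.prop_iff_of_iso (h.2.some.app Y)).symm

end Functors

/-! ### Finite generation and the equivalence for graded modules. -/

namespace GrMod

variable {A : Type u} [CommRing A] {𝒜 : ℤ → AddSubgroup A} [GradedRing 𝒜]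

instance : (isFG 𝒜).IsClosedUnderIsomorphisms where
  of_iso {M N} e h := by
    have : Module.Finite A M.carrier := h
    refine Module.Finite.of_surjective (Hom.toLin e.hom) fun n => ⟨Hom.toLin e.inv n, ?_⟩
    exact LinearMap.congr_fun (congrArg Hom.toLin e.inv_hom_id) n

instance : (fgModules (𝒜 0)).IsClosedUnderIsomorphisms where
  of_iso {M N} e h := by
    have : Module.Finite (𝒜 0) M := h
    exact Module.Finite.equiv e.toLinearEquiv

/-- The degree zero part of `a n` is `a_0 n` when `n` has degree zero, so `A N ∩ M_0 = N`. Hence `N`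
can be recovered from the submodule of `M` that it generates. -/
theorem mem_of_mem_span (M : GrMod 𝒜) (N : Submodule (𝒜 0) (M.gr 0)) {x : M.carrier}
    (hx : x ∈ Submodule.span A ((fun n : M.gr 0 => n.1) '' N)) :
    DirectSum.decompose M.gr x 0 ∈ N := by
  have key : ∀ (a : A) (n : M.gr 0), DirectSum.decompose M.gr (a • n.1) 0 =
      (DirectSum.decompose 𝒜 a 0) • n := by
    intro a n
    induction a using DirectSum.Decomposition.inductionOn 𝒜 with
    | zero =>
      rw [zero_smul, DirectSum.decompose_zero, DirectSum.decompose_zero]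
      exact (zero_smul (𝒜 0) n).symm
    | @homogeneous e a =>
      refine Subtype.ext ?_
      have h1 := M.smul_mem a.2 n.2
      rw [add_zero] at h1
      by_cases h : e = 0
      · subst h
        rw [DirectSum.decompose_of_mem_same _ h1, DirectSum.decompose_coe, DirectSum.of_eq_same]
        rfl
      · rw [DirectSum.decompose_of_mem_ne _ h1 h, DirectSum.decompose_coe, DirectSum.of_eq_of_ne _ _ _ (Ne.symm h)]
        exact congrArg Subtype.val (zero_smul (𝒜 0) n).symm
    | add a b ha hb => rw [add_smul, DirectSum.decompose_add, DirectSum.add_apply, ha, hb,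
        DirectSum.decompose_add, DirectSum.add_apply, add_smul]
  refine Submodule.closure_induction (p := fun x _ => DirectSum.decompose M.gr x 0 ∈ N) ?_ ?_ ?_
    (R := A) hx
  · simp
  · intro x y _ _ hx hy
    rw [DirectSum.decompose_add, DirectSum.add_apply]; exact add_mem hx hy
  · rintro a _ ⟨n, hn, rfl⟩
    rw [key]
    exact N.smul_mem _ hn

/-- If `M` is noetherian, ascending chains of `A_0`-submodules `N` of `M_0` stop because `N ↦ A N`
is strictly increasing. Conversely `M_0` generates `M`: for `n` of degree `d` and `1 = ∑ a_i b_i`,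
one has `n = ∑ a_i (b_i n)` with `b_i n` in `M_0`. -/
theorem isFG_iff [IsNoetherianRing A] (h : IsStronglyGraded 𝒜) (M : GrMod 𝒜) :
    isFG 𝒜 M ↔ fgModules (𝒜 0) ((zeroFunctor 𝒜).obj M) := by
  constructor
  · intro hM
    have : Module.Finite A M.carrier := hM
    have : IsNoetherian A M.carrier := inferInstance
    let φ : Submodule (𝒜 0) (M.gr 0) → Submodule A M.carrier := fun N =>
      Submodule.span A ((fun n : M.gr 0 => n.1) '' N)
    have hφ : StrictMono φ := by
      refine (Monotone.strictMono_of_injective ?_ ?_)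
      · exact fun N N' h => Submodule.span_mono (Set.image_mono h)
      · intro N N' hN
        ext n
        have : ∀ N : Submodule (𝒜 0) (M.gr 0), n ∈ N ↔ n.1 ∈ φ N := by
          intro N
          refine ⟨fun hn => Submodule.subset_span ⟨n, hn, rfl⟩, fun hn => ?_⟩
          have := mem_of_mem_span M N hn
          rwa [DirectSum.decompose_coe, DirectSum.of_eq_same] at this
        rw [this, this, hN]
    have hw : WellFoundedGT (Submodule (𝒜 0) (M.gr 0)) := hφ.wellFoundedGT
    have : IsNoetherian (𝒜 0) (M.gr 0) := isNoetherian_iff'.2 hw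
    exact (inferInstance : Module.Finite (𝒜 0) (M.gr 0))
  · intro hM
    obtain ⟨S, hS⟩ : (⊤ : Submodule (𝒜 0) (M.gr 0)).FG := Module.finite_def.1 hM
    classical
    refine Module.finite_def.2 ⟨S.image (fun n : M.gr 0 => n.1), ?_⟩
    have h0 : ∀ n : M.gr 0, n.1 ∈ Submodule.span A ((S.image (fun n : M.gr 0 => n.1) : Finset M.carrier) : Set M.carrier) := by
      intro n
      have hn : n ∈ Submodule.span (𝒜 0) (S : Set (M.gr 0)) := hS ▸ trivial
      induction hn using Submodule.span_induction with
      | mem n hn => exact Submodule.subset_span (Finset.mem_coe.2 (Finset.mem_image_of_mem _ hn))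
      | zero => exact zero_mem _
      | add m n _ _ hm hn => exact add_mem hm hn
      | smul c n _ hn => exact Submodule.smul_mem _ (c : A) hn
    rw [eq_top_iff]
    rintro m -
    rw [← DirectSum.sum_support_decompose M.gr m]
    refine sum_mem fun d _ => ?_
    generalize DirectSum.decompose M.gr m d = n
    have h1 : ∀ x ∈ pairing 𝒜 d, x • n.1 ∈ Submodule.span A
        ((S.image (fun n : M.gr 0 => n.1) : Finset M.carrier) : Set M.carrier) := by
      intro x hx
      induction hx using AddSubgroup.closure_induction with
      | mem x hx =>
        obtain ⟨a, ha, b, hb, rfl⟩ := hx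
        rw [mul_smul]
        have := M.smul_mem hb n.2
        rw [neg_add_cancel] at this
        exact Submodule.smul_mem _ _ (h0 ⟨_, this⟩)
      | zero => rw [zero_smul]; exact zero_mem _
      | add x y _ _ hx hy => rw [add_smul]; exact add_mem hx hy
      | neg x _ hx => rw [neg_smul]; exact neg_mem hx
    simpa using h1 1 (h d)

theorem isQuasiInverse_coindFunctor (h : IsStronglyGraded 𝒜) :
    IsQuasiInverse (zeroFunctor 𝒜) (coindFunctor 𝒜) :=
  ⟨⟨(toCoindIso h).symm⟩, ⟨coindZeroIso 𝒜⟩⟩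

/-- The isomorphism `A ⊗ N ≅ Hom(A, N)` for a strongly graded ring. -/
def tensorCoindIso (h : IsStronglyGraded 𝒜) : tensorFunctor 𝒜 ≅ coindFunctor 𝒜 :=
  isoOfCompIso (toCoindIso h) (tensorZeroIso 𝒜)

theorem isQuasiInverse_tensorFunctor (h : IsStronglyGraded 𝒜) :
    IsQuasiInverse (zeroFunctor 𝒜) (tensorFunctor 𝒜) :=
  (isQuasiInverse_coindFunctor h).of_iso (tensorCoindIso h).symm

theorem isStronglyGraded_iff :
    IsStronglyGraded 𝒜 ↔ ∀ p : GSpec 𝒜, IsStandardRing p.locGr :=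
  ⟨fun h p => h.isStandardRing_loc p, isStronglyGraded_of_isStandardRing_loc⟩

theorem zeroFunctor_isEquivalence_iff :
    (zeroFunctor 𝒜).IsEquivalence ↔ ∀ p : GSpec 𝒜, IsStandardRing p.locGr :=
  Iff.trans (b := IsStronglyGraded 𝒜) ⟨fun _ => isStronglyGraded_of_faithful,
    fun h => (isQuasiInverse_coindFunctor h).isEquivalence_left⟩ isStronglyGraded_iff

end GrMod

/-! ### Local criteria for isomorphisms of sheaves. -/

section SheafIso

variable {X : TopCat.{u}}

/-- Local vanishing of the kernel gives injectivity on every open set. Local preimages are then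
unique, hence agree on overlaps and glue to a preimage. -/
theorem sheaf_isIso_of_local {F G : TopCat.Sheaf AddCommGrpCat.{u} X} (f : F ⟶ G)
    (hi : ∀ (U : Opens X) (s : F.presheaf.obj (op U)), f.hom.app (op U) s = 0 → ∀ x ∈ U,
      ∃ (V : Opens X) (_ : x ∈ V) (i : V ⟶ U), F.presheaf.map i.op s = 0)
    (hs : ∀ (U : Opens X) (t : G.presheaf.obj (op U)), ∀ x ∈ U,
      ∃ (V : Opens X) (_ : x ∈ V) (i : V ⟶ U) (s : F.presheaf.obj (op V)),
        f.hom.app (op V) s = G.presheaf.map i.op t) : IsIso f := by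
  have hnat : ∀ {U V : Opens X} (i : V ⟶ U) (s : F.presheaf.obj (op U)),
      f.hom.app (op V) (F.presheaf.map i.op s) = G.presheaf.map i.op (f.hom.app (op U) s) :=
    fun i s => NatTrans.naturality_apply f.hom i.op s
  have hinj : ∀ U : Opens X, Function.Injective (f.hom.app (op U)) := by
    intro U
    rw [injective_iff_map_eq_zero]
    intro s h
    choose V hV i hi using hi U s h
    refine F.eq_of_locally_eq' (fun x : U => V x.1 x.2) U (fun x => i x.1 x.2)
      (fun x hx => Opens.mem_iSup.2 ⟨⟨x, hx⟩, hV x hx⟩) _ _ fun x => ?_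
    rw [hi, map_zero]
  have hsurj : ∀ U : Opens X, Function.Surjective (f.hom.app (op U)) := by
    intro U t
    choose V hV i s hs using hs U t
    have hcov : U ≤ ⨆ x : U, V x.1 x.2 := fun x hx => Opens.mem_iSup.2 ⟨⟨x, hx⟩, hV x hx⟩
    obtain ⟨a, ha, -⟩ := F.existsUnique_gluing' (fun x : U => V x.1 x.2) U (fun x => i x.1 x.2)
      hcov (fun x => s x.1 x.2) (by
        intro x y
        apply hinj
        refine (hnat _ _).trans (Eq.trans ?_ (hnat _ _).symm)
        rw [hs, hs, ← ConcreteCategory.comp_apply, ← ConcreteCategory.comp_apply,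
          ← Functor.map_comp, ← Functor.map_comp]
        rfl)
    refine ⟨a, G.eq_of_locally_eq' (fun x : U => V x.1 x.2) U (fun x => i x.1 x.2) hcov _ _ fun x => ?_⟩
    rw [← hnat, ha, hs]
  have (U : (Opens X)ᵒᵖ) : IsIso (f.hom.app U) := by
    rw [ConcreteCategory.isIso_iff_bijective]
    exact ⟨hinj U.unop, hsurj U.unop⟩
  have h1 : IsIso f.hom := NatIso.isIso_of_isIso_app f.hom
  exact ⟨⟨inv f.hom⟩, Sheaf.hom_ext (IsIso.hom_inv_id f.hom), Sheaf.hom_ext (IsIso.inv_hom_id f.hom)⟩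

end SheafIso

variable {X : GradedRingedSpace.{u}}

namespace GMod

theorem isIso_of_app {F G : GMod X} (f : F ⟶ G) (h : ∀ d, IsIso (Hom.app f d)) : IsIso f := by
  have hinv : ∀ d (U : Opens X.carrier) (s : F.Sec d U),
      (inv (Hom.app f d)).hom.app (op U) ((Hom.app f d).hom.app (op U) s) = s := by
    intro d U s
    have := IsIso.hom_inv_id (Hom.app f d)
    have := congrArg (fun g : F.sec d ⟶ F.sec d => g.hom.app (op U) s) this
    exact this
  have hinv' : ∀ d (U : Opens X.carrier) (s : G.Sec d U),
      (Hom.app f d).hom.app (op U) ((inv (Hom.app f d)).hom.app (op U) s) = s := by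
    intro d U s
    have := IsIso.inv_hom_id (Hom.app f d)
    have := congrArg (fun g : G.sec d ⟶ G.sec d => g.hom.app (op U) s) this
    exact this
  refine ⟨⟨fun d => inv (Hom.app f d), fun {i j k} h U a s => ?_⟩, hom_ext fun d => ?_, hom_ext fun d => ?_⟩
  · obtain ⟨t, rfl⟩ : ∃ t, (Hom.app f j).hom.app (op U) t = s := ⟨_, hinv' j U s⟩
    rw [hinv, ← f.map_smul, hinv]
  · exact IsIso.hom_inv_id _
  · exact IsIso.inv_hom_id _

theorem res_res (F : GMod X) {d : ℤ} {U V W : Opens X.carrier} (i : V ⟶ U) (j : W ⟶ V)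
    (s : F.Sec d U) : F.res d j (F.res d i s) = F.res d (j ≫ i) s :=
  (ConcreteCategory.congr_hom ((F.sec d).presheaf.map_comp i.op j.op) s).symm

theorem res_smul (F : GMod X) {i j k : ℤ} (h : i + j = k) {U V : Opens X.carrier} (f : V ⟶ U)
    (a : X.gr U i) (s : F.Sec j U) :
    F.res k f (F.smul h U a s) = F.smul h V (X.resGr f i a) (F.res j f s) := F.smul_res h f a s

/-- Associativity with all degrees as free variables related by equations. It applies when degrees
agree only after arithmetic, without transport along an equality. -/
theorem smul_smul (F : GMod X) {i j k l m n : ℤ} (h : j + k = l) (h' : i + l = m) (hn : i + j = n)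
    (hm : n + k = m) {U : Opens X.carrier} (a : X.gr U i) (b : X.gr U j) (c : X.gr U n)
    (hc : c.1 = a.1 * b.1) (s : F.Sec k U) :
    F.smul h' U a (F.smul h U b s) = F.smul hm U c s := by
  subst hn
  rw [← F.mul_smul h h' U a b s]
  congr 2
  exact Subtype.ext hc.symm

theorem smul_one (F : GMod X) {j i : ℤ} (hi : i + j = j) {U : Opens X.carrier} (c : X.gr U i)
    (hc : c.1 = 1) (s : F.Sec j U) : F.smul hi U c s = s := by
  obtain rfl : i = 0 := by omega
  conv_rhs => rw [← F.one_smul U s]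
  congr 2
  exact Subtype.ext hc

end GMod

namespace GradedRingedSpace

namespace ZeroMod

theorem isIso_of_local {G H : X.ZeroMod} (f : G ⟶ H)
    (hi : ∀ (U : Opens X.carrier) (s : Sec G U), mapSec f U s = 0 → ∀ x ∈ U,
      ∃ (V : Opens X.carrier) (_ : x ∈ V) (i : V ⟶ U), res G i s = 0)
    (hs : ∀ (U : Opens X.carrier) (t : Sec H U), ∀ x ∈ U,
      ∃ (V : Opens X.carrier) (_ : x ∈ V) (i : V ⟶ U) (s : Sec G V), mapSec f V s = res H i t) :
    IsIso f := by
  have h1 : IsIso ((SheafOfModules.toSheaf X.zeroRing).map f) :=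
    sheaf_isIso_of_local (X := X.carrier) (F := ab G) (G := ab H) _ hi hs
  have h2 : IsIso ((PresheafOfModules.toPresheaf X.zeroRing.obj).map f.val) :=
    Functor.map_isIso (sheafToPresheaf (Opens.grothendieckTopology X.carrier) AddCommGrpCat.{u})
      ((SheafOfModules.toSheaf X.zeroRing).map f)
  have h3 : IsIso f.val := isIso_of_reflects_iso f.val (PresheafOfModules.toPresheaf X.zeroRing.obj)
  exact (isIso_iff_of_reflects_iso f (SheafOfModules.forget _)).1 h3

/-- A morphism of sheaves of `𝒪_{X₀}`-modules from additive maps on sections. -/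
def homMk {G H : X.ZeroMod} (f : ∀ U : Opens X.carrier, Sec G U →+ Sec H U)
    (hact : ∀ U (c : X.gr U 0) g, f U (act G c g) = act H c (f U g))
    (hres : ∀ {U V : Opens X.carrier} (i : V ⟶ U) g, f V (res G i g) = res H i (f U g)) : G ⟶ H :=
  ⟨PresheafOfModules.homMk (M₁ := G.val) (M₂ := H.val)
    { app := fun U => AddCommGrpCat.ofHom (f U.unop)
      naturality := fun _ _ i => AddCommGrpCat.hom_ext (AddMonoidHom.ext fun g => hres i.unop g) }
    (fun U c g => hact U.unop c g)⟩

theorem hom_ext' {G H : X.ZeroMod} {f g : G ⟶ H} (h : ∀ U s, mapSec f U s = mapSec g U s) : f = g :=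
  SheafOfModules.hom_ext (PresheafOfModules.hom_ext fun U => ModuleCat.hom_ext
    (LinearMap.ext fun s => h U.unop s))

/-- The element `1` in degree `-0`. -/
def negOne (U : Opens X.carrier) : X.gr U (-0) := ⟨1, SetLike.one_mem_graded (X.gr U)⟩

/-- Evaluation at `1`: the morphism `ℋom(𝒪_X, G)_0 → G`. -/
def coindZeroHom (G : X.ZeroMod) : (coind G).zero ⟶ G :=
  homMk (G := (coind G).zero) (fun U => AddMonoidHom.mk' (fun f : coindSec G 0 U => f.1 ⟨U, le_rfl⟩ (negOne U))
      fun _ _ => rfl)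
    (fun U c (f : coindSec G 0 U) => by
      have := f.2.1 ⟨U, le_rfl⟩ c (negOne U)
      refine Eq.trans ?_ this
      change f.1 ⟨U, le_rfl⟩ ⟨(X.res (𝟙 U) c.1) * _, _⟩ = _
      congr 1
      exact Subtype.ext (congrArg (· * _) (X.res_id c.1)))
    (fun {U V} i (f : coindSec G 0 U) => by
      refine Eq.trans ?_ (f.2.2 ⟨U, le_rfl⟩ ⟨V, i.le⟩ i (negOne U)).symm
      change f.1 ⟨V, _⟩ _ = _
      exact congrArg _ (Subtype.ext (map_one (X.res i)).symm))

/-- A linear map on `𝒪_{X₀}` is determined by its value at `1`, through `f(b) = b f(1)`, and a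
section `g` is the value at `1` of the map `b ↦ b g`. -/
theorem isIso_coindZeroHom (G : X.ZeroMod) : IsIso (coindZeroHom G) := by
  refine isIso_of_local _ ?_ ?_
  · intro U (f : coindSec G 0 U) hf x hx
    refine ⟨U, hx, 𝟙 U, (res_id (coind G).zero f).trans ?_⟩
    replace hf : f.1 ⟨U, le_rfl⟩ (negOne U) = 0 := hf
    refine Subtype.ext (funext fun V => AddMonoidHom.ext fun b => ?_)
    have h1 := f.2.1 V b (negOne V.1)
    have h2 := f.2.2 ⟨U, le_rfl⟩ V (homOfLE V.2) (negOne U)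
    rw [hf, map_zero] at h2
    have h3 : X.resGr (homOfLE V.2) (-0) (negOne U) = negOne V.1 :=
      Subtype.ext (map_one (X.res _))
    rw [← h3, ← h2] at h1
    refine Eq.trans ?_ (h1.trans ?_)
    · congr 1
      refine Subtype.ext ?_
      change b.1 = b.1 * X.res _ 1
      rw [map_one, mul_one]
    · exact smul_zero (A := Sec G V.1) (show X.zeroRing.obj.obj (op V.1) from b)
  · intro U g x hx
    refine ⟨U, hx, 𝟙 U, (⟨fun V => AddMonoidHom.mk' (fun b : X.gr V.1 0 => act G b (res G (homOfLE V.2) g))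
      (fun b b' => add_smul (show X.zeroRing.obj.obj (op V.1) from b)
        (show X.zeroRing.obj.obj (op V.1) from b') _), ?_, ?_⟩ : coindSec G 0 U), ?_⟩
    · intro V c b
      exact mul_smul (show X.zeroRing.obj.obj (op V.1) from c)
        (show X.zeroRing.obj.obj (op V.1) from b) (res G (homOfLE V.2) g)
    · intro V W i b
      change res G i (act G b _) = act G (X.resGr i 0 b) _
      rw [res_act, res_res]
      rfl
    · rw [res_id]
      refine Eq.trans (one_smul (X.zeroRing.obj.obj (op U)) (res G _ g)) (res_id G g)

variable (X) in
/-- The isomorphism `ℋom(𝒪_X, G)_0 ≅ G`. -/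
def coindZeroIso : coindFunctor X ⋙ GMod.zeroFunctor X ≅ 𝟭 X.ZeroMod :=
  NatIso.ofComponents (fun G => @asIso _ _ _ _ (coindZeroHom G) (isIso_coindZeroHom G))
    (fun _ => hom_ext' fun _ _ => rfl)

end ZeroMod

end GradedRingedSpace

/-! ### The comparison of `F` with `ℋom(𝒪_X, F_0)`. -/

namespace GMod

open GradedRingedSpace ZeroMod

/-- The morphism `F → ℋom(𝒪_X, F_0)`. -/
def toCoind (F : GMod X) : F ⟶ coind F.zero where
  app d := ⟨
    { app := fun U => AddCommGrpCat.ofHom (AddMonoidHom.mk'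
        (fun s : F.Sec d U.unop => (⟨fun V => AddMonoidHom.mk'
            (fun b => F.smul (neg_add_cancel d) V.1 b (F.res d (homOfLE V.2) s))
            (fun b b' => DFunLike.congr_fun (map_add (F.smul (neg_add_cancel d) V.1) b b') _),
          fun V c b => (F.smul_smul (neg_add_cancel d) (zero_add 0) (zero_add (-d)) (neg_add_cancel d)
            c b _ rfl _).symm,
          fun V W i b => by
            change F.res 0 i (F.smul _ _ _ _) = F.smul _ _ _ _
            rw [F.res_smul, res_res]
            rfl⟩ : coindSec F.zero d U.unop))
        (fun s t => Subtype.ext (funext fun V => AddMonoidHom.ext fun b => by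
          change F.smul _ V.1 b (F.res d _ (s + t)) = F.smul _ V.1 b _ + F.smul _ V.1 b _
          rw [map_add, map_add])))
      naturality := fun U V i => AddCommGrpCat.hom_ext (AddMonoidHom.ext fun s =>
        Subtype.ext (funext fun W => AddMonoidHom.ext fun b => by
          change F.smul _ W.1 b (F.res d _ (F.res d i.unop s)) = F.smul _ W.1 b (F.res d _ s)
          rw [res_res]
          rfl)) }⟩
  map_smul {i j k} h U a s := Subtype.ext (funext fun V => AddMonoidHom.ext fun b => by
    change F.smul _ V.1 b (F.res k _ (F.smul h U a s)) = F.smul (neg_add_cancel j) V.1 _ (F.res j _ s)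
    rw [F.res_smul]
    exact F.smul_smul _ _ (by omega) _ _ _ _ (mul_comm _ _) _)

theorem toCoind_apply (F : GMod X) {d : ℤ} {U : Opens X.carrier} (s : F.Sec d U)
    (V : {V : Opens X.carrier // V ≤ U}) (b : X.gr V.1 (-d)) :
    (show coindSec F.zero d U from (Hom.app (toCoind F) d).hom.app (op U) s).1 V b =
      F.smul (neg_add_cancel d) V.1 b (F.res d (homOfLE V.2) s) := rfl

variable (X) in
/-- The natural transformation `F → ℋom(𝒪_X, F_0)`. -/
def toCoindTrans : 𝟭 (GMod X) ⟶ zeroFunctor X ⋙ coindFunctor X where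
  app F := toCoind F
  naturality F G f := hom_ext fun d => Sheaf.hom_ext (NatTrans.ext (funext fun U =>
    AddCommGrpCat.hom_ext (AddMonoidHom.ext fun s => Subtype.ext (funext fun V =>
      AddMonoidHom.ext fun b => by
        change G.smul _ V.1 b (G.res d _ ((Hom.app f d).hom.app U s)) =
          (Hom.app f 0).hom.app (op V.1) (F.smul _ V.1 b (F.res d _ s))
        rw [f.map_smul]
        congr 1
        exact (NatTrans.naturality_apply (Hom.app f d).hom (homOfLE V.2).op s).symm))))

end GMod

namespace GradedRingedSpace

/-- Inverse homogeneous sections of degree `d` and `-d` on an open set. -/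
def UnitsOn (X : GradedRingedSpace.{u}) (U : Opens X.carrier) (d : ℤ) : Prop :=
  ∃ (a : X.gr U d) (b : X.gr U (-d)), a.1 * b.1 = 1

theorem UnitsOn.res {U V : Opens X.carrier} (i : V ⟶ U) {d : ℤ} (h : X.UnitsOn U d) :
    X.UnitsOn V d := by
  obtain ⟨a, b, hab⟩ := h
  exact ⟨X.resGr i d a, X.resGr i (-d) b, by
    rw [resGr_coe, resGr_coe, ← map_mul, hab, map_one]⟩

theorem UnitsOn.all {U : Opens X.carrier} (h : X.UnitsOn U 1) (d : ℤ) : X.UnitsOn U d := by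
  obtain ⟨a, b, hab⟩ := h
  have key : ∀ n : ℕ, X.UnitsOn U n ∧ X.UnitsOn U (-n) := by
    intro n
    have ha := SetLike.pow_mem_graded n a.2
    have hb := SetLike.pow_mem_graded n b.2
    have h1 : a.1 ^ n * b.1 ^ n = 1 := by rw [← mul_pow, hab, one_pow]
    constructor
    · exact ⟨⟨_, by simpa using ha⟩, ⟨_, by simpa using hb⟩, h1⟩
    · exact ⟨⟨_, by simpa using hb⟩, ⟨_, by simpa using ha⟩, by rw [← h1, mul_comm]⟩
  obtain ⟨n, rfl | rfl⟩ := d.eq_nat_or_neg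
  · exact (key n).1
  · exact (key n).2

end GradedRingedSpace

/-- The inverse of a homogeneous unit is homogeneous. -/
theorem exists_homogeneous_inverse {A : Type u} [CommRing A] {𝒜 : ℤ → AddSubgroup A} [GradedRing 𝒜]
    {d : ℤ} {a : A} (ha : a ∈ 𝒜 d) (h : IsUnit a) : ∃ b ∈ 𝒜 (-d), a * b = 1 := by
  obtain ⟨b, hb⟩ := h.exists_right_inv
  refine ⟨_, SetLike.coe_mem (DirectSum.decompose 𝒜 b (-d)), ?_⟩
  have := DirectSum.coe_decompose_mul_add_of_left_mem 𝒜 (i := d) (j := -d) (b := b) ha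
  rw [add_neg_cancel, hb, DirectSum.decompose_of_mem_same 𝒜 (SetLike.one_mem_graded 𝒜)] at this
  exact this.symm

namespace GradedRingedSpace

/-- The inverse of a homogeneous unit is homogeneous, and an equation between germs holds on a
neighbourhood. Standardness thus becomes a statement about sections, which is the form used
everywhere below. -/
theorem IsStandardPoint.unitsOn {x : X.carrier} (h : X.IsStandardPoint x) :
    ∃ (U : Opens X.carrier) (_ : x ∈ U), X.UnitsOn U 1 := by
  obtain ⟨a, ha, hu⟩ := h
  obtain ⟨b, hb, hab⟩ := exists_homogeneous_inverse ha hu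
  obtain ⟨U, hxU, s, hs, rfl⟩ := ha
  obtain ⟨V, hxV, t, ht, rfl⟩ := hb
  have e : X.germ x (mem_inf' hxU hxV) (X.res (Opens.infLELeft U V) s * X.res (Opens.infLERight U V) t) =
      X.germ x (mem_inf' hxU hxV) 1 := by
    rw [map_mul, X.germ_res, X.germ_res, hab, map_one]
  obtain ⟨W, hxW, i, j, hij⟩ := X.sheaf.presheaf.germ_eq x (mem_inf' hxU hxV) (mem_inf' hxU hxV) _ _ e
  replace hij : X.res i (X.res (Opens.infLELeft U V) s * X.res (Opens.infLERight U V) t) = X.res j 1 := hij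
  rw [map_mul, map_one] at hij
  exact ⟨W, hxW, ⟨_, X.map_mem i (X.map_mem _ hs)⟩, ⟨_, X.map_mem i (X.map_mem _ ht)⟩, hij⟩

theorem UnitsOn.isStandardPoint {U : Opens X.carrier} (h : X.UnitsOn U 1) {x : X.carrier}
    (hx : x ∈ U) : X.IsStandardPoint x := by
  obtain ⟨a, b, hab⟩ := h
  refine ⟨X.germ x hx a.1, X.germ_mem_stalkGr x hx a.2, IsUnit.of_mul_eq_one (X.germ x hx b.1) ?_⟩
  rw [← map_mul, hab, map_one]

theorem IsStandard.exists_unitsOn (h : X.IsStandard) (d : ℤ) {U : Opens X.carrier} {x : X.carrier}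
    (hx : x ∈ U) : ∃ (V : Opens X.carrier) (_ : x ∈ V) (_ : V ⟶ U), X.UnitsOn V d := by
  obtain ⟨V, hxV, hV⟩ := (h x).unitsOn
  exact ⟨U ⊓ V, mem_inf' hx hxV, Opens.infLELeft U V, (hV.res (Opens.infLERight U V)).all d⟩

end GradedRingedSpace

namespace GMod

open GradedRingedSpace ZeroMod

/-- Near each point there are sections `b`, `a` of degrees `d`, `-d` with `b a = 1`. A section `s`
of degree `d` is `b (a s)`, hence determined by its action on `a`, and a map `t` is induced by the
section `b t(a)`. -/
theorem isIso_toCoind (hX : X.IsStandard) (F : GMod X) : IsIso (toCoind F) := by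
  refine isIso_of_app _ fun d => sheaf_isIso_of_local _ ?_ ?_
  · intro U s hs x hx
    obtain ⟨V, hxV, i, b, a, hba⟩ := hX.exists_unitsOn d hx
    refine ⟨V, hxV, i, ?_⟩
    have h1 : F.smul (neg_add_cancel d) V a (F.res d i s) = 0 :=
      (toCoind_apply F s ⟨V, i.le⟩ a).symm.trans
        (congrArg (fun f : coindSec F.zero d U => f.1 ⟨V, i.le⟩ a) hs)
    have h2 := F.smul_smul (neg_add_cancel d) (add_zero d) (add_neg_cancel d) (zero_add d) b a
      ⟨1, SetLike.one_mem_graded _⟩ hba.symm (F.res d i s)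
    rw [h1, map_zero, F.smul_one _ _ rfl] at h2
    exact h2.symm
  · intro U (t : coindSec F.zero d U) x hx
    obtain ⟨V, hxV, i, b, a, hba⟩ := hX.exists_unitsOn d hx
    refine ⟨V, hxV, i, F.smul (add_zero d) V b (t.1 ⟨V, i.le⟩ a), ?_⟩
    refine Subtype.ext (funext fun W => AddMonoidHom.ext fun c => ?_)
    refine (toCoind_apply F _ W c).trans ?_
    have hc : c.1 * X.res (homOfLE W.2) b.1 ∈ X.gr W.1 0 := by
      have := SetLike.mul_mem_graded c.2 (X.map_mem (homOfLE W.2) b.2)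
      rwa [neg_add_cancel] at this
    refine (congrArg (F.smul (neg_add_cancel d) W.1 c) (F.res_smul (add_zero d) (homOfLE W.2) b _)).trans ?_
    rw [F.smul_smul (add_zero d) (neg_add_cancel d) (neg_add_cancel d) (zero_add 0) c
      (X.resGr (homOfLE W.2) d b) ⟨_, hc⟩ rfl]
    have h1 := t.2.2 ⟨V, i.le⟩ ⟨W.1, W.2.trans i.le⟩ (homOfLE W.2) a
    have h2 := t.2.1 ⟨W.1, W.2.trans i.le⟩ ⟨_, hc⟩ (X.resGr (homOfLE W.2) (-d) a)
    rw [← h1] at h2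
    -- The element `c b` has degree zero, so linearity moves it inside `t`, and `c b a = c`.
    refine h2.symm.trans ?_
    change t.1 ⟨W.1, _⟩ _ = t.1 ⟨W.1, _⟩ c
    refine congrArg _ (Subtype.ext ?_)
    change c.1 * X.res _ b.1 * X.res _ a.1 = c.1
    rw [mul_assoc, ← map_mul, hba, map_one, mul_one]

/-- The isomorphism `F ≅ ℋom(𝒪_X, F_0)` for standard `X`. -/
def toCoindIso (hX : X.IsStandard) : 𝟭 (GMod X) ≅ zeroFunctor X ⋙ coindFunctor X :=
  have : ∀ F, IsIso ((toCoindTrans X).app F) := isIso_toCoind hX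
  have := NatIso.isIso_of_isIso_app (toCoindTrans X)
  asIso (toCoindTrans X)

theorem isQuasiInverse_coindFunctor (hX : X.IsStandard) :
    IsQuasiInverse (zeroFunctor X) (coindFunctor X) :=
  ⟨⟨(toCoindIso hX).symm⟩, ⟨coindZeroIso X⟩⟩

end GMod

/-! ### The degree zero part of `𝒪_X ⊗ G`, computed on stalks. -/

namespace GradedRingedSpace

/-- The projection of the stalk to its degree zero part. -/
def stalkProj (x : X.carrier) : X.stalk x →ₗ[X.zeroPresheaf.stalk x] X.stalk x where
  toFun z := (DirectSum.decompose (X.stalkGr x) z 0 : X.stalkGr x 0)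
  map_add' a b := by simp
  map_smul' c z := by
    obtain ⟨U, hx, c, rfl⟩ := X.zeroPresheaf.exists_germ_eq c
    have e : algebraMap _ (X.stalk x) (X.zeroPresheaf.germ U x hx c) = X.germ x hx c.1 :=
      ZeroMod.algebraMap_germ x U hx c
    rw [RingHom.id_apply, Algebra.smul_def, Algebra.smul_def, e]
    have := DirectSum.coe_decompose_mul_add_of_left_mem (X.stalkGr x) (i := 0) (j := 0) (b := z)
      (X.germ_mem_stalkGr x hx c.2)
    rwa [add_zero] at this

/-- If a germ of degree zero vanishes in the stalk of `𝒪_X`, a representative vanishes on a smaller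
open set, where it is also zero as a section of `𝒪_{X₀}`. -/
theorem algebraMap_stalk_injective (x : X.carrier) :
    Function.Injective (algebraMap (X.zeroPresheaf.stalk x) (X.stalk x)) := by
  rw [injective_iff_map_eq_zero]
  intro c hc
  obtain ⟨U, hx, c, rfl⟩ := X.zeroPresheaf.exists_germ_eq c
  replace hc : X.germ x hx c.1 = 0 := (ZeroMod.algebraMap_germ x U hx c).symm.trans hc
  obtain ⟨V, hxV, i, j, hij⟩ := X.sheaf.presheaf.germ_eq x hx hx c.1 0 (hc.trans (map_zero _).symm)
  have h1 : X.resGr i 0 c = 0 := Subtype.ext (hij.trans (map_zero (X.res j)))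
  have h2 := X.zeroPresheaf.germ_res_apply i x hxV c
  rw [← h2]
  refine (congrArg _ ?_).trans (map_zero (X.zeroPresheaf.germ V x hxV).hom)
  exact h1

/-- The retraction of the stalk of `𝒪_X` onto the stalk of `𝒪_{X₀}`. -/
theorem exists_retraction (x : X.carrier) :
    ∃ r : X.stalk x →ₗ[X.zeroPresheaf.stalk x] X.zeroPresheaf.stalk x, r 1 = 1 := by
  let e := LinearEquiv.ofInjective (Algebra.linearMap (X.zeroPresheaf.stalk x) (X.stalk x))
    (algebraMap_stalk_injective x)
  have hr : ∀ z, stalkProj x z ∈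
      LinearMap.range (Algebra.linearMap (X.zeroPresheaf.stalk x) (X.stalk x)) := by
    intro z
    obtain ⟨U, hx, a, ha, h⟩ := SetLike.coe_mem (DirectSum.decompose (X.stalkGr x) z 0)
    exact ⟨X.zeroPresheaf.germ U x hx ⟨a, ha⟩, (ZeroMod.algebraMap_germ x U hx ⟨a, ha⟩).trans h⟩
  refine ⟨e.symm.toLinearMap ∘ₗ (stalkProj x).codRestrict _ hr, ?_⟩
  change e.symm _ = 1
  rw [LinearEquiv.symm_apply_eq]
  refine Subtype.ext ?_
  change ((DirectSum.decompose (X.stalkGr x) 1 0 : X.stalkGr x 0) : X.stalk x) = algebraMap _ _ 1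
  rw [DirectSum.decompose_of_mem_same _ (SetLike.one_mem_graded _), map_one]

namespace ZeroMod

/-- Projection to degree zero makes the stalk of `𝒪_{X₀}` a direct summand of the stalk of `𝒪_X`.
Tensoring the retraction with the stalk of `G` gives a left inverse of `m ↦ 1 ⊗ m`; no flatness is
needed. -/
theorem one_tmul_injective (G : X.ZeroMod) (x : X.carrier) {m : stalk G x}
    (h : (1 : X.stalk x) ⊗ₜ[X.zeroPresheaf.stalk x] m = 0) : m = 0 := by
  obtain ⟨r, hr⟩ := exists_retraction x
  have := congrArg (TensorProduct.lid (X.zeroPresheaf.stalk x) (stalk G x) ∘ r.rTensor (stalk G x)) h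
  simp only [Function.comp_apply, LinearMap.rTensor_tmul, hr, TensorProduct.lid_tmul, one_smul,
    map_zero] at this
  exact this

theorem eq_zero_of_germ (G : X.ZeroMod) {U : Opens X.carrier} {g : Sec G U}
    (h : ∀ x hx, germ G x hx g = 0) : g = 0 := by
  have : ∀ x : U, ∃ (V : Opens X.carrier) (_ : x.1 ∈ V) (i : V ⟶ U), res G i g = 0 := by
    intro x
    obtain ⟨V, hxV, i, j, hij⟩ := TopCat.Presheaf.germ_eq (pre G).presheaf x.1 x.2 x.2 g 0
      ((h x.1 x.2).trans (map_zero (germ G x.1 x.2)).symm)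
    exact ⟨V, hxV, i, hij.trans (map_zero (res G j))⟩
  choose V hV i hi using this
  refine (ab G).eq_of_locally_eq' V U i (fun x hx => Opens.mem_iSup.2 ⟨⟨x, hx⟩, hV _⟩) _ _ fun x => ?_
  exact (hi x).trans (map_zero (res G (i x))).symm

/-- The morphism `G → (𝒪_X ⊗ G)_0`. -/
def tensorZeroHom (G : X.ZeroMod) : G ⟶ (tensor G).zero :=
  homMk (H := (tensor G).zero) (fun U => AddMonoidHom.mk'
      (fun g => (⟨fun x => (1 : X.stalk x.1) ⊗ₜ[X.zeroPresheaf.stalk x.1] germ G x.1 x.2 g, fun x => ⟨U, x.2, 𝟙 U,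
        AddSubgroup.subset_closure ⟨1, SetLike.one_mem_graded _, g, fun y => by
          rw [map_one]
          rfl⟩⟩⟩ :
        (tensorGroups G 0).sections U))
      (fun g g' => Subtype.ext (funext fun x => by
        change (1 : X.stalk x.1) ⊗ₜ[X.zeroPresheaf.stalk x.1] germ G x.1 x.2 (g + g') =
          1 ⊗ₜ germ G x.1 x.2 g + 1 ⊗ₜ germ G x.1 x.2 g'
        rw [map_add, TensorProduct.tmul_add])))
    (fun U c g => Subtype.ext (funext fun x => by
      change (1 : X.stalk x.1) ⊗ₜ[X.zeroPresheaf.stalk x.1] germ G x.1 x.2 (act G c g) = X.germ x.1 x.2 c.1 • (1 ⊗ₜ germ G x.1 x.2 g)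
      rw [germ_act, ← TensorProduct.smul_tmul, Algebra.smul_def, algebraMap_germ,
        TensorProduct.smul_tmul']
      rfl))
    (fun {U V} i g => Subtype.ext (funext fun x => by
      change (1 : X.stalk x.1) ⊗ₜ[X.zeroPresheaf.stalk x.1] germ G x.1 x.2 (res G i g) = 1 ⊗ₜ germ G x.1 _ g
      rw [germ_res]))

/-- Surjectivity: for `a` of degree zero, `a ⊗ g = 1 ⊗ a g`, so a local sum of such functions comes
from one section of `G`. Injectivity is checked on stalks. -/
theorem isIso_tensorZeroHom (G : X.ZeroMod) : IsIso (tensorZeroHom G) := by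
  refine isIso_of_local _ ?_ ?_
  · intro U g hg x hx
    refine ⟨U, hx, 𝟙 U, (res_id G g).trans ?_⟩
    refine eq_zero_of_germ G fun x hx => one_tmul_injective G x ?_
    exact congrFun (congrArg (fun s : (tensorGroups G 0).sections U => s.1) hg) ⟨x, hx⟩
  · intro U (t : (tensorGroups G 0).sections U) x hx
    obtain ⟨V, hV, i, h⟩ := t.2 ⟨x, hx⟩
    have key : ∀ s ∈ (tensorGroups G 0).fn V, ∃ g : Sec G V, ∀ y : V, 1 ⊗ₜ germ G y.1 y.2 g = s y := by
      intro s hs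
      induction hs using AddSubgroup.closure_induction with
      | mem s hs =>
        obtain ⟨a, ha, g, hg⟩ := hs
        refine ⟨act G ⟨a, ha⟩ g, fun y => ?_⟩
        rw [hg, germ_act, ← TensorProduct.smul_tmul, Algebra.smul_def, algebraMap_germ, mul_one]
      | zero => exact ⟨0, fun y => by rw [map_zero, TensorProduct.tmul_zero]; rfl⟩
      | add s t _ _ hs ht =>
        obtain ⟨g, hg⟩ := hs
        obtain ⟨g', hg'⟩ := ht
        exact ⟨g + g', fun y => by rw [map_add, TensorProduct.tmul_add, hg, hg']; rfl⟩
      | neg s _ hs =>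
        obtain ⟨g, hg⟩ := hs
        exact ⟨-g, fun y => by rw [map_neg, TensorProduct.tmul_neg, hg]; rfl⟩
    obtain ⟨g, hg⟩ := key _ h
    exact ⟨V, hV, i, g, Subtype.ext (funext fun y => hg y)⟩

variable (X) in
/-- The isomorphism `(𝒪_X ⊗ G)_0 ≅ G`. -/
def tensorZeroIso : tensorFunctor X ⋙ GMod.zeroFunctor X ≅ 𝟭 X.ZeroMod :=
  Iso.symm <| NatIso.ofComponents
    (fun G => @asIso _ _ _ _ (tensorZeroHom G) (isIso_tensorZeroHom G))
    (fun {G H} f => hom_ext' fun U s => Subtype.ext (funext fun x => by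
      change (1 : X.stalk x.1) ⊗ₜ[X.zeroPresheaf.stalk x.1] germ H x.1 x.2 (mapSec f U s) = tensorStalkMap f x.1 (1 ⊗ₜ germ G x.1 x.2 s)
      rw [← stalkMap_germ]
      rfl))

/-- The isomorphism `𝒪_X ⊗ G ≅ ℋom(𝒪_X, G)` for standard `X`. -/
def tensorCoindIso (hX : X.IsStandard) : tensorFunctor X ≅ coindFunctor X :=
  isoOfCompIso (GMod.toCoindIso hX) (tensorZeroIso X)

end ZeroMod

end GradedRingedSpace

/-! ### Skyscraper sheaves and graded local rings: the equivalence forces standardness. -/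

section Skyscraper

variable (x : X.carrier) (M : GrMod (X.stalkGr x))

/-- The skyscraper presheaf with value `M_d` at `x`. -/
def skyPresheaf (d : ℤ) : TopCat.Presheaf AddCommGrpCat.{u} X.carrier where
  obj U := AddCommGrpCat.of (ULift.{u} (PLift (x ∈ U.unop)) → M.gr d)
  map i := AddCommGrpCat.ofHom
    { toFun := fun s h => s ⟨⟨i.unop.le h.down.down⟩⟩
      map_zero' := rfl
      map_add' := fun _ _ => rfl }

theorem skyPresheaf_isSheaf (d : ℤ) : (skyPresheaf x M d).IsSheaf := by
  rw [TopCat.Presheaf.isSheaf_iff_isSheaf_comp (CategoryTheory.forget AddCommGrpCat)]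
  apply TopCat.Presheaf.isSheaf_of_isSheafUniqueGluing_types
  intro ι U (sf : ∀ i, ULift.{u} (PLift (x ∈ U i)) → M.gr d) hsf
  have hc : ∀ i j (hi : x ∈ U i) (hj : x ∈ U j), sf i ⟨⟨hi⟩⟩ = sf j ⟨⟨hj⟩⟩ := fun i j hi hj =>
    congrFun (hsf i j) ⟨⟨mem_inf' hi hj⟩⟩
  have hm : ∀ h : ULift.{u} (PLift (x ∈ iSup U)), ∃ i, x ∈ U i := fun h => Opens.mem_iSup.1 h.down.down
  refine ⟨(fun h => sf (hm h).choose ⟨⟨(hm h).choose_spec⟩⟩ :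
    ULift.{u} (PLift (x ∈ iSup U)) → M.gr d), fun i => funext fun h => hc _ _ _ h.down.down, ?_⟩
  intro t ht
  refine funext fun h => ?_
  exact congrFun (ht (hm h).choose) ⟨⟨(hm h).choose_spec⟩⟩

/-- The skyscraper sheaf of graded modules with stalk `M` at `x`. -/
def sky : GMod X where
  sec d := ⟨skyPresheaf x M d, skyPresheaf_isSheaf x M d⟩
  smul {i j k} h U := AddMonoidHom.mk'
    (fun a => AddMonoidHom.mk'
      (fun (s : ULift.{u} (PLift (x ∈ U)) → M.gr j) =>
        (fun hx => ⟨X.germ x hx.down.down a.1 • (s hx).1,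
          h ▸ M.smul_mem (X.germ_mem_stalkGr x hx.down.down a.2) (s hx).2⟩ :
        ULift.{u} (PLift (x ∈ U)) → M.gr k))
      (fun s t => funext fun hx => Subtype.ext (smul_add _ _ _)))
    (fun a b => AddMonoidHom.ext fun s => funext fun hx => Subtype.ext (by
      change X.germ x hx.down.down (a.1 + b.1) • (_ : M.carrier) = _
      rw [map_add, add_smul]
      rfl))
  one_smul U s := funext fun hx => Subtype.ext (by
    change X.germ x hx.down.down 1 • (_ : M.carrier) = _
    rw [map_one, one_smul])
  mul_smul h h' U a b s := funext fun hx => Subtype.ext (by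
    change X.germ x hx.down.down (a.1 * b.1) • (_ : M.carrier) = _
    rw [map_mul, mul_smul]
    rfl)
  smul_res h U V f a s := funext fun hx => Subtype.ext (by
    change X.germ x (f.le hx.down.down) a.1 • (_ : M.carrier) = X.germ x hx.down.down (X.res f a.1) • _
    rw [X.germ_res]
    rfl)

end Skyscraper

/-- The module argument is applied to the graded ring at `x`: the skyscraper sheaf with value `A(d)
/ A A_d` has no sections of degree zero, so faithfulness makes its identity zero, and its sections
over the whole space in degree `-d` vanish. -/
theorem one_mem_pairing_stalk [h : (GMod.zeroFunctor X).Faithful] (x : X.carrier) (d : ℤ) :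
    (1 : X.stalk x) ∈ pairing (X.stalkGr x) d := by
  let M := GrMod.shiftQuotient (X.stalkGr x) d
  have hM : ∀ m : M.gr 0, m = 0 := fun m => Subtype.ext (GrMod.shiftQuotient_zero d m.1 m.2)
  let z : sky x M ⟶ sky x M := ⟨fun d => 0, fun h U a s => (map_zero ((sky x M).smul h U a)).symm⟩
  have hz : 𝟙 (sky x M) = z := by
    apply (GMod.zeroFunctor X).map_injective
    refine GradedRingedSpace.ZeroMod.hom_ext' fun U s => ?_
    refine funext fun hx => ?_
    exact (hM _).trans (hM _).symm
  refine GrMod.one_mem_pairing_of_shiftQuotient fun m hm => ?_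
  have h1 := congrArg (fun f : sky x M ⟶ sky x M =>
    (show ULift.{u} (PLift (x ∈ (⊤ : Opens X.carrier))) → M.gr (-d) from
      (GMod.Hom.app f (-d)).hom.app (op ⊤) (show ULift.{u} (PLift (x ∈ (⊤ : Opens X.carrier))) → M.gr (-d) from
        fun _ => ⟨m, hm⟩)) ⟨⟨trivial⟩⟩) hz
  exact congrArg Subtype.val h1

section LocalGraded

variable {A : Type u} [CommRing A] {𝒜 : ℤ → AddSubgroup A} [GradedRing 𝒜]

/-- A strictly larger homogeneous ideal `J` contains a homogeneous element outside the given one,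
hence, after multiplication, an element `z` of `A_0` outside `m`. It also contains `m`, as `(c w)_0
= c_0 w`. Since `m` is maximal, `1 = y z + w` for some `y` in `A_0` and `w` in `m`, so `1` lies in
`J`. -/
theorem isCoatom_largestIdeal (m : Ideal (𝒜 0)) [hm : m.IsMaximal] :
    IsCoatom (⟨largestIdeal m, largestIdeal_isHomogeneous m⟩ : HomogeneousIdeal 𝒜) := by
  have hp := hm.isPrime
  refine ⟨fun h => (GSpec.ofMax m).one_not_mem ?_, fun (J : HomogeneousIdeal 𝒜) hJ => ?_⟩
  · have : (1 : A) ∈ (⟨largestIdeal m, largestIdeal_isHomogeneous m⟩ : HomogeneousIdeal 𝒜) := by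
      rw [h]; trivial
    exact this
  · obtain ⟨a, haJ, ha⟩ := SetLike.exists_of_lt hJ
    have hd : ∃ d, ((DirectSum.decompose 𝒜 a d : 𝒜 d) : A) ∉ largestIdeal m := by
      by_contra! hc
      refine ha ?_
      change a ∈ largestIdeal m
      classical
      rw [← DirectSum.sum_support_decompose 𝒜 a]
      exact sum_mem fun d _ => hc d
    obtain ⟨d, hd⟩ := hd
    obtain ⟨c, hc, z, hz, hzm⟩ := not_mem_largestIdeal (SetLike.coe_mem _) hd
    have hzJ : (z : A) ∈ J := by
      rw [hz]
      exact J.toIdeal.mul_mem_left _ (J.is_homogeneous' d haJ)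
    obtain ⟨y, w, hw, hyw⟩ := hm.exists_inv hzm
    have hwJ : (w : A) ∈ J := by
      refine hJ.le ?_
      change (w : A) ∈ largestIdeal m
      intro c
      have : DirectSum.decompose 𝒜 (c * (w : A)) 0 = DirectSum.decompose 𝒜 c 0 * w :=
        Subtype.ext (by
          have := DirectSum.coe_decompose_mul_add_of_right_mem 𝒜 (i := 0) (j := 0) (a := c) w.2
          rwa [add_zero] at this)
      rw [this]
      exact m.mul_mem_left _ hw
    have h1 : (1 : A) ∈ J.toIdeal := by
      have e : (1 : A) = (y : A) * z + w := (congrArg Subtype.val hyw).symm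
      rw [e]
      exact J.toIdeal.add_mem (J.toIdeal.mul_mem_left _ hzJ) hwJ
    exact HomogeneousIdeal.ext ((Ideal.eq_top_iff_one _).2 h1)

/-- Without a unit of degree `1`, every product `a b` with `a` of degree `1` and `b` of degree `-1`
is a nonunit of `A_0`. It lies in some maximal ideal of `A_0`, hence in a maximal homogeneous ideal
over it. There is only one, so it would contain `1`, a sum of such products. -/
theorem isStandardRing_of_isLocalGraded (hl : IsLocalGraded 𝒜) (h : (1 : A) ∈ pairing 𝒜 1) :
    IsStandardRing 𝒜 := by
  obtain ⟨m, hm, hu⟩ := hl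
  by_contra hc
  have key : ∀ a ∈ 𝒜 1, ∀ b ∈ 𝒜 (-1), a * b ∈ m := by
    intro a ha b hb
    have hab : a * b ∈ 𝒜 0 := by simpa using SetLike.mul_mem_graded ha hb
    have hn : ¬ IsUnit (⟨a * b, hab⟩ : 𝒜 0) := by
      intro hu
      have : IsUnit (a * b) := hu.map (algebraMap (𝒜 0) A)
      exact hc ⟨a, ha, isUnit_of_mul_isUnit_left this⟩
    obtain ⟨m', hm', hmem⟩ := exists_max_ideal_of_mem_nonunits hn
    rw [← hu _ (isCoatom_largestIdeal m')]
    change a * b ∈ largestIdeal m'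
    intro c
    have : DirectSum.decompose 𝒜 (c * (a * b)) 0 = DirectSum.decompose 𝒜 c 0 * ⟨a * b, hab⟩ :=
      Subtype.ext (by
        have := DirectSum.coe_decompose_mul_add_of_right_mem 𝒜 (i := 0) (j := 0) (a := c) hab
        rwa [add_zero] at this)
    rw [this]
    exact m'.mul_mem_left _ hmem
  refine hm.1 (HomogeneousIdeal.ext ((Ideal.eq_top_iff_one _).2 ?_))
  have : pairing 𝒜 1 ≤ m.toIdeal.toAddSubgroup := by
    refine (AddSubgroup.closure_le _).2 ?_
    rintro _ ⟨a, ha, b, hb, rfl⟩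
    exact key a ha b hb
  exact this h

end LocalGraded

theorem GMod.zeroFunctor_isEquivalence_iff (hX : X.IsGradedScheme) :
    (GMod.zeroFunctor X).IsEquivalence ↔ X.IsStandard :=
  ⟨fun _ x => isStandardRing_of_isLocalGraded (hX.isLocal x) (one_mem_pairing_stalk x 1),
    fun h => (GMod.isQuasiInverse_coindFunctor h).isEquivalence_left⟩

/-! ### Standard points of spectra and of open subspaces. -/

section AffineUnits

variable {A : Type u} [CommRing A] {𝒜 : ℤ → AddSubgroup A} [GradedRing 𝒜]

variable (𝒜) in
/-- The homogeneous primes that do not contain `f`. -/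
def gBasicOpen (f : A) : Opens (gspecTop 𝒜) where
  carrier := {p | f ∉ GSpec.ideal p}
  is_open' := ⟨_, (PrimeSpectrum.basicOpen f).isOpen, rfl⟩

theorem exists_num_den {p : GSpec 𝒜} (h : IsStandardRing p.locGr) :
    ∃ (e : ℤ) (m a : A), m ∈ 𝒜 (1 + e) ∧ a ∈ 𝒜 e ∧ m ∉ p.ideal ∧ a ∉ p.ideal := by
  obtain ⟨_, ⟨e, m, a, hm, ha, rfl⟩, hu⟩ := h
  exact ⟨e, m, a, hm, ha, GSpec.num_not_mem hu, a.2.2⟩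

theorem isStandardRing_loc {p : GSpec 𝒜} {e : ℤ} {m a : A} (hm : m ∈ 𝒜 (1 + e)) (ha : a ∈ 𝒜 e)
    (hmp : m ∉ p.ideal) (hap : a ∉ p.ideal) : IsStandardRing p.locGr := by
  refine ⟨Localization.mk m (⟨a, ⟨e, ha⟩, hap⟩ : p.homCompl), p.mk_mem_locGr hm _ ha,
    IsUnit.of_mul_eq_one (Localization.mk a (⟨m, ⟨_, hm⟩, hmp⟩ : p.homCompl)) ?_⟩
  rw [Localization.mk_mul, ← Localization.mk_one, Localization.mk_eq_mk_iff,
    Localization.r_iff_exists]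
  exact ⟨1, by simp [mul_comm]⟩

variable [IsNoetherianRing A]

/-- The section `m / a` of degree `d`. -/
def fracSec {V : Opens (gspecTop 𝒜)} {d e : ℤ} {m a : A} (hm : m ∈ 𝒜 (d + e)) (ha : a ∈ 𝒜 e)
    (hV : ∀ q ∈ V, a ∉ GSpec.ideal q) : (gspec 𝒜).gr V d :=
  ⟨⟨fun q => q.1.frac m a ⟨e, ha⟩ (hV q.1 q.2), fun x => ⟨V, x.2, 𝟙 V, m, a, ⟨e, ha⟩,
    fun q => hV q.1 q.2, fun _ => rfl⟩⟩, fun x => ⟨V, x.2, 𝟙 V, e, m, a, hm, ha,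
    fun q => hV q.1 q.2, fun _ => rfl⟩⟩

omit [IsNoetherianRing A] in
theorem GSpec.frac_mul_frac (p : GSpec 𝒜) {m a : A} (hm : SetLike.IsHomogeneousElem 𝒜 m)
    (ha : SetLike.IsHomogeneousElem 𝒜 a) (hmp : m ∉ p.ideal) (hap : a ∉ p.ideal) :
    p.frac m a ha hap * p.frac a m hm hmp = 1 := by
  rw [GSpec.frac_mul, ← Localization.mk_one, GSpec.frac, Localization.mk_eq_mk_iff,
    Localization.r_iff_exists]
  exact ⟨1, by simp [mul_comm]⟩

theorem unitsOn_gspec {V : Opens (gspecTop 𝒜)} {d e : ℤ} {m a : A} (hm : m ∈ 𝒜 (d + e))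
    (ha : a ∈ 𝒜 e) (hmV : ∀ q ∈ V, m ∉ GSpec.ideal q) (haV : ∀ q ∈ V, a ∉ GSpec.ideal q) :
    (gspec 𝒜).UnitsOn V d :=
  ⟨fracSec hm ha haV, fracSec (d := -d) (e := d + e) (by simpa using ha) hm hmV,
    Subtype.ext (funext fun q => q.1.frac_mul_frac ⟨_, hm⟩ ⟨_, ha⟩ (hmV q.1 q.2) (haV q.1 q.2))⟩

/-- The stalk at `p` is never identified with `A_𝔭`. Inverse sections of degrees `1` and `-1` near
`p` have inverse values in `A_𝔭`; conversely a unit `m / a` of `A_𝔭` is the value of a section that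
is invertible on `D(m) ∩ D(a)`. -/
theorem gspec_isStandardPoint_iff (p : gspecTop 𝒜) :
    (gspec 𝒜).IsStandardPoint p ↔ IsStandardRing (GSpec.locGr p) := by
  constructor
  · intro h
    obtain ⟨V, hpV, a, b, hab⟩ := GradedRingedSpace.IsStandardPoint.unitsOn h
    refine ⟨a.1.1 ⟨p, hpV⟩, gspecGr_val a.2 ⟨p, hpV⟩, IsUnit.of_mul_eq_one (b.1.1 ⟨p, hpV⟩) ?_⟩
    exact congrFun (congrArg Subtype.val hab) ⟨p, hpV⟩
  · intro h
    obtain ⟨e, m, a, hm, ha, hmp, hap⟩ := exists_num_den h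
    refine GradedRingedSpace.UnitsOn.isStandardPoint (X := gspec 𝒜)
      (U := gBasicOpen 𝒜 m ⊓ gBasicOpen 𝒜 a) (unitsOn_gspec hm ha (fun q hq => hq.1) fun q hq => hq.2)
      (mem_inf' hmp hap)

end AffineUnits

/-- Both sides ask for inverse sections of degrees `1` and `-1` on a neighbourhood, and the
neighbourhood may be taken inside `U`. -/
theorem restrict_isStandardPoint_iff (X : GradedRingedSpace.{u}) (U : Opens X.carrier)
    (p : (X.restrict U).carrier) :
    (X.restrict U).IsStandardPoint p ↔ X.IsStandardPoint (show U from p).1 := by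
  constructor
  · intro h
    obtain ⟨V, hpV, hV⟩ := GradedRingedSpace.IsStandardPoint.unitsOn h
    have hV' : X.UnitsOn (U.isOpenEmbedding.isOpenMap.functor.obj V) 1 := hV
    exact hV'.isStandardPoint ⟨p, hpV, rfl⟩
  · intro h
    obtain ⟨V, hpV, hV⟩ := GradedRingedSpace.IsStandardPoint.unitsOn h
    let W : Opens (X.restrict U).carrier := (Opens.map U.inclusion').obj V
    have hW : U.isOpenEmbedding.isOpenMap.functor.obj W ≤ V := by
      rintro _ ⟨y, hy, rfl⟩
      exact hy
    have hW' : (X.restrict U).UnitsOn W 1 := hV.res (homOfLE hW)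
    exact hW'.isStandardPoint hpV

/-! ### Standard points of weighted projective spaces. -/

section Weighted

variable {A : Type u} [CommRing A] {n : ℕ} {w : Fin (n + 1) → ℕ}

/-- The degrees of the homogeneous fractions that are units at `p`. -/
def unitDegrees (p : GSpec (weightedGr A w)) : AddSubgroup ℤ where
  carrier := {d | ∃ (e : ℤ) (m a : MvPolynomial (Fin (n + 1)) A), m ∈ weightedGr A w (d + e) ∧
    a ∈ weightedGr A w e ∧ m ∉ p.ideal ∧ a ∉ p.ideal}
  zero_mem' := ⟨0, 1, 1, SetLike.one_mem_graded (weightedGr A w), SetLike.one_mem_graded (weightedGr A w),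
    p.one_not_mem, p.one_not_mem⟩
  add_mem' := by
    rintro d d' ⟨e, m, a, hm, ha, hmp, hap⟩ ⟨e', m', a', hm', ha', hmp', hap'⟩
    refine ⟨e + e', m * m', a * a', ?_, SetLike.mul_mem_graded ha ha', p.mul_not_mem hmp hmp',
      p.mul_not_mem hap hap'⟩
    have := SetLike.mul_mem_graded hm hm'
    rwa [show d + e + (d' + e') = d + d' + (e + e') by ring] at this
  neg_mem' := by
    rintro d ⟨e, m, a, hm, ha, hmp, hap⟩
    exact ⟨d + e, a, m, by rwa [neg_add_cancel_left], hm, hap, hmp⟩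

theorem X_mem_weightedGr (i : Fin (n + 1)) :
    (MvPolynomial.X i : MvPolynomial (Fin (n + 1)) A) ∈ weightedGr A w (w i) :=
  MvPolynomial.isWeightedHomogeneous_X A (fun i => (w i : ℤ)) i

/-- If every monomial of `f` were divisible by some variable in `p`, then `f` would lie in `p`. So
the degree of `f` is a combination of weights of variables outside `p`. -/
theorem exists_monomial {p : GSpec (weightedGr A w)} {d : ℤ} {f : MvPolynomial (Fin (n + 1)) A}
    (hf : f ∈ weightedGr A w d) (hp : f ∉ p.ideal) :
    ∃ α : Fin (n + 1) →₀ ℕ, (∑ i, (α i : ℤ) * w i) = d ∧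
      ∀ i, α i ≠ 0 → (MvPolynomial.X i : MvPolynomial (Fin (n + 1)) A) ∉ p.ideal := by
  by_contra! hc
  refine hp ?_
  change f ∈ p.ideal.toIdeal
  rw [f.as_sum]
  refine sum_mem fun α hα => ?_
  have hw : Finsupp.weight (fun i => (w i : ℤ)) α = d := hf (MvPolynomial.mem_support_iff.1 hα)
  rw [Finsupp.weight_apply, Finsupp.sum_fintype _ _ (by simp)] at hw
  obtain ⟨i, hi, hX⟩ := hc α (by simpa using hw)
  have h1 : (MvPolynomial.X i : MvPolynomial (Fin (n + 1)) A) ∣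
      MvPolynomial.monomial α (MvPolynomial.coeff α f) := by
    rw [MvPolynomial.X_dvd_monomial]
    exact Or.inr hi
  exact Ideal.mem_of_dvd _ h1 hX

-- By `exists_monomial` the number `g` divides the degree of every homogeneous polynomial outside
-- `p`, hence the degree of every homogeneous unit of `A_𝔭`. Conversely the degrees of units form a
-- cyclic group containing each `w_i` with `x_i ∉ p`; its generator divides `g`, and is `±1` if `g =
-- 1`.
open Classical in
theorem isStandardRing_weighted_iff (p : GSpec (weightedGr A w)) :
    IsStandardRing p.locGr ↔ (Finset.univ.filter fun i =>
      (MvPolynomial.X i : MvPolynomial (Fin (n + 1)) A) ∉ p.ideal.toIdeal).gcd w = 1 := by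
  set g := (Finset.univ.filter fun i =>
      (MvPolynomial.X i : MvPolynomial (Fin (n + 1)) A) ∉ p.ideal.toIdeal).gcd w with hg
  constructor
  · intro h
    obtain ⟨e, m, a, hm, ha, hmp, hap⟩ := exists_num_den h
    have key : ∀ {d : ℤ} {f : MvPolynomial (Fin (n + 1)) A}, f ∈ weightedGr A w d → f ∉ p.ideal →
        (g : ℤ) ∣ d := by
      intro d f hf hfp
      obtain ⟨α, rfl, hα⟩ := exists_monomial hf hfp
      refine Finset.dvd_sum fun i _ => ?_
      by_cases hi : α i = 0
      · simp [hi]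
      · refine Dvd.dvd.mul_left (Int.natCast_dvd_natCast.2 (Finset.gcd_dvd ?_)) _
        exact Finset.mem_filter.2 ⟨Finset.mem_univ _, hα i hi⟩
    have h1 : (g : ℤ) ∣ 1 := (Int.dvd_add_left (key ha hap)).1 (key hm hmp)
    exact Nat.dvd_one.1 (Int.natCast_dvd_natCast.1 h1)
  · intro h
    obtain ⟨k, hk⟩ := Int.subgroup_cyclic (unitDegrees p)
    have hdvd : k.natAbs ∣ g := by
      refine Finset.dvd_gcd fun i hi => ?_
      have : (w i : ℤ) ∈ unitDegrees p := ⟨0, MvPolynomial.X i, 1, by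
        rw [add_zero]; exact X_mem_weightedGr i, SetLike.one_mem_graded (weightedGr A w),
        (Finset.mem_filter.1 hi).2, p.one_not_mem⟩
      rw [hk, AddSubgroup.mem_closure_singleton] at this
      obtain ⟨l, hl⟩ := this
      rw [← Int.natCast_dvd_natCast, Int.natAbs_dvd, ← hl]
      exact ⟨l, by simp [mul_comm]⟩
    rw [h, Nat.dvd_one] at hdvd
    have h1 : (1 : ℤ) ∈ unitDegrees p := by
      rw [hk, AddSubgroup.mem_closure_singleton]
      rcases Int.natAbs_eq k with hk' | hk' <;> rw [hdvd] at hk'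
      · exact ⟨1, by rw [hk']; rfl⟩
      · exact ⟨-1, by rw [hk']; rfl⟩
    obtain ⟨e, m, a, hm, ha, hmp, hap⟩ := h1
    exact isStandardRing_loc hm ha hmp hap

/-- Evaluation at the `i`-th unit vector kills the other variables and sends `x_i` to `1`, so no
power of `x_i` lies in the ideal `I` of the other variables. The radical of `I` is the intersection
of the homogeneous primes above `I`, one of which must therefore miss `x_i`. -/
theorem exists_coordinate_prime [Nontrivial A] (i : Fin (n + 1)) :
    ∃ p : GSpec (weightedGr A w), (MvPolynomial.X i : MvPolynomial (Fin (n + 1)) A) ∉ p.ideal ∧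
      ∀ j, j ≠ i → (MvPolynomial.X j : MvPolynomial (Fin (n + 1)) A) ∈ p.ideal := by
  let I : Ideal (MvPolynomial (Fin (n + 1)) A) := Ideal.span (MvPolynomial.X '' {j | j ≠ i})
  have hI : I.IsHomogeneous (weightedGr A w) := by
    refine Ideal.homogeneous_span _ _ ?_
    rintro _ ⟨j, -, rfl⟩
    exact ⟨_, X_mem_weightedGr j⟩
  have hX : (MvPolynomial.X i : MvPolynomial (Fin (n + 1)) A) ∉ I.radical := by
    rintro ⟨k, hk⟩
    have hle : I ≤ RingHom.ker (MvPolynomial.aeval (R := A) (Pi.single i (1 : A))) := by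
      refine Ideal.span_le.2 ?_
      rintro _ ⟨j, hj, rfl⟩
      change MvPolynomial.aeval _ _ = _
      rw [MvPolynomial.aeval_X, Pi.single_eq_of_ne hj]
    have h1 : MvPolynomial.aeval (R := A) (Pi.single i (1 : A)) (MvPolynomial.X i ^ k) = 0 := hle hk
    rw [map_pow, MvPolynomial.aeval_X, Pi.single_eq_same, one_pow] at h1
    exact one_ne_zero h1
  rw [hI.radical_eq, Ideal.mem_sInf] at hX
  push Not at hX
  obtain ⟨P, ⟨hP, hle, hPp⟩, hXP⟩ := hX
  exact ⟨⟨⟨P, hP⟩, hPp⟩, hXP, fun j hj => hle (Ideal.subset_span ⟨j, hj, rfl⟩)⟩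

variable [IsNoetherianRing A]

theorem wproj_isStandardPoint_iff (p : (wproj A w).carrier) :
    (wproj A w).IsStandardPoint p ↔ weightGcd p = 1 :=
  ((restrict_isStandardPoint_iff (gspec (weightedGr A w)) (projOpen (weightedGr A w)) p).trans
    (gspec_isStandardPoint_iff _)).trans (isStandardRing_weighted_iff _)

/-- At a prime that contains exactly the variables other than `x_i` the greatest common divisor is
`w_i`. Conversely every point of the open set misses some variable, so if all weights are `1` the
greatest common divisor there is `1`. -/
theorem wproj_isStandard_iff [Nontrivial A] (hw : ∀ i, 0 < w i) :
    (wproj A w).IsStandard ↔ ∀ i, w i = 1 := by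
  classical
  constructor
  · intro h i
    obtain ⟨p, hi, hj⟩ := exists_coordinate_prime (A := A) (w := w) i
    have hp : p ∈ projOpen (weightedGr A w) := fun hc =>
      hi (hc (w i) (by exact_mod_cast hw i) _ (X_mem_weightedGr i))
    have h1 := (gspec_isStandardPoint_iff (𝒜 := weightedGr A w) p).1
      ((restrict_isStandardPoint_iff (gspec (weightedGr A w)) (projOpen (weightedGr A w)) ⟨p, hp⟩).1
      (h (show (wproj A w).carrier from (⟨p, hp⟩ : projOpen (weightedGr A w)))))
    rw [isStandardRing_weighted_iff] at h1
    have h2 : (Finset.univ.filter fun k =>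
      (MvPolynomial.X k : MvPolynomial (Fin (n + 1)) A) ∉ p.ideal.toIdeal) = {i} := by
      ext k
      simp only [Finset.mem_filter, Finset.mem_univ, true_and, Finset.mem_singleton]
      refine ⟨fun hk => by_contra fun hki => hk (hj k hki), ?_⟩
      rintro rfl
      exact hi
    rw [h2, Finset.gcd_singleton] at h1
    simpa using h1
  · intro h p
    rw [wproj_isStandardPoint_iff]
    have hp : ¬ ∀ d : ℤ, 0 < d → ∀ a ∈ weightedGr A w d,
      a ∈ GSpec.ideal (show projOpen (weightedGr A w) from p).1 :=
      (show projOpen (weightedGr A w) from p).2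
    push Not at hp
    obtain ⟨d, hd, f, hf, hfp⟩ := hp
    obtain ⟨α, hα, hX⟩ := exists_monomial hf hfp
    -- The monomial has degree `d > 0`, so it is not constant.
    have : ∃ i, α i ≠ 0 := by
      by_contra! hc
      simp only [hc] at hα
      simp at hα
      omega
    obtain ⟨i, hi⟩ := this
    have h1 : weightGcd p ∣ w i := Finset.gcd_dvd (Finset.mem_filter.2 ⟨Finset.mem_univ _, hX i hi⟩)
    rw [h i] at h1
    exact Nat.dvd_one.1 h1

end Weighted

/-! ### Presentations of sheaves of modules on a site, in terms of sections. -/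

section Presentations

open Limits

variable {C : Type u} [SmallCategory C] {J : GrothendieckTopology C} {R : Sheaf J RingCat.{u}}

namespace SheafModule

variable {M : SheafOfModules.{u} R}

/-- A family of submodules which is closed under gluing, as a sheaf of modules. -/
def subsheaf (N : M.val.Submodule)
    (h : ∀ (U : C) (m : M.val.obj (op U)) (S : Sieve U), S ∈ J U →
      (∀ V (f : V ⟶ U), S f → M.val.map f.op m ∈ N.obj (op V)) → m ∈ N.obj (op U)) :
    SheafOfModules.{u} R where
  val := N.toPresheafOfModules
  isSheaf := by
    rw [Presheaf.isSheaf_iff_isSheaf_forget J _ (CategoryTheory.forget AddCommGrpCat.{u}),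
      isSheaf_iff_isSheaf_of_type]
    have hM := M.isSheaf
    rw [Presheaf.isSheaf_iff_isSheaf_forget J _ (CategoryTheory.forget AddCommGrpCat.{u}),
      isSheaf_iff_isSheaf_of_type] at hM
    let F : Subfunctor (M.val.presheaf ⋙ CategoryTheory.forget AddCommGrpCat.{u}) :=
      { obj := fun U => {m | (show M.val.obj U from m) ∈ N.obj U}
        map := fun f m hm => N.map f hm }
    have hF : Presieve.IsSheaf J F.toFunctor := by
      rw [Subfunctor.isSheaf_iff _ hM]
      intro U s hs
      exact h U.unop s _ hs fun V f hf => hf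
    exact hF

def subsheafι (N : M.val.Submodule)
    (h : ∀ (U : C) (m : M.val.obj (op U)) (S : Sieve U), S ∈ J U →
      (∀ V (f : V ⟶ U), S f → M.val.map f.op m ∈ N.obj (op V)) → m ∈ N.obj (op U)) :
    subsheaf N h ⟶ M := ⟨N.ι⟩

instance (N : M.val.Submodule) (h) : Mono (subsheafι N h) :=
  (SheafOfModules.forget R).mono_of_mono_map (inferInstanceAs (Mono N.ι))

/-- Restriction of sections. -/
abbrev res (M : SheafOfModules.{u} R) {U V : C} (f : V ⟶ U) :
    M.val.obj (op U) →ₛₗ[(R.obj.map f.op).hom] M.val.obj (op V) := M.val.restrictₛₗ f.op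

theorem res_res {U V W : C} (f : V ⟶ U) (g : W ⟶ V) (m : M.val.obj (op U)) :
    res M g (res M f m) = res M (g ≫ f) m := by
  have := ConcreteCategory.congr_hom (M.val.presheaf.map_comp f.op g.op) m
  exact this.symm

/-- The value of a global section at `U`. -/
abbrev secAt (s : M.sections) (U : C) : M.val.obj (op U) := s.val (op U)

theorem res_section (s : M.sections) {U V : C} (f : V ⟶ U) : res M f (secAt s U) = secAt s V :=
  s.property f.op

theorem eq_of_locally {U : C} {m m' : M.val.obj (op U)} {S : Sieve U} (hS : S ∈ J U)
    (h : ∀ V (f : V ⟶ U), S f → res M f m = res M f m') : m = m' :=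
  M.isSheaf.isSeparated U S hS m m' (fun V f hf => h V f hf)

theorem surjective_of_isIso {N : SheafOfModules.{u} R} (f : N ⟶ M) [IsIso f] (U : C)
    (m : M.val.obj (op U)) : f.val.app (op U) ((inv f).val.app (op U) m) = m := by
  have := congrArg (fun g : M ⟶ M => g.val.app (op U) m) (IsIso.inv_hom_id f)
  exact this

theorem app_res {N : SheafOfModules.{u} R} (f : N ⟶ M) {U V : C} (g : V ⟶ U) (n : N.val.obj (op U)) :
    f.val.app (op V) (res N g n) = res M g (f.val.app (op U) n) :=
  PresheafOfModules.naturality_apply f.val g.op n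

variable {I : Type u}

/-- The linear combinations of the sections `s i` over `V`. -/
def spanOn (s : I → M.sections) (V : C) : Submodule (R.obj.obj (op V)) (M.val.obj (op V)) :=
  Submodule.span _ (Set.range fun i => secAt (s i) V)

theorem res_mem_spanOn (s : I → M.sections) {U V : C} (f : V ⟶ U) {m : M.val.obj (op U)}
    (hm : m ∈ spanOn s U) : res M f m ∈ spanOn s V := by
  have h : spanOn s U ≤ (spanOn s V).comap (res M f) := by
    refine Submodule.span_le.2 ?_
    rintro _ ⟨i, rfl⟩
    change res M f _ ∈ spanOn s V
    rw [res_section]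
    exact Submodule.subset_span ⟨i, rfl⟩
  exact h hm

/-- The restrictions to which `m` becomes a linear combination of the sections `s i`. -/
def spanSieve (s : I → M.sections) {U : C} (m : M.val.obj (op U)) : Sieve U where
  arrows V f := res M f m ∈ spanOn s V
  downward_closed := by
    intro V W f hf g
    rw [← res_res]
    exact res_mem_spanOn s g hf

/-- The sections which are locally linear combinations of the sections `s i`. -/
def locallySpanned (s : I → M.sections) : M.val.Submodule where
  obj U :=
    { carrier := {m | spanSieve s (U := U.unop) m ∈ J U.unop}
      zero_mem' := J.superset_covering (fun V f _ => by
        change res M f 0 ∈ _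
        rw [map_zero]; exact zero_mem _) (J.top_mem _)
      add_mem' := fun {a b} ha hb => J.superset_covering (fun V f hf => by
        change res M f (a + b) ∈ _
        rw [map_add]; exact add_mem hf.1 hf.2) (J.intersection_covering ha hb)
      smul_mem' := fun c a ha => J.superset_covering (fun V f hf => by
        change res M f (c • a) ∈ _
        rw [map_smulₛₗ]; exact Submodule.smul_mem _ _ hf) ha }
  map {U V} f m hm := by
    refine J.superset_covering (fun W g hg => ?_) (J.pullback_stable f.unop hm)
    change res M g (res M f.unop m) ∈ _
    rw [res_res]
    exact hg

theorem locallySpanned_local (s : I → M.sections) (U : C) (m : M.val.obj (op U)) (S : Sieve U)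
    (hS : S ∈ J U) (h : ∀ V (f : V ⟶ U), S f → M.val.map f.op m ∈ (locallySpanned s).obj (op V)) :
    m ∈ (locallySpanned s).obj (op U) := by
  refine J.transitive hS _ fun V f hf => J.superset_covering (fun W g hg => ?_) (h V f hf)
  change res M (g ≫ f) m ∈ _
  rw [← res_res]
  exact hg

/-- The locally spanned sections form a subsheaf through which the map from the free module factors.
If that map is an epimorphism then so is the inclusion of the subsheaf, which is a monomorphism as
well, hence an isomorphism. -/
theorem spanSieve_mem (s : I → M.sections) [Epi (M.freeHomEquiv.symm s)] {U : C}
    (m : M.val.obj (op U)) : spanSieve s m ∈ J U := by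
  let S := subsheaf (locallySpanned s) (locallySpanned_local s)
  let ι : S ⟶ M := subsheafι (locallySpanned s) (locallySpanned_local s)
  let s' : I → S.sections := fun i => PresheafOfModules.sectionsMk
    (fun V => ⟨(s i).val V, J.superset_covering (fun W g _ => by
      change res M g (secAt (s i) V.unop) ∈ _
      rw [res_section]
      exact Submodule.subset_span ⟨i, rfl⟩) (J.top_mem _)⟩)
    (fun V W f => Subtype.ext ((s i).property f))
  have h : S.freeHomEquiv.symm s' ≫ ι = M.freeHomEquiv.symm s := by
    rw [SheafOfModules.freeHomEquiv_symm_comp]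
    rfl
  have : Epi ι := by
    have : Epi (S.freeHomEquiv.symm s' ≫ ι) := h ▸ inferInstance
    exact epi_of_epi (S.freeHomEquiv.symm s') ι
  have : IsIso ι := isIso_of_mono_of_epi ι
  have h1 := surjective_of_isIso ι U m
  rw [← h1]
  exact ((inv ι).val.app (op U) m).2

/-- Two morphisms out of `M` that agree on the `s i` agree on their linear combinations, hence
locally on every section, hence everywhere by separatedness. -/
theorem epi_of_spanSieve_mem (s : I → M.sections)
    (h : ∀ (U : C) (m : M.val.obj (op U)), spanSieve s m ∈ J U) : Epi (M.freeHomEquiv.symm s) := by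
  refine ⟨fun {N} f g hfg => ?_⟩
  rw [SheafOfModules.freeHomEquiv_symm_comp, SheafOfModules.freeHomEquiv_symm_comp] at hfg
  have hs := N.freeHomEquiv.symm.injective hfg
  have hle : ∀ V, spanOn s V ≤ LinearMap.eqLocus (f.val.app (op V)).hom (g.val.app (op V)).hom := by
    intro V
    refine Submodule.span_le.2 ?_
    rintro _ ⟨i, rfl⟩
    exact congrArg (fun t : N.sections => t.val (op V)) (congrFun hs i)
  refine SheafOfModules.hom_ext (PresheafOfModules.hom_ext fun U => ?_)
  refine ModuleCat.hom_ext (LinearMap.ext fun m => ?_)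
  refine eq_of_locally (h U.unop m) fun V k hk => ?_
  have := hle V hk
  change f.val.app (op V) (res M k m) = g.val.app (op V) (res M k m) at this
  rw [app_res, app_res] at this
  exact this

section Kernel

variable {F : SheafOfModules.{u} R} (f : F ⟶ M)

/-- The kernel of a morphism, computed on sections. -/
def kerSubmodule : F.val.Submodule where
  obj U := LinearMap.ker (f.val.app U).hom
  map {U V} i m hm := by
    have := app_res f i.unop m
    change f.val.app V (res F i.unop m) = 0
    refine this.trans ?_
    rw [show f.val.app U m = 0 from hm]
    exact map_zero (res M i.unop)

theorem kerSubmodule_local (U : C) (m : F.val.obj (op U)) (S : Sieve U)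
    (hS : S ∈ J U) (h : ∀ V (i : V ⟶ U), S i → F.val.map i.op m ∈ (kerSubmodule f).obj (op V)) :
    m ∈ (kerSubmodule f).obj (op U) := by
  refine eq_of_locally (M := M) hS fun V i hi => ?_
  have h1 : f.val.app (op V) (res F i m) = 0 := h V i hi
  rw [app_res] at h1
  exact h1.trans (map_zero (res M i)).symm

def kerLift : subsheaf (kerSubmodule f) (kerSubmodule_local f) ⟶ kernel f :=
  kernel.lift f (subsheafι _ (kerSubmodule_local f))
    (SheafOfModules.hom_ext (PresheafOfModules.hom_ext fun _ =>
      ModuleCat.hom_ext (LinearMap.ext fun m => m.2)))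

/-- Relates the categorical kernel to the kernel computed on sections: a section killed by `f` comes
from the abstract kernel, through the sheaf of sections that `f` kills. -/
theorem ι_kerLift {U : C} {m : F.val.obj (op U)} (hm : f.val.app (op U) m = 0) :
    (kernel.ι f).val.app (op U) ((kerLift f).val.app (op U) ⟨m, hm⟩) = m := by
  have h : kerLift f ≫ kernel.ι f = subsheafι _ (kerSubmodule_local f) := kernel.lift_ι _ _ _
  exact congrArg (fun g : subsheaf _ (kerSubmodule_local f) ⟶ F => g.val.app (op U) ⟨m, hm⟩) h

theorem app_kernel_ι {U : C} (k : (kernel f).val.obj (op U)) :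
    f.val.app (op U) ((kernel.ι f).val.app (op U) k) = 0 :=
  congrArg (fun g : kernel f ⟶ M => g.val.app (op U) k) (kernel.condition f)

theorem kernel_ι_injective (U : C) : Function.Injective ((kernel.ι f).val.app (op U)) := by
  have h : Mono ((SheafOfModules.forget R).map (kernel.ι f)) := inferInstance
  have : Mono (kernel.ι f).val := h
  exact PresheafOfModules.injective_of_mono (kernel.ι f).val (X := op U)

end Kernel

/-- A relation `x` is a section of the kernel, which by `spanSieve_mem` is locally spanned by the
chosen generators; the inclusion of the kernel carries this statement to the free module. -/
theorem spanSieve_relations_mem (P : M.Presentation) {U : C}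
    (x : (SheafOfModules.free P.generators.I).val.obj (op U))
    (hx : P.generators.π.val.app (op U) x = 0) :
    spanSieve (fun j => SheafOfModules.sectionsMap (kernel.ι P.generators.π) (P.relations.s j)) x ∈
      J U := by
  have h := spanSieve_mem P.relations.s ((kerLift P.generators.π).val.app (op U) ⟨x, hx⟩)
  refine J.superset_covering (fun V i hi => ?_) h
  have h1 := Submodule.apply_mem_span_image_of_mem_span
    ((kernel.ι P.generators.π).val.app (op V)).hom hi
  change (kernel.ι P.generators.π).val.app (op V) (res _ i _) ∈ _ at h1
  rw [app_res, ι_kerLift] at h1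
  refine Submodule.span_mono ?_ h1
  rintro _ ⟨_, ⟨j, rfl⟩, rfl⟩
  exact ⟨j, rfl⟩

/-- A presentation from generators and generators of the module of relations. -/
def presentationOf {L : Type u} (s : I → M.sections)
    (κ : L → (SheafOfModules.free (R := R) I).sections)
    (hs : ∀ (U : C) (m : M.val.obj (op U)), spanSieve s m ∈ J U)
    (hκ : ∀ j U, (M.freeHomEquiv.symm s).val.app (op U) (secAt (κ j) U) = 0)
    (hrel : ∀ (U : C) (x : (SheafOfModules.free (R := R) I).val.obj (op U)),
      (M.freeHomEquiv.symm s).val.app (op U) x = 0 → spanSieve κ x ∈ J U) : M.Presentation where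
  generators := ⟨I, s, epi_of_spanSieve_mem s hs⟩
  relations :=
    { I := L
      s := fun j => SheafOfModules.sectionsMap (kerLift (M.freeHomEquiv.symm s))
        (PresheafOfModules.sectionsMk (fun U => ⟨(κ j).val U, hκ j U.unop⟩)
          (fun V W f => Subtype.ext ((κ j).property f)))
      epi := by
        refine epi_of_spanSieve_mem _ fun U k => ?_
        refine J.superset_covering (fun V i hi => ?_) (hrel U _ (app_kernel_ι _ k))
        have h1 : res _ i ((kernel.ι (M.freeHomEquiv.symm s)).val.app (op U) k) ∈
          spanOn κ V := hi
        rw [← app_res] at h1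
        have h2 : spanOn κ V ≤ Submodule.map ((kernel.ι (M.freeHomEquiv.symm s)).val.app (op V)).hom
            (spanOn (fun j => SheafOfModules.sectionsMap (kerLift (M.freeHomEquiv.symm s))
        (PresheafOfModules.sectionsMk (fun U => ⟨(κ j).val U, hκ j U.unop⟩)
          (fun V W f => Subtype.ext ((κ j).property f)))) V) := by
          refine Submodule.span_le.2 ?_
          rintro _ ⟨j, rfl⟩
          exact ⟨_, Submodule.subset_span ⟨j, rfl⟩, ι_kerLift _ (hκ j V)⟩
        -- The span is known in the free module only; injectivity of the kernel inclusion on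
        -- sections brings it back to the kernel.
        obtain ⟨y, hy, h3⟩ := h2 h1
        obtain rfl := kernel_ι_injective (M.freeHomEquiv.symm s) V h3
        exact hy }

section Coordinates

open Classical in
/-- The coordinates of a section of a free sheaf of modules. -/
def coord (i : I) : SheafOfModules.free (R := R) I ⟶ SheafOfModules.unit R :=
  (SheafOfModules.unit R).freeHomEquiv.symm
    (fun k => (SheafOfModules.unit R).unitHomEquiv (if k = i then 𝟙 _ else 0))

theorem freeHomEquiv_symm_app (s : I → M.sections) (i : I) (U : C) :
    (M.freeHomEquiv.symm s).val.app (op U) (secAt (SheafOfModules.freeSection (R := R) i) U) =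
      secAt (s i) U :=
  congrArg (fun t : M.sections => t.val (op U))
    (SheafOfModules.sectionsMap_freeHomEquiv_symm_freeSection s i)

open Classical in
theorem coord_freeSection (i k : I) (U : C) :
    (coord (R := R) i).val.app (op U) (secAt (SheafOfModules.freeSection k) U) =
      (show R.obj.obj (op U) from if k = i then 1 else 0) := by
  refine (freeHomEquiv_symm_app _ k U).trans ?_
  split_ifs <;> rfl

/-- The section of a free sheaf of modules with given coordinates. -/
def ofCoord (U : C) : (I →₀ R.obj.obj (op U)) →ₗ[R.obj.obj (op U)]
    (SheafOfModules.free (R := R) I).val.obj (op U) :=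
  Finsupp.linearCombination _ fun i => secAt (SheafOfModules.freeSection (R := R) i) U

/-- In particular `ofCoord` is injective. A section of an infinite free sheaf need only locally be
in its image, so coordinates are defined as morphisms of sheaves. -/
theorem coord_ofCoord {U : C} (c : I →₀ R.obj.obj (op U)) (i : I) :
    (coord (R := R) i).val.app (op U) (ofCoord U c) = (show R.obj.obj (op U) from c i) := by
  classical
  refine (map_finsuppSum ((coord (R := R) i).val.app (op U)).hom c _).trans ?_
  have hm : ∀ k, (coord (R := R) i).val.app (op U) (c k • secAt (SheafOfModules.freeSection k) U) =
      c k • (coord (R := R) i).val.app (op U) (secAt (SheafOfModules.freeSection k) U) :=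
    fun k => map_smul ((coord (R := R) i).val.app (op U)).hom _ _
  refine (Finset.sum_congr rfl fun k _ => (hm k).trans (congrArg (c k • ·) (coord_freeSection i k U))).trans ?_
  refine (Finset.sum_eq_single i ?_ ?_).trans ?_
  · intro b _ hb
    rw [if_neg hb]
    exact mul_zero (c b)
  · intro h
    rw [Finsupp.notMem_support_iff.1 h]
    exact zero_mul (M₀ := R.obj.obj (op U)) _
  · rw [if_pos rfl]
    exact mul_one (c i)

theorem freeHomEquiv_symm_ofCoord (s : I → M.sections) {U : C} (c : I →₀ R.obj.obj (op U)) :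
    (M.freeHomEquiv.symm s).val.app (op U) (ofCoord U c) =
      Finsupp.linearCombination (R.obj.obj (op U)) (fun i => secAt (s i) U) c := by
  refine (map_finsuppSum ((M.freeHomEquiv.symm s).val.app (op U)).hom c _).trans ?_
  refine Finset.sum_congr rfl fun k _ => ?_
  refine (map_smul ((M.freeHomEquiv.symm s).val.app (op U)).hom _ _).trans ?_
  exact congrArg (c k • ·) (freeHomEquiv_symm_app s k U)

/-- Restriction of coordinates. -/
abbrev resCoord (R : Sheaf J RingCat.{u}) {U V : C} (f : V ⟶ U) (c : I →₀ R.obj.obj (op U)) :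
    I →₀ R.obj.obj (op V) :=
  c.mapRange (R.obj.map f.op) (map_zero (R.obj.map f.op).hom)

theorem res_linearCombination (s : I → M.sections) {U V : C} (f : V ⟶ U)
    (c : I →₀ R.obj.obj (op U)) :
    res M f (Finsupp.linearCombination (R.obj.obj (op U)) (fun i => secAt (s i) U) c) =
      Finsupp.linearCombination (R.obj.obj (op V)) (fun i => secAt (s i) V) (resCoord R f c) := by
  refine Eq.trans ?_ (Finsupp.sum_mapRange_index fun i => zero_smul _ (secAt (s i) V)).symm
  rw [Finsupp.linearCombination_apply, Finsupp.sum, map_sum]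
  refine Finset.sum_congr rfl fun i _ => ?_
  rw [map_smulₛₗ, res_section]
  rfl

theorem res_ofCoord {U V : C} (f : V ⟶ U) (c : I →₀ R.obj.obj (op U)) :
    res _ f (ofCoord U c) = ofCoord V (resCoord R f c) :=
  res_linearCombination _ f c

theorem mem_spanOn {s : I → M.sections} {U : C} {x : M.val.obj (op U)} :
    x ∈ spanOn s U ↔ ∃ c : I →₀ R.obj.obj (op U),
      Finsupp.linearCombination (R.obj.obj (op U)) (fun i => secAt (s i) U) c = x :=
  Finsupp.mem_span_range_iff_exists_finsupp

theorem coord_linearCombination {L : Type u} (κ : L → (SheafOfModules.free (R := R) I).sections)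
    {U V : C} (f : V ⟶ U) (c : I →₀ R.obj.obj (op U)) (b : L →₀ R.obj.obj (op V))
    (h : Finsupp.linearCombination (R.obj.obj (op V)) (fun l => secAt (κ l) V) b =
      res _ f (ofCoord U c)) (n : I) :
    R.obj.map f.op (c n) = b.sum fun l a => a *
      (show R.obj.obj (op V) from (coord (R := R) n).val.app (op V) (secAt (κ l) V)) := by
  rw [res_ofCoord] at h
  refine (coord_ofCoord (resCoord R f c) n).symm.trans ((congrArg _ h.symm).trans ?_)
  refine (map_finsuppSum ((coord (R := R) n).val.app (op V)).hom b _).trans ?_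
  exact Finsupp.sum_congr fun l _ => map_smul ((coord (R := R) n).val.app (op V)).hom _ _

theorem ofCoord_linearCombination {L : Type u} (κ : L → (SheafOfModules.free (R := R) I).sections)
    {U V : C} (f : V ⟶ U) (c : I →₀ R.obj.obj (op U)) (b : L →₀ R.obj.obj (op V))
    (φ : L → I →₀ R.obj.obj (op V)) (hκ : ∀ l, secAt (κ l) V = ofCoord V (φ l))
    (h : resCoord R f c = Finsupp.linearCombination (R.obj.obj (op V)) φ b) :
    Finsupp.linearCombination (R.obj.obj (op V)) (fun l => secAt (κ l) V) b =
      res _ f (ofCoord U c) := by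
  rw [res_ofCoord, h]
  refine Eq.trans ?_ (map_finsuppSum (ofCoord V) b _).symm
  refine Finsupp.sum_congr fun l _ => ?_
  exact (congrArg (b l • ·) (hκ l)).trans (map_smul (ofCoord V) (b l) (φ l)).symm

/-- The map classified by the basis sections is the identity, an epimorphism, so every section is
locally a finite combination of basis sections. -/
theorem spanSieve_freeSection_mem {U : C} (x : (SheafOfModules.free (R := R) I).val.obj (op U)) :
    spanSieve (SheafOfModules.freeSection (R := R)) x ∈ J U := by
  have : Epi ((SheafOfModules.free (R := R) I).freeHomEquiv.symm SheafOfModules.freeSection) := by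
    have h : (SheafOfModules.free (R := R) I).freeHomEquiv.symm SheafOfModules.freeSection = 𝟙 _ :=
      Equiv.symm_apply_apply _ _
    rw [h]
    infer_instance
  exact spanSieve_mem _ x

end Coordinates

end SheafModule

end Presentations

/-! ### Quasi-coherence and coherence on `X₀` through generators and relations. -/

section LocalPresentations

variable {X : GradedRingedSpace.{u}}

namespace GradedRingedSpace

namespace ZeroMod

instance (G : X.ZeroMod) (U : Opens X.carrier) : Module (X.gr U 0) (Sec G U) :=
  inferInstanceAs (Module (X.zeroRing.obj.obj (op U)) (Sec G U))

/-- Restriction of families of sections of degree zero. -/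
def resFin {I : Type u} {U V : Opens X.carrier} (i : V ⟶ U) (c : I →₀ X.gr U 0) : I →₀ X.gr V 0 :=
  c.mapRange (X.resGr i 0) (map_zero _)

/-- Linear combinations of sections. -/
abbrev lin (G : X.ZeroMod) {U : Opens X.carrier} {I : Type u} (e : I → Sec G U) :
    (I →₀ X.gr U 0) →ₗ[X.gr U 0] Sec G U := Finsupp.linearCombination (X.gr U 0) e

theorem res_lin (G : X.ZeroMod) {U V : Opens X.carrier} (i : V ⟶ U) {I : Type u} (e : I → Sec G U)
    (c : I →₀ X.gr U 0) : res G i (lin G e c) = lin G (fun k => res G i (e k)) (resFin i c) := by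
  refine Eq.trans ?_ (Finsupp.sum_mapRange_index fun k => zero_smul (X.gr V 0) (res G i (e k))).symm
  rw [Finsupp.linearCombination_apply, Finsupp.sum, map_sum]
  exact Finset.sum_congr rfl fun k _ => res_act G i (c k) (e k)

/-- The sections `e` generate `G` over `U`, and the families `φ` generate their relations. -/
structure IsPresentedBy (G : X.ZeroMod) (U : Opens X.carrier) {I L : Type u} (e : I → Sec G U)
    (φ : L → I →₀ X.gr U 0) : Prop where
  gen : ∀ {V : Opens X.carrier} (i : V ⟶ U) (g : Sec G V) {x : X.carrier}, x ∈ V →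
    ∃ (W : Opens X.carrier) (_ : x ∈ W) (k : W ⟶ V) (c : I →₀ X.gr W 0),
      lin G (fun n => res G (k ≫ i) (e n)) c = res G k g
  rel : ∀ l, lin G e (φ l) = 0
  relgen : ∀ {V : Opens X.carrier} (i : V ⟶ U) (c : I →₀ X.gr V 0),
    lin G (fun n => res G i (e n)) c = 0 → ∀ {x : X.carrier}, x ∈ V →
    ∃ (W : Opens X.carrier) (_ : x ∈ W) (k : W ⟶ V) (b : L →₀ X.gr W 0),
      resFin k c = Finsupp.linearCombination (X.gr W 0) (fun l => resFin (k ≫ i) (φ l)) b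

theorem mem_over_iff {U : Opens X.carrier} {V : Over U} (S : Sieve V) :
    S ∈ ((Opens.grothendieckTopology X.carrier).over U) V ↔ ∀ x ∈ V.left,
      ∃ (W : Opens X.carrier) (k : W ⟶ V.left),
        S (Over.homMk k : Over.mk (k ≫ V.hom) ⟶ V) ∧ x ∈ W := by
  rw [GrothendieckTopology.mem_over_iff]
  refine forall₂_congr fun x _ => ?_
  constructor
  · rintro ⟨W, k, hk, hx⟩
    exact ⟨W, k, (Sieve.overEquiv_iff _ _).1 hk, hx⟩
  · rintro ⟨W, k, hk, hx⟩
    exact ⟨W, k, (Sieve.overEquiv_iff _ _).2 hk, hx⟩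

theorem eq_zero_of_locally (G : X.ZeroMod) {U : Opens X.carrier} (g : Sec G U)
    (h : ∀ x ∈ U, ∃ (W : Opens X.carrier) (_ : x ∈ W) (k : W ⟶ U), res G k g = 0) : g = 0 := by
  choose W hW k hk using h
  refine (ab G).eq_of_locally_eq' (fun x : U => W x.1 x.2) U (fun x => k x.1 x.2)
    (fun x hx => Opens.mem_iSup.2 ⟨⟨x, hx⟩, hW x hx⟩) _ _ fun x => ?_
  exact (hk x.1 x.2).trans (map_zero (res G (k x.1 x.2))).symm

theorem resFin_resFin {I : Type u} {U V W : Opens X.carrier} (i : V ⟶ U) (j : W ⟶ V)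
    (c : I →₀ X.gr U 0) : resFin j (resFin i c) = resFin (j ≫ i) c :=
  Finsupp.ext fun n => Subtype.ext (X.res_res i j (c n).1)

-- The index types of the presentation are part of the conclusion because its finiteness is read off
-- from them.
open SheafModule in
theorem IsPresentedBy.exists_presentation {G : X.ZeroMod} {U : Opens X.carrier} {I L : Type u}
    {e : I → Sec G U} {φ : L → I →₀ X.gr U 0} (h : IsPresentedBy G U e φ) :
    ∃ P : (G.over U).Presentation, P.generators.I = I ∧ P.relations.I = L := by
  let s : I → (G.over U).sections := fun n => PresheafOfModules.sectionsMk
    (fun V => res G V.unop.hom (e n)) (by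
      intro V W f
      exact res_res G V.unop.hom f.unop.left (e n))
  let κ : L → (SheafOfModules.free (R := X.zeroRing.over U) I).sections := fun l =>
    PresheafOfModules.sectionsMk
      (fun V => ofCoord V.unop (resFin V.unop.hom (φ l))) (by
        intro V W f
        refine (res_ofCoord f.unop _).trans ?_
        exact congrArg (ofCoord W.unop) (resFin_resFin V.unop.hom f.unop.left (φ l)))
  refine ⟨presentationOf s κ ?_ ?_ ?_, rfl, rfl⟩
  · intro V m
    rw [mem_over_iff]
    intro x hx
    obtain ⟨W, hW, k, c, hc⟩ := h.gen V.hom m hx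
    exact ⟨W, k, mem_spanOn.2 ⟨c, hc⟩, hW⟩
  · intro l V
    refine (freeHomEquiv_symm_ofCoord s (resFin V.hom (φ l))).trans ?_
    refine (res_lin G V.hom e (φ l)).symm.trans ?_
    rw [h.rel, map_zero]
    rfl
  · intro V x hx
    rw [mem_over_iff]
    intro p hp
    -- A relation is a section of the free sheaf and has finitely supported coordinates only
    -- locally; it is restricted to such an open set before `relgen` is applied.
    obtain ⟨W, k, hk, hW⟩ := (mem_over_iff _).1 (spanSieve_freeSection_mem x) p hp
    obtain ⟨c, hc⟩ := mem_spanOn.1 hk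
    have h1 : lin G (fun n => res G (k ≫ V.hom) (e n)) c = 0 := by
      refine (freeHomEquiv_symm_ofCoord s (U := Over.mk (k ≫ V.hom)) c).symm.trans ?_
      refine (congrArg _ hc).trans ?_
      refine (app_res _ _ _).trans ?_
      rw [hx, map_zero]
      rfl
    obtain ⟨W', hW', k', b, hb⟩ := h.relgen (k ≫ V.hom) c h1 hW
    refine ⟨W', k' ≫ k, mem_spanOn.2 ⟨b, ?_⟩, hW'⟩
    refine (ofCoord_linearCombination (R := X.zeroRing.over U) κ
      (Over.homMk k' : Over.mk (k' ≫ k ≫ V.hom) ⟶ Over.mk (k ≫ V.hom)) c b _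
      (fun l => rfl) hb).trans ?_
    exact (congrArg _ hc).trans (SheafModule.res_res _ _ _)

/-- On a noetherian space finitely many of the open sets `W` cover `U`. An index outside the
finitely many supports involved has `a i = 0` on each of these, hence on `U`. -/
theorem exists_finsupp_of_locally [NoetherianSpace X.carrier] {I : Type u} {U : Opens X.carrier}
    (a : I → X.gr U 0) (h : ∀ x ∈ U, ∃ (W : Opens X.carrier) (_ : x ∈ W) (k : W ⟶ U)
      (c : I →₀ X.gr W 0), ∀ i, X.resGr k 0 (a i) = c i) : ∃ c : I →₀ X.gr U 0, ⇑c = a := by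
  classical
  choose W hW k c hc using h
  obtain ⟨t, ht⟩ := (NoetherianSpace.isCompact (U : Set X.carrier)).elim_finite_subcover
    (fun x : U => (W x.1 x.2 : Set X.carrier)) (fun x => (W x.1 x.2).isOpen)
    (fun x hx => Set.mem_iUnion.2 ⟨⟨x, hx⟩, hW x hx⟩)
  have hfin : (Function.support a).Finite := by
    refine (t.biUnion fun x => (c x.1 x.2).support).finite_toSet.subset fun i hi => ?_
    by_contra hn
    refine hi (Subtype.ext (X.sheaf.eq_of_locally_eq' (fun x : t => W x.1.1 x.1.2) U
      (fun x => k x.1.1 x.1.2) (fun x hx => ?_) _ _ fun x => ?_))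
    · obtain ⟨y, hy⟩ := Set.mem_iUnion.1 (ht hx)
      obtain ⟨hyt, hy⟩ := Set.mem_iUnion.1 hy
      exact Opens.mem_iSup.2 ⟨⟨y, hyt⟩, hy⟩
    · have h1 : i ∉ (c x.1.1 x.1.2).support := fun h =>
        hn (Finset.mem_coe.2 (Finset.mem_biUnion.2 ⟨x.1, x.2, h⟩))
      have h2 := hc x.1.1 x.1.2 i
      rw [Finsupp.notMem_support_iff.1 h1] at h2
      exact (congrArg Subtype.val h2).trans (map_zero (X.res (k x.1.1 x.1.2))).symm
  exact ⟨Finsupp.ofSupportFinite a hfin, rfl⟩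

theorem linearCombination_apply_apply {S : Type*} [CommRing S] {I L : Type*} (ψ : L → I →₀ S)
    (b : L →₀ S) (n : I) :
    Finsupp.linearCombination S ψ b n = b.sum fun l a => a * ψ l n := by
  rw [Finsupp.linearCombination_apply, Finsupp.sum, Finsupp.finsetSum_apply]
  rfl

-- The relations are sections over `U` of a free sheaf. Their coordinates are locally of finite
-- support, and then of finite support over `U` because the space is noetherian; these coordinates
-- are the families `φ l`.
set_option maxHeartbeats 2000000 in
open SheafModule in
theorem exists_isPresentedBy [NoetherianSpace X.carrier] (G : X.ZeroMod) (U : Opens X.carrier)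
    (P : (G.over U).Presentation) :
    ∃ (e : P.generators.I → Sec G U) (φ : P.relations.I → P.generators.I →₀ X.gr U 0),
      IsPresentedBy G U e φ := by
  let s := P.generators.s
  let κ := fun l => SheafOfModules.sectionsMap (Limits.kernel.ι P.generators.π) (P.relations.s l)
  have hs : ∀ {V : Opens X.carrier} (i : V ⟶ U) (n), secAt (s n) (Over.mk i) =
      res G i (secAt (s n) (Over.mk (𝟙 U))) := fun i n =>
    (res_section (s n) (Over.homMk i : Over.mk i ⟶ Over.mk (𝟙 U))).symm
  let a : P.relations.I → P.generators.I → X.gr U 0 := fun l n =>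
    (coord (R := X.zeroRing.over U) n).val.app (op (Over.mk (𝟙 U))) (secAt (κ l) (Over.mk (𝟙 U)))
  have ha : ∀ {V : Opens X.carrier} (i : V ⟶ U) l n,
      (coord (R := X.zeroRing.over U) n).val.app (op (Over.mk i)) (secAt (κ l) (Over.mk i)) =
        X.resGr i 0 (a l n) := by
    intro V i l n
    have h1 := res_section (κ l) (Over.homMk i : Over.mk i ⟶ Over.mk (𝟙 U))
    rw [← h1, app_res]
    rfl
  have hloc : ∀ l, ∀ x ∈ U, ∃ (W : Opens X.carrier) (_ : x ∈ W) (k : W ⟶ U)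
      (c : P.generators.I →₀ X.gr W 0), ofCoord (Over.mk k) c = secAt (κ l) (Over.mk k) ∧
        ∀ i, X.resGr k 0 (a l i) = c i := by
    intro l x hx
    obtain ⟨W, k, hk, hW⟩ := (mem_over_iff _).1
      (spanSieve_freeSection_mem (secAt (κ l) (Over.mk (𝟙 U)))) x hx
    obtain ⟨c, hc⟩ := mem_spanOn.1 hk
    rw [res_section] at hc
    refine ⟨W, hW, k, c, hc, fun i => ?_⟩
    rw [← ha k l i]
    refine (congrArg _ hc.symm).trans ?_
    exact coord_ofCoord c i
  choose φ hφ using fun l => exists_finsupp_of_locally (a l) fun x hx => by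
    obtain ⟨W, hW, k, c, -, hc⟩ := hloc l x hx
    exact ⟨W, hW, k, c, hc⟩
  have hκ : ∀ l, ∀ x ∈ U, ∃ (W : Opens X.carrier) (_ : x ∈ W) (k : W ⟶ U),
      ofCoord (Over.mk k) (resFin k (φ l)) = secAt (κ l) (Over.mk k) := by
    intro l x hx
    obtain ⟨W, hW, k, c, hc, hc'⟩ := hloc l x hx
    refine ⟨W, hW, k, ?_⟩
    rw [← hc]
    refine congrArg _ (Finsupp.ext fun i => ?_)
    refine Eq.trans ?_ (hc' i)
    exact congrArg (X.resGr k 0) (congrFun (hφ l) i)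
  let e : P.generators.I → Sec G U := fun n => secAt (s n) (Over.mk (𝟙 U))
  have hlin : ∀ {V : Opens X.carrier} (i : V ⟶ U) (c : P.generators.I →₀ X.gr V 0),
      Finsupp.linearCombination ((X.zeroRing.over U).obj.obj (op (Over.mk i)))
        (fun n => secAt (s n) (Over.mk i)) c = lin G (fun n => res G i (e n)) c := 
    fun {V} i c => congrArg (fun e' : P.generators.I → Sec G V => lin G e' c) (funext fun n => hs i n)
  refine ⟨e, φ, ?_, ?_, ?_⟩
  · intro V i g x hx
    obtain ⟨W, k, hk, hW⟩ := (mem_over_iff _).1 (spanSieve_mem s (U := Over.mk i) g) x hx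
    obtain ⟨c, hc⟩ := mem_spanOn.1 hk
    exact ⟨W, hW, k, c, (hlin (k ≫ i) c).symm.trans hc⟩
  · intro l
    -- Only locally is the relation section the combination with coordinates `φ l`, so the vanishing
    -- is checked locally as well.
    refine eq_zero_of_locally G (lin G e (φ l)) fun x hx => ?_
    obtain ⟨W, hW, k, hk⟩ := hκ l x hx
    refine ⟨W, hW, k, ?_⟩
    have h1 := freeHomEquiv_symm_ofCoord s (U := Over.mk k) (resFin k (φ l))
    have h2 : P.generators.π.val.app (op (Over.mk k)) (secAt (κ l) (Over.mk k)) = 0 :=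
      app_kernel_ι _ _
    refine (res_lin G k e (φ l)).trans ((hlin k _).symm.trans ?_)
    exact h1.symm.trans ((congrArg _ hk).trans h2)
  · intro V i c hc x hx
    have h0 : P.generators.π.val.app (op (Over.mk i)) (ofCoord (Over.mk i) c) = 0 :=
      (freeHomEquiv_symm_ofCoord s (U := Over.mk i) c).trans ((hlin i c).trans hc)
    obtain ⟨W, k, hk, hW⟩ := (mem_over_iff _).1 (spanSieve_relations_mem P _ h0) x hx
    obtain ⟨b, hb⟩ := mem_spanOn.1 hk
    let b' : P.relations.I →₀ X.gr W 0 := b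
    refine ⟨W, hW, k, b', Finsupp.ext fun n => ?_⟩
    refine (coord_linearCombination (R := X.zeroRing.over U) κ
      (Over.homMk k : Over.mk (k ≫ i) ⟶ Over.mk i) c b hb n).trans ?_
    refine Eq.trans ?_ (linearCombination_apply_apply (S := X.gr W 0) _ b' n).symm
    refine Finset.sum_congr rfl fun l _ => ?_
    refine congrArg (fun z : X.gr W 0 => b' l * z) ((ha (k ≫ i) l n).trans ?_)
    exact congrArg (X.resGr (k ≫ i) 0) (congrFun (hφ l) n).symm

end ZeroMod

end GradedRingedSpace

end LocalPresentations

namespace GradedRingedSpace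

variable {X : GradedRingedSpace.{u}}

namespace ZeroMod

theorem coversTop_iff {X : TopCat.{u}} {ι : Type*} (Y : ι → Opens X) :
    (Opens.grothendieckTopology X).CoversTop Y ↔ ∀ x : X, ∃ i, x ∈ Y i := by
  constructor
  · intro h x
    obtain ⟨V, f, hf, hx⟩ := h ⊤ x trivial
    obtain ⟨i, ⟨g⟩⟩ := (Sieve.mem_ofObjects_iff _ _).1 hf
    exact ⟨i, g.le hx⟩
  · intro h W x hx
    obtain ⟨i, hi⟩ := h x
    exact ⟨W ⊓ Y i, Opens.infLELeft _ _, (Sieve.mem_ofObjects_iff _ _).2 ⟨i, ⟨Opens.infLERight _ _⟩⟩,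
      mem_inf' hx hi⟩

/-- Replaces presentations in slice categories by families of sections and coefficients, in which
form the graded and the ungraded side can be compared directly. -/
theorem isQCoh_iff [NoetherianSpace X.carrier] (G : X.ZeroMod) :
    isQCoh X G ↔ ∀ x, ∃ (U : Opens X.carrier) (_ : x ∈ U) (I L : Type u) (e : I → Sec G U)
      (φ : L → I →₀ X.gr U 0), IsPresentedBy G U e φ := by
  constructor
  · rintro ⟨⟨q⟩⟩ x
    obtain ⟨i, hi⟩ := (coversTop_iff q.X).1 q.coversTop x
    obtain ⟨e, φ, h⟩ := exists_isPresentedBy G (q.X i) (q.presentation i)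
    exact ⟨_, hi, _, _, e, φ, h⟩
  · intro h
    choose U hU I L e φ h using h
    choose P hP using fun x => (h x).exists_presentation
    let q : SheafOfModules.QuasicoherentData.{u, u, u, u} (C := Opens X.carrier) (R := X.zeroRing) G :=
      { I := X.carrier
        X := U
        coversTop := (coversTop_iff U).2 fun x => ⟨x, hU x⟩
        presentation := P }
    exact q.isQuasicoherent

theorem isCoh_iff [NoetherianSpace X.carrier] (G : X.ZeroMod) :
    isCoh X G ↔ ∀ x, ∃ (U : Opens X.carrier) (_ : x ∈ U) (I L : Type u) (_ : Finite I)
      (_ : Finite L) (e : I → Sec G U) (φ : L → I →₀ X.gr U 0), IsPresentedBy G U e φ := by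
  constructor
  · rintro ⟨q, hq⟩ x
    obtain ⟨i, hi⟩ := (coversTop_iff q.X).1 q.coversTop x
    obtain ⟨e, φ, h⟩ := exists_isPresentedBy G (q.X i) (q.presentation i)
    have h1 := hq.isFinite_presentation i
    exact ⟨_, hi, _, _, h1.isFiniteType_generators.finite, h1.isFiniteType_relations.finite, e, φ, h⟩
  · intro h
    choose U hU I L hI hL e φ h using h
    choose P hP using fun x => (h x).exists_presentation
    let q : SheafOfModules.QuasicoherentData.{u, u, u, u} (C := Opens X.carrier) (R := X.zeroRing) G :=
      { I := X.carrier
        X := U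
        coversTop := (coversTop_iff U).2 fun x => ⟨x, hU x⟩
        presentation := P }
    have hq : ∀ x, (P x).IsFinite := fun x =>
      { isFiniteType_generators := ⟨(hP x).1 ▸ hI x⟩
        isFiniteType_relations := ⟨(hP x).2 ▸ hL x⟩ }
    have hq' : q.IsFinitePresentation := { isFinite_presentation := hq }
    change SheafOfModules.IsFinitePresentation (R := X.zeroRing) G
    exact { exists_quasicoherentData := ⟨q, hq'⟩ }

instance : (isQCoh X).IsClosedUnderIsomorphisms :=
  inferInstanceAs (SheafOfModules.isQuasicoherent X.zeroRing).IsClosedUnderIsomorphisms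

instance : (isCoh X).IsClosedUnderIsomorphisms :=
  inferInstanceAs (SheafOfModules.isFinitePresentation X.zeroRing).IsClosedUnderIsomorphisms

end ZeroMod

end GradedRingedSpace

/-! ### Graded localization at homogeneous elements. -/

section Localization

variable {A : Type u} [CommRing A] (𝒜 : ℤ → AddSubgroup A)

/-- The grading of the localization at a multiplicative system `S` of homogeneous elements. -/
def locGrading (S : Submonoid A) [SetLike.GradedMonoid 𝒜] (d : ℤ) : AddSubgroup (Localization S) where
  carrier := {x | ∃ (e : ℤ) (m : A) (a : S), m ∈ 𝒜 (d + e) ∧ (a : A) ∈ 𝒜 e ∧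
    x = Localization.mk m a}
  zero_mem' := ⟨0, 0, 1, zero_mem _, SetLike.one_mem_graded 𝒜, (Localization.mk_zero _).symm⟩
  add_mem' := by
    rintro _ _ ⟨e, m, a, hm, ha, rfl⟩ ⟨e', m', a', hm', ha', rfl⟩
    refine ⟨e + e', a * m' + a' * m, a * a', add_mem ?_ ?_, SetLike.mul_mem_graded ha ha', ?_⟩
    · have := SetLike.mul_mem_graded ha hm'
      rwa [show e + (d + e') = d + (e + e') by ring] at this
    · have := SetLike.mul_mem_graded ha' hm
      rwa [show e' + (d + e) = d + (e + e') by ring] at this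
    · rw [Localization.add_mk]
  neg_mem' := by
    rintro _ ⟨e, m, a, hm, ha, rfl⟩
    exact ⟨e, -m, a, neg_mem hm, ha, by rw [Localization.neg_mk]⟩

variable [GradedRing 𝒜] (S : Submonoid A)

variable {𝒜 S} in
theorem mk_mem_locGrading {d e : ℤ} {m : A} (hm : m ∈ 𝒜 (d + e)) (a : S)
    (ha : (a : A) ∈ 𝒜 e) : Localization.mk m a ∈ locGrading 𝒜 S d := ⟨e, m, a, hm, ha, rfl⟩

theorem locGrading_common_denom (s : Finset ℤ) (f : ℤ → Localization S)
    (hf : ∀ d, f d ∈ locGrading 𝒜 S d) :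
    ∃ (E : ℤ) (b : S) (n : ℤ → A), (b : A) ∈ 𝒜 E ∧ (∀ d, n d ∈ 𝒜 (d + E)) ∧
      ∀ d ∈ s, f d = Localization.mk (n d) b := by
  classical
  induction s using Finset.induction_on with
  | empty => exact ⟨0, 1, 0, SetLike.one_mem_graded 𝒜, fun d => zero_mem _, by simp⟩
  | insert i s hi ih =>
    obtain ⟨E, b, n, hb, hn, h⟩ := ih
    obtain ⟨e, m, a, hm, ha, hx⟩ := hf i
    refine ⟨e + E, a * b, fun d => if d = i then b * m else a * n d,
      SetLike.mul_mem_graded ha hb, ?_, ?_⟩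
    · intro d
      dsimp only
      split_ifs with hd
      · subst hd
        have := SetLike.mul_mem_graded hb hm
        rwa [show E + (d + e) = d + (e + E) by ring] at this
      · have := SetLike.mul_mem_graded ha (hn d)
        rwa [show e + (d + E) = d + (e + E) by ring] at this
    · intro d hd
      dsimp only
      split_ifs with hdi
      · subst hdi
        rw [hx, Localization.mk_eq_mk_iff, Localization.r_iff_exists]
        exact ⟨1, by push_cast; ring⟩
      · rw [h d (Finset.mem_of_mem_insert_of_ne hd hdi), Localization.mk_eq_mk_iff,
          Localization.r_iff_exists]
        exact ⟨1, by push_cast; ring⟩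

variable [hS : Fact (∀ s ∈ S, SetLike.IsHomogeneousElem 𝒜 s)]

theorem locGrading_isInternal : DirectSum.IsInternal (locGrading 𝒜 S) := by
  apply isInternal_of
  · intro x
    induction x using Localization.induction_on with
    | H y =>
      obtain ⟨m, a⟩ := y
      obtain ⟨e, he⟩ := hS.out a a.2
      classical
      have : (Localization.mk m a : Localization S) =
          ∑ i ∈ (DirectSum.decompose 𝒜 m).support,
            Localization.mk ((DirectSum.decompose 𝒜 m i : 𝒜 i) : A) a := by
        rw [← Localization.mk_sum, DirectSum.sum_support_decompose]
      rw [this]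
      refine sum_mem fun i _ => ?_
      refine AddSubgroup.mem_iSup_of_mem (i - e) (mk_mem_locGrading (e := e) ?_ a he)
      rw [sub_add_cancel]
      exact SetLike.coe_mem _
  · intro s f hf h0 d hd
    obtain ⟨E, b, n, hb, hn, h⟩ := locGrading_common_denom 𝒜 S s f hf
    rw [Finset.sum_congr rfl h, ← Localization.mk_sum, Localization.mk_eq_mk',
      IsLocalization.mk'_eq_zero_iff] at h0
    obtain ⟨c, hc⟩ := h0
    obtain ⟨e, he⟩ := hS.out c c.2
    rw [Finset.mul_sum] at hc
    have := eq_zero_of_sum_eq_zero (𝒜 := 𝒜) (e + E) s (fun d => c * n d) (fun d => by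
      have := SetLike.mul_mem_graded he (hn d)
      rwa [show e + (d + E) = d + (e + E) by ring] at this) hc d hd
    rw [h d hd, Localization.mk_eq_mk', IsLocalization.mk'_eq_zero_iff]
    exact ⟨c, this⟩

instance : SetLike.GradedMonoid (locGrading 𝒜 S) where
  one_mem := ⟨0, 1, 1, SetLike.one_mem_graded 𝒜, SetLike.one_mem_graded 𝒜,
    Localization.mk_one.symm⟩
  mul_mem := by
    rintro i j _ _ ⟨e, m, a, hm, ha, rfl⟩ ⟨e', m', a', hm', ha', rfl⟩
    refine ⟨e + e', m * m', a * a', ?_, SetLike.mul_mem_graded ha ha', Localization.mk_mul _ _ _ _⟩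
    have := SetLike.mul_mem_graded hm hm'
    rwa [show (i + e) + (j + e') = i + j + (e + e') by ring] at this

instance : GradedRing (locGrading 𝒜 S) where
  toDecomposition := (locGrading_isInternal 𝒜 S).chooseDecomposition

/-- The localization map as a homomorphism of graded rings. -/
def toLoc : 𝒜 →+*ᵍ locGrading 𝒜 S where
  toRingHom := algebraMap A (Localization S)
  map_mem {d a} ha := ⟨0, a, 1, by simpa using ha, SetLike.one_mem_graded 𝒜, Localization.mk_one_eq_algebraMap a |>.symm⟩

end Localization

/-! ### Maps of spectra, and the spectrum of `A_f` as the open subspace `D(f)`. -/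

section Comap

variable {A B : Type u} [CommRing A] [CommRing B] {𝒜 : ℤ → AddSubgroup A} {ℬ : ℤ → AddSubgroup B}
  [GradedRing 𝒜] [GradedRing ℬ] (φ : 𝒜 →+*ᵍ ℬ)

/-- The map of spectra attached to a homomorphism of graded rings. -/
def GSpec.comap (q : GSpec ℬ) : GSpec 𝒜 := ⟨q.ideal.comap φ, q.isPrime.comap φ⟩

theorem GSpec.mem_comap {q : GSpec ℬ} {a : A} : a ∈ (q.comap φ).ideal ↔ φ a ∈ q.ideal := Iff.rfl

theorem GSpec.continuous_comap : Continuous (GSpec.comap φ) :=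
  continuous_induced_rng.2
    ((PrimeSpectrum.continuous_comap (φ : A →+* B)).comp (continuous_induced_dom (f := GSpec.toPrime)))

omit [GradedRing 𝒜] [GradedRing ℬ] in
theorem isHom_map {a : A} (ha : SetLike.IsHomogeneousElem 𝒜 a) : SetLike.IsHomogeneousElem ℬ (φ a) :=
  ha.imp fun _ h => φ.map_mem h

theorem GSpec.homCompl_le_comap (q : GSpec ℬ) :
    (q.comap φ).homCompl ≤ q.homCompl.comap (φ : A →+* B) :=
  fun _ ha => ⟨isHom_map φ ha.1, ha.2⟩

/-- The homomorphism of local rings attached to a homomorphism of graded rings. -/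
def GSpec.locMap (q : GSpec ℬ) : (q.comap φ).Loc →+* q.Loc :=
  IsLocalization.map q.Loc (φ : A →+* B) (q.homCompl_le_comap φ)

theorem GSpec.locMap_frac (q : GSpec ℬ) (m a : A) (ha : SetLike.IsHomogeneousElem 𝒜 a)
    (hp : a ∉ (q.comap φ).ideal) :
    q.locMap φ ((q.comap φ).frac m a ha hp) = 
      q.frac (φ m) (φ a) (isHom_map φ ha) (mt (GSpec.mem_comap φ).2 hp) := by
  unfold GSpec.frac GSpec.locMap
  rw [Localization.mk_eq_mk', IsLocalization.map_mk', Localization.mk_eq_mk']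
  rfl

theorem GSpec.frac_eq_iff (p : GSpec 𝒜) {m a m' a' : A} {ha : SetLike.IsHomogeneousElem 𝒜 a}
    {hp : a ∉ p.ideal} {ha' : SetLike.IsHomogeneousElem 𝒜 a'} {hp' : a' ∉ p.ideal} :
    p.frac m a ha hp = p.frac m' a' ha' hp' ↔ ∃ c, SetLike.IsHomogeneousElem 𝒜 c ∧ c ∉ p.ideal ∧
      c * (a' * m) = c * (a * m') := by
  unfold GSpec.frac
  rw [Localization.mk_eq_mk_iff, Localization.r_iff_exists]
  exact ⟨fun ⟨c, h⟩ => ⟨c, c.2.1, c.2.2, h⟩, fun ⟨c, h, h', h''⟩ => ⟨⟨c, h, h'⟩, h''⟩⟩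

theorem GSpec.frac_eq_zero_iff (p : GSpec 𝒜) {m a : A} {ha : SetLike.IsHomogeneousElem 𝒜 a}
    {hp : a ∉ p.ideal} :
    p.frac m a ha hp = 0 ↔ ∃ c, SetLike.IsHomogeneousElem 𝒜 c ∧ c ∉ p.ideal ∧ c * m = 0 := by
  unfold GSpec.frac
  rw [Localization.mk_eq_mk', IsLocalization.mk'_eq_zero_iff]
  exact ⟨fun ⟨c, h⟩ => ⟨c, c.2.1, c.2.2, h⟩, fun ⟨c, h, h', h''⟩ => ⟨⟨c, h, h'⟩, h''⟩⟩

theorem GSpec.exists_frac (p : GSpec 𝒜) (x : p.Loc) : ∃ m a ha hp, x = p.frac m a ha hp := by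
  induction x using Localization.induction_on with
  | H y => exact ⟨y.1, y.2.1, y.2.2.1, y.2.2.2, rfl⟩

end Comap

section BasicOpen

variable {A : Type u} [CommRing A] {𝒜 : ℤ → AddSubgroup A} [GradedRing 𝒜] (f : A)

local notation "S" => Submonoid.powers f

theorem isHom_powers {f : A} (hf : SetLike.IsHomogeneousElem 𝒜 f) :
    ∀ s ∈ Submonoid.powers f, SetLike.IsHomogeneousElem 𝒜 s := by
  obtain ⟨e, he⟩ := hf
  rintro _ ⟨n, rfl⟩
  exact ⟨n • e, SetLike.pow_mem_graded n he⟩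

theorem isUnit_toLoc (s : S) : IsUnit (toLoc 𝒜 S (s : A)) :=
  IsLocalization.map_units (Localization S) s

theorem mk_mul_toLoc (m : A) (s : S) :
    (Localization.mk m s : Localization S) * toLoc 𝒜 S s = toLoc 𝒜 S m := by
  rw [Localization.mk_eq_mk']
  exact IsLocalization.mk'_spec _ _ _

variable [hS : Fact (∀ s ∈ Submonoid.powers f, SetLike.IsHomogeneousElem 𝒜 s)]

theorem toLoc_not_mem (q : GSpec (locGrading 𝒜 S)) (s : S) : toLoc 𝒜 S (s : A) ∉ q.ideal :=
  fun h => q.isPrime.ne_top (Ideal.eq_top_of_isUnit_mem _ h (isUnit_toLoc f s))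

/-- The iterated fraction `(m / s') / (n / s)` is `(m s) / (n s')`, a fraction of elements of `A`.
-/
theorem frac_mk (q : GSpec (locGrading 𝒜 S)) (m n : A) (s s' : S)
    (h : SetLike.IsHomogeneousElem (locGrading 𝒜 S) (Localization.mk n s))
    (hq : (Localization.mk n s : Localization S) ∉ q.ideal)
    (h' : SetLike.IsHomogeneousElem 𝒜 (n * s')) :
    ∃ hq' : n * (s' : A) ∉ (q.comap (toLoc 𝒜 S)).ideal,
      q.frac (Localization.mk m s') (Localization.mk n s) h hq =
        q.locMap (toLoc 𝒜 S) ((q.comap _).frac (m * s) (n * s') h' hq') := by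
  have hm := mk_mul_toLoc (𝒜 := 𝒜) f m s'
  have hn := mk_mul_toLoc (𝒜 := 𝒜) f n s
  refine ⟨fun hmem => ?_, ?_⟩
  · rw [GSpec.mem_comap, map_mul, ← hn] at hmem
    exact q.mul_not_mem (q.mul_not_mem hq (toLoc_not_mem f q s)) (toLoc_not_mem f q s') hmem
  · rw [GSpec.locMap_frac, GSpec.frac_eq_iff]
    refine ⟨1, isHom_one, q.one_not_mem, ?_⟩
    rw [map_mul, map_mul, ← hm, ← hn]
    ring

/-- The numerator and denominator are chosen before `q`: a function equal to `b / c` on an open set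
has to be given by one and the same fraction `m / a` at all its points. -/
theorem exists_frac_toLoc (b c : Localization S) (hc : SetLike.IsHomogeneousElem (locGrading 𝒜 S) c) :
    ∃ (m a : A) (ha : SetLike.IsHomogeneousElem 𝒜 a), ∀ (q : GSpec (locGrading 𝒜 S)) (hq : c ∉ q.ideal),
      ∃ hq', q.frac b c hc hq = q.locMap (toLoc 𝒜 S) ((q.comap _).frac m a ha hq') := by
  obtain ⟨e, k, n, s, hn, hs, rfl⟩ := id hc
  induction b using Localization.induction_on with
  | H y =>
    obtain ⟨m, s'⟩ := y
    exact ⟨m * s, n * s', SetLike.IsHomogeneousElem.mul ⟨_, hn⟩ (hS.out _ s'.2),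
      fun q hq => frac_mk f q m n s s' hc hq _⟩

theorem exists_frac_toLoc_graded {d e : ℤ} (b c : Localization S) (hb : b ∈ locGrading 𝒜 S (d + e))
    (hc : c ∈ locGrading 𝒜 S e) :
    ∃ (e' : ℤ) (m a : A) (_ : m ∈ 𝒜 (d + e')) (ha : a ∈ 𝒜 e'),
      ∀ (q : GSpec (locGrading 𝒜 S)) (hq : c ∉ q.ideal), ∃ hq',
        q.frac b c (isHom hc) hq = q.locMap (toLoc 𝒜 S) ((q.comap _).frac m a (isHom ha) hq') := by
  obtain ⟨k, n, s, hn, hs, rfl⟩ := id hc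
  obtain ⟨k', m, s', hm, hs', rfl⟩ := id hb
  refine ⟨e + k + k', m * s, n * s', ?_, SetLike.mul_mem_graded hn hs',
    fun q hq => frac_mk f q m n s s' _ hq _⟩
  have := SetLike.mul_mem_graded hm hs
  rwa [show d + e + k' + k = d + (e + k + k') by ring] at this

/-- Homogeneous elements of `A_f` outside `q` differ from elements of `A` by powers of `f`, which
are units. So localizing `A` at the preimage of `q` already inverts everything needed. -/
theorem locMap_bijective (q : GSpec (locGrading 𝒜 S)) :
    Function.Bijective (q.locMap (toLoc 𝒜 S)) := by
  constructor
  · rw [injective_iff_map_eq_zero]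
    intro x hx
    obtain ⟨m, a, ha, hp, rfl⟩ := GSpec.exists_frac _ x
    rw [GSpec.locMap_frac, GSpec.frac_eq_zero_iff] at hx
    obtain ⟨c, ⟨d, hc⟩, hcq, h⟩ := hx
    obtain ⟨k, n, s, hn, hs, rfl⟩ := hc
    have h1 : toLoc 𝒜 S (n * m) = 0 := by
      rw [map_mul, ← mk_mul_toLoc f n s, mul_right_comm, h, zero_mul]
    obtain ⟨s', hs'⟩ := (IsLocalization.map_eq_zero_iff S (Localization S) _).1 h1
    rw [GSpec.frac_eq_zero_iff]
    refine ⟨s' * n, (hS.out _ s'.2).mul ⟨_, hn⟩, fun hmem => ?_, by rw [mul_assoc, hs']⟩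
    rw [GSpec.mem_comap, map_mul, ← mk_mul_toLoc f n s] at hmem
    exact q.mul_not_mem (toLoc_not_mem f q s') (q.mul_not_mem hcq (toLoc_not_mem f q s)) hmem
  · intro x
    obtain ⟨b, c, hc, hq, rfl⟩ := GSpec.exists_frac _ x
    obtain ⟨m, a, ha, h⟩ := exists_frac_toLoc f b c hc
    obtain ⟨hq', h⟩ := h q hq
    exact ⟨_, h.symm⟩

/-- The usual correspondence between primes of `A_f` and primes of `A` disjoint from the powers of
`f`; extension and contraction along a graded map preserve homogeneity. -/
theorem range_comap_toLoc : Set.range (GSpec.comap (toLoc 𝒜 S)) = gBasicOpen 𝒜 f := by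
  ext p
  constructor
  · rintro ⟨q, rfl⟩
    exact toLoc_not_mem f q ⟨f, Submonoid.mem_powers f⟩
  · intro hp
    have hd : Disjoint (S : Set A) (p.ideal.toIdeal : Set A) :=
      (Ideal.disjoint_powers_iff_notMem _ p.isPrime.isRadical).2 hp
    refine ⟨⟨p.ideal.map (toLoc 𝒜 S),
      IsLocalization.isPrime_of_isPrime_disjoint S (Localization S) _ p.isPrime hd⟩, ?_⟩
    refine GSpec.ext (HomogeneousIdeal.toIdeal_injective ?_)
    exact IsLocalization.under_map_of_isPrime_disjoint S (Localization S) p.isPrime hd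

/-- Both topologies are induced from the ordinary prime spectra, where localization is an embedding,
and the image is `D(f)`. -/
theorem isOpenEmbedding_comap_toLoc : Topology.IsOpenEmbedding
    (GSpec.comap (toLoc 𝒜 S) : GSpec (locGrading 𝒜 S) → GSpec 𝒜) := by
  have h := PrimeSpectrum.localization_comap_isEmbedding (Localization S) S
  have h1 : Topology.IsInducing (GSpec.toPrime (𝒜 := locGrading 𝒜 S)) := ⟨rfl⟩
  have h2 : Topology.IsInducing (GSpec.toPrime (𝒜 := 𝒜)) := ⟨rfl⟩
  have h3 : Topology.IsInducing (GSpec.toPrime ∘ GSpec.comap (toLoc 𝒜 S)) := h.isInducing.comp h1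
  refine ⟨⟨Topology.IsInducing.of_comp (GSpec.continuous_comap _) h2.continuous h3, fun q q' hq => ?_⟩, ?_⟩
  · have h4 := h.injective (a₁ := q.toPrime) (a₂ := q'.toPrime) (congrArg GSpec.toPrime hq)
    exact GSpec.ext (HomogeneousIdeal.toIdeal_injective (congrArg PrimeSpectrum.asIdeal h4))
  · rw [range_comap_toLoc]
    exact (gBasicOpen 𝒜 f).isOpen

end BasicOpen

section Pullback

variable {A B : Type u} [CommRing A] [CommRing B] {𝒜 : ℤ → AddSubgroup A} {ℬ : ℤ → AddSubgroup B}
  [GradedRing 𝒜] [GradedRing ℬ] (φ : 𝒜 →+*ᵍ ℬ)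

/-- The continuous map of spectra attached to a homomorphism of graded rings. -/
def gspecMap : gspecTop ℬ ⟶ gspecTop 𝒜 := TopCat.ofHom ⟨GSpec.comap φ, GSpec.continuous_comap φ⟩

variable {W : Opens (gspecTop 𝒜)} {V : Opens (gspecTop ℬ)}
  (h : ∀ q : gspecTop ℬ, q ∈ V → gspecMap φ q ∈ W)

/-- The pullback of a function on the spectrum. -/
def pullFun (s : ∀ p : W, GSpec.Loc p.1) (q : V) : GSpec.Loc q.1 :=
  GSpec.locMap φ q.1 (s ⟨gspecMap φ q.1, h q.1 q.2⟩)

theorem pullFun_mem {s : ∀ p : W, GSpec.Loc p.1} (hs : s ∈ (fracRings 𝒜).sections W) :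
    pullFun φ h s ∈ (fracRings ℬ).sections V := by
  intro x
  obtain ⟨W', hW', i, m, a, ha, hne, hv⟩ := hs ⟨gspecMap φ x.1, h x.1 x.2⟩
  refine ⟨V ⊓ (Opens.map (gspecMap φ)).obj W', ⟨x.2, hW'⟩, Opens.infLELeft _ _, φ m, φ a, isHom_map φ ha,
    fun q hq => hne ⟨gspecMap φ q.1, q.2.2⟩ hq, fun q => ?_⟩
  exact (congrArg (GSpec.locMap φ q.1) (hv ⟨gspecMap φ q.1, q.2.2⟩)).trans
    (GSpec.locMap_frac φ q.1 m a ha _)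

theorem pullFun_mem_graded {s : ∀ p : W, GSpec.Loc p.1} {d : ℤ}
    (hs : s ∈ (fracGroups 𝒜 d).sections W) :
    pullFun φ h s ∈ (fracGroups ℬ d).sections V := by
  intro x
  obtain ⟨W', hW', i, e, m, a, hm, ha, hne, hv⟩ := hs ⟨gspecMap φ x.1, h x.1 x.2⟩
  refine ⟨V ⊓ (Opens.map (gspecMap φ)).obj W', ⟨x.2, hW'⟩, Opens.infLELeft _ _, e, φ m, φ a,
    φ.map_mem hm, φ.map_mem ha,
    fun q hq => hne ⟨gspecMap φ q.1, q.2.2⟩ hq, fun q => ?_⟩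
  exact (congrArg (GSpec.locMap φ q.1) (hv ⟨gspecMap φ q.1, q.2.2⟩)).trans
    (GSpec.locMap_frac φ q.1 m a (isHom ha) _)

/-- The pullback of sections of the structure sheaf. -/
def pullSec : (fracRings 𝒜).sections W →+* (fracRings ℬ).sections V where
  toFun s := ⟨pullFun φ h s.1, pullFun_mem φ h s.2⟩
  map_one' := Subtype.ext (funext fun q => map_one (GSpec.locMap φ q.1))
  map_zero' := Subtype.ext (funext fun q => map_zero (GSpec.locMap φ q.1))
  map_add' _ _ := Subtype.ext (funext fun q => map_add (GSpec.locMap φ q.1) _ _)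
  map_mul' _ _ := Subtype.ext (funext fun q => map_mul (GSpec.locMap φ q.1) _ _)

end Pullback

/-! ### The open immersion of `gspec A_f` into `gspec A`. -/

section Away

variable {A : Type u} [CommRing A] (𝒜 : ℤ → AddSubgroup A) [GradedRing 𝒜] (f : A)

variable [hS : Fact (∀ s ∈ Submonoid.powers f, SetLike.IsHomogeneousElem 𝒜 s)]

variable {𝒜}

/-- The image of an open subset of the spectrum of the localization at the powers of `f`. -/
abbrev awayImage (V : Opens (gspecTop (locGrading 𝒜 (Submonoid.powers f)))) : Opens (gspecTop 𝒜) :=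
  Topology.IsOpenEmbedding.functor (f := gspecMap (toLoc 𝒜 (Submonoid.powers f)))
    (isOpenEmbedding_comap_toLoc (𝒜 := 𝒜) f) |>.obj V

local notation "φ" => toLoc 𝒜 (Submonoid.powers f)

variable {V : Opens (gspecTop (locGrading 𝒜 (Submonoid.powers f)))}

theorem gspecMap_mem_image (q : gspecTop (locGrading 𝒜 (Submonoid.powers f))) (hq : q ∈ V) : gspecMap φ q ∈ awayImage f V :=
  ⟨q, hq, rfl⟩

/-- A local expression `b / c` of the pulled back function is the image of a fraction `m / a` over
`A`; injectivity on local rings shows that the original function is `m / a` on the image. -/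
theorem mem_of_pullFun_mem {s : ∀ p : awayImage f V, GSpec.Loc p.1}
    (hs : pullFun φ (gspecMap_mem_image f) s ∈ (fracRings (locGrading 𝒜 (Submonoid.powers f))).sections V) :
    s ∈ (fracRings 𝒜).sections (awayImage f V) := by
  rintro ⟨_, q, hq, rfl⟩
  obtain ⟨W, hW, i, b, c, hc, hne, hv⟩ := hs ⟨q, hq⟩
  obtain ⟨m, a, ha, hh⟩ := exists_frac_toLoc f b c hc
  have hne' : ∀ p : awayImage f W, a ∉ p.1.ideal := by
    rintro ⟨_, q', hq', rfl⟩
    exact (hh q' (hne ⟨q', hq'⟩)).1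
  refine ⟨awayImage f W, ⟨q, hW, rfl⟩, (isOpenEmbedding_comap_toLoc (𝒜 := 𝒜) f).isOpenMap.functor.map i,
    m, a, ha, hne', ?_⟩
  rintro ⟨_, q', hq', rfl⟩
  refine (locMap_bijective f q').injective ?_
  exact (hv ⟨q', hq'⟩).trans (hh q' (hne ⟨q', hq'⟩)).2

theorem mem_graded_of_pullFun_mem {d : ℤ} {s : ∀ p : awayImage f V, GSpec.Loc p.1}
    (hs : pullFun φ (gspecMap_mem_image f) s ∈ (fracGroups (locGrading 𝒜 (Submonoid.powers f)) d).sections V) :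
    s ∈ (fracGroups 𝒜 d).sections (awayImage f V) := by
  rintro ⟨_, q, hq, rfl⟩
  obtain ⟨W, hW, i, e, b, c, hb, hc, hne, hv⟩ := hs ⟨q, hq⟩
  obtain ⟨e', m, a, hm, ha, hh⟩ := exists_frac_toLoc_graded f b c hb hc
  have hne' : ∀ p : awayImage f W, a ∉ p.1.ideal := by
    rintro ⟨_, q', hq', rfl⟩
    exact (hh q' (hne ⟨q', hq'⟩)).1
  refine ⟨awayImage f W, ⟨q, hW, rfl⟩, (isOpenEmbedding_comap_toLoc (𝒜 := 𝒜) f).isOpenMap.functor.map i,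
    e', m, a, hm, ha, hne', ?_⟩
  rintro ⟨_, q', hq', rfl⟩
  refine (locMap_bijective f q').injective ?_
  exact (hv ⟨q', hq'⟩).trans (hh q' (hne ⟨q', hq'⟩)).2

theorem exists_pullFun_eq (t : ∀ q : V, GSpec.Loc q.1) :
    ∃ s : ∀ p : awayImage f V, GSpec.Loc p.1, pullFun φ (gspecMap_mem_image f) s = t := by
  -- Every point of the image has exactly one preimage `q`. Quantifying over all `q` above the point
  -- lets the value be chosen at each point and still be used at a given `q`.
  have key : ∀ p : awayImage f V, ∃ z : GSpec.Loc p.1, ∀ (q : V) (h : GSpec.comap φ q.1 = p.1),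
      GSpec.locMap φ q.1 (h ▸ z) = t q := by
    rintro ⟨_, q, hq, rfl⟩
    obtain ⟨z, hz⟩ := (locMap_bijective f q).surjective (t ⟨q, hq⟩)
    refine ⟨z, ?_⟩
    rintro ⟨q', hq'⟩ h
    obtain rfl : q' = q := (isOpenEmbedding_comap_toLoc (𝒜 := 𝒜) f).injective h
    exact hz
  choose s hs using key
  exact ⟨s, funext fun q => hs ⟨gspecMap φ q.1, gspecMap_mem_image f q.1 q.2⟩ q rfl⟩

theorem pullSec_bijective :
    Function.Bijective (pullSec φ (gspecMap_mem_image (V := V) f)) := by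
  constructor
  · intro s t hst
    refine Subtype.ext (funext ?_)
    rintro ⟨_, q, hq, rfl⟩
    exact (locMap_bijective f q).injective (congrFun (congrArg Subtype.val hst) ⟨q, hq⟩)
  · intro t
    obtain ⟨s, hs⟩ := exists_pullFun_eq f t.1
    exact ⟨⟨s, mem_of_pullFun_mem f (by rw [hs]; exact t.2)⟩, Subtype.ext hs⟩

variable [IsNoetherianRing A]

instance : IsNoetherianRing (Localization (Submonoid.powers f)) := IsLocalization.isNoetherianRing (Submonoid.powers f) _ inferInstance

variable (𝒜) in
/-- The spectrum of the localization at the powers of `f` is the open subspace `D(f)`. -/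
def awayImmersion : OpenImmersion (gspec (locGrading 𝒜 (Submonoid.powers f))) (gspec 𝒜) where
  base := gspecMap φ
  isOpenEmbedding := isOpenEmbedding_comap_toLoc f
  iso V := RingEquiv.ofBijective _ (pullSec_bijective (V := V) f)
  iso_res _ _ := rfl
  iso_mem _ _ _ := ⟨fun h => mem_graded_of_pullFun_mem f h, fun h => pullFun_mem_graded φ (gspecMap_mem_image f) h⟩

end Away

/-! ### Composition of open immersions and small affine neighbourhoods. -/

namespace GradedRingedSpace

variable (X : GradedRingedSpace.{u})

/-- Sections on equal open sets. -/
def resIso {U V : Opens X.carrier} (h : U = V) : X.Sec U ≃+* X.Sec V :=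
  RingEquiv.ofRingHom (X.res (eqToHom h.symm)) (X.res (eqToHom h))
    (RingHom.ext fun a => (X.res_res _ _ a).trans (X.res_id a))
    (RingHom.ext fun a => (X.res_res _ _ a).trans (X.res_id a))

variable {X}

theorem resIso_apply {U V : Opens X.carrier} (h : U = V) (a : X.Sec U) :
    X.resIso h a = X.res (eqToHom h.symm) a := rfl

theorem resIso_mem {U V : Opens X.carrier} (h : U = V) {d : ℤ} (a : X.Sec U) :
    X.resIso h a ∈ X.gr V d ↔ a ∈ X.gr U d := by
  subst h
  rw [resIso_apply, eqToHom_refl, X.res_id]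

end GradedRingedSpace

namespace OpenImmersion

variable {Z Y X : GradedRingedSpace.{u}}

theorem isOpenEmbedding_comp (k : OpenImmersion Z Y) (j : OpenImmersion Y X) :
    Topology.IsOpenEmbedding (k.base ≫ j.base) := j.isOpenEmbedding.comp k.isOpenEmbedding

theorem image_image (k : OpenImmersion Z Y) (j : OpenImmersion Y X) (V : Opens Z.carrier) :
    (isOpenEmbedding_comp k j).isOpenMap.functor.obj V = j.image.obj (k.image.obj V) :=
  Opens.ext (Set.image_comp j.base k.base V)

/-- The composition of open immersions. -/
def comp (k : OpenImmersion Z Y) (j : OpenImmersion Y X) : OpenImmersion Z X where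
  base := k.base ≫ j.base
  isOpenEmbedding := isOpenEmbedding_comp k j
  iso V := (X.resIso (image_image k j V)).trans ((j.iso (k.image.obj V)).trans (k.iso V))
  iso_res {V W} i a := by
    change k.iso W (j.iso _ (X.res _ (X.res _ a))) = Z.res i (k.iso V (j.iso _ (X.res _ a)))
    rw [← k.iso_res, ← j.iso_res, X.res_res, X.res_res]
    rfl
  iso_mem V d a := by
    refine ((k.iso_mem V d _).trans (j.iso_mem _ d _)).trans ?_
    exact GradedRingedSpace.resIso_mem (image_image k j V) a

theorem unitsOn (j : OpenImmersion Y X) (V : Opens Y.carrier) {d : ℤ}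
    (h : X.UnitsOn (j.image.obj V) d) : Y.UnitsOn V d := by
  obtain ⟨a, b, hab⟩ := h
  exact ⟨⟨j.iso V a.1, (j.iso_mem V d _).2 a.2⟩, ⟨j.iso V b.1, (j.iso_mem V (-d) _).2 b.2⟩,
    (map_mul (j.iso V) a.1 b.1).symm.trans ((congrArg _ hab).trans (map_one _))⟩

theorem isStandardPoint (j : OpenImmersion Y X) {y : Y.carrier} (h : X.IsStandardPoint (j.base y)) :
    Y.IsStandardPoint y := by
  obtain ⟨U, hU, hu⟩ := h.unitsOn
  refine GradedRingedSpace.UnitsOn.isStandardPoint (U := (Opens.map j.base).obj U) ?_ hU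
  refine j.unitsOn _ (hu.res (homOfLE ?_))
  rintro _ ⟨y, hy, rfl⟩
  exact hy

theorem isStandard (j : OpenImmersion Y X) (h : X.IsStandard) : Y.IsStandard :=
  fun _ => j.isStandardPoint (h _)

end OpenImmersion

/-- The complement of `U` is `V(I)` with `I` homogeneous and not contained in `p`. Some homogeneous
component of an element of `I` lies outside `p`, and serves as `g`. -/
theorem exists_gBasicOpen_le {A : Type u} [CommRing A] {𝒜 : ℤ → AddSubgroup A} [GradedRing 𝒜]
    {U : Opens (gspecTop 𝒜)} {p : GSpec 𝒜} (hp : p ∈ U) :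
    ∃ g, SetLike.IsHomogeneousElem 𝒜 g ∧ g ∉ p.ideal ∧ gBasicOpen 𝒜 g ≤ U := by
  obtain ⟨I, hI⟩ := (GSpec.isClosed_iff _).1 (isClosed_compl_iff.2 U.isOpen)
  have h1 : ¬ I ≤ p.ideal := fun h => by
    have : p ∈ (U : Set (gspecTop 𝒜))ᶜ := by rw [hI]; exact h
    exact this hp
  by_contra! hc
  refine h1 fun a ha => ?_
  classical
  rw [← DirectSum.sum_support_decompose 𝒜 a]
  refine sum_mem fun i _ => ?_
  have hi : ((DirectSum.decompose 𝒜 a i : 𝒜 i) : A) ∈ I := I.isHomogeneous i ha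
  by_contra hip
  refine hc _ ⟨i, SetLike.coe_mem _⟩ hip fun q hq => ?_
  by_contra hqU
  have : q ∈ (U : Set (gspecTop 𝒜))ᶜ := hqU
  rw [hI] at this
  exact hq (this hi)

/-- An affine neighbourhood of `x` is shrunk to a basic open subset `D(f)` of it, which is affine
again, being the spectrum of the localization at `f`. -/
theorem exists_affine_le {X : GradedRingedSpace.{u}} (hX : X.IsGradedScheme) {U : Opens X.carrier}
    {x : X.carrier} (hx : x ∈ U) :
    ∃ (B : Type u) (_ : CommRing B) (_ : IsNoetherianRing B) (ℬ : ℤ → AddSubgroup B) (_ : GradedRing ℬ)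
      (j : OpenImmersion (gspec ℬ) X), x ∈ Set.range j.base ∧ j.image.obj ⊤ ≤ U := by
  obtain ⟨A, _, _, 𝒜, _, j, p, rfl⟩ := hX.isLocallyAffine x
  obtain ⟨f, hf, hfp, hfU⟩ := exists_gBasicOpen_le (U := (Opens.map j.base).obj U) (p := p) hx
  have : Fact (∀ s ∈ Submonoid.powers f, SetLike.IsHomogeneousElem 𝒜 s) := ⟨isHom_powers hf⟩
  have hr := range_comap_toLoc (𝒜 := 𝒜) f
  refine ⟨_, _, inferInstance, locGrading 𝒜 (Submonoid.powers f), inferInstance,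
    (awayImmersion 𝒜 f).comp j, ?_, ?_⟩
  · have : p ∈ Set.range (GSpec.comap (toLoc 𝒜 (Submonoid.powers f))) := by
      rw [hr]; exact hfp
    obtain ⟨q, rfl⟩ := this
    exact ⟨q, rfl⟩
  · rintro _ ⟨q, -, rfl⟩
    refine hfU (x := GSpec.comap (toLoc 𝒜 (Submonoid.powers f)) q) fun hq => ?_
    have : GSpec.comap (toLoc 𝒜 (Submonoid.powers f)) q ∈ (gBasicOpen 𝒜 f : Set (gspecTop 𝒜)) := by
      rw [← hr]; exact ⟨q, rfl⟩
    exact this hq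

/-! ### Global sections of the structure sheaf of `gspec A`. -/

section GlobalSections

variable {A : Type u} [CommRing A] {𝒜 : ℤ → AddSubgroup A} [GradedRing 𝒜]

theorem exists_gspec_of_notMem_radical {J : Ideal A} (hJ : J.IsHomogeneous 𝒜) {f : A}
    (hf : f ∉ J.radical) : ∃ q : GSpec 𝒜, J ≤ q.ideal.toIdeal ∧ f ∉ q.ideal := by
  rw [hJ.radical_eq, Ideal.mem_sInf] at hf
  push Not at hf
  obtain ⟨P, ⟨hP, hJP, hp⟩, hfP⟩ := hf
  exact ⟨⟨⟨P, hP⟩, hp⟩, hJP, hfP⟩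

/-- The annihilator of a homogeneous element is a homogeneous ideal. If it contained no power of
`f`, some homogeneous prime containing it would miss `f`, against the hypothesis at that prime. -/
theorem exists_pow_mul_eq_zero {d : ℤ} {y : A} (hy : y ∈ 𝒜 d) (f : A)
    (h : ∀ q : GSpec 𝒜, f ∉ q.ideal → ∃ c ∉ q.ideal, c * y = 0) : ∃ n : ℕ, f ^ n * y = 0 := by
  let J : Ideal A := LinearMap.ker (LinearMap.toSpanSingleton A A y)
  have mem : ∀ c, c ∈ J ↔ c * y = 0 := fun c => LinearMap.mem_ker
  have hJ : J.IsHomogeneous 𝒜 := by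
    intro i c hc
    rw [mem] at hc ⊢
    rw [← DirectSum.coe_decompose_mul_add_of_right_mem 𝒜 hy, hc]
    simp
  by_contra! hn
  obtain ⟨q, hJq, hfq⟩ := exists_gspec_of_notMem_radical hJ (f := f)
    (fun ⟨n, hf⟩ => hn n ((mem _).1 hf))
  obtain ⟨c, hcq, hc⟩ := h q hfq
  exact hcq (hJq ((mem c).2 hc))

theorem GSpec.frac_one (p : GSpec 𝒜) (m : A) :
    p.frac m 1 isHom_one p.one_not_mem = algebraMap A p.Loc m :=
  Localization.mk_one_eq_algebraMap m

theorem GSpec.algebraMap_mul_frac (p : GSpec 𝒜) (m a : A) (ha : SetLike.IsHomogeneousElem 𝒜 a)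
    (hp : a ∉ p.ideal) : algebraMap A p.Loc a * p.frac m a ha hp = algebraMap A p.Loc m := by
  unfold GSpec.frac
  rw [Localization.mk_eq_mk', mul_comm]
  exact IsLocalization.mk'_spec p.Loc m (⟨a, ha, hp⟩ : p.homCompl)

theorem GSpec.isUnit_algebraMap (p : GSpec 𝒜) {a : A} (ha : SetLike.IsHomogeneousElem 𝒜 a)
    (hp : a ∉ p.ideal) : IsUnit (algebraMap A p.Loc a) :=
  IsLocalization.map_units p.Loc (⟨a, ha, hp⟩ : p.homCompl)

theorem GSpec.algebraMap_eq_zero (p : GSpec 𝒜) {y : A} (h : algebraMap A p.Loc y = 0) :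
    ∃ c, SetLike.IsHomogeneousElem 𝒜 c ∧ c ∉ p.ideal ∧ c * y = 0 := by
  rw [← p.frac_one] at h
  exact p.frac_eq_zero_iff.1 h

/-- A section of degree `d` is given near every point by a fraction `a / h` on `D(h)`. -/
theorem exists_frac_on_gBasicOpen {U : Opens (gspecTop 𝒜)} {d : ℤ} {s : (fracRings 𝒜).sections U}
    (hs : s ∈ gspecGr 𝒜 U d) {p : GSpec 𝒜} (hp : p ∈ U) :
    ∃ (e : ℤ) (a h : A) (_ : a ∈ 𝒜 (d + e)) (_ : h ∈ 𝒜 e) (_ : h ∉ p.ideal)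
      (hU : gBasicOpen 𝒜 h ≤ U), ∀ (q : GSpec 𝒜) (hq : h ∉ q.ideal),
        algebraMap A q.Loc h * s.1 ⟨q, hU hq⟩ = algebraMap A q.Loc a := by
  obtain ⟨W, hW, i, e, m, c, hm, hc, hne, h⟩ := mem_gspecGr.1 hs ⟨p, hp⟩
  obtain ⟨g, ⟨k, hg⟩, hgp, hgW⟩ := exists_gBasicOpen_le hW
  have hU : gBasicOpen 𝒜 (g * c) ≤ W := fun q hq => hgW fun hgq => hq (Ideal.mul_mem_right _ _ hgq)
  refine ⟨k + e, g * m, g * c, ?_, SetLike.mul_mem_graded hg hc,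
    p.mul_not_mem hgp (hne ⟨p, hW⟩), hU.trans i.le, fun q hq => ?_⟩
  · have := SetLike.mul_mem_graded hg hm
    rwa [show k + (d + e) = d + (k + e) by ring] at this
  · rw [show s.1 ⟨q, i.le (hU hq)⟩ = _ from h ⟨q, hU hq⟩, map_mul, mul_assoc,
      GSpec.algebraMap_mul_frac, map_mul]

/-- The section on `V` given by an element of `A`. -/
def toSections (V : Opens (gspecTop 𝒜)) : A →+* (fracRings 𝒜).sections V where
  toFun a := ⟨fun q => algebraMap A (GSpec.Loc q.1) a, fun x => ⟨V, x.2, 𝟙 V, a, 1, isHom_one,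
    fun q => q.1.one_not_mem, fun q => (q.1.frac_one a).symm⟩⟩
  map_one' := Subtype.ext (funext fun q => map_one (algebraMap A (GSpec.Loc q.1)))
  map_zero' := Subtype.ext (funext fun q => map_zero (algebraMap A (GSpec.Loc q.1)))
  map_add' _ _ := Subtype.ext (funext fun q => map_add (algebraMap A (GSpec.Loc q.1)) _ _)
  map_mul' _ _ := Subtype.ext (funext fun q => map_mul (algebraMap A (GSpec.Loc q.1)) _ _)

theorem toSections_mem (V : Opens (gspecTop 𝒜)) {d : ℤ} {a : A} (ha : a ∈ 𝒜 d) :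
    toSections V a ∈ gspecGr 𝒜 V d := mem_gspecGr.2 fun x => ⟨V, x.2, 𝟙 V, 0, a, 1, by simpa using ha,
  SetLike.one_mem_graded 𝒜, fun q => q.1.one_not_mem, fun q => (q.1.frac_one a).symm⟩

/-- The denominators of a global section. -/
def denomIdeal (s : (fracRings 𝒜).sections ⊤) : Ideal A where
  carrier := {b | ∃ n : A, toSections ⊤ b * s = toSections ⊤ n}
  zero_mem' := ⟨0, by rw [map_zero, zero_mul]⟩
  add_mem' := by
    rintro b b' ⟨n, h⟩ ⟨n', h'⟩
    exact ⟨n + n', by rw [map_add, add_mul, h, h', map_add]⟩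
  smul_mem' := by
    rintro c b ⟨n, h⟩
    exact ⟨c * n, by rw [smul_eq_mul, map_mul, mul_assoc, h, map_mul]⟩

variable [IsNoetherianRing A]

/-- On `D(h)` the section is `a / h`; the claim is that `h s - a` is killed by a power of `h` at
every point. Near any point `s = b / c` on some `D(c)`, and there `h b - c a` is killed by a power
of `h c` because it vanishes on `D(h c)`. Quasi-compactness provides one exponent for all points. -/
theorem exists_pow_mul_section_eq_zero {d e : ℤ} {s : (fracRings 𝒜).sections ⊤}
    (hs : s ∈ gspecGr 𝒜 ⊤ d) {a h : A} (ha : a ∈ 𝒜 (d + e)) (hh : h ∈ 𝒜 e)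
    (hq : ∀ q : GSpec 𝒜, h ∉ q.ideal → algebraMap A q.Loc h * s.1 ⟨q, trivial⟩ = algebraMap A q.Loc a) :
    ∃ n : ℕ, ∀ q : GSpec 𝒜,
      algebraMap A q.Loc h ^ n * (algebraMap A q.Loc h * s.1 ⟨q, trivial⟩ - algebraMap A q.Loc a) = 0 := by
  have hc : IsCompact (Set.univ : Set (gspecTop 𝒜)) := NoetherianSpace.isCompact _
  suffices H : ∃ n : ℕ, ∀ q : GSpec 𝒜, q ∈ (Set.univ : Set (gspecTop 𝒜)) →
      algebraMap A q.Loc h ^ n * (algebraMap A q.Loc h * s.1 ⟨q, trivial⟩ - algebraMap A q.Loc a) = 0 from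
    H.imp fun n hn q => hn q trivial
  refine hc.induction_on (p := fun T => ∃ n : ℕ, ∀ q : GSpec 𝒜, q ∈ T →
    algebraMap A q.Loc h ^ n * (algebraMap A q.Loc h * s.1 ⟨q, trivial⟩ - algebraMap A q.Loc a) = 0)
    ?_ ?_ ?_ ?_
  · exact ⟨0, fun q hq => hq.elim⟩
  · rintro T T' hT ⟨n, hn⟩
    exact ⟨n, fun q hq => hn q (hT hq)⟩
  · rintro T T' ⟨n, hn⟩ ⟨n', hn'⟩
    refine ⟨n + n', fun q hq => hq.elim (fun h => ?_) fun h => ?_⟩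
    · rw [add_comm, pow_add, mul_assoc, hn q h, mul_zero]
    · rw [pow_add, mul_assoc, hn' q h, mul_zero]
  · intro p _
    obtain ⟨k, b, c, hb, hc, hcp, _, hbc⟩ := exists_frac_on_gBasicOpen hs (p := p) trivial
    have hy : h * b - c * a ∈ 𝒜 (d + e + k) := by
      refine sub_mem ?_ ?_
      · have := SetLike.mul_mem_graded hh hb
        rwa [show e + (d + k) = d + e + k by ring] at this
      · have := SetLike.mul_mem_graded hc ha
        rwa [show k + (d + e) = d + e + k by ring] at this
    obtain ⟨n, hn⟩ := exists_pow_mul_eq_zero hy (h * c) fun q hhc => by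
      have h1 : h ∉ q.ideal := fun h' => hhc (Ideal.mul_mem_right _ _ h')
      have h2 : c ∉ q.ideal := fun h' => hhc (Ideal.mul_mem_left _ _ h')
      obtain ⟨z, -, hz⟩ := q.algebraMap_eq_zero (y := h * b - c * a) (by
        rw [map_sub, map_mul, map_mul, ← hq q h1, ← hbc q h2]; ring)
      exact ⟨z, hz⟩
    refine ⟨gBasicOpen 𝒜 c, mem_nhdsWithin_of_mem_nhds ((gBasicOpen 𝒜 c).isOpen.mem_nhds hcp),
      n, fun q hcq => ?_⟩
    have h1 := congrArg (algebraMap A q.Loc) hn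
    rw [map_mul, map_sub, map_pow, map_mul, map_mul, map_mul, ← hbc q hcq, map_zero] at h1
    have hu := q.isUnit_algebraMap (isHom hc) hcq
    -- On `D(c)` one has `h b - c a = c (h s - a)`, so besides the `n` factors `c` from `(h c)^n`
    -- one more unit is cancelled.
    refine (hu.pow (n + 1)).mul_left_cancel ?_
    rw [mul_zero, ← h1]
    ring

/-- Global sections of degree `d` of the structure sheaf come from elements of degree `d`. -/
theorem exists_eq_toSections {d : ℤ} {s : (fracRings 𝒜).sections ⊤} (hs : s ∈ gspecGr 𝒜 ⊤ d) :
    ∃ b ∈ 𝒜 d, s = toSections ⊤ b := by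
  -- Since `h^(n+1) s = h^n a` at all points, the power `h^(n+1)` is a global denominator outside
  -- `p`.
  have key : ∀ p : GSpec 𝒜, ∃ b ∈ denomIdeal s, SetLike.IsHomogeneousElem 𝒜 b ∧ b ∉ p.ideal := by
    intro p
    obtain ⟨e, a, h, ha, hh, hp, _, hq⟩ := exists_frac_on_gBasicOpen hs (p := p) trivial
    obtain ⟨n, hn⟩ := exists_pow_mul_section_eq_zero hs ha hh hq
    refine ⟨h ^ (n + 1), ⟨h ^ n * a, Subtype.ext (funext fun q => ?_)⟩,
      ⟨_, SetLike.pow_mem_graded (n + 1) hh⟩, fun h' => hp (p.isPrime.mem_of_pow_mem _ h')⟩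
    have h1 := hn q.1
    rw [mul_sub, sub_eq_zero] at h1
    change algebraMap A q.1.Loc (h ^ (n + 1)) * s.1 q = algebraMap A q.1.Loc (h ^ n * a)
    rw [map_mul, map_pow, map_pow, ← h1, pow_succ, mul_assoc]
  have h1 : (1 : A) ∈ denomIdeal s := by
    by_contra hc
    -- The ideal of denominators need not be known to be homogeneous. Its homogeneous core already
    -- contains all the homogeneous denominators found above, and no homogeneous prime contains all
    -- of them.
    have hJ : ((denomIdeal s).homogeneousCore 𝒜).toIdeal ≤ denomIdeal s :=
      Ideal.toIdeal_homogeneousCore_le 𝒜 _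
    obtain ⟨q, hq, -⟩ := exists_gspec_of_notMem_radical (f := 1)
      ((denomIdeal s).homogeneousCore 𝒜).isHomogeneous (fun ⟨n, hn⟩ => hc (hJ (by simpa using hn)))
    obtain ⟨b, hb, hbh, hbq⟩ := key q
    exact hbq (hq (Ideal.mem_homogeneousCore_of_homogeneous_of_mem hbh hb))
  obtain ⟨n, hn⟩ := h1
  rw [map_one, one_mul] at hn
  -- The numerator `n` need not be homogeneous. As `s` has degree `d`, it equals the component of
  -- degree `d` of the image of `n` at each point.
  refine ⟨(DirectSum.decompose 𝒜 n d : 𝒜 d), SetLike.coe_mem _, Subtype.ext (funext fun q => ?_)⟩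
  have h2 := gspecGr_val hs q
  have h3 := q.1.comp_frac d n 1 (SetLike.one_mem_graded 𝒜) q.1.one_not_mem
  rw [q.1.frac_one, q.1.frac_one, add_zero] at h3
  refine Eq.trans ?_ h3
  rw [show algebraMap A q.1.Loc n = s.1 q by rw [hn]; rfl]
  exact (DirectSum.decompose_of_mem_same _ h2).symm

end GlobalSections

/-! ### Homogeneous presentations of graded modules. -/

namespace GrMod

variable {A : Type u} [CommRing A] {𝒜 : ℤ → AddSubgroup A} [GradedRing 𝒜]

theorem decompose_smul (M : GrMod 𝒜) {j : ℤ} (a : A) {x : M.carrier} (hx : x ∈ M.gr j) (e : ℤ) :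
    ((DirectSum.decompose M.gr (a • x) e : M.gr e) : M.carrier) =
      ((DirectSum.decompose 𝒜 a (e - j) : 𝒜 (e - j)) : A) • x := by
  induction a using DirectSum.Decomposition.inductionOn 𝒜 with
  | zero => simp
  | @homogeneous i m =>
    by_cases h : i = e - j
    · subst h
      rw [DirectSum.decompose_of_mem_same _ m.2, DirectSum.decompose_of_mem_same]
      have := M.smul_mem m.2 hx
      rwa [sub_add_cancel] at this
    · rw [DirectSum.decompose_of_mem_ne _ m.2 h, zero_smul,
        DirectSum.decompose_of_mem_ne M.gr (M.smul_mem m.2 hx) (fun h' => h (by linarith))]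
  | add m m' h h' =>
    rw [add_smul, DirectSum.decompose_add, DirectSum.decompose_add, DirectSum.add_apply,
      DirectSum.add_apply, AddSubgroup.coe_add, AddSubgroup.coe_add, add_smul, h, h']

section Components

variable (𝒜) in
/-- The homogeneous components of a vector with respect to a basis of given degrees. -/
def hcomp {I : Type u} (d : I → ℤ) (e : ℤ) (c : I →₀ A) : I →₀ A :=
  Finsupp.onFinset c.support (fun i => (DirectSum.decompose 𝒜 (c i) (e - d i) : 𝒜 (e - d i))) (by
    intro i hi
    rw [Finsupp.mem_support_iff]
    intro h
    exact hi (by rw [h]; simp))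

theorem hcomp_apply {I : Type u} (d : I → ℤ) (e : ℤ) (c : I →₀ A) (i : I) :
    hcomp 𝒜 d e c i = (DirectSum.decompose 𝒜 (c i) (e - d i) : 𝒜 (e - d i)) := rfl

theorem hcomp_mem {I : Type u} (d : I → ℤ) (e : ℤ) (c : I →₀ A) (i : I) :
    hcomp 𝒜 d e c i ∈ 𝒜 (e - d i) := SetLike.coe_mem _

/-- The component of degree `e` of `c_i m_i` is `(c_i)_{e - d_i} m_i`. This is what allows arbitrary
coefficients to be replaced by homogeneous ones of the expected degrees. -/
theorem linearCombination_hcomp (M : GrMod 𝒜) {I : Type u} {d : I → ℤ} {m : I → M.carrier}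
    (hm : ∀ i, m i ∈ M.gr (d i)) (e : ℤ) (c : I →₀ A) :
    Finsupp.linearCombination A m (hcomp 𝒜 d e c) =
      (DirectSum.decompose M.gr (Finsupp.linearCombination A m c) e : M.gr e) := by
  refine (Finsupp.onFinset_sum _ fun i => zero_smul A (m i)).trans ?_
  rw [Finsupp.linearCombination_apply, Finsupp.sum, DirectSum.decompose_sum, DFinsupp.finsetSum_apply,
    AddSubgroup.val_finsetSum]
  exact Finset.sum_congr rfl fun i _ => (M.decompose_smul (c i) (hm i) e).symm

variable (𝒜) in
/-- The graded ring as a graded module over itself. -/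
def self : GrMod 𝒜 where
  carrier := ModuleCat.of A A
  gr := 𝒜
  isInternal := DirectSum.Decomposition.isInternal 𝒜
  smul_mem ha hm := SetLike.mul_mem_graded ha hm

theorem sum_hcomp {I : Type u} (d : I → ℤ) (c : I →₀ A) :
    ∃ T : Finset ℤ, c = ∑ e ∈ T, hcomp 𝒜 d e c := by
  classical
  refine ⟨c.support.biUnion fun i => (DirectSum.decompose 𝒜 (c i)).support.image (· + d i),
    Finsupp.ext fun i => ?_⟩
  rw [Finsupp.finsetSum_apply]
  by_cases hi : i ∈ c.support
  · rw [← Finset.sum_subset (Finset.subset_biUnion_of_mem _ hi)]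
    · rw [Finset.sum_image (fun _ _ _ _ h => add_right_cancel h)]
      refine (DirectSum.sum_support_decompose 𝒜 (c i)).symm.trans (Finset.sum_congr rfl fun k _ => ?_)
      rw [hcomp_apply, add_sub_cancel_right]
    · intro e _ he
      rw [hcomp_apply]
      by_contra hne
      refine he (Finset.mem_image.2 ⟨e - d i, DFinsupp.mem_support_iff.2 fun h => hne ?_, by ring⟩)
      rw [h]; rfl
  · rw [Finsupp.notMem_support_iff.1 hi]
    refine (Finset.sum_eq_zero fun e _ => ?_).symm
    rw [hcomp_apply, Finsupp.notMem_support_iff.1 hi]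
    simp

end Components

/-- A presentation of a graded module by homogeneous generators and relations. -/
structure IsPresentedBy (M : GrMod 𝒜) {I L : Type u} (d : I → ℤ) (m : I → M.carrier) (δ : L → ℤ)
    (r : L → I →₀ A) : Prop where
  mem : ∀ i, m i ∈ M.gr (d i)
  span : ∀ x, ∃ c, Finsupp.linearCombination A m c = x
  rel_mem : ∀ l i, r l i ∈ 𝒜 (δ l - d i)
  rel : ∀ l, Finsupp.linearCombination A m (r l) = 0
  relspan : ∀ c, Finsupp.linearCombination A m c = 0 → ∃ k, Finsupp.linearCombination A r k = c

namespace IsPresentedBy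

variable {M : GrMod 𝒜} {I L : Type u} {d : I → ℤ} {m : I → M.carrier} {δ : L → ℤ} {r : L → I →₀ A}
  (h : IsPresentedBy M d m δ r)

include h

theorem exists_homogeneous {e : ℤ} {x : M.carrier} (hx : x ∈ M.gr e) :
    ∃ c : I →₀ A, (∀ i, c i ∈ 𝒜 (e - d i)) ∧ Finsupp.linearCombination A m c = x := by
  obtain ⟨c, hc⟩ := h.span x
  refine ⟨hcomp 𝒜 d e c, hcomp_mem d e c, ?_⟩
  rw [M.linearCombination_hcomp h.mem, hc, DirectSum.decompose_of_mem_same _ hx]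

/-- Coordinate by coordinate, this is the passage to components in the graded module `A` with
generators `r l i` of degree `δ l - d i`; the shift by `d i` cancels, so the same homogeneous
coefficients serve all coordinates. -/
theorem exists_homogeneous_rel {e : ℤ} {c : I →₀ A} (hc : ∀ i, c i ∈ 𝒜 (e - d i))
    (h0 : Finsupp.linearCombination A m c = 0) :
    ∃ k : L →₀ A, (∀ l, k l ∈ 𝒜 (e - δ l)) ∧ Finsupp.linearCombination A r k = c := by
  obtain ⟨k, hk⟩ := h.relspan c h0
  refine ⟨hcomp 𝒜 δ e k, hcomp_mem δ e k, Finsupp.ext fun i => ?_⟩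
  have h1 := (self 𝒜).linearCombination_hcomp (d := fun l => δ l - d i) (m := fun l => r l i)
    (fun l => h.rel_mem l i) (e - d i) k
  have h2 : ∀ k' : L →₀ A, Finsupp.linearCombination A r k' i =
      Finsupp.linearCombination A (fun l => r l i) k' := fun k' => by
    rw [Finsupp.linearCombination_apply, Finsupp.linearCombination_apply, Finsupp.sum, Finsupp.sum,
      Finsupp.finsetSum_apply]
    rfl
  have h3 : hcomp 𝒜 (fun l => δ l - d i) (e - d i) k = hcomp 𝒜 δ e k := Finsupp.ext fun l => by
    rw [hcomp_apply, hcomp_apply, sub_sub_sub_cancel_right]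
  rw [h3] at h1
  have h4 : Finsupp.linearCombination A (fun l => r l i) k = c i := by rw [← h2, hk]
  rw [h2]
  exact h1.trans ((DirectSum.decompose_of_mem_same (self 𝒜).gr (h4.symm ▸ hc i)).trans h4)

end IsPresentedBy

/-- The homogeneous components of a relation between homogeneous generators are again relations, and
a finitely supported relation is the sum of finitely many of them. -/
theorem mem_span_homogeneous_rel (M : GrMod 𝒜) {I : Type u} {d : I → ℤ} {m : I → M.carrier}
    (hm : ∀ i, m i ∈ M.gr (d i)) {c : I →₀ A} (hc : Finsupp.linearCombination A m c = 0) :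
    c ∈ Submodule.span A {c : I →₀ A | (∃ e, ∀ i, c i ∈ 𝒜 (e - d i)) ∧
      Finsupp.linearCombination A m c = 0} := by
  obtain ⟨T, hT⟩ := sum_hcomp (𝒜 := 𝒜) d c
  rw [hT]
  refine sum_mem fun e _ => Submodule.subset_span ⟨⟨e, hcomp_mem d e c⟩, ?_⟩
  rw [M.linearCombination_hcomp hm, hc]
  simp

/-- Common to the two existence results below: `R` is the set of all homogeneous relations in the
general case, and a finite subset of it with the same span in the finitely generated case. -/
theorem exists_isPresentedBy_of_span (M : GrMod 𝒜) {I : Type u} {d : I → ℤ} {m : I → M.carrier}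
    (hm : ∀ i, m i ∈ M.gr (d i)) (hs : Submodule.span A (Set.range m) = ⊤) (R : Set (I →₀ A))
    (hR : R ⊆ {c : I →₀ A | (∃ e, ∀ i, c i ∈ 𝒜 (e - d i)) ∧ Finsupp.linearCombination A m c = 0})
    (hR' : Submodule.span A {c : I →₀ A | (∃ e, ∀ i, c i ∈ 𝒜 (e - d i)) ∧
      Finsupp.linearCombination A m c = 0} = Submodule.span A R) :
    ∃ (δ : R → ℤ), IsPresentedBy M d m δ (fun l : R => l.1) := by
  choose δ hδ using fun l : R => (hR l.2).1
  refine ⟨δ, hm, fun x => ?_, hδ, fun l => (hR l.2).2, fun c hc => ?_⟩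
  · have : x ∈ Submodule.span A (Set.range m) := by rw [hs]; trivial
    exact (Finsupp.mem_span_range_iff_exists_finsupp.1 this)
  · have := M.mem_span_homogeneous_rel hm hc
    rw [hR', ← Subtype.range_coe (s := R)] at this
    exact (Finsupp.mem_span_range_iff_exists_finsupp.1 this)

omit [GradedRing 𝒜] in
theorem span_homogeneous (M : GrMod 𝒜) :
    Submodule.span A {x : M.carrier | ∃ e, x ∈ M.gr e} = ⊤ := by
  refine eq_top_iff.2 fun x _ => ?_
  classical
  rw [← DirectSum.sum_support_decompose M.gr x]
  exact sum_mem fun e _ => Submodule.subset_span ⟨e, SetLike.coe_mem _⟩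

theorem exists_isPresentedBy (M : GrMod 𝒜) :
    ∃ (I L : Type u) (d : I → ℤ) (m : I → M.carrier) (δ : L → ℤ) (r : L → I →₀ A),
      IsPresentedBy M d m δ r := by
  obtain ⟨d, hd⟩ := Classical.axiom_of_choice fun x : {x : M.carrier | ∃ e, x ∈ M.gr e} => x.2
  obtain ⟨δ, h⟩ := M.exists_isPresentedBy_of_span (m := fun x : {x : M.carrier | ∃ e, x ∈ M.gr e} => x.1)
    hd (by rw [Subtype.range_coe]; exact M.span_homogeneous) _ subset_rfl rfl
  exact ⟨_, _, _, _, _, _, h⟩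

/-- A finitely generated module spanned by its homogeneous elements is spanned by finitely many of
them. The relations between these form a submodule of a finite free module over a noetherian ring,
and the same selection applies to them. -/
theorem exists_finite_isPresentedBy [IsNoetherianRing A] (M : GrMod 𝒜) [hM : Module.Finite A M.carrier] :
    ∃ (I L : Type u) (_ : Finite I) (_ : Finite L) (d : I → ℤ) (m : I → M.carrier) (δ : L → ℤ)
      (r : L → I →₀ A), IsPresentedBy M d m δ r := by
  have h1 : (Submodule.span A {x : M.carrier | ∃ e, x ∈ M.gr e}).FG := by
    rw [M.span_homogeneous]; exact hM.fg_top
  obtain ⟨s, hs, hs'⟩ := (Submodule.fg_span_iff_fg_span_finset_subset _).1 h1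
  obtain ⟨d, hd⟩ := Classical.axiom_of_choice fun x : s => hs x.2
  have h2 : (Submodule.span A {c : s →₀ A | (∃ e, ∀ i, c i ∈ 𝒜 (e - d i)) ∧
      Finsupp.linearCombination A (fun x : s => x.1) c = 0}).FG := IsNoetherian.noetherian _
  obtain ⟨R, hR, hR'⟩ := (Submodule.fg_span_iff_fg_span_finset_subset _).1 h2
  obtain ⟨δ, h⟩ := M.exists_isPresentedBy_of_span (m := fun x : s => x.1) hd
    (by rw [← M.span_homogeneous, hs']; congr 1; exact Subtype.range_coe) R hR hR'
  exact ⟨_, _, inferInstance, inferInstance, _, _, _, _, h⟩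

end GrMod

/-! ### A presentation of `(M~)_0` from a homogeneous presentation of `M`. -/

section TildePresentation

open GradedRingedSpace ZeroMod

variable {A : Type u} [CommRing A] {𝒜 : ℤ → AddSubgroup A} [GradedRing 𝒜]

theorem linearCombination_apply_apply' {S : Type*} [CommRing S] {I L : Type*} (ψ : L → I →₀ S)
    (b : L →₀ S) {T : Finset L} (hT : b.support ⊆ T) (n : I) :
    Finsupp.linearCombination S ψ b n = ∑ l ∈ T, b l * ψ l n := by
  rw [linearCombination_apply_apply]
  exact Finsupp.sum_of_support_subset b hT (fun l a => a * ψ l n) fun _ _ => zero_mul _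

theorem linearCombination_eq_sum {S M : Type*} [CommRing S] [AddCommGroup M] [Module S M] {I : Type*}
    (m : I → M) (c : I →₀ S) {T : Finset I} (hT : c.support ⊆ T) :
    Finsupp.linearCombination S m c = ∑ i ∈ T, c i • m i := by
  rw [Finsupp.linearCombination_apply]
  exact Finsupp.sum_of_support_subset c hT (fun i a => a • m i) fun _ _ => zero_smul _ _

section LocalizedModules

variable {M : GrMod 𝒜}

/-- The canonical map to the localization. -/
abbrev GrMod.toLocMod (M : GrMod 𝒜) (q : GSpec 𝒜) : M.carrier →ₗ[A] M.Loc q :=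
  LocalizedModule.mkLinearMap q.homCompl M.carrier

theorem GSpec.algebraMap_smul_modFrac (p : GSpec 𝒜) (m : M.carrier) (a : A)
    (ha : SetLike.IsHomogeneousElem 𝒜 a) (hp : a ∉ p.ideal) :
    algebraMap A p.Loc a • p.modFrac m a ha hp = M.toLocMod p m := by
  rw [algebraMap_smul]
  exact (LocalizedModule.smul'_mk a m (⟨a, ha, hp⟩ : p.homCompl)).trans
    (LocalizedModule.mk_cancel (⟨a, ha, hp⟩ : p.homCompl) m)

theorem GSpec.frac_zero (p : GSpec 𝒜) (a : A) (ha : SetLike.IsHomogeneousElem 𝒜 a)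
    (hp : a ∉ p.ideal) : p.frac 0 a ha hp = 0 := Localization.mk_zero _

theorem GSpec.toLocMod_eq_zero (p : GSpec 𝒜) {m : M.carrier} (h : M.toLocMod p m = 0) :
    ∃ b, SetLike.IsHomogeneousElem 𝒜 b ∧ b ∉ p.ideal ∧ b • m = 0 := by
  obtain ⟨c, hc⟩ := (IsLocalizedModule.eq_zero_iff p.homCompl (M.toLocMod p)).1 h
  exact ⟨c.1, c.2.1, c.2.2, hc⟩

end LocalizedModules

variable [IsNoetherianRing A] (M : GrMod 𝒜)

/-- The value of a section of degree zero of `M~` at a point. -/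
def tildeVal {U : Opens (gspec 𝒜).carrier} (p : GSpec 𝒜) (hp : p ∈ U) :
    Sec (tilde M).zero U →+ M.Loc p :=
  (Pi.evalAddMonoidHom (fun q : U => GrMod.Loc M q.1) ⟨p, hp⟩).comp ((tildeGroups M 0).sections U).subtype

/-- The value of a section of the structure sheaf at a point. -/
def secVal {U : Opens (gspec 𝒜).carrier} (p : GSpec 𝒜) (hp : p ∈ U) : (gspec 𝒜).Sec U →+* p.Loc :=
  (Pi.evalRingHom (fun q : U => GSpec.Loc q.1) ⟨p, hp⟩).comp ((fracRings 𝒜).sections U).subtype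

/-- The section of the structure sheaf given by an element of `A`. -/
def toSec (V : Opens (gspec 𝒜).carrier) : A →+* (gspec 𝒜).Sec V := toSections V

theorem toSec_mem (V : Opens (gspec 𝒜).carrier) {e : ℤ} {a : A} (ha : a ∈ 𝒜 e) :
    toSec V a ∈ (gspec 𝒜).gr V e := toSections_mem V ha

variable {M} {U V W : Opens (gspec 𝒜).carrier} {p : GSpec 𝒜}

theorem tilde_ext {s t : Sec (tilde M).zero U} (h : ∀ p hp, tildeVal M p hp s = tildeVal M p hp t) :
    s = t :=
  Subtype.ext (funext fun q => h q.1 q.2)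

theorem sec_ext {s t : (gspec 𝒜).Sec U} (h : ∀ p hp, secVal p hp s = secVal p hp t) : s = t :=
  Subtype.ext (funext fun q => h q.1 q.2)

theorem tildeVal_res (i : V ⟶ U) (s : Sec (tilde M).zero U) (hp : p ∈ V) :
    tildeVal M p hp (ZeroMod.res (tilde M).zero i s) = tildeVal M p (i.le hp) s := rfl

theorem secVal_res (i : V ⟶ U) (s : (gspec 𝒜).Sec U) (hp : p ∈ V) :
    secVal p hp ((gspec 𝒜).res i s) = secVal p (i.le hp) s := rfl

theorem tildeVal_lin {I : Type u} (e : I → Sec (tilde M).zero U)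
    (c : I →₀ (gspec 𝒜).gr U 0) (T : Finset I) (hT : c.support ⊆ T) (hp : p ∈ U) :
    tildeVal M p hp (lin (tilde M).zero e c) = ∑ i ∈ T, secVal p hp (c i).1 • tildeVal M p hp (e i) := by
  refine (congrArg _ (linearCombination_eq_sum (S := (gspec 𝒜).gr U 0) e c hT)).trans ?_
  rw [map_sum]
  rfl

theorem exists_modFrac (g : Sec (tilde M).zero V) {x : GSpec 𝒜} (hx : x ∈ V) :
    ∃ (W : Opens (gspec 𝒜).carrier) (_ : x ∈ W) (k : W ⟶ V) (e : ℤ) (μ : M.carrier) (a : A)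
      (_ : μ ∈ M.gr e) (ha : a ∈ 𝒜 e) (hne : ∀ q ∈ W, a ∉ GSpec.ideal q),
      ∀ (p : GSpec 𝒜) (hp : p ∈ W), tildeVal M p hp (ZeroMod.res (tilde M).zero k g) =
        p.modFrac μ a (isHom ha) (hne p hp) := by
  let g' : (tildeGroups M 0).sections V := g
  obtain ⟨W, hW, k, e, μ, a, hμ, ha, hne, hg⟩ := g'.2 ⟨x, hx⟩
  exact ⟨W, hW, k, e, μ, a, by rwa [zero_add] at hμ, ha, fun q hq => hne ⟨q, hq⟩, fun p hp => hg ⟨p, hp⟩⟩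

/-- The section of degree `e` of `M~` given by an element of degree `e`. -/
def toTilde {e : ℤ} (V : Opens (gspec 𝒜).carrier) {m : M.carrier} (hm : m ∈ M.gr e) :
    (tilde M).Sec e V :=
  (⟨fun q => M.toLocMod q.1 m, fun x => ⟨V, x.2, 𝟙 V, 0, m, 1, by rwa [add_zero],
    SetLike.one_mem_graded 𝒜, fun q => GSpec.one_not_mem q.1, fun _ => rfl⟩⟩ : (tildeGroups M e).sections V)

variable {I L : Type u} {d : I → ℤ} {m : I → M.carrier} {δ : L → ℤ}
  {r : L → I →₀ A} (h : M.IsPresentedBy d m δ r) (u : ∀ e, (gspec 𝒜).gr V e)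
  (v : ∀ e, (gspec 𝒜).gr V (-e)) (hd : ∀ i, (u (d i)).1 * (v (d i)).1 = 1)
  (hδ : ∀ l, (u (δ l)).1 * (v (δ l)).1 = 1)

/-- The generators of degree zero of `M~` attached to homogeneous generators of `M`. -/
def tildeGen (i : I) : Sec (tilde M).zero V :=
  (tilde M).smul (neg_add_cancel (d i)) V (v (d i)) (toTilde V (h.mem i))

include h in
theorem tildeRel_mem (l : L) (i : I) :
    (v (δ l)).1 * toSec V (r l i) * (u (d i)).1 ∈ (gspec 𝒜).gr V 0 := by
  have := SetLike.mul_mem_graded (SetLike.mul_mem_graded (v (δ l)).2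
    (toSec_mem V (h.rel_mem l i))) (u (d i)).2
  rwa [show -δ l + (δ l - d i) + d i = 0 by ring] at this

/-- The relations between the generators of degree zero. -/
def tildeRel (l : L) : I →₀ (gspec 𝒜).gr V 0 :=
  Finsupp.onFinset (r l).support (fun i => ⟨(v (δ l)).1 * toSec V (r l i) * (u (d i)).1,
    tildeRel_mem h u v l i⟩) fun i hi => by
      rw [Finsupp.mem_support_iff]
      intro h0
      refine hi (Subtype.ext ?_)
      change (v (δ l)).1 * toSec V (r l i) * (u (d i)).1 = 0
      rw [h0, map_zero, mul_zero, zero_mul]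

theorem tildeRel_support (l : L) : (tildeRel h u v l).support ⊆ (r l).support :=
  Finsupp.support_onFinset_subset

theorem tildeVal_tildeGen (i : I) (hp : p ∈ V) :
    tildeVal M p hp (tildeGen h v i) = secVal p hp (v (d i)).1 • M.toLocMod p (m i) := rfl

theorem secVal_tildeRel (l : L) (i : I) (hp : p ∈ V) : secVal p hp (tildeRel h u v l i).1 =
    secVal p hp (v (δ l)).1 * algebraMap A p.Loc (r l i) * secVal p hp (u (d i)).1 :=
  (map_mul (secVal p hp) _ _).trans (congrArg (· * _) (map_mul (secVal p hp) _ _))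

theorem secVal_mul_secVal {e : ℤ} {a : (gspec 𝒜).gr V e} {b : (gspec 𝒜).gr V (-e)}
    (hab : a.1 * b.1 = 1) (hp : p ∈ V) : secVal p hp a.1 * secVal p hp b.1 = 1 := by
  rw [← map_mul, hab, map_one]

theorem fracMulUnit_mem {W : Opens (gspec 𝒜).carrier} (k : W ⟶ V) {e j : ℤ} {c a : A}
    (hc : c ∈ 𝒜 (-j + e)) (ha : a ∈ 𝒜 e) (hW : ∀ q ∈ W, a ∉ GSpec.ideal q) :
    (fracSec (V := W) hc ha hW).1 * (gspec 𝒜).res k (u j).1 ∈ (gspec 𝒜).gr W 0 := by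
  have := SetLike.mul_mem_graded (A := (gspec 𝒜).gr W) (fracSec (V := W) hc ha hW).2
    ((gspec 𝒜).map_mem k (u j).2)
  rwa [neg_add_cancel] at this

/-- The section of degree zero `c / a · u`. -/
def fracMulUnit {W : Opens (gspec 𝒜).carrier} (k : W ⟶ V) {e j : ℤ} {c a : A} (hc : c ∈ 𝒜 (-j + e))
    (ha : a ∈ 𝒜 e) (hW : ∀ q ∈ W, a ∉ GSpec.ideal q) : (gspec 𝒜).gr W 0 :=
  ⟨_, fracMulUnit_mem u k hc ha hW⟩

theorem secVal_fracMulUnit (k : W ⟶ V) {e j : ℤ} {c a : A}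
    (hc : c ∈ 𝒜 (-j + e)) (ha : a ∈ 𝒜 e) (hW : ∀ q ∈ W, a ∉ GSpec.ideal q) (hp : p ∈ W) :
    secVal p hp (fracMulUnit u k hc ha hW).1 =
      p.frac c a (isHom ha) (hW p hp) * secVal p (k.le hp) (u j).1 :=
  map_mul (secVal p hp) _ _

theorem fracMulUnit_zero (k : W ⟶ V) {e j : ℤ} {c a : A}
    (hc : c ∈ 𝒜 (-j + e)) (ha : a ∈ 𝒜 e) (hW : ∀ q ∈ W, a ∉ GSpec.ideal q) (h0 : c = 0) :
    fracMulUnit u k hc ha hW = 0 := by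
  subst h0
  refine Subtype.ext (sec_ext fun p hp => ?_)
  rw [secVal_fracMulUnit, GSpec.frac_zero, zero_mul]
  exact (map_zero (secVal p hp)).symm

/-- The family of sections of degree zero `c i / a · u`. -/
def fracMulUnits (k : W ⟶ V) {J : Type u} {D : J → ℤ} {e : ℤ} {c : J →₀ A}
    {a : A} (hc : ∀ i, c i ∈ 𝒜 (-D i + e)) (ha : a ∈ 𝒜 e) (hW : ∀ q ∈ W, a ∉ GSpec.ideal q) :
    J →₀ (gspec 𝒜).gr W 0 :=
  Finsupp.onFinset c.support (fun i => fracMulUnit u k (hc i) ha hW) fun i hi => by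
    rw [Finsupp.mem_support_iff]
    exact fun h0 => hi (fracMulUnit_zero u k (hc i) ha hW h0)

theorem fracMulUnits_support (k : W ⟶ V) {J : Type u} {D : J → ℤ} {e : ℤ}
    {c : J →₀ A} {a : A} (hc : ∀ i, c i ∈ 𝒜 (-D i + e)) (ha : a ∈ 𝒜 e)
    (hW : ∀ q ∈ W, a ∉ GSpec.ideal q) : (fracMulUnits u k hc ha hW).support ⊆ c.support :=
  Finsupp.support_onFinset_subset

theorem algebraMap_mul_fracMulUnits (k : W ⟶ V) {J : Type u} {D : J → ℤ} {e : ℤ}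
    {c : J →₀ A} {a : A} (hc : ∀ i, c i ∈ 𝒜 (-D i + e)) (ha : a ∈ 𝒜 e)
    (hW : ∀ q ∈ W, a ∉ GSpec.ideal q) (i : J) (hp : p ∈ W) :
    algebraMap A p.Loc a * secVal p hp (fracMulUnits u k hc ha hW i).1 =
      algebraMap A p.Loc (c i) * secVal p (k.le hp) (u (D i)).1 := by
  refine (congrArg _ (secVal_fracMulUnit u k (hc i) ha hW hp)).trans ?_
  rw [← mul_assoc, GSpec.algebraMap_mul_frac]

-- Locally `g = μ / a` with `μ` and `a` of the same degree, and `μ = ∑ c_i m_i` with homogeneous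
-- `c_i`. Since `u v = 1` in degree `d i`, this is `g = ∑ (c_i / a · u) (v m_i)`, whose coefficients
-- and generators have degree zero.
include hd in
theorem tilde_gen {V' : Opens (gspec 𝒜).carrier} (i : V' ⟶ V) (g : Sec (tilde M).zero V')
    {x : (gspec 𝒜).carrier} (hx : x ∈ V') :
    ∃ (W : Opens (gspec 𝒜).carrier) (_ : x ∈ W) (k : W ⟶ V') (c : I →₀ (gspec 𝒜).gr W 0),
      lin (tilde M).zero (fun n => ZeroMod.res (tilde M).zero (k ≫ i) (tildeGen h v n)) c =
        ZeroMod.res (tilde M).zero k g := by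
  obtain ⟨W, hW, k, e, μ, a, hμ, ha, hne, hg⟩ := exists_modFrac g hx
  obtain ⟨c, hc, hcμ⟩ := h.exists_homogeneous hμ
  have hc' : ∀ i, c i ∈ 𝒜 (-d i + e) := fun i => by rw [neg_add_eq_sub]; exact hc i
  refine ⟨W, hW, k, fracMulUnits u (k ≫ i) hc' ha hne, tilde_ext fun p hp => ?_⟩
  rw [hg, tildeVal_lin _ _ c.support (fracMulUnits_support _ _ _ _ _)]
  refine ((p.isUnit_algebraMap (isHom ha) (hne p hp)).smul_left_cancel).1 ?_
  rw [GSpec.algebraMap_smul_modFrac, ← hcμ, Finsupp.linearCombination_apply, Finsupp.sum, map_sum, Finset.smul_sum]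
  refine Finset.sum_congr rfl fun n _ => ?_
  rw [tildeVal_res, tildeVal_tildeGen, smul_smul, smul_smul, algebraMap_mul_fracMulUnits, mul_assoc,
    secVal_mul_secVal (hd _), mul_one, algebraMap_smul, map_smul]

-- In `∑ (v r_i u) (v' m_i)` the units `u` and `v'` of degrees `d i` and `-d i` cancel, which leaves
-- `v` times the relation `∑ r_i m_i = 0`.
include hd in
theorem tilde_rel (l : L) : lin (tilde M).zero (tildeGen h v) (tildeRel h u v l) = 0 := by
  refine tilde_ext fun p hp => ?_
  rw [tildeVal_lin _ _ (r l).support (tildeRel_support _ _ _ _), map_zero]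
  have h1 := congrArg (fun z => secVal p hp (v (δ l)).1 • M.toLocMod p z) (h.rel l)
  rw [map_zero, smul_zero, Finsupp.linearCombination_apply, Finsupp.sum, map_sum, Finset.smul_sum] at h1
  refine Eq.trans (Finset.sum_congr rfl fun n _ => ?_) h1
  rw [secVal_tildeRel, tildeVal_tildeGen, smul_smul, mul_assoc _ (secVal p hp (u (d n)).1),
    secVal_mul_secVal (hd _), mul_one, map_smul, ← algebraMap_smul p.Loc (r l n), smul_smul]

/-- Finitely many sections of given degrees have a common denominator near a point. -/
theorem exists_common_denom {V' : Opens (gspec 𝒜).carrier} {x : GSpec 𝒜} (hx : x ∈ V') {J : Type u}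
    (T : Finset J) (D : J → ℤ) (s : ∀ i, (gspec 𝒜).gr V' (D i)) :
    ∃ (e : ℤ) (a : A) (n : J →₀ A), a ∈ 𝒜 e ∧ a ∉ x.ideal ∧ (∀ i, n i ∈ 𝒜 (D i + e)) ∧
      n.support ⊆ T ∧ ∀ (p : GSpec 𝒜) (hp : p ∈ V'), a ∉ p.ideal → ∀ i ∈ T,
        algebraMap A p.Loc a * secVal p hp (s i).1 = algebraMap A p.Loc (n i) := by
  classical
  choose e b c hb hc hcx hcV hbc using fun i => exists_frac_on_gBasicOpen (s i).2 (p := x) hx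
  refine ⟨∑ i ∈ T, e i, ∏ i ∈ T, c i, Finsupp.onFinset T
    (fun i => if i ∈ T then (∏ j ∈ T.erase i, c j) * b i else 0) fun i hi => by
      by_contra hiT; exact hi (if_neg hiT), SetLike.prod_mem_graded 𝒜 e c fun i _ => hc i, fun hmem => ?_,
    fun i => ?_, Finsupp.support_onFinset_subset, fun q hqV hq i hi => ?_⟩
  · have := x.isPrime
    obtain ⟨i, -, hi⟩ := (Ideal.IsPrime.prod_mem_iff (p := x.ideal.toIdeal)).1 hmem
    exact hcx i hi
  · rw [Finsupp.onFinset_apply]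
    split_ifs with hi
    · have := SetLike.mul_mem_graded (SetLike.prod_mem_graded 𝒜 e c (F := T.erase i) fun i _ => hc i)
        (hb i)
      rwa [show ∑ j ∈ T.erase i, e j + (D i + e i) = D i + ∑ j ∈ T, e j by
        rw [← Finset.sum_erase_add T e hi]; ring] at this
    · exact zero_mem _
  · have hci : c i ∉ q.ideal := fun hmem => hq (Ideal.mem_of_dvd _ (Finset.dvd_prod_of_mem c hi) hmem)
    rw [Finsupp.onFinset_apply, if_pos hi, ← Finset.prod_erase_mul T c hi, map_mul, map_mul, mul_assoc]
    exact congrArg _ (hbc i q hci)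

variable (𝒜) in
/-- The value of a section of degree zero of the structure sheaf at a point. -/
def secValZero (p : GSpec 𝒜) (hp : p ∈ U) : (gspec 𝒜).gr U 0 →+* p.Loc :=
  (secVal p hp).comp (algebraMap ((gspec 𝒜).gr U 0) ((gspec 𝒜).Sec U))

theorem secValZero_apply (hp : p ∈ U) (c : (gspec 𝒜).gr U 0) : secValZero 𝒜 p hp c = secVal p hp c.1 :=
  rfl

-- The coefficients `c_j v` are written near `x` as `n_j / a` with a common denominator. The sum `∑
-- n_j m_j` vanishes in `M_𝔭` at `x`, so a homogeneous `b` outside the prime kills it in `M`, and `b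
-- n = ∑ k_l r_l` with homogeneous `k_l`. Dividing by `b a` and multiplying by units of degree `δ l`
-- gives coefficients of degree zero on `D(b a)`.
include hd hδ in
theorem tilde_relgen {V' : Opens (gspec 𝒜).carrier} (i : V' ⟶ V) (c : I →₀ (gspec 𝒜).gr V' 0)
    (h0 : lin (tilde M).zero (fun n => ZeroMod.res (tilde M).zero i (tildeGen h v n)) c = 0)
    {x : (gspec 𝒜).carrier} (hx : x ∈ V') :
    ∃ (W : Opens (gspec 𝒜).carrier) (_ : x ∈ W) (k : W ⟶ V') (b : L →₀ (gspec 𝒜).gr W 0),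
      resFin k c = Finsupp.linearCombination ((gspec 𝒜).gr W 0)
        (fun l => resFin (k ≫ i) (tildeRel h u v l)) b := by
  let x' : GSpec 𝒜 := x
  -- The products `c_j v` have degree `-d j`, so that the numerators `n j` have degree `-d j + E`
  -- and `∑ n_j m_j` is homogeneous of degree `E`.
  obtain ⟨E, a, n, ha, hax, hn, hnc, hna⟩ := exists_common_denom (x := x') hx c.support (fun j => - d j)
    (fun j => ⟨(c j).1 * (gspec 𝒜).res i (v (d j)).1, by
      have := SetLike.mul_mem_graded (c j).2 ((gspec 𝒜).map_mem i (v (d j)).2)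
      rwa [zero_add] at this⟩)
  have h1 : M.toLocMod x' (Finsupp.linearCombination A m n) = 0 := by
    have h2 := congrArg (fun z => algebraMap A x'.Loc a • tildeVal M x' hx z) h0
    rw [tildeVal_lin _ _ c.support subset_rfl, Finset.smul_sum, map_zero, smul_zero] at h2
    rw [linearCombination_eq_sum m n hnc, map_sum]
    refine Eq.trans (Finset.sum_congr rfl fun j hj => ?_) h2
    rw [tildeVal_res, tildeVal_tildeGen, map_smul, ← algebraMap_smul x'.Loc (n j),
      ← hna x' hx hax j hj, map_mul, smul_smul, smul_smul, secVal_res, mul_assoc]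
  obtain ⟨b, ⟨β, hb⟩, hbx, hb0⟩ := x'.toLocMod_eq_zero h1
  rw [← map_smul] at hb0
  obtain ⟨k, hk, hkr⟩ := h.exists_homogeneous_rel (e := β + E) (fun j => by
    have := SetLike.mul_mem_graded hb (hn j)
    rwa [show β + (-d j + E) = β + E - d j by ring] at this) hb0
  let W : Opens (gspec 𝒜).carrier := V' ⊓ gBasicOpen 𝒜 (b * a)
  have hW : ∀ q ∈ W, b * a ∉ GSpec.ideal q := fun q hq => hq.2
  have hk' : ∀ l, k l ∈ 𝒜 (-δ l + (β + E)) := fun l => by rw [neg_add_eq_sub]; exact hk l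
  let f : W ⟶ V' := Opens.infLELeft _ _
  have hba := SetLike.mul_mem_graded hb ha
  refine ⟨W, ⟨hx, x'.mul_not_mem hbx hax⟩, f, fracMulUnits u (f ≫ i) hk' hba hW,
    Finsupp.ext fun j => Subtype.ext (sec_ext fun p hp => ?_)⟩
  have hpa : a ∉ p.ideal := fun h' => hp.2 (Ideal.mul_mem_left _ _ h')
  -- The identity `(b a) (c_j v) = ∑ k_l r_l` in coordinate `j`. Outside the support of `c` both
  -- sides vanish, as `n` is supported there too.
  have hu : algebraMap A p.Loc (b * a) * (secVal p (f.le hp) (c j).1 *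
      secVal p (i.le (f.le hp)) (v (d j)).1) =
      algebraMap A p.Loc (Finsupp.linearCombination A r k j) := by
    rw [hkr, Finsupp.smul_apply, smul_eq_mul, map_mul, map_mul, mul_assoc]
    congr 1
    by_cases hj : j ∈ c.support
    · refine Eq.trans ?_ (hna p (f.le hp) hpa j hj)
      rw [map_mul, secVal_res]
    · have hcj : secVal p (f.le hp) (c j).1 = 0 := by
        rw [Finsupp.notMem_support_iff.1 hj]; exact map_zero _
      rw [Finsupp.notMem_support_iff.1 fun hj' => hj (hnc hj'), map_zero, hcj, zero_mul, mul_zero]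
  rw [linearCombination_apply_apply' (S := (gspec 𝒜).gr W 0) _ _ (fracMulUnits_support _ _ _ _ _),
    ← secValZero_apply, ← secValZero_apply, map_sum]
  refine (p.isUnit_algebraMap (isHom hba) hp.2).mul_left_cancel ?_
  have hu' := congrArg (· * secVal p (i.le (f.le hp)) (u (d j)).1) hu
  rw [mul_assoc, mul_assoc, mul_comm (secVal p _ (v (d j)).1), secVal_mul_secVal (hd _), mul_one,
    linearCombination_apply_apply, Finsupp.sum, map_sum, Finset.sum_mul] at hu'
  refine hu'.trans ?_
  rw [Finset.mul_sum]
  refine Finset.sum_congr rfl fun l _ => ?_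
  have e1 : secVal p hp (resFin (f ≫ i) (tildeRel h u v l) j).1 = secVal p (i.le (f.le hp))
    (tildeRel h u v l j).1 := rfl
  rw [map_mul (secValZero 𝒜 p hp), secValZero_apply, secValZero_apply, e1, ← mul_assoc,
    algebraMap_mul_fracMulUnits, secVal_tildeRel, map_mul]
  -- The factor `E * F` is the product of the inverse units of degrees `δ l` and `-δ l`; it is
  -- inserted so that the first unit completes the coefficient and the second completes the
  -- relation.
  have aux : ∀ K R D E F : p.Loc, E * F = 1 → K * R * D = K * E * (F * R * D) := by
    intro K R D E F hEF
    linear_combination (-(K * R * D)) * hEF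
  exact aux _ _ _ _ _ (secVal_mul_secVal (hδ l) (i.le (f.le hp)))

include hd hδ in
theorem tilde_isPresentedBy : ZeroMod.IsPresentedBy (X := gspec 𝒜) (tilde M).zero V (tildeGen h v)
    (tildeRel h u v) where
  gen i g _ hx := tilde_gen h u v hd i g hx
  rel := tilde_rel h u v hd
  relgen i c h0 _ hx := tilde_relgen h u v hd hδ i c h0 hx

end TildePresentation

/-! ### A sheaf of modules is determined by its generators and relations. -/

namespace GradedRingedSpace

namespace ZeroMod

variable {X : GradedRingedSpace.{u}} {I L : Type u}

theorem resFin_linearCombination {U V : Opens X.carrier} (i : V ⟶ U) (ψ : L → I →₀ X.gr U 0)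
    (b : L →₀ X.gr U 0) : resFin i (Finsupp.linearCombination (X.gr U 0) ψ b) =
      Finsupp.linearCombination (X.gr V 0) (fun l => resFin i (ψ l)) (resFin i b) := by
  have hb : (resFin i b).support ⊆ b.support := Finsupp.support_mapRange
  refine Finsupp.ext fun n => ?_
  change X.resGr i 0 _ = _
  rw [linearCombination_apply_apply' _ _ subset_rfl, map_sum, linearCombination_apply_apply' _ _ hb]
  exact Finset.sum_congr rfl fun l _ => Subtype.ext (map_mul (X.res i) (b l).1 (ψ l n).1)

theorem res_lin_res (G : X.ZeroMod) {U V W : Opens X.carrier} (i : V ⟶ U) (k : W ⟶ V)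
    (e : I → Sec G U) (c : I →₀ X.gr V 0) :
    res G k (lin G (fun n => res G i (e n)) c) = lin G (fun n => res G (k ≫ i) (e n)) (resFin k c) := by
  rw [res_lin]
  simp only [res_res]

theorem lin_linearCombination (G : X.ZeroMod) {U : Opens X.carrier} (e : I → Sec G U)
    (ψ : L → I →₀ X.gr U 0) (b : L →₀ X.gr U 0) :
    lin G e (Finsupp.linearCombination (X.gr U 0) ψ b) =
      Finsupp.linearCombination (X.gr U 0) (fun l => lin G e (ψ l)) b := by
  rw [linearCombination_eq_sum ψ b subset_rfl, map_sum, linearCombination_eq_sum _ b subset_rfl]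
  exact Finset.sum_congr rfl fun l _ => map_smul _ _ _

namespace IsPresentedBy

variable {G H : X.ZeroMod} {U : Opens X.carrier} {e : I → Sec G U} {e' : I → Sec H U}
  {φ : L → I →₀ X.gr U 0}

theorem restrict (h : IsPresentedBy G U e φ) {V : Opens X.carrier} (i : V ⟶ U) :
    IsPresentedBy G V (fun n => res G i (e n)) (fun l => resFin i (φ l)) where
  gen := by
    intro V' i' g x hx
    obtain ⟨W, hW, k, c, hc⟩ := h.gen (i' ≫ i) g hx
    refine ⟨W, hW, k, c, ?_⟩
    rw [← hc]
    simp only [res_res, Category.assoc]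
  rel l := by rw [← res_lin, h.rel, map_zero]
  relgen := by
    intro V' i' c h0 x hx
    simp only [res_res] at h0
    obtain ⟨W, hW, k, b, hb⟩ := h.relgen (i' ≫ i) c h0 hx
    refine ⟨W, hW, k, b, ?_⟩
    rw [hb]
    simp only [resFin_resFin, Category.assoc]

theorem mapIso (h : IsPresentedBy G U e φ) (f : G ≅ H) :
    IsPresentedBy H U (fun n => mapSec f.hom U (e n)) φ := by
  have h1 : ∀ (V : Opens X.carrier) (s : Sec G V), mapSec f.inv V (mapSec f.hom V s) = s := fun V s =>
    congrArg (fun z : G ⟶ G => mapSec z V s) f.hom_inv_id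
  have h2 : ∀ (V : Opens X.carrier) (s : Sec H V), mapSec f.hom V (mapSec f.inv V s) = s := fun V s =>
    congrArg (fun z : H ⟶ H => mapSec z V s) f.inv_hom_id
  have h3 : ∀ {V : Opens X.carrier} (e : I → Sec G V) (c : I →₀ X.gr V 0),
      lin H (fun n => mapSec f.hom V (e n)) c = mapSec f.hom V (lin G e c) := fun {V} e c => by
    rw [linearCombination_eq_sum _ _ subset_rfl, linearCombination_eq_sum _ _ subset_rfl, map_sum]
    exact Finset.sum_congr rfl fun n _ => (mapSec_act f.hom (c n) (e n)).symm
  have h4 : ∀ {V : Opens X.carrier} (i : V ⟶ U) (c : I →₀ X.gr V 0),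
      lin H (fun n => res H i (mapSec f.hom U (e n))) c =
        mapSec f.hom V (lin G (fun n => res G i (e n)) c) := fun i c => by
    rw [← h3]
    simp only [mapSec_res]
  refine ⟨fun {V} i g x hx => ?_, fun l => ?_, fun {V} i c h0 x hx => ?_⟩
  · obtain ⟨W, hW, k, c, hc⟩ := h.gen i (mapSec f.inv V g) hx
    refine ⟨W, hW, k, c, ?_⟩
    rw [h4, hc, ← mapSec_res, h2]
  · rw [h3, h.rel, map_zero]
  · rw [h4] at h0
    refine h.relgen i c ?_ hx
    rw [← h1 V (lin G _ c), h0, map_zero]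

variable (G H e e') in
/-- Two sections that are locally the same linear combination of given families of sections. -/
def Corr {V : Opens X.carrier} (i : V ⟶ U) (g : Sec G V) (g' : Sec H V) : Prop :=
  ∀ x ∈ V, ∃ (W : Opens X.carrier) (_ : x ∈ W) (k : W ⟶ V) (c : I →₀ X.gr W 0),
    lin G (fun n => res G (k ≫ i) (e n)) c = res G k g ∧
      lin H (fun n => res H (k ≫ i) (e' n)) c = res H k g'

variable {V : Opens X.carrier} {i : V ⟶ U} {g g₁ : Sec G V} {g' g₁' : Sec H V}

theorem Corr.symm (h : Corr G H e e' i g g') : Corr H G e' e i g' g := fun x hx => by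
  obtain ⟨W, hW, k, c, h1, h2⟩ := h x hx
  exact ⟨W, hW, k, c, h2, h1⟩

theorem lin_eq_res_of_le {W W' : Opens X.carrier} {k : W ⟶ V} {c : I →₀ X.gr W 0}
    (h : lin G (fun n => res G (k ≫ i) (e n)) c = res G k g) (l : W' ⟶ W) :
    lin G (fun n => res G ((l ≫ k) ≫ i) (e n)) (resFin l c) = res G (l ≫ k) g := by
  rw [← res_res, ← h, res_lin_res, Category.assoc]

theorem Corr.add (h : Corr G H e e' i g g') (h₁ : Corr G H e e' i g₁ g₁') :
    Corr G H e e' i (g + g₁) (g' + g₁') := fun x hx => by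
  obtain ⟨W, hW, k, c, h1, h2⟩ := h x hx
  obtain ⟨W', hW', k', c', h1', h2'⟩ := h₁ x hx
  refine ⟨W ⊓ W', mem_inf' hW hW', Opens.infLELeft W W' ≫ k,
    resFin (Opens.infLELeft W W') c + resFin (Opens.infLERight W W') c', ?_, ?_⟩
  · rw [map_add, map_add, lin_eq_res_of_le h1]
    exact congrArg _ (lin_eq_res_of_le h1' (Opens.infLERight W W'))
  · rw [map_add, map_add, lin_eq_res_of_le h2]
    exact congrArg _ (lin_eq_res_of_le h2' (Opens.infLERight W W'))

theorem Corr.act (h : Corr G H e e' i g g') (a : X.gr V 0) :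
    Corr G H e e' i (ZeroMod.act G a g) (ZeroMod.act H a g') := fun x hx => by
  obtain ⟨W, hW, k, c, h1, h2⟩ := h x hx
  refine ⟨W, hW, k, X.resGr k 0 a • c, ?_, ?_⟩
  · rw [map_smul, h1, res_act]; rfl
  · rw [map_smul, h2, res_act]; rfl

theorem Corr.neg (h : Corr G H e e' i g g') : Corr G H e e' i (-g) (-g') := fun x hx => by
  obtain ⟨W, hW, k, c, h1, h2⟩ := h x hx
  exact ⟨W, hW, k, -c, by rw [map_neg, h1, map_neg], by rw [map_neg, h2, map_neg]⟩

theorem Corr.res (h : Corr G H e e' i g g') {V' : Opens X.carrier} (l : V' ⟶ V) :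
    Corr G H e e' (l ≫ i) (ZeroMod.res G l g) (ZeroMod.res H l g') := fun x hx => by
  obtain ⟨W, hW, k, c, h1, h2⟩ := h x (l.le hx)
  refine ⟨W ⊓ V', mem_inf' hW hx, Opens.infLERight W V', resFin (Opens.infLELeft W V') c, ?_, ?_⟩
  · rw [res_res]; exact lin_eq_res_of_le h1 _
  · rw [res_res]; exact lin_eq_res_of_le h2 _

/-- If a combination of the generators `e` is zero, its coefficients are locally combinations of the
relations `φ l`. These hold between the `e'` as well, so the same combination of the `e'` is zero.
-/
theorem Corr.eq_zero (h : Corr G H e e' i 0 g') (hG : IsPresentedBy G U e φ)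
    (hH : IsPresentedBy H U e' φ) : g' = 0 := by
  refine eq_zero_of_locally H g' fun x hx => ?_
  obtain ⟨W, hW, k, c, h1, h2⟩ := h x hx
  rw [map_zero] at h1
  obtain ⟨W', hW', k', b, hb⟩ := hG.relgen (k ≫ i) c h1 hW
  refine ⟨W', hW', k' ≫ k, ?_⟩
  rw [← res_res, ← h2, res_lin_res, hb, lin_linearCombination]
  have : ∀ l, lin H (fun n => ZeroMod.res H (k' ≫ k ≫ i) (e' n)) (resFin (k' ≫ k ≫ i) (φ l)) = 0 :=
    fun l => by rw [← res_lin, hH.rel, map_zero]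
  simp only [this]
  rw [linearCombination_eq_sum _ _ subset_rfl]
  exact Finset.sum_eq_zero fun l _ => smul_zero _

theorem Corr.eq (h : Corr G H e e' i g g') (h₁ : Corr G H e e' i g g₁') (hG : IsPresentedBy G U e φ)
    (hH : IsPresentedBy H U e' φ) : g' = g₁' := by
  have h2 := h.add h₁.neg
  rw [add_neg_cancel, ← sub_eq_add_neg] at h2
  exact sub_eq_zero.1 (h2.eq_zero hG hH)

/-- Locally `g = ∑ c_n e_n` is sent to `∑ c_n e'_n`. The coefficients are not unique, but by
`Corr.eq` the result is, so the local sections glue. -/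
theorem exists_corr (hG : IsPresentedBy G U e φ) (hH : IsPresentedBy H U e' φ) (i : V ⟶ U)
    (g : Sec G V) : ∃ g', Corr G H e e' i g g' := by
  choose W hW k c hc using fun x : V => hG.gen i g x.2
  have key : ∀ x, Corr G H e e' (k x ≫ i) (ZeroMod.res G (k x) g)
      (lin H (fun n => ZeroMod.res H (k x ≫ i) (e' n)) (c x)) := fun x y hy => by
    refine ⟨W x, hy, 𝟙 _, c x, ?_, ?_⟩
    · rw [res_id]; exact hc x
    · rw [res_id]; rfl
  obtain ⟨g', hg', -⟩ := (ab H).existsUnique_gluing' W V k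
    (fun x hx => Opens.mem_iSup.2 ⟨⟨x, hx⟩, hW _⟩)
    (fun x => lin H (fun n => ZeroMod.res H (k x ≫ i) (e' n)) (c x)) (by
      intro x y
      have h1 := (key x).res (Opens.infLELeft (W x) (W y))
      have h2 := (key y).res (Opens.infLERight (W x) (W y))
      rw [res_res] at h1 h2
      exact h1.eq h2 hG hH)
  refine ⟨g', fun x hx => ⟨W ⟨x, hx⟩, hW _, k _, c _, hc _, (hg' ⟨x, hx⟩).symm⟩⟩

/-- Sheaves of modules with the same global presentation are isomorphic. -/
theorem nonempty_iso {e : I → Sec G ⊤} {e' : I → Sec H ⊤} {φ : L → I →₀ X.gr ⊤ 0}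
    (hG : IsPresentedBy G ⊤ e φ) (hH : IsPresentedBy H ⊤ e' φ) : Nonempty (G ≅ H) := by
  choose f hf using fun (V : Opens X.carrier) (g : Sec G V) => exists_corr hG hH (homOfLE le_top) g
  let F : G ⟶ H := homMk (fun V => AddMonoidHom.mk' (f V) fun a b =>
      (hf V (a + b)).eq ((hf V a).add (hf V b)) hG hH)
    (fun V c g => (hf V _).eq ((hf V g).act c) hG hH)
    (fun {U V} l g => (hf V _).eq ((hf U g).res l) hG hH)
  have hF : ∀ V g, mapSec F V g = f V g := fun V g => rfl
  have : IsIso F := by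
    refine isIso_of_local F ?_ ?_
    · intro V g h0 x hx
      rw [hF] at h0
      have h1 := (hf V g).symm
      rw [h0] at h1
      exact ⟨V, hx, 𝟙 V, by rw [h1.eq_zero hH hG, map_zero]⟩
    · intro V g' x hx
      obtain ⟨g, hg⟩ := exists_corr hH hG (homOfLE le_top) g'
      refine ⟨V, hx, 𝟙 V, g, ?_⟩
      rw [hF, res_id]
      exact (hf V g).eq hg.symm hG hH
  exact ⟨asIso F⟩

end IsPresentedBy

end ZeroMod

end GradedRingedSpace

/-! ### Transport of presentations along open immersions. -/

namespace OpenImmersion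

open GradedRingedSpace ZeroMod

variable {Y X : GradedRingedSpace.{u}} (j : OpenImmersion Y X) {F : GMod X} {I L : Type u}
  {U V W : Opens Y.carrier}

theorem mem_image {y : Y.carrier} : j.base y ∈ j.image.obj V ↔ y ∈ V :=
  j.isOpenEmbedding.injective.mem_set_image

theorem image_map_le (U : Opens X.carrier) : j.image.obj ((Opens.map j.base).obj U) ≤ U := by
  rintro _ ⟨y, hy, rfl⟩
  exact hy

theorem map_le {U : Opens X.carrier} (h : U ≤ j.image.obj V) : (Opens.map j.base).obj U ≤ V :=
  fun _ hy => j.mem_image.1 (h hy)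

/-- Sections of a restriction. -/
def imSec (j : OpenImmersion Y X) (F : GMod X) (V : Opens Y.carrier) :
    Sec (j.restrict F).zero V ≃+ Sec F.zero (j.image.obj V) := AddEquiv.refl (F.Sec 0 (j.image.obj V))

theorem imSec_res (i : W ⟶ V) (s : Sec (j.restrict F).zero V) :
    j.imSec F W (ZeroMod.res (j.restrict F).zero i s) =
      ZeroMod.res F.zero (j.image.map i) (j.imSec F V s) := rfl

theorem imSec_act (c : Y.gr V 0) (s : Sec (j.restrict F).zero V) :
    j.imSec F V (c • s) = j.symmGr V 0 c • j.imSec F V s := rfl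

theorem symmGr_bijective (V : Opens Y.carrier) (d : ℤ) : Function.Bijective (j.symmGr V d) :=
  ⟨fun _ _ h => Subtype.ext ((j.iso V).symm.injective (congrArg Subtype.val h)), fun a =>
    ⟨⟨j.iso V a.1, (j.iso_mem V d _).2 a.2⟩, Subtype.ext ((j.iso V).symm_apply_apply a.1)⟩⟩

/-- Families of sections of degree zero on `Y` as families on the image. -/
def imFin (V : Opens Y.carrier) : (I →₀ Y.gr V 0) ≃+ (I →₀ X.gr (j.image.obj V) 0) :=
  Finsupp.mapRange.addEquiv (AddEquiv.ofBijective (j.symmGr V 0) (j.symmGr_bijective V 0))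

theorem imFin_apply (c : I →₀ Y.gr V 0) (n : I) : j.imFin V c n = j.symmGr V 0 (c n) := rfl

theorem imFin_support (c : I →₀ Y.gr V 0) : (j.imFin V c).support ⊆ c.support :=
  fun n hn => by
    rw [Finsupp.mem_support_iff] at hn ⊢
    exact fun h => hn (by rw [imFin_apply, h, map_zero])

theorem imFin_resFin (i : W ⟶ V) (c : I →₀ Y.gr V 0) :
    j.imFin W (resFin i c) = resFin (j.image.map i) (j.imFin V c) :=
  Finsupp.ext fun n => (j.symmGr_res i 0 (c n)).symm

theorem imSec_lin (e : I → Sec (j.restrict F).zero V) (c : I →₀ Y.gr V 0) :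
    j.imSec F V (lin (j.restrict F).zero e c) = lin F.zero (fun n => j.imSec F V (e n)) (j.imFin V c) := by
  rw [linearCombination_eq_sum e c subset_rfl, map_sum,
    linearCombination_eq_sum _ _ (j.imFin_support c)]
  exact Finset.sum_congr rfl fun n _ => j.imSec_act (c n) (e n)

theorem imFin_linearCombination (ψ : L → I →₀ Y.gr V 0) (b : L →₀ Y.gr V 0) :
    j.imFin V (Finsupp.linearCombination (Y.gr V 0) ψ b) =
      Finsupp.linearCombination (X.gr (j.image.obj V) 0) (fun l => j.imFin V (ψ l)) (j.imFin V b) := by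
  refine Finsupp.ext fun n => ?_
  rw [linearCombination_apply_apply' _ _ (j.imFin_support b), imFin_apply,
    linearCombination_apply_apply' _ _ subset_rfl, map_sum]
  exact Finset.sum_congr rfl fun l _ => Subtype.ext (map_mul (j.iso V).symm (b l).1 (ψ l n).1)

/-- Sections of the restriction over `V` are sections over the image of `V`, and the coefficient
rings are identified by the immersion. What remains is to pass between open subsets of the image and
open subsets of `Y`. -/
theorem isPresentedBy_image_iff {e : I → Sec (j.restrict F).zero V} {φ : L → I →₀ Y.gr V 0} :
    IsPresentedBy F.zero (j.image.obj V) (fun n => j.imSec F V (e n)) (fun l => j.imFin V (φ l)) ↔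
      IsPresentedBy (j.restrict F).zero V e φ := by
  constructor
  · intro h
    refine ⟨fun {V'} i g y hy => ?_, fun l => ?_, fun {V'} i c h0 y hy => ?_⟩
    · obtain ⟨W, hW, k, c, hc⟩ := h.gen (j.image.map i) (j.imSec F V' g) (j.mem_image.2 hy)
      -- An open set `W` inside the image is replaced by the image of its preimage, to which
      -- everything is restricted along `l`.
      let l : j.image.obj ((Opens.map j.base).obj W) ⟶ W := homOfLE (j.image_map_le W)
      refine ⟨(Opens.map j.base).obj W, hW, homOfLE (j.map_le k.le),
        (j.imFin _).symm (resFin l c), (j.imSec F _).injective ?_⟩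
      rw [imSec_lin, AddEquiv.apply_symm_apply]
      refine Eq.trans ?_ (congrArg (ZeroMod.res F.zero l) hc) |>.trans ?_
      · rw [res_lin_res]; rfl
      · rw [ZeroMod.res_res]; rfl
    · refine (j.imSec F _).injective ?_
      rw [imSec_lin, h.rel, map_zero]
    · have h1 := congrArg (j.imSec F V') h0
      rw [imSec_lin, map_zero] at h1
      obtain ⟨W, hW, k, b, hb⟩ := h.relgen (j.image.map i) (j.imFin V' c) h1 (j.mem_image.2 hy)
      let l : j.image.obj ((Opens.map j.base).obj W) ⟶ W := homOfLE (j.image_map_le W)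
      refine ⟨(Opens.map j.base).obj W, hW, homOfLE (j.map_le k.le),
        (j.imFin _).symm (resFin l b), (j.imFin _).injective ?_⟩
      rw [imFin_linearCombination, AddEquiv.apply_symm_apply]
      have h2 := congrArg (resFin l) hb
      rw [resFin_resFin, resFin_linearCombination] at h2
      simp only [resFin_resFin] at h2
      refine (j.imFin_resFin _ _).trans (h2.trans ?_)
      simp only [imFin_resFin]
      rfl
  · intro h
    refine ⟨fun {V'} i g x hx => ?_, fun l => ?_, fun {V'} i c h0 x hx => ?_⟩
    · obtain ⟨y, hy, rfl⟩ := i.le hx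
      let l : j.image.obj ((Opens.map j.base).obj V') ⟶ V' := homOfLE (j.image_map_le V')
      obtain ⟨W, hW, k, c, hc⟩ := h.gen (homOfLE (j.map_le i.le)) ((j.imSec F _).symm
        (ZeroMod.res F.zero l g)) (x := y) hx
      refine ⟨j.image.obj W, j.mem_image.2 hW, j.image.map k ≫ l, j.imFin W c, ?_⟩
      have h1 := congrArg (j.imSec F W) hc
      rw [imSec_lin, imSec_res, AddEquiv.apply_symm_apply, ZeroMod.res_res] at h1
      exact h1
    · rw [← imSec_lin, h.rel, map_zero]
    · obtain ⟨y, hy, rfl⟩ := i.le hx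
      let l : j.image.obj ((Opens.map j.base).obj V') ⟶ V' := homOfLE (j.image_map_le V')
      obtain ⟨W, hW, k, b, hb⟩ := h.relgen (homOfLE (j.map_le i.le)) ((j.imFin _).symm (resFin l c)) (by
        refine (j.imSec F _).injective ?_
        rw [imSec_lin, AddEquiv.apply_symm_apply, map_zero]
        refine Eq.trans ?_ ((congrArg (ZeroMod.res F.zero l) h0).trans (map_zero _))
        rw [res_lin_res]; rfl) (x := y) hx
      refine ⟨j.image.obj W, j.mem_image.2 hW, j.image.map k ≫ l, j.imFin W b, ?_⟩
      have h1 := congrArg (j.imFin W) hb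
      rw [imFin_linearCombination, imFin_resFin, AddEquiv.apply_symm_apply, resFin_resFin] at h1
      refine h1.trans ?_
      simp only [imFin_resFin]
      rfl

theorem exists_isPresentedBy_restrict {U : Opens X.carrier} {e : I → Sec F.zero U}
    {φ : L → I →₀ X.gr U 0} (h : IsPresentedBy F.zero U e φ) (i : j.image.obj V ≤ U) :
    ∃ (e' : I → Sec (j.restrict F).zero V) (φ' : L → I →₀ Y.gr V 0),
      IsPresentedBy (j.restrict F).zero V e' φ' := by
  refine ⟨fun n => (j.imSec F V).symm (ZeroMod.res F.zero (homOfLE i) (e n)),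
    fun l => (j.imFin V).symm (resFin (homOfLE i) (φ l)), j.isPresentedBy_image_iff.1 ?_⟩
  simp only [AddEquiv.apply_symm_apply]
  exact h.restrict (homOfLE i)

end OpenImmersion

/-! ### Base change of modules given by generators and relations. -/

section BaseChange

variable {R B : Type u} [CommRing R] [CommRing B] [Algebra R B] {I L : Type u} (φ : L → I →₀ R)

/-- The module with given relations between its generators. -/
abbrev RelMod : Type u := (I →₀ R) ⧸ Submodule.span R (Set.range φ)

variable (B) in
/-- The generators of the base change of a module given by generators and relations. -/
def relGen (i : I) : B ⊗[R] RelMod φ := 1 ⊗ₜ Submodule.Quotient.mk (Finsupp.single i 1)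

variable (B) in
/-- The relations of the base change of a module given by generators and relations. -/
def relMap (l : L) : I →₀ B := (φ l).mapRange (algebraMap R B) (map_zero _)

theorem linearCombination_relGen_mapRange (c : I →₀ R) :
    Finsupp.linearCombination B (relGen B φ) (c.mapRange (algebraMap R B) (map_zero _)) =
      1 ⊗ₜ Submodule.Quotient.mk c := by
  induction c using Finsupp.induction_linear with
  | zero => rw [Finsupp.mapRange_zero, map_zero, Submodule.Quotient.mk_zero, tmul_zero]
  | add a b ha hb =>
    rw [Finsupp.mapRange_add (map_add _), map_add, ha, hb, Submodule.Quotient.mk_add, tmul_add]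
  | single i a =>
    rw [Finsupp.mapRange_single, Finsupp.linearCombination_single, algebraMap_smul, relGen, ← tmul_smul,
      ← Submodule.Quotient.mk_smul, Finsupp.smul_single, smul_eq_mul, mul_one]

theorem exists_linearCombination_relGen (x : B ⊗[R] RelMod φ) :
    ∃ c, Finsupp.linearCombination B (relGen B φ) c = x := by
  induction x using TensorProduct.induction_on with
  | zero => exact ⟨0, map_zero _⟩
  | add x y hx hy =>
    obtain ⟨a, ha⟩ := hx
    obtain ⟨b, hb⟩ := hy
    exact ⟨a + b, by rw [map_add, ha, hb]⟩
  | tmul b n =>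
    obtain ⟨c, rfl⟩ := Submodule.Quotient.mk_surjective _ n
    refine ⟨b • c.mapRange (algebraMap R B) (map_zero _), ?_⟩
    rw [map_smul, linearCombination_relGen_mapRange, smul_tmul', smul_eq_mul, mul_one]

theorem linearCombination_relGen_relMap (l : L) :
    Finsupp.linearCombination B (relGen B φ) (relMap B φ l) = 0 := by
  have h : (Submodule.Quotient.mk (φ l) : RelMod φ) = 0 :=
    (Submodule.Quotient.mk_eq_zero _).2 (Submodule.subset_span ⟨l, rfl⟩)
  rw [relMap, linearCombination_relGen_mapRange, h, tmul_zero]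

variable (B) in
/-- The comparison of the base change with the module given by the same generators and
relations. -/
def relLift : B ⊗[R] RelMod φ →ₗ[B] (I →₀ B) ⧸ Submodule.span B (Set.range (relMap B φ)) :=
  LinearMap.liftBaseChange B (Submodule.liftQ _
    (((Submodule.mkQ _).restrictScalars R).comp (Finsupp.mapRange.linearMap (Algebra.linearMap R B))) (by
      rw [Submodule.span_le]
      rintro _ ⟨l, rfl⟩
      exact (Submodule.Quotient.mk_eq_zero _).2 (Submodule.subset_span ⟨l, rfl⟩)))

theorem relLift_relGen (i : I) :
    relLift B φ (relGen B φ i) = Submodule.Quotient.mk (Finsupp.single i 1) := by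
  rw [relLift, relGen, LinearMap.liftBaseChange_tmul, one_smul]
  refine congrArg (Submodule.Quotient.mk) ?_
  change Finsupp.mapRange (algebraMap R B) (map_zero _) (Finsupp.single i 1) = _
  rw [Finsupp.mapRange_single, map_one]

/-- The map `relLift` sends the `i`-th generator of the base change to the class of the `i`-th basis
vector. A vanishing combination therefore has coefficient vector zero modulo the relations;
bijectivity of `relLift` is not needed. -/
theorem exists_linearCombination_relMap {c : I →₀ B}
    (hc : Finsupp.linearCombination B (relGen B φ) c = 0) :
    ∃ k, Finsupp.linearCombination B (relMap B φ) k = c := by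
  have h1 : relLift B φ (Finsupp.linearCombination B (relGen B φ) c) = Submodule.Quotient.mk c := by
    rw [Finsupp.apply_linearCombination]
    have : ⇑(relLift B φ) ∘ relGen B φ = (Submodule.mkQ _) ∘ fun i => Finsupp.single i (1 : B) :=
      funext (relLift_relGen φ)
    rw [this, ← Finsupp.apply_linearCombination, Submodule.mkQ_apply, Finsupp.linearCombination_apply]
    simp
  rw [hc, map_zero] at h1
  have h2 := (Submodule.Quotient.mk_eq_zero _).1 h1.symm
  rwa [← Finsupp.range_linearCombination] at h2

end BaseChange

/-! ### Recovering a graded module from a presentation on an affine graded scheme. -/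

section

variable {A : Type u} [CommRing A] {𝒜 : ℤ → AddSubgroup A} [GradedRing 𝒜] {I L : Type u}
  (φ : L → I →₀ 𝒜 0)

theorem isPresentedBy_tensor : GrMod.IsPresentedBy ((GrMod.tensorFunctor 𝒜).obj (ModuleCat.of (𝒜 0) (RelMod φ)))
    (fun _ => 0) (relGen A φ) (fun _ => 0) (relMap A φ) where
  mem i := GrMod.tmul_mem_tensorGr (SetLike.one_mem_graded 𝒜) _
  span := exists_linearCombination_relGen φ
  rel_mem l i := by rw [sub_zero]; exact (φ l i).2
  rel := linearCombination_relGen_relMap φ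
  relspan _ := exists_linearCombination_relMap φ

theorem finite_tensor [Finite I] :
    Module.Finite A ((GrMod.tensorFunctor 𝒜).obj (ModuleCat.of (𝒜 0) (RelMod φ))).carrier :=
  inferInstanceAs (Module.Finite A (A ⊗[𝒜 0] RelMod φ))

open GradedRingedSpace ZeroMod

variable [IsNoetherianRing A]

variable (𝒜) in
/-- Elements of degree zero as global sections. -/
def toSecZero : 𝒜 0 →+ (gspec 𝒜).gr ⊤ 0 :=
  ((toSec (𝒜 := 𝒜) ⊤ : A →+ (gspec 𝒜).Sec ⊤).comp (𝒜 0).subtype).codRestrict _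
    (fun a => toSec_mem ⊤ a.2)

theorem toSecZero_surjective : Function.Surjective (toSecZero 𝒜) := by
  intro s
  obtain ⟨b, hb, h⟩ := exists_eq_toSections s.2
  exact ⟨⟨b, hb⟩, Subtype.ext h.symm⟩

/-- The coefficients of the relations are global sections of degree zero, hence elements of `A_0`,
and define an `A_0`-module `N`. With `M = A ⊗ N` the degree zero parts of `F` and `M~` have the same
presentation, hence are isomorphic, and the isomorphism lifts because `u_X` is an equivalence on the
standard space `gspec 𝒜`. -/
theorem exists_iso_tilde (hs : (gspec 𝒜).IsStandard) {F : GMod (gspec 𝒜)} {e : I → Sec F.zero ⊤}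
    {ψ : L → I →₀ (gspec 𝒜).gr ⊤ 0} (h : IsPresentedBy F.zero ⊤ e ψ) :
    ∃ M : GrMod 𝒜, Nonempty (F ≅ tilde M) ∧ (Finite I → Module.Finite A M.carrier) := by
  choose φ hφ using fun l => Finsupp.mapRange_surjective (toSecZero 𝒜) (map_zero _)
    toSecZero_surjective (ψ l)
  -- All generators and relations of `A ⊗ N` have degree zero, so only the values in degree zero,
  -- which are `1`, matter; the other values are set to zero.
  let u : ∀ e, (gspec 𝒜).gr ⊤ e := Pi.single 0 ⟨1, SetLike.one_mem_graded _⟩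
  let v : ∀ e, (gspec 𝒜).gr ⊤ (-e) := Pi.single 0 ⟨1, by rw [neg_zero]; exact SetLike.one_mem_graded _⟩
  have hu : (u 0).1 = 1 := by simp [u]
  have hv : (v 0).1 = 1 := by simp [v]
  have huv : (u 0).1 * (v 0).1 = 1 := by rw [hu, hv, one_mul]
  have hM := tilde_isPresentedBy (isPresentedBy_tensor φ) u v (fun _ => huv) fun _ => huv
  have hr : tildeRel (isPresentedBy_tensor φ) u v = ψ := by
    refine funext fun l => Finsupp.ext fun i => Subtype.ext ?_
    rw [← hφ]
    change (v 0).1 * toSec ⊤ (φ l i).1 * (u 0).1 = toSec ⊤ (φ l i).1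
    rw [hu, hv, one_mul, mul_one]
  rw [hr] at hM
  have := (GMod.isQuasiInverse_coindFunctor hs).isEquivalence_left
  obtain ⟨f⟩ := h.nonempty_iso hM
  exact ⟨_, ⟨(GMod.zeroFunctor (gspec 𝒜)).preimageIso f⟩, fun _ => finite_tensor φ⟩

end

/-! ### Quasi-coherence and coherence of `F` and of `F_0`. -/

namespace GMod

open GradedRingedSpace ZeroMod

variable {X : GradedRingedSpace.{u}}

/-- Standardness provides units of every degree on a neighbourhood of `p`, and these twist the
homogeneous presentation of `M` into degree zero. -/
theorem exists_isPresentedBy_of_iso_tilde (hs : X.IsStandard) {A : Type u} [CommRing A]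
    [IsNoetherianRing A] {𝒜 : ℤ → AddSubgroup A} [GradedRing 𝒜] (j : OpenImmersion (gspec 𝒜) X)
    (p : GSpec 𝒜) {M : GrMod 𝒜} {F : GMod X} (f : j.restrict F ≅ tilde M) {I L : Type u} {d : I → ℤ}
    {m : I → M.carrier} {δ : L → ℤ} {r : L → I →₀ A} (h : M.IsPresentedBy d m δ r) :
    ∃ (U : Opens X.carrier) (_ : j.base p ∈ U) (e : I → ZeroMod.Sec F.zero U) (φ : L → I →₀ X.gr U 0),
      IsPresentedBy F.zero U e φ := by
  obtain ⟨V, hV, -, hu⟩ := (j.isStandard hs).exists_unitsOn 1 (x := p) (U := ⊤) trivial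
  choose u v huv using fun e => hu.all e
  have h1 := (tilde_isPresentedBy h u v (fun _ => huv _) fun _ => huv _).mapIso
    ((GMod.zeroFunctor (gspec 𝒜)).mapIso f.symm)
  exact ⟨_, j.mem_image.2 hV, _, _, j.isPresentedBy_image_iff.2 h1⟩

/-- The presentation is restricted to an affine neighbourhood inside `U`, where it is given by
global generators and relations. -/
theorem exists_iso_tilde_of_isPresentedBy (hX : X.IsGradedScheme) (hs : X.IsStandard) {F : GMod X}
    {U : Opens X.carrier} {x : X.carrier} (hx : x ∈ U) {I L : Type u} {e : I → ZeroMod.Sec F.zero U}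
    {φ : L → I →₀ X.gr U 0} (h : IsPresentedBy F.zero U e φ) :
    ∃ (A : Type u) (_ : CommRing A) (_ : IsNoetherianRing A) (𝒜 : ℤ → AddSubgroup A)
      (_ : GradedRing 𝒜) (j : OpenImmersion (gspec 𝒜) X) (M : GrMod 𝒜), x ∈ Set.range j.base ∧
      (Finite I → Module.Finite A M.carrier) ∧ Nonempty (j.restrict F ≅ tilde M) := by
  obtain ⟨A, _, _, 𝒜, _, j, hj, hjU⟩ := exists_affine_le hX hx
  obtain ⟨e', φ', h'⟩ := j.exists_isPresentedBy_restrict h hjU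
  obtain ⟨M, hM, hfin⟩ := exists_iso_tilde (j.isStandard hs) h'
  exact ⟨A, _, inferInstance, 𝒜, _, j, M, hj, hfin, hM⟩

theorem isQCoh_iff_zero (hX : X.IsGradedScheme) (hs : X.IsStandard) (F : GMod X) :
    isQCoh X F ↔ ZeroMod.isQCoh X ((zeroFunctor X).obj F) := by
  have := hX.noetherianSpace
  refine Iff.trans ?_ (ZeroMod.isQCoh_iff F.zero).symm
  refine forall_congr' fun x => ⟨?_, ?_⟩
  · rintro ⟨A, _, _, 𝒜, _, j, M, ⟨p, rfl⟩, ⟨f⟩⟩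
    obtain ⟨I, L, d, m, δ, r, h⟩ := GrMod.exists_isPresentedBy M
    obtain ⟨U, hU, e, φ, h'⟩ := exists_isPresentedBy_of_iso_tilde hs j p f h
    exact ⟨U, hU, I, L, e, φ, h'⟩
  · rintro ⟨U, hU, I, L, e, φ, h⟩
    obtain ⟨A, i1, i2, 𝒜, i3, j, M, hj, -, hM⟩ := exists_iso_tilde_of_isPresentedBy hX hs hU h
    exact ⟨A, i1, i2, 𝒜, i3, j, M, hj, hM⟩

theorem isCoh_iff_zero (hX : X.IsGradedScheme) (hs : X.IsStandard) (F : GMod X) :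
    isCoh X F ↔ ZeroMod.isCoh X ((zeroFunctor X).obj F) := by
  have := hX.noetherianSpace
  refine Iff.trans ?_ (ZeroMod.isCoh_iff F.zero).symm
  refine forall_congr' fun x => ⟨?_, ?_⟩
  · rintro ⟨A, _, _, 𝒜, _, j, M, ⟨p, rfl⟩, _, ⟨f⟩⟩
    obtain ⟨I, L, hI, hL, d, m, δ, r, h⟩ := GrMod.exists_finite_isPresentedBy M
    obtain ⟨U, hU, e, φ, h'⟩ := exists_isPresentedBy_of_iso_tilde hs j p f h
    exact ⟨U, hU, I, L, hI, hL, e, φ, h'⟩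
  · rintro ⟨U, hU, I, L, hI, hL, e, φ, h⟩
    obtain ⟨A, i1, i2, 𝒜, i3, j, M, hj, hfin, hM⟩ := exists_iso_tilde_of_isPresentedBy hX hs hU h
    exact ⟨A, i1, i2, 𝒜, i3, j, M, hj, hfin hI, hM⟩

end GMod

end GrSch

end

/-! ### Assembly of the three parts. -/

theorem mainTheorem11 :
    -- graded modules over a graded ring
    (∀ {A : Type u} [CommRing A] (𝒜 : ℤ → AddSubgroup A) [GradedRing 𝒜],
      ((GrMod.zeroFunctor 𝒜).IsEquivalence ↔ ∀ p : GSpec 𝒜, IsStandardRing p.locGr) ∧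
      ((∀ p : GSpec 𝒜, IsStandardRing p.locGr) →
        Nonempty (GrMod.tensorFunctor 𝒜 ≅ GrMod.coindFunctor 𝒜) ∧
        IsQuasiInverse (GrMod.zeroFunctor 𝒜) (GrMod.tensorFunctor 𝒜) ∧
        IsQuasiInverse (GrMod.zeroFunctor 𝒜) (GrMod.coindFunctor 𝒜) ∧
        IsExact (GrMod.tensorFunctor 𝒜) ∧ IsExact (GrMod.coindFunctor 𝒜) ∧
        (IsNoetherianRing A →
          RestrictsToEquivalence (GrMod.zeroFunctor 𝒜) (GrMod.isFG 𝒜) (fgModules (𝒜 0)) ∧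
          RestrictsToEquivalence (GrMod.tensorFunctor 𝒜) (fgModules (𝒜 0)) (GrMod.isFG 𝒜) ∧
          RestrictsToEquivalence (GrMod.coindFunctor 𝒜) (fgModules (𝒜 0)) (GrMod.isFG 𝒜)))) ∧
    -- sheaves of graded modules on a good graded scheme
    (∀ X : GradedRingedSpace.{u}, X.IsGradedScheme → X.IsGood →
      ((GMod.zeroFunctor X).IsEquivalence ↔ X.IsStandard) ∧
      (X.IsStandard →
        RestrictsToEquivalence (GMod.zeroFunctor X) (GMod.isQCoh X)
          (GradedRingedSpace.ZeroMod.isQCoh X) ∧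
        RestrictsToEquivalence (GMod.zeroFunctor X) (GMod.isCoh X)
          (GradedRingedSpace.ZeroMod.isCoh X) ∧
        Nonempty (GradedRingedSpace.ZeroMod.tensorFunctor X ≅
          GradedRingedSpace.ZeroMod.coindFunctor X) ∧
        IsExact (GradedRingedSpace.ZeroMod.tensorFunctor X) ∧
        IsExact (GradedRingedSpace.ZeroMod.coindFunctor X) ∧
        IsQuasiInverse (GMod.zeroFunctor X) (GradedRingedSpace.ZeroMod.tensorFunctor X) ∧
        IsQuasiInverse (GMod.zeroFunctor X) (GradedRingedSpace.ZeroMod.coindFunctor X))) ∧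
    -- graded weighted projective spaces
    (∀ (A : Type u) [CommRing A] [IsNoetherianRing A] {n : ℕ} (w : Fin (n + 1) → ℕ),
      (∀ i, 0 < w i) →
      (∀ p : (wproj A w).carrier, (wproj A w).IsStandardPoint p ↔ weightGcd p = 1) ∧
      (Nontrivial A → ((wproj A w).IsStandard ↔ ∀ i, w i = 1))) := by
  refine ⟨fun {A} _ 𝒜 _ => ⟨GrMod.zeroFunctor_isEquivalence_iff, fun h => ?_⟩,
    fun X hX _ => ⟨GMod.zeroFunctor_isEquivalence_iff hX, fun h => ?_⟩,
    fun A _ _ n w hw => ⟨wproj_isStandardPoint_iff, fun _ => wproj_isStandard_iff hw⟩⟩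
  -- Once the functors are known to be quasi-inverse equivalences, exactness is automatic, and the
  -- restricted equivalences follow from the criterion for finite generation.
  · have hA := GrMod.isStronglyGraded_iff.2 h
    have hc := GrMod.isQuasiInverse_coindFunctor hA
    have ht := GrMod.isQuasiInverse_tensorFunctor hA
    have := hc.isEquivalence_left
    have := hc.isEquivalence_right
    have := ht.isEquivalence_right
    exact ⟨⟨GrMod.tensorCoindIso hA⟩, ht, hc, isExact_of_isEquivalence _, isExact_of_isEquivalence _,
      fun _ => ⟨restrictsToEquivalence _ _ _ (GrMod.isFG_iff hA),
        ht.restrictsToEquivalence _ _ (GrMod.isFG_iff hA),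
        hc.restrictsToEquivalence _ _ (GrMod.isFG_iff hA)⟩⟩
  · have hc := GMod.isQuasiInverse_coindFunctor h
    have ht := hc.of_iso (GradedRingedSpace.ZeroMod.tensorCoindIso h).symm
    have := hc.isEquivalence_left
    have := hc.isEquivalence_right
    have := ht.isEquivalence_right
    exact ⟨restrictsToEquivalence _ _ _ (GMod.isQCoh_iff_zero hX h),
      restrictsToEquivalence _ _ _ (GMod.isCoh_iff_zero hX h), ⟨GradedRingedSpace.ZeroMod.tensorCoindIso h⟩,
      isExact_of_isEquivalence _, isExact_of_isEquivalence _, ht, hc⟩
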